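/- **Setting.** Let $G$ and $H$ be Hausdorff étale groupoids with locally compact Hausdorff unit spaces $X=G^0$ and $Y=H^0$, and let $\Omega\colon G\to H$ be a Hausdorff étale correspondence: a Hausdorff space with commuting continuous actions of $G$ on the left (anchor map $\rho\colon\Omega\to X$) and of $H$ on the right (anchor map $\sigma\colon\Omega\to Y$), the right action being free, proper and étale (i.e. $\sigma$ is a local homeomorphism). An $H$-$C^*$-algebra $B$ is a $C_0(Y)$-algebra, regarded as the algebra $\Gamma_0(Y,\mathcal B)$ of $C_0$-sections of its upper semicontinuous $C^*$-bundle $\mathcal B=\bigsqcup_y B_y$, with a continuous action of $H$ on $\mathcal B$ by $*$-isomorphisms of the fibres. Let $B$, $C$ be $H$-$C^*$-algebras and $E\colon B\to C$ an $H$-equivariant $C^*$-correspondence: a Hilbert $C$-module $E=\Gamma_0(Y,\mathcal E)$ with a continuous action of $H$ on $\mathcal E$ by linear isometries compatible with the $C$-valued inner product and the right $C$-action, and a nondegenerate $C_0(Y)$-linear $*$-homomorphism $B\to\mathcal L(E)$ such that $h\cdot(b\cdot e)=(h\cdot b)\cdot(h\cdot e)$ on fibres. A $C^*$-correspondence (always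 with nondegenerate structure map) is *proper* if its structure map takes values in the compact operators. The induced algebra $\mathrm{Ind}_\Omega B$ consists of the bounded continuous sections $\xi$ of $\sigma^*\mathcal B$ with $\xi(\omega\cdot h)=h^{-1}\cdot\xi(\omega)$ and with $[\omega]\mapsto\|\xi(\omega)\|$ vanishing at infinity on $\Omega/H$. Its fibre at $x\in X$ consists of the sections of the same kind over $\Omega^x=\rho^{-1}(x)$; the associated bundle $\mathrm{Ind}_\Omega\mathcal B\to X$ has the topology determined by the elements of $\mathrm{Ind}_\Omega B$, and $G$ acts by $(g\cdot\xi)(\omega)=\xi(g^{-1}\cdot\omega)$. For a groupoid $K$ with source map $s$ and a $K$-$C^*$-algebra $A$, the full crossed product $K\ltimes A$ is the completion of the $*$-algebra $\Gamma_c(K,s^*\mathcal A)$ of compactly supported continuous sections, with $$(a*b)(g)=\sum_{h\in K^{s(g)}}(h\cdot a(gh))\,b(h^{-1}),\qquad a^*(g)=g^{-1}\cdot a(g^{-1})^*,$$ in the maximal $C^*$-norm. **Theorem.** $\Gamma_c(G,s^*\mathrm{Ind}_\Omega\mathcal B)$ and $\Gamma_c(H,s^*\mathcal C)$ are closed under these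 operations, and their maximal $C^*$-norms are finite. The formulas $$\langle\xi,\eta\rangle(h)=\sum_{\omega\in\Omega_{r(h)}}\langle h^{-1}\cdot\xi(\omega),\eta(\omega\cdot h)\rangle,\qquad (\xi\cdot c)(\omega)=\sum_{h\in H^{\sigma(\omega)}}(h\cdot\xi(\omega\cdot h))\cdot c(h^{-1}),$$ $$(b\cdot\xi)(\omega)=\sum_{g\in G_{\rho(\omega)}}\big(b(g^{-1})(g\cdot\omega)\big)\cdot\xi(g\cdot\omega)$$ for $\xi,\eta\in\Gamma_c(\Omega,\sigma^*\mathcal E)$, $c\in\Gamma_c(H,s^*\mathcal C)$, $b\in\Gamma_c(G,s^*\mathrm{Ind}_\Omega\mathcal B)$ define elements of $\Gamma_c(H,s^*\mathcal C)$, $\Gamma_c(\Omega,\sigma^*\mathcal E)$ and $\Gamma_c(\Omega,\sigma^*\mathcal E)$ respectively. There is a Hilbert $H\ltimes C$-module $\Omega\ltimes E$ containing a dense copy of $\Gamma_c(\Omega,\sigma^*\mathcal E)$ whose inner product and right action extend the first two formulas, and the left action given by the third formula extends to a nondegenerate $*$-homomorphism $G\ltimes\mathrm{Ind}_\Omega B\to\mathcal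 L(\Omega\ltimes E)$. This makes $\Omega\ltimes E$ a $C^*$-correspondence from $G\ltimes\mathrm{Ind}_\Omega B$ to $H\ltimes C$, which is proper whenever $E$ is proper. -/

import Mathlib

open Topology
open scoped ENNReal

universe uX uG uY uH uΩ uA uB uC uE

noncomputable section

/-! ### Étale groupoids and their actions on spaces -/

/-- An étale groupoid with space of arrows `G` and unit space `X`, where `X` is identified with an
open subspace of `G` through `one`. The product `mul g h` and the inverse are those of the groupoid;
`mul g h` is only meaningful when `src g = rng h`, and it is a junk value otherwise. -/
structure EtaleGroupoid (G : Type uG) (X : Type uX) [TopologicalSpace G] [TopologicalSpace X] where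
  src : G → X
  rng : G → X
  one : X → G
  mul : G → G → G
  inv : G → G
  src_one : ∀ x, src (one x) = x
  rng_one : ∀ x, rng (one x) = x
  src_mul : ∀ {g h}, src g = rng h → src (mul g h) = src h
  rng_mul : ∀ {g h}, src g = rng h → rng (mul g h) = rng g
  mul_assoc : ∀ {g h k}, src g = rng h → src h = rng k → mul (mul g h) k = mul g (mul h k)
  one_mul : ∀ g, mul (one (rng g)) g = g
  mul_one : ∀ g, mul g (one (src g)) = g
  src_inv : ∀ g, src (inv g) = rng g
  rng_inv : ∀ g, rng (inv g) = src g
  inv_mul : ∀ g, mul (inv g) g = one (src g)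
  mul_inv : ∀ g, mul g (inv g) = one (rng g)
  continuous_src : Continuous src
  continuous_inv : Continuous inv
  continuous_mul : ContinuousOn (fun p : G × G => mul p.1 p.2) {p | src p.1 = rng p.2}
  isOpenEmbedding_one : IsOpenEmbedding one
  isLocalHomeomorph_rng : IsLocalHomeomorph rng

section Actions

variable {G : Type uG} {X : Type uX} [TopologicalSpace G] [TopologicalSpace X]

/-- A continuous left action of a groupoid on a space `Z`. The value `smul g z` is only meaningful
when `src g = anchor z`. -/
structure LeftAction (𝒢 : EtaleGroupoid G X) (Z : Type*) [TopologicalSpace Z] where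
  anchor : Z → X
  smul : G → Z → Z
  anchor_smul : ∀ {g z}, 𝒢.src g = anchor z → anchor (smul g z) = 𝒢.rng g
  one_smul : ∀ z, smul (𝒢.one (anchor z)) z = z
  mul_smul : ∀ {g h z}, 𝒢.src g = 𝒢.rng h → 𝒢.src h = anchor z →
    smul (𝒢.mul g h) z = smul g (smul h z)
  continuous_anchor : Continuous anchor
  continuous_smul : ContinuousOn (fun p : G × Z => smul p.1 p.2) {p | 𝒢.src p.1 = anchor p.2}

/-- A continuous right action of a groupoid on a space `Z`. The value `smul z g` is only meaningful
when `rng g = anchor z`. -/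
structure RightAction (𝒢 : EtaleGroupoid G X) (Z : Type*) [TopologicalSpace Z] where
  anchor : Z → X
  smul : Z → G → Z
  anchor_smul : ∀ {z g}, 𝒢.rng g = anchor z → anchor (smul z g) = 𝒢.src g
  smul_one : ∀ z, smul z (𝒢.one (anchor z)) = z
  smul_mul : ∀ {z g h}, 𝒢.rng g = anchor z → 𝒢.src g = 𝒢.rng h →
    smul z (𝒢.mul g h) = smul (smul z g) h
  continuous_anchor : Continuous anchor
  continuous_smul : ContinuousOn (fun p : Z × G => smul p.1 p.2) {p | 𝒢.rng p.2 = anchor p.1}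

namespace RightAction

variable {𝒢 : EtaleGroupoid G X} {Z : Type*} [TopologicalSpace Z]

def IsFree (R : RightAction 𝒢 Z) : Prop :=
  ∀ z g, 𝒢.rng g = R.anchor z → R.smul z g = z → g ∈ Set.range 𝒢.one

def IsProper (R : RightAction 𝒢 Z) : Prop :=
  IsProperMap fun p : {p : Z × G // 𝒢.rng p.2 = R.anchor p.1} => (R.smul p.1.1 p.1.2, p.1.1)

def IsEtale (R : RightAction 𝒢 Z) : Prop := IsLocalHomeomorph R.anchor

/-- The orbit space `Z/G`, with the quotient topology. -/
abbrev Orbits (R : RightAction 𝒢 Z) : Type _ :=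
  Quot fun z z' : Z => ∃ g, 𝒢.rng g = R.anchor z ∧ R.smul z g = z'

/-- The action map of the restriction of a right action to an invariant subspace. -/
def restrictSMul (R : RightAction 𝒢 Z) (P : Z → Prop)
    (hP : ∀ z g, P z → 𝒢.rng g = R.anchor z → P (R.smul z g)) (z : {z // P z}) (g : G) :
    {z // P z} := open Classical in
  if h : 𝒢.rng g = R.anchor z.1 then ⟨R.smul z.1 g, hP z.1 g z.2 h⟩ else z

theorem restrictSMul_coe (R : RightAction 𝒢 Z) (P : Z → Prop)
    (hP : ∀ z g, P z → 𝒢.rng g = R.anchor z → P (R.smul z g)) (z : {z // P z}) (g : G)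
    (h : 𝒢.rng g = R.anchor z.1) : (R.restrictSMul P hP z g : Z) = R.smul z.1 g := by
  rw [restrictSMul, dif_pos h]

/-- The restriction of a right action to an invariant subspace. -/
abbrev restrict (R : RightAction 𝒢 Z) (P : Z → Prop)
    (hP : ∀ z g, P z → 𝒢.rng g = R.anchor z → P (R.smul z g)) : RightAction 𝒢 {z // P z} where
  anchor z := R.anchor z.1
  smul := R.restrictSMul P hP
  anchor_smul {z g} h := by
    rw [R.restrictSMul_coe P hP z g h]; exact R.anchor_smul h
  smul_one z := Subtype.ext <| by
    rw [R.restrictSMul_coe P hP _ _ (𝒢.rng_one _)]; exact R.smul_one z.1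
  smul_mul {z g h} hg hh := Subtype.ext <| by
    have h1 : 𝒢.rng (𝒢.mul g h) = R.anchor z.1 := (𝒢.rng_mul hh).trans hg
    have h2 := R.restrictSMul_coe P hP z g hg
    rw [R.restrictSMul_coe P hP _ _ h1, R.restrictSMul_coe P hP, h2, R.smul_mul hg hh]
    rw [h2, R.anchor_smul hg, hh]
  continuous_anchor := R.continuous_anchor.comp continuous_subtype_val
  continuous_smul := by
    rw [continuousOn_iff_continuous_domRestrict, continuous_induced_rng]
    refine Continuous.congr (f := fun p : {p : {z // P z} × G | 𝒢.rng p.2 = R.anchor p.1.1} =>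
      R.smul p.1.1.1 p.1.2) ?_ fun p => (R.restrictSMul_coe P hP _ _ p.2).symm
    exact R.continuous_smul.comp_continuous
      (f := fun p : {p : {z // P z} × G | 𝒢.rng p.2 = R.anchor p.1.1} => (p.1.1.1, p.1.2))
      (by fun_prop) (fun p => p.2)

end RightAction

/-- An étale correspondence from `𝒢` to `ℋ`: a `𝒢`-`ℋ`-bispace `Ω` whose right action is free,
proper and étale. -/
structure EtaleCorrespondence {H : Type uH} {Y : Type uY} [TopologicalSpace H] [TopologicalSpace Y]
    (𝒢 : EtaleGroupoid G X) (ℋ : EtaleGroupoid H Y) (Ω : Type uΩ) [TopologicalSpace Ω] where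
  left : LeftAction 𝒢 Ω
  right : RightAction ℋ Ω
  left_anchor_smul : ∀ {ω h}, ℋ.rng h = right.anchor ω →
    left.anchor (right.smul ω h) = left.anchor ω
  right_anchor_smul : ∀ {g ω}, 𝒢.src g = left.anchor ω →
    right.anchor (left.smul g ω) = right.anchor ω
  smul_comm : ∀ {g ω h}, 𝒢.src g = left.anchor ω → ℋ.rng h = right.anchor ω →
    right.smul (left.smul g ω) h = left.smul g (right.smul ω h)
  free : right.IsFree
  proper : right.IsProper
  etale : right.IsEtale

end Actions

/-! ### Banach bundles and their sections -/

section Bundles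

variable {X : Type uX}

/-- The total space (disjoint union) of a family of fibres. Its topology is extra data. -/
@[ext]
structure Tot (A : X → Type*) where
  base : X
  val : A base

/-- The fibre product of two total spaces, with the topology of a subspace of the product. -/
structure FibProd (A B : X → Type*) where
  base : X
  fst : A base
  snd : B base

instance (A B : X → Type*) [TopologicalSpace (Tot A)] [TopologicalSpace (Tot B)] :
    TopologicalSpace (FibProd A B) :=
  TopologicalSpace.induced
    (fun p => ((⟨p.base, p.fst⟩ : Tot A), (⟨p.base, p.snd⟩ : Tot B))) inferInstance

/-- Transport of an element of a fibre along an equality of base points. -/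
def tr {A : X → Type*} {x y : X} (h : x = y) (a : A x) : A y := h ▸ a

theorem tot_tr {A : X → Type*} {x y : X} (h : x = y) (a : A x) :
    (⟨y, tr h a⟩ : Tot A) = ⟨x, a⟩ := by
  subst h; rfl

theorem norm_tr {A : X → Type*} [∀ y, Norm (A y)] {x y : X} (h : x = y) (a : A x) :
    ‖tr h a‖ = ‖a‖ := by
  subst h; rfl

theorem tr_tr {A : X → Type*} {x y z : X} (h : x = y) (k : y = z) (a : A x) :
    tr k (tr h a) = tr (h.trans k) a := by
  subst h k; rfl

theorem apply_eq_tr {A : X → Type*} {Z : Type*} {p : Z → X} (ξ : ∀ z, A (p z)) {z z' : Z}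
    (h : z = z') : ξ z = tr (congrArg p h.symm) (ξ z') := by
  subst h; rfl

/-- `a` is a continuous section of the pullback along `p : Z → X` of the bundle `A` over `X`. -/
def IsContSec {A : X → Type*} [TopologicalSpace (Tot A)] {Z : Type*} [TopologicalSpace Z]
    (p : Z → X) (a : ∀ z, A (p z)) : Prop :=
  Continuous fun z => (⟨p z, a z⟩ : Tot A)

theorem IsContSec.map₂ {A : X → Type*} [TopologicalSpace (Tot A)] {Z : Type*} [TopologicalSpace Z]
    {p : Z → X} {op : ∀ {y}, A y → A y → A y}
    (hop : Continuous fun q : FibProd A A => (⟨q.base, op q.fst q.snd⟩ : Tot A))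
    {a b : ∀ z, A (p z)} (ha : IsContSec p a) (hb : IsContSec p b) :
    IsContSec p fun z => op (a z) (b z) :=
  hop.comp (f := fun z => (⟨p z, a z, b z⟩ : FibProd A A))
    (continuous_induced_rng.2 (ha.prodMk hb))

/-- `a` is a continuous section with compact support of the pullback along `p` of the bundle `A`. -/
def IsCc {A : X → Type*} [TopologicalSpace (Tot A)] [∀ x, Zero (A x)]
    {Z : Type*} [TopologicalSpace Z] (p : Z → X) (a : ∀ z, A (p z)) : Prop :=
  IsContSec p a ∧ IsCompact (closure {z | a z ≠ 0})

/-- The space `Γ_c(Z, p^* A)`. -/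
def Cc (A : X → Type*) [TopologicalSpace (Tot A)] [∀ x, Zero (A x)]
    {Z : Type*} [TopologicalSpace Z] (p : Z → X) : Type _ :=
  {a : ∀ z, A (p z) // IsCc p a}

/-- `a` is a continuous section of `A` vanishing at infinity, i.e. `a ∈ Γ₀(X, A)`. -/
def IsC0 [TopologicalSpace X] {A : X → Type*} [TopologicalSpace (Tot A)] [∀ x, Norm (A x)]
    (a : ∀ x, A x) : Prop :=
  IsContSec (fun x : X => x) a ∧ ∀ ε > 0, ∃ K : Set X, IsCompact K ∧ ∀ x ∉ K, ‖a x‖ < ε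

/-- A (complex, upper semicontinuous) Banach bundle. The last field says that each element of a
fibre is the value of a section in `Γ₀(X, A)`; this holds by construction for the bundle associated
to a `C₀(X)`-Banach space, and in fact for all Banach bundles over locally compact Hausdorff
spaces. -/
class BanachBundle [TopologicalSpace X] (A : X → Type*) [∀ x, NormedAddCommGroup (A x)]
    [∀ x, NormedSpace ℂ (A x)] [∀ x, CompleteSpace (A x)] [TopologicalSpace (Tot A)] : Prop where
  continuous_base : Continuous (Tot.base : Tot A → X)
  isOpenMap_base : IsOpenMap (Tot.base : Tot A → X)
  upperSemicontinuous_norm : UpperSemicontinuous fun a : Tot A => ‖a.val‖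
  continuous_add : Continuous fun p : FibProd A A => (⟨p.base, p.fst + p.snd⟩ : Tot A)
  continuous_smul : ∀ c : ℂ, Continuous fun a : Tot A => (⟨a.base, c • a.val⟩ : Tot A)
  tendsto_zero : ∀ x : X,
    (𝓝 x).comap (Tot.base : Tot A → X) ⊓ (𝓝 (0 : ℝ)).comap (fun a : Tot A => ‖a.val‖) ≤
      𝓝 (⟨x, 0⟩ : Tot A)
  exists_section : ∀ (x : X) (a : A x), ∃ ξ : ∀ x, A x, IsC0 ξ ∧ ξ x = a

/-- A C⋆-bundle, i.e. the bundle of fibres of a `C₀(X)`-algebra. -/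
class CStarBundle [TopologicalSpace X] (A : X → Type*) [∀ x, NonUnitalCStarAlgebra (A x)]
    [TopologicalSpace (Tot A)] : Prop extends BanachBundle A where
  continuous_mul : Continuous fun p : FibProd A A => (⟨p.base, p.fst * p.snd⟩ : Tot A)
  continuous_star : Continuous fun a : Tot A => (⟨a.base, star a.val⟩ : Tot A)

end Bundles

/-! ### Hilbert modules and C⋆-correspondences -/

/-- A right Hilbert module `M` over a C⋆-algebra `Q`: `ip` is the `Q`-valued inner product
(linear in the second variable) and `ract` is the right action of `Q`. -/
class HilbertModule (Q M : Type*) [NonUnitalCStarAlgebra Q] [NormedAddCommGroup M]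
    [NormedSpace ℂ M] [CompleteSpace M] where
  ip : M → M → Q
  ract : M → Q → M
  ip_add : ∀ m n k, ip m (n + k) = ip m n + ip m k
  ip_smul : ∀ (c : ℂ) m n, ip m (c • n) = c • ip m n
  ip_ract : ∀ m n q, ip m (ract n q) = ip m n * q
  star_ip : ∀ m n, star (ip m n) = ip n m
  ip_self_nonneg : ∀ m, ∃ q, ip m m = star q * q
  norm_sq : ∀ m, ‖m‖ ^ 2 = ‖ip m m‖

open HilbertModule (ip ract)

section Correspondences

variable (P Q M : Type*) [NonUnitalCStarAlgebra P] [NonUnitalCStarAlgebra Q]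
  [NormedAddCommGroup M] [NormedSpace ℂ M] [CompleteSpace M] [HilbertModule Q M]

/-- The structure map of a C⋆-correspondence `M : P → Q`: a nondegenerate ⋆-homomorphism from `P`
to the adjointable operators on the Hilbert `Q`-module `M`. -/
structure CStarCorrespondence where
  toHom : P →ₙₐ[ℂ] (M →L[ℂ] M)
  adjoint : ∀ p (m n : M), (ip (toHom p m) n : Q) = ip m (toHom (star p) n)
  nondegenerate : Dense (Submodule.span ℂ {k : M | ∃ p m, toHom p m = k} : Set M)

variable {P Q M}

/-- The correspondence is proper if `P` acts by compact operators, which are the norm limits of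
linear combinations of operators `k ↦ m ⟨n, k⟩`. -/
def CStarCorrespondence.IsProper (F : CStarCorrespondence P Q M) : Prop :=
  ∀ p, F.toHom p ∈ closure (Submodule.span ℂ
    {T : M →L[ℂ] M | ∃ m n, ∀ k, T k = ract m (ip n k : Q)} : Set (M →L[ℂ] M))

end Correspondences

/-! ### Groupoid actions on bundles, equivariant correspondences -/

section Equivariant

variable {G : Type uG} {X : Type uX} [TopologicalSpace G] [TopologicalSpace X]
  (𝒢 : EtaleGroupoid G X)

/-- An action of a groupoid on a C⋆-bundle by ⋆-isomorphisms `act g : A (src g) → A (rng g)`. -/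
structure CStarAction (A : X → Type*) [∀ x, NonUnitalCStarAlgebra (A x)]
    [TopologicalSpace (Tot A)] where
  act : ∀ {x y : X} (g : G), 𝒢.src g = x → 𝒢.rng g = y → (A x ≃⋆ₐ[ℂ] A y)
  act_one : ∀ (x : X) (a : A x), act (𝒢.one x) (𝒢.src_one x) (𝒢.rng_one x) a = a
  act_mul : ∀ (g h : G) (hgh : 𝒢.src g = 𝒢.rng h) (a : A (𝒢.src h)),
    act (𝒢.mul g h) (𝒢.src_mul hgh) (𝒢.rng_mul hgh) a = act g hgh rfl (act h rfl rfl a)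
  continuous_act : Continuous fun p : {p : G × Tot A // 𝒢.src p.1 = p.2.base} =>
    (⟨𝒢.rng p.1.1, act p.1.1 p.2 rfl p.1.2.val⟩ : Tot A)

/-- `E` is a bundle of Hilbert modules over the C⋆-bundle `C`. -/
class HilbertBundle (C E : X → Type*) [∀ x, NonUnitalCStarAlgebra (C x)] [TopologicalSpace (Tot C)]
    [∀ x, NormedAddCommGroup (E x)] [∀ x, NormedSpace ℂ (E x)] [∀ x, CompleteSpace (E x)]
    [TopologicalSpace (Tot E)] [∀ x, HilbertModule (C x) (E x)] : Prop extends BanachBundle E where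
  continuous_ip : Continuous fun p : FibProd E E => (⟨p.base, ip p.fst p.snd⟩ : Tot C)
  continuous_ract : Continuous fun p : FibProd E C => (⟨p.base, ract p.fst p.snd⟩ : Tot E)

variable {𝒢}

/-- An action of a groupoid on a Hilbert bundle by linear isometric isomorphisms, compatible with
a given action on the coefficient C⋆-bundle. -/
structure HilbertAction {C : X → Type*} [∀ x, NonUnitalCStarAlgebra (C x)] [TopologicalSpace (Tot C)]
    (γ : CStarAction 𝒢 C) (E : X → Type*)
    [∀ x, NormedAddCommGroup (E x)] [∀ x, NormedSpace ℂ (E x)] [∀ x, CompleteSpace (E x)]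
    [TopologicalSpace (Tot E)] [∀ x, HilbertModule (C x) (E x)] where
  act : ∀ {x y : X} (g : G), 𝒢.src g = x → 𝒢.rng g = y → (E x ≃ₗᵢ[ℂ] E y)
  act_one : ∀ (x : X) (e : E x), act (𝒢.one x) (𝒢.src_one x) (𝒢.rng_one x) e = e
  act_mul : ∀ (g h : G) (hgh : 𝒢.src g = 𝒢.rng h) (e : E (𝒢.src h)),
    act (𝒢.mul g h) (𝒢.src_mul hgh) (𝒢.rng_mul hgh) e = act g hgh rfl (act h rfl rfl e)
  continuous_act : Continuous fun p : {p : G × Tot E // 𝒢.src p.1 = p.2.base} =>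
    (⟨𝒢.rng p.1.1, act p.1.1 p.2 rfl p.1.2.val⟩ : Tot E)
  act_ip : ∀ (g : G) (e f : E (𝒢.src g)),
    γ.act g rfl rfl (ip e f) = ip (act g rfl rfl e) (act g rfl rfl f)
  act_ract : ∀ (g : G) (e : E (𝒢.src g)) (c : C (𝒢.src g)),
    act g rfl rfl (ract e c) = ract (act g rfl rfl e) (γ.act g rfl rfl c)

/-- A `𝒢`-equivariant C⋆-correspondence, given by its fibres. -/
structure EquivariantCorrespondence {B C E : X → Type*}
    [∀ x, NonUnitalCStarAlgebra (B x)] [TopologicalSpace (Tot B)]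
    [∀ x, NonUnitalCStarAlgebra (C x)] [TopologicalSpace (Tot C)]
    [∀ x, NormedAddCommGroup (E x)] [∀ x, NormedSpace ℂ (E x)] [∀ x, CompleteSpace (E x)]
    [TopologicalSpace (Tot E)] [∀ x, HilbertModule (C x) (E x)]
    (β : CStarAction 𝒢 B) {γ : CStarAction 𝒢 C} (ε : HilbertAction γ E) where
  fibre : ∀ x, CStarCorrespondence (B x) (C x) (E x)
  continuous_fibre : Continuous fun p : FibProd B E =>
    (⟨p.base, (fibre p.base).toHom p.fst p.snd⟩ : Tot E)
  equivariant : ∀ (g : G) (b : B (𝒢.src g)) (e : E (𝒢.src g)),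
    ε.act g rfl rfl ((fibre _).toHom b e) = (fibre _).toHom (β.act g rfl rfl b) (ε.act g rfl rfl e)

/-- Properness of an equivariant correspondence `E : B → C`: each element of `Γ₀(X, B)` acts on the
Hilbert module `Γ₀(X, E)` as a limit, in the operator norm, of sums of operators
`v ↦ e ⟨f, v⟩` with `e, f ∈ Γ₀(X, E)`. -/
def EquivariantCorrespondence.IsProper {B C E : X → Type*}
    [∀ x, NonUnitalCStarAlgebra (B x)] [TopologicalSpace (Tot B)]
    [∀ x, NonUnitalCStarAlgebra (C x)] [TopologicalSpace (Tot C)]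
    [∀ x, NormedAddCommGroup (E x)] [∀ x, NormedSpace ℂ (E x)] [∀ x, CompleteSpace (E x)]
    [TopologicalSpace (Tot E)] [∀ x, HilbertModule (C x) (E x)]
    {β : CStarAction 𝒢 B} {γ : CStarAction 𝒢 C} {ε : HilbertAction γ E}
    (φ : EquivariantCorrespondence β ε) : Prop :=
  ∀ b : ∀ x, B x, IsC0 b → ∀ δ > 0, ∃ (n : ℕ) (e f : Fin n → ∀ x, E x),
    (∀ i, IsC0 (e i)) ∧ (∀ i, IsC0 (f i)) ∧
      ∀ v : ∀ x, E x, IsC0 v → ∀ r : ℝ, (∀ x, ‖v x‖ ≤ r) →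
        ∀ x, ‖(φ.fibre x).toHom (b x) (v x) - ∑ i, ract (e i x) (ip (f i x) (v x) : C x)‖ ≤ δ * r

end Equivariant

/-! ### Full crossed products -/

section CrossedProducts

variable {G : Type uG} {X : Type uX} [TopologicalSpace G] [TopologicalSpace X]
  (𝒢 : EtaleGroupoid G X) {A : X → Type uA}
  [∀ x, NonUnitalRing (A x)] [∀ x, Module ℂ (A x)] [∀ x, Star (A x)] [TopologicalSpace (Tot A)]
  (act : ∀ {x y : X} (g : G), 𝒢.src g = x → 𝒢.rng g = y → A x → A y)

/-- The convolution `(a * b)(g) = ∑_{h ∈ G^{s(g)}} (h · a(gh)) b(h⁻¹)`. -/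
def conv (a b : ∀ g, A (𝒢.src g)) (g : G) : A (𝒢.src g) :=
  ∑ᶠ h : {h : G // 𝒢.rng h = 𝒢.src g},
    act h.1 (𝒢.src_mul h.2.symm).symm h.2 (a (𝒢.mul g h.1)) *
      tr ((𝒢.src_inv h.1).trans h.2) (b (𝒢.inv h.1))

/-- The involution `a^*(g) = g⁻¹ · a(g⁻¹)^*`. -/
def adj (a : ∀ g, A (𝒢.src g)) (g : G) : A (𝒢.src g) :=
  act (𝒢.inv g) rfl (𝒢.rng_inv g) (star (a (𝒢.inv g)))

/-- `π` is a ⋆-homomorphism from the ⋆-algebra `Γ_c(G, s^* A)` to the C⋆-algebra `D`. -/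
structure IsStarRep {D : Type*} [NonUnitalCStarAlgebra D] (π : Cc A 𝒢.src → D) : Prop where
  map_add : ∀ a b c : Cc A 𝒢.src, (∀ g, c.1 g = a.1 g + b.1 g) → π c = π a + π b
  map_smul : ∀ (t : ℂ) (a b : Cc A 𝒢.src), (∀ g, b.1 g = t • a.1 g) → π b = t • π a
  map_mul : ∀ a b c : Cc A 𝒢.src, (∀ g, c.1 g = conv 𝒢 act a.1 b.1 g) → π c = π a * π b
  map_star : ∀ a b : Cc A 𝒢.src, (∀ g, b.1 g = adj 𝒢 act a.1 g) → π b = star (π a)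

/-- A ⋆-homomorphism from `Γ_c(G, s^* A)` to some C⋆-algebra. -/
structure ConvRep where
  D : Type (max uG uA)
  [inst : NonUnitalCStarAlgebra D]
  π : Cc A 𝒢.src → D
  isStarRep : IsStarRep 𝒢 act π

instance (i : ConvRep 𝒢 act) : NonUnitalCStarAlgebra i.D := i.inst

/-- `Γ_c(G, s^* A)` is closed under the operations of the convolution ⋆-algebra, and its maximal
C⋆-norm `‖a‖ = sup ‖π a‖` is finite. -/
structure IsConvAlgebra : Prop where
  add : ∀ a b : Cc A 𝒢.src, IsCc 𝒢.src fun g => a.1 g + b.1 g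
  smul : ∀ (t : ℂ) (a : Cc A 𝒢.src), IsCc 𝒢.src fun g => t • a.1 g
  conv : ∀ a b : Cc A 𝒢.src, IsCc 𝒢.src (conv 𝒢 act a.1 b.1)
  adj : ∀ a : Cc A 𝒢.src, IsCc 𝒢.src (adj 𝒢 act a.1)
  bddAbove : ∀ a : Cc A 𝒢.src, BddAbove (Set.range fun i : ConvRep 𝒢 act => ‖i.π a‖)

/-- The element `(π a)_π` of the `ℓ^∞`-product over all ⋆-homomorphisms `π` to C⋆-algebras; its norm
is the maximal C⋆-norm of `a`. -/
def universalRep (a : Cc A 𝒢.src) : lp (fun i : ConvRep 𝒢 act => i.D) ∞ := open Classical in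
  if h : Memℓp (fun i : ConvRep 𝒢 act => i.π a) ∞ then ⟨fun i => i.π a, h⟩ else 0

/-- The full crossed product: the completion of `Γ_c(G, s^* A)` for the maximal C⋆-norm, realised as
the C⋆-algebra generated by the image of `Γ_c(G, s^* A)` under its universal representation. -/
def CrossedProduct : Type _ :=
  (NonUnitalStarAlgebra.adjoin ℂ (Set.range (universalRep 𝒢 act))).topologicalClosure

instance : NonUnitalCStarAlgebra (CrossedProduct 𝒢 act) :=
  NonUnitalStarSubalgebra.nonUnitalCStarAlgebra
    (NonUnitalStarAlgebra.adjoin ℂ (Set.range (universalRep 𝒢 act))).topologicalClosure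
    (h_closed := NonUnitalStarSubalgebra.isClosed_topologicalClosure _)

/-- The canonical map `Γ_c(G, s^* A) → G ⋉ A`. -/
def crossedι (a : Cc A 𝒢.src) : CrossedProduct 𝒢 act :=
  ⟨universalRep 𝒢 act a, NonUnitalStarSubalgebra.le_topologicalClosure _
    (NonUnitalStarAlgebra.subset_adjoin ℂ _ ⟨a, rfl⟩)⟩

end CrossedProducts

/-! ### Induced algebras -/

section Induced

variable {H : Type uH} {Y : Type uY} [TopologicalSpace H] [TopologicalSpace Y]
  {ℋ : EtaleGroupoid H Y} {B : Y → Type uB} [∀ y, NonUnitalCStarAlgebra (B y)]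
  [TopologicalSpace (Tot B)]

theorem CStarBundle.isContSec_zero [CStarBundle B] {Z : Type*} [TopologicalSpace Z] {p : Z → Y}
    (hp : Continuous p) : IsContSec p fun z => (0 : B (p z)) := by
  refine continuous_iff_continuousAt.2 fun z => ?_
  refine Filter.Tendsto.mono_right ?_ (BanachBundle.tendsto_zero (A := B) (p z))
  refine Filter.tendsto_inf.2 ⟨Filter.tendsto_comap_iff.2 hp.continuousAt,
    Filter.tendsto_comap_iff.2 ?_⟩
  refine Filter.Tendsto.congr (f₁ := fun _ : Z => (0 : ℝ)) (fun z => ?_) tendsto_const_nhds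
  exact norm_zero.symm

theorem act_tr (β : CStarAction ℋ B) (g : H) {x x' y y' : Y} (e : x = x') (f : y = y')
    (hx : ℋ.src g = x') (hy : ℋ.rng g = y) (b : B x) :
    β.act g hx (hy.trans f) (tr e b) = tr f (β.act g (hx.trans e.symm) hy b) := by
  subst e f; rfl

variable [CStarBundle B]

/-- For a right `ℋ`-space `Z` with anchor map `σ` and a C⋆-bundle `B` with an action of `ℋ`, the
algebra of bounded continuous sections `ξ` of `σ^* B` with `ξ(z · h) = h⁻¹ · ξ(z)` such that
`[z] ↦ ‖ξ(z)‖` vanishes at infinity on `Z/ℋ`, with pointwise operations and the supremum norm. -/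
def Ind {Z : Type*} [TopologicalSpace Z] (R : RightAction ℋ Z) (β : CStarAction ℋ B) :
    NonUnitalStarSubalgebra ℂ (lp (fun z => B (R.anchor z)) ∞) where
  carrier := {ξ | IsContSec R.anchor (fun z => ξ z) ∧
    (∀ z h, (hz : ℋ.rng h = R.anchor z) →
      ξ (R.smul z h) =
        β.act (ℋ.inv h) ((ℋ.src_inv h).trans hz)
          ((ℋ.rng_inv h).trans (R.anchor_smul hz).symm) (ξ z)) ∧
    ∀ ε > 0, ∃ K : Set R.Orbits, IsCompact K ∧ ∀ z, Quot.mk _ z ∉ K → ‖ξ z‖ < ε}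
  add_mem' := by
    rintro ξ η ⟨h1, h2, h3⟩ ⟨k1, k2, k3⟩
    refine ⟨h1.map₂ (op := fun a b => a + b) BanachBundle.continuous_add k1, fun z h hz => ?_,
      fun ε hε => ?_⟩
    · simp only [lp.coeFn_add, Pi.add_apply, h2 z h hz, k2 z h hz, map_add]
    · obtain ⟨K, hK, hK'⟩ := h3 (ε / 2) (half_pos hε)
      obtain ⟨L, hL, hL'⟩ := k3 (ε / 2) (half_pos hε)
      refine ⟨K ∪ L, hK.union hL, fun z hz => ?_⟩
      have := norm_add_le (ξ z) (η z)
      have := hK' z fun h => hz (Or.inl h)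
      have := hL' z fun h => hz (Or.inr h)
      simp only [lp.coeFn_add, Pi.add_apply]
      linarith
  zero_mem' := by
    refine ⟨CStarBundle.isContSec_zero R.continuous_anchor, fun z h hz => ?_,
      fun ε hε => ⟨∅, isCompact_empty, fun z _ => ?_⟩⟩
    · simp only [lp.coeFn_zero, Pi.zero_apply, map_zero]
    · simpa using hε
  mul_mem' := by
    rintro ξ η ⟨h1, h2, h3⟩ ⟨k1, k2, k3⟩
    refine ⟨h1.map₂ (op := fun a b => a * b) CStarBundle.continuous_mul k1, fun z h hz => ?_,
      fun ε hε => ?_⟩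
    · simp only [lp.infty_coeFn_mul, Pi.mul_apply, h2 z h hz, k2 z h hz, map_mul]
    · obtain ⟨K, hK, hK'⟩ := h3 (ε / (‖η‖ + 1)) (by positivity)
      refine ⟨K, hK, fun z hz => ?_⟩
      have e1 := hK' z hz
      have e2 : ‖η z‖ ≤ ‖η‖ := lp.norm_apply_le_norm (by simp) η z
      rw [lt_div_iff₀ (by positivity)] at e1
      simp only [lp.infty_coeFn_mul, Pi.mul_apply]
      refine (norm_mul_le _ _).trans_lt (lt_of_le_of_lt ?_ e1)
      gcongr
      linarith
  smul_mem' := by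
    rintro c ξ ⟨h1, h2, h3⟩
    refine ⟨(BanachBundle.continuous_smul (A := B) c).comp h1, fun z h hz => ?_, fun ε hε => ?_⟩
    · simp only [lp.coeFn_smul, Pi.smul_apply, h2 z h hz, map_smul]
    · obtain ⟨K, hK, hK'⟩ := h3 (ε / (‖c‖ + 1)) (by positivity)
      refine ⟨K, hK, fun z hz => ?_⟩
      have e1 := hK' z hz
      rw [lt_div_iff₀ (by positivity)] at e1
      simp only [lp.coeFn_smul, Pi.smul_apply, norm_smul]
      nlinarith [norm_nonneg (ξ z)]
  star_mem' := by
    rintro ξ ⟨h1, h2, h3⟩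
    refine ⟨(CStarBundle.continuous_star (A := B)).comp h1, fun z h hz => ?_, fun ε hε => ?_⟩
    · simp only [lp.coeFn_star, Pi.star_apply, h2 z h hz, map_star]
    · obtain ⟨K, hK, hK'⟩ := h3 ε hε
      exact ⟨K, hK, fun z hz => by simpa using hK' z hz⟩

variable {G : Type uG} {X : Type uX} [TopologicalSpace G] [TopologicalSpace X]
  {𝒢 : EtaleGroupoid G X} {Ω : Type uΩ} [TopologicalSpace Ω]
  (W : EtaleCorrespondence 𝒢 ℋ Ω) (β : CStarAction ℋ B)

theorem EtaleCorrespondence.fibre_invariant (x : X) (ω : Ω) (h : H) (hω : W.left.anchor ω = x)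
    (hh : ℋ.rng h = W.right.anchor ω) : W.left.anchor (W.right.smul ω h) = x :=
  (W.left_anchor_smul hh).trans hω

/-- The right `ℋ`-space `Ω^x`, the fibre of `Ω` over `x ∈ X`. -/
abbrev EtaleCorrespondence.fibre (x : X) : RightAction ℋ {ω // W.left.anchor ω = x} :=
  W.right.restrict (fun ω => W.left.anchor ω = x) (W.fibre_invariant x)

/-- The fibre of `Ind_Ω B` at `x ∈ X`: the sections over `Ω^x` that are `ℋ`-equivariant and vanish
at infinity on `Ω^x/ℋ`. -/
abbrev IndFib (x : X) : Type _ := Ind (W.fibre x) β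

/-- The restriction to `Ω^x` of an element of `Ind_Ω B`. -/
def indRestrict (η : Ind W.right β) (x : X) :
    lp (fun ω : {ω // W.left.anchor ω = x} => B (W.right.anchor ω.1)) ∞ :=
  ⟨fun ω => η.1 ω.1, memℓp_infty ⟨‖η.1‖, by
    rintro _ ⟨ω, rfl⟩
    exact lp.norm_apply_le_norm (by simp) η.1 ω.1⟩⟩

/-- The topology of the Banach bundle associated to `Ind_Ω B`, generated by the sets of all `ξ` over
an open `U ⊆ X` with `‖ξ - η|_x‖ < r`, where `x` is the base point of `ξ` and `η ∈ Ind_Ω B`. -/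
instance : TopologicalSpace (Tot (IndFib W β)) :=
  TopologicalSpace.generateFrom {S | ∃ (η : Ind W.right β) (U : Set X) (r : ℝ), IsOpen U ∧
    S = {p | p.base ∈ U ∧ ‖p.val.1 - indRestrict W β η p.base‖ < r}}

/-- The point `g · ω ∈ Ω^y` for `ω ∈ Ω^x` and `g` with source `x` and range `y`. -/
def EtaleCorrespondence.move {x y : X} (g : G) (hx : 𝒢.src g = x) (hy : 𝒢.rng g = y)
    (ω : {ω // W.left.anchor ω = x}) : {ω // W.left.anchor ω = y} :=
  ⟨W.left.smul g ω.1, (W.left.anchor_smul (hx.trans ω.2.symm)).trans hy⟩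

theorem EtaleCorrespondence.anchor_move {x y : X} (g : G) (hx : 𝒢.src g = x) (hy : 𝒢.rng g = y)
    (ω : {ω // W.left.anchor ω = x}) :
    W.right.anchor (W.move g hx hy ω).1 = W.right.anchor ω.1 :=
  W.right_anchor_smul (hx.trans ω.2.symm)

theorem EtaleCorrespondence.continuous_move {x y : X} (g : G) (hx : 𝒢.src g = x)
    (hy : 𝒢.rng g = y) : Continuous (W.move g hx hy) :=
  Continuous.subtype_mk (W.left.continuous_smul.comp_continuous
    (f := fun ω : {ω // W.left.anchor ω = x} => (g, ω.1)) (by fun_prop)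
    fun ω => hx.trans ω.2.symm) _

theorem EtaleCorrespondence.move_smul {x y : X} (g : G) (hx : 𝒢.src g = x) (hy : 𝒢.rng g = y)
    (ω : {ω // W.left.anchor ω = x}) (h : H) (hh : ℋ.rng h = W.right.anchor ω.1) :
    W.move g hx hy ((W.fibre x).smul ω h) = (W.fibre y).smul (W.move g hx hy ω) h := by
  have hh' : ℋ.rng h = W.right.anchor (W.move g hx hy ω).1 :=
    hh.trans (W.anchor_move g hx hy ω).symm
  have e1 : (((W.fibre x).smul ω h).1 : Ω) = W.right.smul ω.1 h :=
    W.right.restrictSMul_coe _ (W.fibre_invariant x) ω h hh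
  have e2 : (((W.fibre y).smul (W.move g hx hy ω) h).1 : Ω) =
      W.right.smul (W.left.smul g ω.1) h :=
    W.right.restrictSMul_coe _ (W.fibre_invariant y) (W.move g hx hy ω) h hh'
  refine Subtype.ext (Eq.trans ?_ e2.symm)
  exact (congrArg (W.left.smul g) e1).trans (W.smul_comm (hx.trans ω.2.symm) hh).symm

theorem EtaleCorrespondence.move_inv_move {x y : X} (g : G) (hx : 𝒢.src g = x)
    (hy : 𝒢.rng g = y) (ω : {ω // W.left.anchor ω = y}) :
    W.move g hx hy
      (W.move (𝒢.inv g) ((𝒢.src_inv g).trans hy) ((𝒢.rng_inv g).trans hx) ω) = ω := by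
  refine Subtype.ext ?_
  change W.left.smul g (W.left.smul (𝒢.inv g) ω.1) = ω.1
  rw [← W.left.mul_smul (𝒢.rng_inv g).symm ((𝒢.src_inv g).trans (hy.trans ω.2.symm)),
    𝒢.mul_inv, hy.trans ω.2.symm, W.left.one_smul]

/-- The action of `𝒢` on the bundle `Ind_Ω B`, given by `(g · ξ)(ω) = ξ(g⁻¹ · ω)`. -/
def indAct {x y : X} (g : G) (hx : 𝒢.src g = x) (hy : 𝒢.rng g = y) (ξ : IndFib W β x) :
    IndFib W β y :=
  have hx' : 𝒢.rng (𝒢.inv g) = x := (𝒢.rng_inv g).trans hx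
  have hy' : 𝒢.src (𝒢.inv g) = y := (𝒢.src_inv g).trans hy
  ⟨⟨fun ω => tr (W.anchor_move (𝒢.inv g) hy' hx' ω) (ξ.1 (W.move (𝒢.inv g) hy' hx' ω)),
    memℓp_infty ⟨‖ξ.1‖, by
      rintro _ ⟨ω, rfl⟩
      dsimp only
      rw [norm_tr]
      exact lp.norm_apply_le_norm (by simp) ξ.1 _⟩⟩, by
    obtain ⟨h1, h2, h3⟩ := ξ.2
    refine ⟨?_, fun ω h hh => ?_, fun ε hε => ?_⟩
    · refine Continuous.congr (h1.comp (W.continuous_move (𝒢.inv g) hy' hx')) fun ω => ?_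
      exact (tot_tr _ _).symm
    · have hh' : ℋ.rng h = W.right.anchor (W.move (𝒢.inv g) hy' hx' ω).1 :=
        hh.trans (W.anchor_move _ hy' hx' ω).symm
      dsimp only
      rw [apply_eq_tr (p := fun z : {ω // W.left.anchor ω = x} => W.right.anchor z.1)
        (fun z => ξ.1 z) (W.move_smul (𝒢.inv g) hy' hx' ω h hh),
        h2 (W.move (𝒢.inv g) hy' hx' ω) h hh', tr_tr]
      refine (act_tr β (ℋ.inv h) _ _ _ _ _).symm
    · obtain ⟨K, hK, hK'⟩ := h3 ε hε
      let f : (W.fibre x).Orbits → (W.fibre y).Orbits :=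
        Quot.lift (fun ω => Quot.mk _ (W.move g hx hy ω)) (by
          rintro ω _ ⟨h, hh, rfl⟩
          refine Quot.sound ⟨h, hh.trans (W.anchor_move g hx hy ω).symm, ?_⟩
          exact (W.move_smul g hx hy ω h hh).symm)
      have hf : Continuous f :=
        continuous_quot_lift _ (continuous_quot_mk.comp (W.continuous_move g hx hy))
      refine ⟨f '' K, hK.image hf, fun ω hω => ?_⟩
      dsimp only
      rw [norm_tr]
      refine hK' _ fun hmem => hω ⟨_, hmem, ?_⟩
      exact congrArg (Quot.mk _) (W.move_inv_move g hx hy ω)⟩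

end Induced

/-! ### The operations on `Γ_c(Ω, σ^* E)` -/

section CrossedProductModule

variable {G : Type uG} {X : Type uX} {H : Type uH} {Y : Type uY} {Ω : Type uΩ}
  [TopologicalSpace G] [TopologicalSpace X] [TopologicalSpace H] [TopologicalSpace Y]
  [TopologicalSpace Ω] {𝒢 : EtaleGroupoid G X} {ℋ : EtaleGroupoid H Y}
  (W : EtaleCorrespondence 𝒢 ℋ Ω)
  {B : Y → Type uB} [∀ y, NonUnitalCStarAlgebra (B y)] [TopologicalSpace (Tot B)] [CStarBundle B]
  {C : Y → Type uC} [∀ y, NonUnitalCStarAlgebra (C y)] [TopologicalSpace (Tot C)]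
  {E : Y → Type uE} [∀ y, NormedAddCommGroup (E y)] [∀ y, NormedSpace ℂ (E y)]
  [∀ y, CompleteSpace (E y)] [TopologicalSpace (Tot E)] [∀ y, HilbertModule (C y) (E y)]
  {β : CStarAction ℋ B} {γ : CStarAction ℋ C} {ε : HilbertAction γ E}

/-- The full crossed product `H ⋉ C` of a C⋆-bundle with an action. -/
abbrev CStarAction.Crossed (γ : CStarAction ℋ C) : Type _ :=
  CrossedProduct ℋ (A := C) fun h hx hy => γ.act h hx hy

/-- The canonical map `Γ_c(H, s^* C) → H ⋉ C`. -/
abbrev CStarAction.ι (γ : CStarAction ℋ C) : Cc C ℋ.src → γ.Crossed :=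
  crossedι ℋ (A := C) fun h hx hy => γ.act h hx hy

/-- The full crossed product `G ⋉ Ind_Ω B`. -/
abbrev IndCrossed (β : CStarAction ℋ B) : Type _ :=
  CrossedProduct 𝒢 (A := IndFib W β) fun g hx hy => indAct W β g hx hy

/-- The canonical map `Γ_c(G, s^* Ind_Ω B) → G ⋉ Ind_Ω B`. -/
abbrev indι (β : CStarAction ℋ B) : Cc (IndFib W β) 𝒢.src → IndCrossed W β :=
  crossedι 𝒢 (A := IndFib W β) fun g hx hy => indAct W β g hx hy

/-- `⟨ξ, η⟩(h) = ∑_{ω ∈ Ω_{r(h)}} ⟨h⁻¹ · ξ(ω), η(ω · h)⟩`. -/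
def innerSec (ε : HilbertAction γ E) (ξ η : ∀ ω, E (W.right.anchor ω)) (h : H) : C (ℋ.src h) :=
  ∑ᶠ ω : {ω : Ω // W.right.anchor ω = ℋ.rng h},
    ip (ε.act (ℋ.inv h) ((ℋ.src_inv h).trans ω.2.symm) (ℋ.rng_inv h) (ξ ω.1))
      (tr (W.right.anchor_smul ω.2.symm) (η (W.right.smul ω.1 h)))

/-- `(ξ · c)(ω) = ∑_{h ∈ H^{σ(ω)}} (h · ξ(ω · h)) · c(h⁻¹)`. -/
def rightSec (ε : HilbertAction γ E) (ξ : ∀ ω, E (W.right.anchor ω)) (c : ∀ h, C (ℋ.src h))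
    (ω : Ω) : E (W.right.anchor ω) :=
  ∑ᶠ h : {h : H // ℋ.rng h = W.right.anchor ω},
    ract (ε.act h.1 (W.right.anchor_smul h.2).symm h.2 (ξ (W.right.smul ω h.1)))
      (tr ((ℋ.src_inv h.1).trans h.2) (c (ℋ.inv h.1)))

/-- `(b · ξ)(ω) = ∑_{g ∈ G_{ρ(ω)}} b(g⁻¹)(g · ω) · ξ(g · ω)`. -/
def leftSec (φ : EquivariantCorrespondence β ε) (b : ∀ g, IndFib W β (𝒢.src g))
    (ξ : ∀ ω, E (W.right.anchor ω)) (ω : Ω) : E (W.right.anchor ω) :=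
  ∑ᶠ g : {g : G // 𝒢.src g = W.left.anchor ω},
    tr (W.right_anchor_smul g.2) ((φ.fibre _).toHom
      ((b (𝒢.inv g.1)).1 ⟨W.left.smul g.1 ω, (W.left.anchor_smul g.2).trans (𝒢.src_inv g.1).symm⟩)
      (ξ (W.left.smul g.1 ω)))

/-- The Hilbert `H ⋉ C`-module `M` is the crossed product module `Ω ⋉ E`: it contains, through `j`,
a dense copy of `Γ_c(Ω, σ^* E)`, and its inner product and right action extend those of
`Γ_c(Ω, σ^* E)`. -/
structure IsCrossedProductModule (ε : HilbertAction γ E) {M : Type*} [NormedAddCommGroup M]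
    [NormedSpace ℂ M] [CompleteSpace M] [HilbertModule γ.Crossed M]
    (j : Cc E W.right.anchor → M) : Prop where
  map_add : ∀ ξ η ζ : Cc E W.right.anchor, (∀ ω, ζ.1 ω = ξ.1 ω + η.1 ω) → j ζ = j ξ + j η
  map_smul : ∀ (t : ℂ) (ξ η : Cc E W.right.anchor), (∀ ω, η.1 ω = t • ξ.1 ω) → j η = t • j ξ
  injective : Function.Injective j
  denseRange : DenseRange j
  ip_eq : ∀ ξ η, ∃ hc : IsCc ℋ.src (innerSec W ε ξ.1 η.1),
    (ip (j ξ) (j η) : γ.Crossed) = γ.ι ⟨_, hc⟩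
  ract_eq : ∀ ξ (c : Cc C ℋ.src), ∃ hc : IsCc W.right.anchor (rightSec W ε ξ.1 c.1),
    ract (j ξ) (γ.ι c) = j ⟨_, hc⟩

end CrossedProductModule

end

-- Every formula of the theorem is a sum along the fibres of an étale map: the projections of the
-- composable pairs of an action, or the source and range maps. Locally such a sum has a single
-- term, read through a local inverse, so `isCc_pushSec` gives continuity and compact support at
-- once; properness of the right action supplies the compact supports of inner products. The
-- algebraic identities are reindexings of finite double sums.
--
-- Norms are controlled by bisections. If `b` is supported in a bisection, `b⋆ b` lives on the
-- units, where the sections vanishing off a compact set form a C⋆-algebra, and ⋆-homomorphisms of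
-- C⋆-algebras are contractive. So every representation is bounded by the supremum norm on such
-- sections, and every compactly supported section is a finite sum of them. This makes the maximal
-- norm finite. The same computation, with `PreHilbert.ip_map_le` in place of contractivity, shows
-- that `Γ_c(G, s⋆ Ind B)` acts on `Γ_c(Ω, σ⋆E)` by bounded operators.
--
-- The main point is positivity of `⟨ξ, ξ⟩` in the full crossed product. In a Hilbert module
-- finitely many vectors are almost fixed by some `∑ f⟨f, ·⟩` (`AdjOp.exists_approx_unit`).
-- Spreading such `f` to sections and cutting them off by functions whose orbit sums form a
-- partition of unity gives `ζ` with `∑ ζ⟨ζ, ξ⟩` uniformly close to `ξ` and vanishing where `ξ`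
-- does; the bridge is `rightSec_innerSec`, valid when `ζ` is supported where the anchor map is
-- injective. Hence `⟨ξ, ξ⟩` is a limit of sums `∑ ⟨ζ, ξ⟩⋆⟨ζ, ξ⟩`. The completion is a Hilbert
-- module, and it contains `Γ_c(Ω, σ⋆E)` faithfully because the regular representations separate the
-- elements of `Γ_c(H, s⋆C)`.
--
-- The induced bundle need only be handled through approximations by restrictions of elements of
-- `Ind_Ω B`; this gives the bundle of C⋆-algebras and the action on which the general results are
-- used. The left action is adjointable because the pairs `(ω, g)` carry the involution `(gω, g⁻¹)`.
-- It is nondegenerate because freeness lets sections of `B` be extended locally to elements of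
-- `Ind_Ω B`.
--
-- For properness it suffices to treat sections on the units. Fibrewise approximations by rank one
-- operators are glued over orbits as before. The result is close fibre by fibre only, and
-- `norm_le_of_pointwise` turns this into an estimate of operator norms by looking at the powers of
-- `T⋆T`.

universe uD

set_option linter.unusedSectionVars false

noncomputable section

open Filter

open HilbertModule (ip ract)

/-! ### Bundles with enough local sections -/

section ApproxBundles

variable {X : Type*} [TopologicalSpace X]

/-- A Banach bundle (with not necessarily complete fibres) in which each element of a fibre is
approximated by the values of continuous sections. -/
class ApproxBundle (A : X → Type*) [∀ x, NormedAddCommGroup (A x)] [∀ x, NormedSpace ℂ (A x)]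
    [TopologicalSpace (Tot A)] : Prop where
  continuous_base : Continuous (Tot.base : Tot A → X)
  upperSemicontinuous_norm : UpperSemicontinuous fun a : Tot A => ‖a.val‖
  continuous_add : Continuous fun p : FibProd A A => (⟨p.base, p.fst + p.snd⟩ : Tot A)
  continuous_smul : ∀ c : ℂ, Continuous fun a : Tot A => (⟨a.base, c • a.val⟩ : Tot A)
  tendsto_zero : ∀ x : X,
    (𝓝 x).comap (Tot.base : Tot A → X) ⊓ (𝓝 (0 : ℝ)).comap (fun a : Tot A => ‖a.val‖) ≤
      𝓝 (⟨x, 0⟩ : Tot A)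
  exists_approx : ∀ (x : X) (a : A x) (r : ℝ), 0 < r →
    ∃ ξ : ∀ x, A x, IsContSec (fun x : X => x) ξ ∧ ‖ξ x - a‖ < r

instance BanachBundle.toApproxBundle (A : X → Type*) [∀ x, NormedAddCommGroup (A x)]
    [∀ x, NormedSpace ℂ (A x)] [∀ x, CompleteSpace (A x)] [TopologicalSpace (Tot A)]
    [BanachBundle A] : ApproxBundle A where
  continuous_base := BanachBundle.continuous_base
  upperSemicontinuous_norm := BanachBundle.upperSemicontinuous_norm
  continuous_add := BanachBundle.continuous_add
  continuous_smul := BanachBundle.continuous_smul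
  tendsto_zero := BanachBundle.tendsto_zero
  exists_approx x a r hr := by
    obtain ⟨ξ, h1, h2⟩ := BanachBundle.exists_section x a
    exact ⟨ξ, h1.1, by simpa [h2] using hr⟩

theorem tendsto_fibProd {P Q : X → Type*} [TopologicalSpace (Tot P)] [TopologicalSpace (Tot Q)]
    {Z : Type*} {l : Filter Z} {p : Z → X} {a : ∀ z, P (p z)} {b : ∀ z, Q (p z)} {x : X} {a₀ : P x}
    {b₀ : Q x} (ha : Tendsto (fun z => (⟨p z, a z⟩ : Tot P)) l (𝓝 ⟨x, a₀⟩))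
    (hb : Tendsto (fun z => (⟨p z, b z⟩ : Tot Q)) l (𝓝 ⟨x, b₀⟩)) :
    Tendsto (fun z => (⟨p z, a z, b z⟩ : FibProd P Q)) l (𝓝 ⟨x, a₀, b₀⟩) := by
  rw [nhds_induced]
  exact tendsto_comap_iff.2 (ha.prodMk_nhds hb)

theorem tendsto_map₂ {P Q S : X → Type*} [TopologicalSpace (Tot P)] [TopologicalSpace (Tot Q)]
    [TopologicalSpace (Tot S)] {m : ∀ {y}, P y → Q y → S y}
    (hm : Continuous fun q : FibProd P Q => (⟨q.base, m q.fst q.snd⟩ : Tot S))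
    {Z : Type*} {l : Filter Z} {p : Z → X} {a : ∀ z, P (p z)} {b : ∀ z, Q (p z)} {x : X} {a₀ : P x}
    {b₀ : Q x} (ha : Tendsto (fun z => (⟨p z, a z⟩ : Tot P)) l (𝓝 ⟨x, a₀⟩))
    (hb : Tendsto (fun z => (⟨p z, b z⟩ : Tot Q)) l (𝓝 ⟨x, b₀⟩)) :
    Tendsto (fun z => (⟨p z, m (a z) (b z)⟩ : Tot S)) l (𝓝 ⟨x, m a₀ b₀⟩) :=
  (hm.tendsto ⟨x, a₀, b₀⟩).comp (tendsto_fibProd ha hb)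

theorem IsContSec.map₂' {P Q S : X → Type*} [TopologicalSpace (Tot P)] [TopologicalSpace (Tot Q)]
    [TopologicalSpace (Tot S)] {m : ∀ {y}, P y → Q y → S y}
    (hm : Continuous fun q : FibProd P Q => (⟨q.base, m q.fst q.snd⟩ : Tot S))
    {Z : Type*} [TopologicalSpace Z] {p : Z → X} {a : ∀ z, P (p z)} {b : ∀ z, Q (p z)}
    (ha : IsContSec p a) (hb : IsContSec p b) : IsContSec p fun z => m (a z) (b z) :=
  hm.comp (f := fun z => (⟨p z, a z, b z⟩ : FibProd P Q))
    (continuous_induced_rng.2 (ha.prodMk hb))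

section Raw

variable {A : X → Type*} [TopologicalSpace (Tot A)]

theorem IsContSec.comp {Z Z' : Type*} [TopologicalSpace Z] [TopologicalSpace Z'] {p : Z → X}
    {a : ∀ z, A (p z)} (ha : IsContSec p a) {f : Z' → Z} (hf : Continuous f) :
    IsContSec (fun z => p (f z)) fun z => a (f z) :=
  Continuous.comp ha hf

theorem IsContSec.congr_base {Z : Type*} [TopologicalSpace Z] {p q : Z → X}
    {a : ∀ z, A (p z)} (ha : IsContSec p a) (h : ∀ z, p z = q z) :
    IsContSec q fun z => tr (h z) (a z) :=
  Continuous.congr ha fun z => (tot_tr (h z) (a z)).symm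

end Raw

variable {A : X → Type*} [∀ x, NormedAddCommGroup (A x)] [∀ x, NormedSpace ℂ (A x)]
  [TopologicalSpace (Tot A)] [ApproxBundle A] {Z : Type*} {l : Filter Z} {p : Z → X}

theorem tendsto_base {a : ∀ z, A (p z)} {x : X} {a₀ : A x}
    (ha : Tendsto (fun z => (⟨p z, a z⟩ : Tot A)) l (𝓝 ⟨x, a₀⟩)) : Tendsto p l (𝓝 x) :=
  (ApproxBundle.continuous_base (A := A)).continuousAt.tendsto.comp ha

theorem tendsto_tot_add {a b : ∀ z, A (p z)} {x : X} {a₀ b₀ : A x}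
    (ha : Tendsto (fun z => (⟨p z, a z⟩ : Tot A)) l (𝓝 ⟨x, a₀⟩))
    (hb : Tendsto (fun z => (⟨p z, b z⟩ : Tot A)) l (𝓝 ⟨x, b₀⟩)) :
    Tendsto (fun z => (⟨p z, a z + b z⟩ : Tot A)) l (𝓝 ⟨x, a₀ + b₀⟩) :=
  tendsto_map₂ (m := fun a b => a + b) ApproxBundle.continuous_add ha hb

theorem tendsto_tot_const_smul (c : ℂ) {a : ∀ z, A (p z)} {x : X} {a₀ : A x}
    (ha : Tendsto (fun z => (⟨p z, a z⟩ : Tot A)) l (𝓝 ⟨x, a₀⟩)) :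
    Tendsto (fun z => (⟨p z, c • a z⟩ : Tot A)) l (𝓝 ⟨x, c • a₀⟩) :=
  ((ApproxBundle.continuous_smul (A := A) c).tendsto ⟨x, a₀⟩).comp ha

theorem tendsto_tot_sub {a b : ∀ z, A (p z)} {x : X} {a₀ b₀ : A x}
    (ha : Tendsto (fun z => (⟨p z, a z⟩ : Tot A)) l (𝓝 ⟨x, a₀⟩))
    (hb : Tendsto (fun z => (⟨p z, b z⟩ : Tot A)) l (𝓝 ⟨x, b₀⟩)) :
    Tendsto (fun z => (⟨p z, a z - b z⟩ : Tot A)) l (𝓝 ⟨x, a₀ - b₀⟩) := by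
  simpa [sub_eq_add_neg] using tendsto_tot_add ha (tendsto_tot_const_smul (-1) hb)

theorem tendsto_tot_zero {a : ∀ z, A (p z)} {x : X} (hp : Tendsto p l (𝓝 x))
    (ha : Tendsto (fun z => ‖a z‖) l (𝓝 0)) :
    Tendsto (fun z => (⟨p z, a z⟩ : Tot A)) l (𝓝 ⟨x, 0⟩) := by
  refine Tendsto.mono_right ?_ (ApproxBundle.tendsto_zero x)
  rw [tendsto_inf, tendsto_comap_iff, tendsto_comap_iff]
  exact ⟨hp, ha⟩

theorem eventually_tot_norm_lt {a : ∀ z, A (p z)} {x : X} {a₀ : A x}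
    (ha : Tendsto (fun z => (⟨p z, a z⟩ : Tot A)) l (𝓝 ⟨x, a₀⟩)) {r : ℝ} (hr : ‖a₀‖ < r) :
    ∀ᶠ z in l, ‖a z‖ < r :=
  ha.eventually (ApproxBundle.upperSemicontinuous_norm (A := A) ⟨x, a₀⟩ r hr)

/-- Addition is continuous at `(a₀, 0)`, so a neighbourhood of `a₀` contains the sums of elements of
a neighbourhood `V` of `a₀` and of a neighbourhood of the zero over `x`. By `tendsto_zero` the
latter contains all vectors of small norm over points near `x`. It remains to write `a = b + (a -
b)`. -/
theorem tendsto_tot_of_approx {a : ∀ z, A (p z)} {x : X} {a₀ : A x} (hp : Tendsto p l (𝓝 x))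
    (h : ∀ r > 0, ∃ b : ∀ z, A (p z), ∃ b₀ : A x,
      Tendsto (fun z => (⟨p z, b z⟩ : Tot A)) l (𝓝 ⟨x, b₀⟩) ∧ ‖b₀ - a₀‖ < r ∧
        ∀ᶠ z in l, ‖a z - b z‖ < r) :
    Tendsto (fun z => (⟨p z, a z⟩ : Tot A)) l (𝓝 ⟨x, a₀⟩) := by
  have hadd : Tendsto (fun q : FibProd A A => (⟨q.base, q.fst + q.snd⟩ : Tot A))
      (𝓝 ⟨x, a₀, 0⟩) (𝓝 ⟨x, a₀⟩) := by
    have := (ApproxBundle.continuous_add (A := A)).tendsto ⟨x, a₀, 0⟩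
    simpa using this
  intro W hW
  have h1 := hadd hW
  rw [mem_map, nhds_induced, nhds_prod_eq] at h1
  obtain ⟨S, hS, hSW⟩ := mem_comap.1 h1
  obtain ⟨V₀, hV₀, T, hT, hVT⟩ := mem_prod_iff.1 hS
  obtain ⟨V, hVV, hVo, hVa⟩ := mem_nhds_iff.1 hV₀
  obtain ⟨T', hT', T'', hT'', hTT⟩ := mem_inf_iff_superset.1 (ApproxBundle.tendsto_zero x hT)
  obtain ⟨U, hU, hUT⟩ := mem_comap.1 hT'
  obtain ⟨N, hN, hNT⟩ := mem_comap.1 hT''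
  obtain ⟨ε, hε, hεN⟩ := Metric.mem_nhds_iff.1 hN
  -- The inclusion of the fibre over `x` is continuous at `a₀`; this puts `b₀` in `V` once it is
  -- close to `a₀` in norm.
  have hV' : ∀ᶠ c in 𝓝 a₀, (⟨x, c⟩ : Tot A) ∈ V := by
    have : Tendsto (fun c : A x => (⟨x, c⟩ : Tot A)) (𝓝 a₀) (𝓝 ⟨x, a₀⟩) := by
      have h0 : Tendsto (fun c : A x => (⟨x, c - a₀⟩ : Tot A)) (𝓝 a₀) (𝓝 ⟨x, 0⟩) := by
        refine tendsto_tot_zero (p := fun _ => x) tendsto_const_nhds ?_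
        have : Tendsto (fun c => ‖c - a₀‖) (𝓝 a₀) (𝓝 ‖a₀ - a₀‖) :=
          ((continuous_id.sub continuous_const).norm).tendsto a₀
        simpa using this
      have := tendsto_tot_add h0 (b := fun _ => a₀) (b₀ := a₀) tendsto_const_nhds
      simpa using this
    exact this (hVo.mem_nhds hVa)
  obtain ⟨δ, hδ, hδV⟩ := Metric.mem_nhds_iff.1 hV'
  obtain ⟨b, b₀, hb, hb0, hab⟩ := h (min ε δ) (lt_min hε hδ)
  have hbV : (⟨x, b₀⟩ : Tot A) ∈ V :=
    hδV (by rw [mem_ball_iff_norm]; exact hb0.trans_le (min_le_right _ _))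
  have hbV' := hb.eventually_mem (hVo.mem_nhds hbV)
  have hU' := hp.eventually_mem hU
  change ∀ᶠ z in l, _ ∈ W
  filter_upwards [hbV', hab, hU'] with z h1 h2 h3
  have h4 : (⟨p z, a z - b z⟩ : Tot A) ∈ T := by
    refine hTT ⟨hUT h3, hNT (hεN ?_)⟩
    rw [mem_ball_zero_iff, norm_norm]
    exact h2.trans_le (min_le_left _ _)
  have := hSW (show (⟨p z, b z, a z - b z⟩ : FibProd A A) ∈ _ from hVT ⟨hVV h1, h4⟩)
  simpa using this

/-- The axioms give continuity for a fixed scalar only. Since `‖a z‖` is eventually bounded by upper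
semicontinuity, the correction `(f z - c) • a z` tends to zero. -/
theorem tendsto_tot_smul {f : Z → ℂ} {c : ℂ} (hf : Tendsto f l (𝓝 c)) {a : ∀ z, A (p z)} {x : X}
    {a₀ : A x} (ha : Tendsto (fun z => (⟨p z, a z⟩ : Tot A)) l (𝓝 ⟨x, a₀⟩)) :
    Tendsto (fun z => (⟨p z, f z • a z⟩ : Tot A)) l (𝓝 ⟨x, c • a₀⟩) := by
  have h0 : Tendsto (fun z => (⟨p z, (f z - c) • a z⟩ : Tot A)) l (𝓝 ⟨x, 0⟩) := by
    refine tendsto_tot_zero (tendsto_base ha) ?_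
    have h1 : Tendsto (fun z => ‖f z - c‖ * (‖a₀‖ + 1)) l (𝓝 0) := by
      have := ((hf.sub_const c).norm).mul_const (‖a₀‖ + 1)
      simpa using this
    refine squeeze_zero' (Eventually.of_forall fun z => norm_nonneg _) ?_ h1
    filter_upwards [eventually_tot_norm_lt ha (lt_add_one ‖a₀‖)] with z hz
    rw [norm_smul]
    exact mul_le_mul_of_nonneg_left hz.le (norm_nonneg _)
  have := tendsto_tot_add h0 (tendsto_tot_const_smul c ha)
  simpa [← add_smul] using this

theorem tendsto_tot_sum {ι : Type*} (s : Finset ι) {a : ι → ∀ z, A (p z)} {x : X} {a₀ : ι → A x}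
    (hp : Tendsto p l (𝓝 x))
    (ha : ∀ i ∈ s, Tendsto (fun z => (⟨p z, a i z⟩ : Tot A)) l (𝓝 ⟨x, a₀ i⟩)) :
    Tendsto (fun z => (⟨p z, ∑ i ∈ s, a i z⟩ : Tot A)) l (𝓝 ⟨x, ∑ i ∈ s, a₀ i⟩) := by
  classical
  induction s using Finset.induction_on with
  | empty => simpa using tendsto_tot_zero (a := fun z => (0 : A (p z))) hp (by simp [tendsto_const_nhds])
  | insert i s hi ih =>
    simp only [Finset.sum_insert hi]
    exact tendsto_tot_add (ha i (Finset.mem_insert_self _ _))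
      (ih fun j hj => ha j (Finset.mem_insert_of_mem hj))

section Continuous

variable [TopologicalSpace Z]

theorem isContSec_iff {a : ∀ z, A (p z)} :
    IsContSec p a ↔ ∀ z₀, Tendsto (fun z => (⟨p z, a z⟩ : Tot A)) (𝓝 z₀) (𝓝 ⟨p z₀, a z₀⟩) :=
  continuous_iff_continuousAt

theorem IsContSec.continuous_base {a : ∀ z, A (p z)} (ha : IsContSec p a) : Continuous p :=
  (ApproxBundle.continuous_base (A := A)).comp ha

theorem IsContSec.zero (hp : Continuous p) : IsContSec p fun z => (0 : A (p z)) :=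
  isContSec_iff.2 fun z => tendsto_tot_zero (hp.tendsto z) (by simp)

theorem IsContSec.add {a b : ∀ z, A (p z)} (ha : IsContSec p a) (hb : IsContSec p b) :
    IsContSec p fun z => a z + b z :=
  isContSec_iff.2 fun z => tendsto_tot_add (isContSec_iff.1 ha z) (isContSec_iff.1 hb z)

theorem IsContSec.sub {a b : ∀ z, A (p z)} (ha : IsContSec p a) (hb : IsContSec p b) :
    IsContSec p fun z => a z - b z :=
  isContSec_iff.2 fun z => tendsto_tot_sub (isContSec_iff.1 ha z) (isContSec_iff.1 hb z)

theorem IsContSec.smul {f : Z → ℂ} (hf : Continuous f) {a : ∀ z, A (p z)} (ha : IsContSec p a) :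
    IsContSec p fun z => f z • a z :=
  isContSec_iff.2 fun z => tendsto_tot_smul (hf.tendsto z) (isContSec_iff.1 ha z)

theorem IsContSec.const_smul (c : ℂ) {a : ∀ z, A (p z)} (ha : IsContSec p a) :
    IsContSec p fun z => c • a z :=
  IsContSec.smul continuous_const ha

theorem IsContSec.sum {ι : Type*} (s : Finset ι) (hp : Continuous p) {a : ι → ∀ z, A (p z)}
    (ha : ∀ i ∈ s, IsContSec p (a i)) : IsContSec p fun z => ∑ i ∈ s, a i z :=
  isContSec_iff.2 fun z => tendsto_tot_sum s (hp.tendsto z) fun i hi => isContSec_iff.1 (ha i hi) z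

theorem IsContSec.isOpen_norm_lt {a : ∀ z, A (p z)} (ha : IsContSec p a) (r : ℝ) :
    IsOpen {z | ‖a z‖ < r} :=
  isOpen_iff_mem_nhds.2 fun z hz => eventually_tot_norm_lt (isContSec_iff.1 ha z) hz

/-- A section that is locally uniformly approximated by continuous sections is continuous. -/
theorem IsContSec.of_approx (hp : Continuous p) {a : ∀ z, A (p z)}
    (h : ∀ z₀, ∀ r > 0, ∃ b : ∀ z, A (p z), IsContSec p b ∧ ∀ᶠ z in 𝓝 z₀, ‖a z - b z‖ < r) :
    IsContSec p a :=
  isContSec_iff.2 fun z₀ => tendsto_tot_of_approx (hp.tendsto z₀) fun r hr => by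
    obtain ⟨b, hb, hab⟩ := h z₀ r hr
    refine ⟨b, b z₀, isContSec_iff.1 hb z₀, ?_, hab⟩
    rw [norm_sub_rev]; exact hab.self_of_nhds

/-- Continuity of a section is a local property. -/
theorem IsContSec.of_eventuallyEq {a : ∀ z, A (p z)}
    (h : ∀ z₀, ∃ b : ∀ z, A (p z), IsContSec p b ∧ ∀ᶠ z in 𝓝 z₀, a z = b z) : IsContSec p a := by
  refine continuous_iff_continuousAt.2 fun z₀ => ?_
  obtain ⟨b, hb, hab⟩ := h z₀
  refine (Continuous.continuousAt (x := z₀) hb).congr ?_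
  filter_upwards [hab] with z hz
  rw [hz]

end Continuous

end ApproxBundles

/-! ### Actions on bundles by linear isometries -/

theorem tr_add {X : Type*} {A : X → Type*} [∀ x, Add (A x)] {x y : X} (h : x = y) (a b : A x) :
    tr h (a + b) = tr h a + tr h b := by subst h; rfl

theorem tr_mul {X : Type*} {A : X → Type*} [∀ x, Mul (A x)] {x y : X} (h : x = y) (a b : A x) :
    tr h (a * b) = tr h a * tr h b := by subst h; rfl

theorem tr_star {X : Type*} {A : X → Type*} [∀ x, Star (A x)] {x y : X} (h : x = y) (a : A x) :
    tr h (star a) = star (tr h a) := by subst h; rfl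

theorem tr_zero {X : Type*} {A : X → Type*} [∀ x, Zero (A x)] {x y : X} (h : x = y) :
    tr h (0 : A x) = 0 := by subst h; rfl

theorem tr_smul {X : Type*} {A : X → Type*} [∀ x, SMul ℂ (A x)] {x y : X} (h : x = y) (c : ℂ)
    (a : A x) : tr h (c • a) = c • tr h a := by subst h; rfl

theorem tr_eq_zero {X : Type*} {A : X → Type*} [∀ x, Zero (A x)] {x y : X} (h : x = y) {a : A x} :
    tr h a = 0 ↔ a = 0 := by subst h; rfl

theorem tr_finsum {X : Type*} {A : X → Type*} [∀ x, AddCommMonoid (A x)] {ι : Type*} {x y : X}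
    (h : x = y) (f : ι → A x) : tr h (∑ᶠ i, f i) = ∑ᶠ i, tr h (f i) := by subst h; rfl

section RawActions

variable {G : Type*} {X : Type*} [TopologicalSpace G] [TopologicalSpace X]
  {𝒢 : EtaleGroupoid G X} {A : X → Type*}
  {act : ∀ {x y : X} (g : G), 𝒢.src g = x → 𝒢.rng g = y → A x → A y}

theorem raw_act_tr {x x' y : X} (g : G) (e : x = x') (hx : 𝒢.src g = x') (hy : 𝒢.rng g = y)
    (a : A x) : act g hx hy (tr e a) = act g (hx.trans e.symm) hy a := by
  subst e; rfl

theorem tr_raw_act {x y y' : X} (g : G) (e : y = y') (hx : 𝒢.src g = x) (hy : 𝒢.rng g = y)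
    (a : A x) : tr e (act g hx hy a) = act g hx (hy.trans e) a := by
  subst e; rfl

theorem raw_act_sec_congr {Z : Type*} {p : Z → X} (ξ : ∀ z, A (p z)) {g g' : G} {z z' : Z} {y : X}
    (hg : g = g') (hz : z = z') (hx : 𝒢.src g = p z) (hy : 𝒢.rng g = y) :
    act g hx hy (ξ z) =
      act g' (by rw [← hg, ← hz, hx]) (by rw [← hg, hy]) (ξ z') := by
  subst hg hz; rfl

variable [∀ x, NormedAddCommGroup (A x)] [∀ x, NormedSpace ℂ (A x)] [TopologicalSpace (Tot A)]

/-- A continuous action of a groupoid on a bundle by linear isometries. -/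
structure IsIsoAction (𝒢 : EtaleGroupoid G X)
    (act : ∀ {x y : X} (g : G), 𝒢.src g = x → 𝒢.rng g = y → A x → A y) : Prop where
  map_add : ∀ {x y : X} (g : G) (hx : 𝒢.src g = x) (hy : 𝒢.rng g = y) (a b : A x),
    act g hx hy (a + b) = act g hx hy a + act g hx hy b
  map_smul : ∀ {x y : X} (g : G) (hx : 𝒢.src g = x) (hy : 𝒢.rng g = y) (c : ℂ) (a : A x),
    act g hx hy (c • a) = c • act g hx hy a
  norm_map : ∀ {x y : X} (g : G) (hx : 𝒢.src g = x) (hy : 𝒢.rng g = y) (a : A x),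
    ‖act g hx hy a‖ = ‖a‖
  one : ∀ (x : X) (a : A x), act (𝒢.one x) (𝒢.src_one x) (𝒢.rng_one x) a = a
  mul : ∀ (g h : G) (hgh : 𝒢.src g = 𝒢.rng h) (a : A (𝒢.src h)),
    act (𝒢.mul g h) (𝒢.src_mul hgh) (𝒢.rng_mul hgh) a = act g hgh rfl (act h rfl rfl a)
  continuous : Continuous fun p : {p : G × Tot A // 𝒢.src p.1 = p.2.base} =>
    (⟨𝒢.rng p.1.1, act p.1.1 p.2 rfl p.1.2.val⟩ : Tot A)

namespace IsIsoAction

variable (ha : IsIsoAction 𝒢 act)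
include ha

theorem map_zero {x y : X} (g : G) (hx : 𝒢.src g = x) (hy : 𝒢.rng g = y) :
    act g hx hy (0 : A x) = 0 := by
  simpa using ha.map_smul g hx hy 0 0

theorem map_eq_zero {x y : X} (g : G) (hx : 𝒢.src g = x) (hy : 𝒢.rng g = y) {a : A x} :
    act g hx hy a = 0 ↔ a = 0 := by
  rw [← norm_eq_zero, ha.norm_map, norm_eq_zero]

theorem map_finsum {x y : X} (g : G) (hx : 𝒢.src g = x) (hy : 𝒢.rng g = y) {ι : Type*}
    (f : ι → A x) : act g hx hy (∑ᶠ i, f i) = ∑ᶠ i, act g hx hy (f i) :=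
  AddMonoidHom.map_finsum_of_injective (AddMonoidHom.mk' (act g hx hy) (ha.map_add g hx hy))
    ((injective_iff_map_eq_zero _).2 fun _ h => (ha.map_eq_zero g hx hy).1 h) f

theorem act_act {x y z : X} (g h : G) (hx : 𝒢.src h = x) (hy : 𝒢.rng h = y) (hy' : 𝒢.src g = y)
    (hz : 𝒢.rng g = z) (a : A x) :
    act g hy' hz (act h hx hy a) = act (𝒢.mul g h) ((𝒢.src_mul (hy'.trans hy.symm)).trans hx)
      ((𝒢.rng_mul (hy'.trans hy.symm)).trans hz) a := by
  subst hx hy hz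
  exact (ha.mul g h hy' a).symm

theorem act_one {x y z : X} (hx : 𝒢.src (𝒢.one z) = x) (hy : 𝒢.rng (𝒢.one z) = y) (a : A x) :
    act (𝒢.one z) hx hy a = tr (((𝒢.src_one z).symm.trans hx).symm.trans
      ((𝒢.rng_one z).symm.trans hy)) a := by
  obtain rfl : z = x := (𝒢.src_one z).symm.trans hx
  obtain rfl : z = y := (𝒢.rng_one z).symm.trans hy
  exact ha.one z a

/-- A transport between fibres is the action of a unit, so it can be absorbed into products of
arrows. -/
theorem tr_eq_act {x y : X} (e : x = y) (a : A x) :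
    tr e a = act (𝒢.one x) (𝒢.src_one x) ((𝒢.rng_one x).trans e) a := by
  subst e; exact (ha.one x a).symm

theorem tendsto {Z : Type*} {l : Filter Z} {g : Z → G} {g₀ : G} (hg : Tendsto g l (𝓝 g₀))
    {p q : Z → X} (hp : ∀ z, 𝒢.src (g z) = p z) (hq : ∀ z, 𝒢.rng (g z) = q z) {x y : X}
    (hx : 𝒢.src g₀ = x) (hy : 𝒢.rng g₀ = y) {a : ∀ z, A (p z)} {a₀ : A x}
    (h : Tendsto (fun z => (⟨p z, a z⟩ : Tot A)) l (𝓝 ⟨x, a₀⟩)) :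
    Tendsto (fun z => (⟨q z, act (g z) (hp z) (hq z) (a z)⟩ : Tot A)) l
      (𝓝 ⟨y, act g₀ hx hy a₀⟩) := by
  obtain rfl : q = fun z => 𝒢.rng (g z) := funext fun z => (hq z).symm
  subst hy
  have h1 := ha.continuous.tendsto ⟨(g₀, ⟨x, a₀⟩), hx⟩
  refine h1.comp (f := fun z => (⟨(g z, ⟨p z, a z⟩), hp z⟩ :
    {p : G × Tot A // 𝒢.src p.1 = p.2.base})) ?_
  rw [tendsto_subtype_rng]
  exact hg.prodMk_nhds h

theorem isContSec {Z : Type*} [TopologicalSpace Z] {g : Z → G} (hg : Continuous g)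
    {p q : Z → X} (hp : ∀ z, 𝒢.src (g z) = p z) (hq : ∀ z, 𝒢.rng (g z) = q z)
    {a : ∀ z, A (p z)} (h : IsContSec p a) :
    IsContSec q fun z => act (g z) (hp z) (hq z) (a z) :=
  continuous_iff_continuousAt.2 fun z =>
    ha.tendsto (hg.tendsto z) hp hq (hp z) (hq z) (Continuous.tendsto h z)

end IsIsoAction

end RawActions

section

variable {G : Type*} {X : Type*} [TopologicalSpace G] [TopologicalSpace X] {𝒢 : EtaleGroupoid G X}

theorem CStarAction.isIsoAction {A : X → Type*} [∀ x, NonUnitalCStarAlgebra (A x)]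
    [TopologicalSpace (Tot A)] (γ : CStarAction 𝒢 A) :
    IsIsoAction 𝒢 (A := A) fun g hx hy => γ.act g hx hy where
  map_add g hx hy := _root_.map_add (γ.act g hx hy)
  map_smul g hx hy := _root_.map_smul (γ.act g hx hy)
  norm_map g hx hy a := NonUnitalStarAlgHom.norm_map (γ.act g hx hy) (γ.act g hx hy).injective a
  one := γ.act_one
  mul := γ.act_mul
  continuous := γ.continuous_act

theorem HilbertAction.isIsoAction {C : X → Type*} [∀ x, NonUnitalCStarAlgebra (C x)]
    [TopologicalSpace (Tot C)] {γ : CStarAction 𝒢 C} {E : X → Type*}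
    [∀ x, NormedAddCommGroup (E x)] [∀ x, NormedSpace ℂ (E x)] [∀ x, CompleteSpace (E x)]
    [TopologicalSpace (Tot E)] [∀ x, HilbertModule (C x) (E x)] (ε : HilbertAction γ E) :
    IsIsoAction 𝒢 (A := E) fun g hx hy => ε.act g hx hy where
  map_add g hx hy := _root_.map_add (ε.act g hx hy)
  map_smul g hx hy := _root_.map_smul (ε.act g hx hy)
  norm_map g hx hy a := (ε.act g hx hy).norm_map a
  one := ε.act_one
  mul := ε.act_mul
  continuous := ε.continuous_act

end

/-! ### Étale maps and locally compact spaces -/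

/-- Charts provide one compact neighbourhood of each point, which is enough in a Hausdorff space. -/
theorem IsLocalHomeomorph.locallyCompactSpace {Z T : Type*} [TopologicalSpace Z]
    [TopologicalSpace T] [T2Space Z] [LocallyCompactSpace T] {p : Z → T}
    (hp : IsLocalHomeomorph p) : LocallyCompactSpace Z := by
  have : WeaklyLocallyCompactSpace Z := ⟨fun z => by
    obtain ⟨e, hz, -⟩ := hp z
    have h1 : LocallyCompactSpace e.target := e.open_target.locallyCompactSpace
    have h2 : LocallyCompactSpace e.source :=
      e.toHomeomorphSourceTarget.locallyCompactSpace_iff.2 h1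
    obtain ⟨K, hK, hzK⟩ := exists_compact_mem_nhds (⟨z, hz⟩ : e.source)
    refine ⟨Subtype.val '' K, hK.image continuous_subtype_val, ?_⟩
    have := image_mem_map (m := Subtype.val) hzK
    rwa [map_nhds_subtype_coe_eq_nhds hz (e.open_source.mem_nhds hz)] at this⟩
  infer_instance

/-- A continuous, open and locally injective map. -/
structure IsEtaleMap {Z T : Type*} [TopologicalSpace Z] [TopologicalSpace T] (p : Z → T) : Prop where
  continuous : Continuous p
  isOpenMap : IsOpenMap p
  exists_injOn : ∀ z, ∃ U ∈ 𝓝 z, U.InjOn p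

theorem IsLocalHomeomorph.isEtaleMap {Z T : Type*} [TopologicalSpace Z] [TopologicalSpace T]
    {p : Z → T} (hp : IsLocalHomeomorph p) : IsEtaleMap p where
  continuous := hp.continuous
  isOpenMap := hp.isOpenMap
  exists_injOn z := by
    obtain ⟨e, hz, rfl⟩ := hp z
    exact ⟨e.source, e.open_source.mem_nhds hz, e.injOn⟩

section FibreProducts

variable {P Q T : Type*} [TopologicalSpace P] [TopologicalSpace Q] [TopologicalSpace T]
  {a : P → T} {b : Q → T} {c : P × Q → Prop}

/-- Étale maps are stable under base change. The predicate `c` leaves open in which direction the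
equation of the fibre product is written, so that left and right actions are both covered. -/
theorem IsEtaleMap.fst (hc : ∀ q, c q ↔ a q.1 = b q.2) (ha : Continuous a) (hb : IsEtaleMap b) :
    IsEtaleMap fun q : {q : P × Q // c q} => q.1.1 where
  continuous := by fun_prop
  isOpenMap := by
    refine isOpenMap_iff_nhds_le.2 fun q S hS => ?_
    rw [mem_map, nhds_subtype_eq_comap, mem_comap] at hS
    obtain ⟨V, hV, hVS⟩ := hS
    obtain ⟨V1, hV1, V2, hV2, hVV⟩ := mem_nhds_prod_iff.1 hV
    have h1 : b '' V2 ∈ 𝓝 (a q.1.1) := by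
      rw [(hc _).1 q.2]; exact hb.isOpenMap.image_mem_nhds hV2
    filter_upwards [hV1, ha.continuousAt h1] with x hx ⟨y, hy, hxy⟩
    exact hVS (show (⟨(x, y), (hc _).2 hxy.symm⟩ : {q : P × Q // c q}) ∈ _ from hVV ⟨hx, hy⟩)
  exists_injOn q := by
    obtain ⟨U, hU, hUi⟩ := hb.exists_injOn q.1.2
    refine ⟨{q | q.1.2 ∈ U}, (by fun_prop : Continuous fun q : {q : P × Q // c q} =>
      q.1.2).continuousAt hU, fun x hx y hy (hxy : x.1.1 = y.1.1) => ?_⟩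
    refine Subtype.ext (Prod.ext hxy (hUi hx hy ?_))
    rw [← (hc _).1 x.2, ← (hc _).1 y.2, hxy]

theorem IsEtaleMap.snd (hc : ∀ q, c q ↔ a q.1 = b q.2) (ha : IsEtaleMap a) (hb : Continuous b) :
    IsEtaleMap fun q : {q : P × Q // c q} => q.1.2 where
  continuous := by fun_prop
  isOpenMap := by
    refine isOpenMap_iff_nhds_le.2 fun q S hS => ?_
    rw [mem_map, nhds_subtype_eq_comap, mem_comap] at hS
    obtain ⟨V, hV, hVS⟩ := hS
    obtain ⟨V1, hV1, V2, hV2, hVV⟩ := mem_nhds_prod_iff.1 hV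
    have h1 : a '' V1 ∈ 𝓝 (b q.1.2) := by
      rw [← (hc _).1 q.2]; exact ha.isOpenMap.image_mem_nhds hV1
    filter_upwards [hV2, hb.continuousAt h1] with y hy ⟨x, hx, hxy⟩
    exact hVS (show (⟨(x, y), (hc _).2 hxy⟩ : {q : P × Q // c q}) ∈ _ from hVV ⟨hx, hy⟩)
  exists_injOn q := by
    obtain ⟨U, hU, hUi⟩ := ha.exists_injOn q.1.1
    refine ⟨{q | q.1.1 ∈ U}, (by fun_prop : Continuous fun q : {q : P × Q // c q} =>
      q.1.1).continuousAt hU, fun x hx y hy (hxy : x.1.2 = y.1.2) => ?_⟩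
    refine Subtype.ext (Prod.ext (hUi hx hy ?_) hxy)
    rw [(hc _).1 x.2, (hc _).1 y.2, hxy]

theorem isClosed_fibreProduct [T2Space T] (hc : ∀ q, c q ↔ a q.1 = b q.2) (ha : Continuous a)
    (hb : Continuous b) : IsClosed {q : P × Q | c q} := by
  simp_rw [hc]
  exact isClosed_eq (ha.comp continuous_fst) (hb.comp continuous_snd)

theorem locallyCompactSpace_fibreProduct [T2Space T] [LocallyCompactSpace P]
    [LocallyCompactSpace Q] (hc : ∀ q, c q ↔ a q.1 = b q.2) (ha : Continuous a)
    (hb : Continuous b) : LocallyCompactSpace {q : P × Q // c q} :=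
  (isClosed_fibreProduct hc ha hb).locallyCompactSpace

end FibreProducts

/-- The part of the fibre in `K` is compact, and it is covered by neighbourhoods each containing at
most one of its points. -/
theorem IsEtaleMap.finite_fibre {Z T : Type*} [TopologicalSpace Z] [TopologicalSpace T] [T1Space T]
    {p : Z → T} (hp : IsEtaleMap p) {K : Set Z} (hK : IsCompact K) (w : T) :
    {z | z ∈ K ∧ p z = w}.Finite := by
  have h1 : IsCompact {z | z ∈ K ∧ p z = w} :=
    hK.inter_right (isClosed_singleton.preimage hp.continuous)
  obtain ⟨t, -, ht⟩ := h1.elim_nhds_subcover (fun z => (hp.exists_injOn z).choose)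
    fun z _ => (hp.exists_injOn z).choose_spec.1
  refine Set.Finite.subset (t.finite_toSet.biUnion (t := fun i =>
    (hp.exists_injOn i).choose ∩ {z | z ∈ K ∧ p z = w}) fun i _ => ?_) fun z hz => ?_
  · exact Set.Subsingleton.finite fun x hx y hy =>
      (hp.exists_injOn i).choose_spec.2 hx.1 hy.1 (hx.2.2.trans hy.2.2.symm)
  · obtain ⟨i, hi, hzi⟩ := Set.mem_iUnion₂.1 (ht hz)
    exact Set.mem_iUnion₂.2 ⟨i, hi, hzi, hz⟩

theorem exists_partition {Z : Type*} [TopologicalSpace Z] [T2Space Z] [LocallyCompactSpace Z]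
    {K : Set Z} (hK : IsCompact K) (U : Z → Set Z) (hU : ∀ z ∈ K, U z ∈ 𝓝 z) :
    ∃ (n : ℕ) (t : Fin n → Z) (χ : Fin n → C(Z, ℝ)), (∀ i, t i ∈ K) ∧
      (∀ i, tsupport (χ i) ⊆ U (t i)) ∧ (∀ z ∈ K, ∑ i, χ i z = 1) ∧
      (∀ i z, 0 ≤ χ i z) ∧ (∀ i z, χ i z ≤ 1) ∧ ∀ i, HasCompactSupport (χ i) := by
  obtain ⟨t, ht, hKt⟩ := hK.elim_nhds_subcover (fun z => interior (U z))
    fun z hz => interior_mem_nhds.2 (hU z hz)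
  obtain ⟨f, h1, h2, h3, h4⟩ := exists_continuous_sum_one_of_isOpen_isCompact (n := t.card)
    (s := fun i => interior (U (t.equivFin.symm i))) (fun i => isOpen_interior) hK (by
      refine hKt.trans (Set.iUnion₂_subset fun z hz => ?_)
      refine Set.subset_iUnion_of_subset (t.equivFin ⟨z, hz⟩) ?_
      simp)
  refine ⟨t.card, fun i => t.equivFin.symm i, f, fun i => ht _ (t.equivFin.symm i).2,
    fun i => (h1 i).trans interior_subset, fun z hz => ?_, fun i z => (h3 i z).1,
    fun i z => (h3 i z).2, h4⟩
  simpa using h2 hz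

/-! ### Compactly supported sections -/

section Cc

variable {X : Type*} [TopologicalSpace X] {A : X → Type*} [∀ x, NormedAddCommGroup (A x)]
  [∀ x, NormedSpace ℂ (A x)] [TopologicalSpace (Tot A)]
  {Z : Type*} [TopologicalSpace Z] {p : Z → X}

theorem IsCc.of_eq_zero [R1Space Z] {a : ∀ z, A (p z)} (ha : IsContSec p a) {K : Set Z}
    (hK : IsCompact K) (h : ∀ z ∉ K, a z = 0) : IsCc p a :=
  ⟨ha, hK.closure_of_subset fun z hz => by_contra fun hzK => hz (h z hzK)⟩

theorem IsCc.eq_zero {a : ∀ z, A (p z)} {z : Z} (hz : z ∉ closure {z | a z ≠ 0}) : a z = 0 :=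
  by_contra fun h => hz (subset_closure h)

variable [ApproxBundle A]

theorem IsCc.zero (hp : Continuous p) : IsCc p fun z => (0 : A (p z)) :=
  ⟨IsContSec.zero hp, by simp⟩

theorem IsCc.continuous_base {a : ∀ z, A (p z)} (ha : IsCc p a) : Continuous p :=
  ha.1.continuous_base

theorem IsCc.add {a b : ∀ z, A (p z)} (ha : IsCc p a) (hb : IsCc p b) :
    IsCc p fun z => a z + b z := by
  refine ⟨ha.1.add hb.1, (ha.2.union hb.2).of_isClosed_subset isClosed_closure ?_⟩
  rw [← closure_union]
  refine closure_mono fun z (hz : a z + b z ≠ 0) => ?_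
  by_contra h
  simp only [Set.mem_union, Set.mem_ofPred_eq, not_or, not_not] at h
  exact hz (by rw [h.1, h.2, add_zero])

theorem closure_support_smul_subset (f : Z → ℂ) (a : ∀ z, A (p z)) :
    closure {z | f z • a z ≠ 0} ⊆ closure {z | a z ≠ 0} :=
  closure_mono fun z (hz : f z • a z ≠ 0) => (smul_ne_zero_iff.1 hz).2

theorem closure_support_smul_subset' (f : Z → ℝ) (a : ∀ z, A (p z)) :
    closure {z | (f z : ℂ) • a z ≠ 0} ⊆ tsupport f :=
  closure_mono fun z (hz : (f z : ℂ) • a z ≠ 0) => by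
    simpa using (smul_ne_zero_iff.1 hz).1

theorem IsCc.smul {a : ∀ z, A (p z)} (ha : IsCc p a) {f : Z → ℂ} (hf : Continuous f) :
    IsCc p fun z => f z • a z :=
  ⟨ha.1.smul hf, ha.2.of_isClosed_subset isClosed_closure (closure_support_smul_subset f a)⟩

theorem IsCc.const_smul {a : ∀ z, A (p z)} (ha : IsCc p a) (c : ℂ) :
    IsCc p fun z => c • a z :=
  ha.smul continuous_const

theorem IsCc.neg {a : ∀ z, A (p z)} (ha : IsCc p a) : IsCc p fun z => - a z := by
  simpa using ha.const_smul (-1)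

theorem IsCc.sub {a b : ∀ z, A (p z)} (ha : IsCc p a) (hb : IsCc p b) :
    IsCc p fun z => a z - b z := by
  simpa [sub_eq_add_neg] using ha.add hb.neg

theorem IsContSec.isCc_smul {a : ∀ z, A (p z)} (ha : IsContSec p a) {f : Z → ℝ}
    (hf : Continuous f) (hfc : HasCompactSupport f) : IsCc p fun z => (f z : ℂ) • a z :=
  ⟨ha.smul (by fun_prop), IsCompact.of_isClosed_subset hfc isClosed_closure
    (closure_support_smul_subset' f a)⟩

theorem IsCc.sum {ι : Type*} (s : Finset ι) (hp : Continuous p) {a : ι → ∀ z, A (p z)}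
    (ha : ∀ i ∈ s, IsCc p (a i)) : IsCc p fun z => ∑ i ∈ s, a i z := by
  classical
  induction s using Finset.induction_on with
  | empty => simpa using IsCc.zero (A := A) hp
  | insert i s hi ih =>
    simp only [Finset.sum_insert hi]
    exact (ha i (Finset.mem_insert_self _ _)).add
      (ih fun j hj => ha j (Finset.mem_insert_of_mem hj))

/-- The norm is only upper semicontinuous, but this is the half that makes the sets `‖a z‖ < n`
open. -/
theorem IsContSec.exists_bound {a : ∀ z, A (p z)} (ha : IsContSec p a) {K : Set Z}
    (hK : IsCompact K) : ∃ r : ℝ, 0 < r ∧ ∀ z ∈ K, ‖a z‖ < r := by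
  obtain ⟨n, hn⟩ := hK.elim_directed_cover (fun n : ℕ => {z | ‖a z‖ < n})
    (fun n => ha.isOpen_norm_lt n)
    (fun z _ => Set.mem_iUnion.2 (exists_nat_gt ‖a z‖))
    (Monotone.directed_le fun m n h z (hz : ‖a z‖ < m) => hz.trans_le (by exact_mod_cast h))
  exact ⟨n + 1, by positivity, fun z hz => (hn hz).trans (lt_add_one _)⟩

theorem IsCc.exists_bound {a : ∀ z, A (p z)} (ha : IsCc p a) :
    ∃ r : ℝ, 0 < r ∧ ∀ z, ‖a z‖ ≤ r := by
  obtain ⟨r, hr, h⟩ := ha.1.exists_bound ha.2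
  refine ⟨r, hr, fun z => ?_⟩
  by_cases hz : z ∈ closure {z | a z ≠ 0}
  · exact (h z hz).le
  · rw [IsCc.eq_zero hz, norm_zero]; exact hr.le

/-- To prove an additive property of compactly supported sections, it suffices to consider
sections with small supports. -/
theorem IsCc.induction [T2Space Z] [LocallyCompactSpace Z] (U : Z → Set Z) (hU : ∀ z, U z ∈ 𝓝 z)
    {P : (∀ z, A (p z)) → Prop} (h0 : P fun _ => 0)
    (hadd : ∀ a b, IsCc p a → IsCc p b → P a → P b → P fun z => a z + b z)
    (hsmall : ∀ a z₀, IsCc p a → closure {z | a z ≠ 0} ⊆ U z₀ → P a)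
    {a : ∀ z, A (p z)} (ha : IsCc p a) : P a := by
  classical
  obtain ⟨n, t, χ, -, h2, h3, -, -, h6⟩ := exists_partition ha.2 U fun z _ => hU z
  have key : ∀ s : Finset (Fin n), P fun z => ∑ i ∈ s, (χ i z : ℂ) • a z := by
    intro s
    induction s using Finset.induction_on with
    | empty => simpa using h0
    | insert i s hi ih =>
      simp only [Finset.sum_insert hi]
      refine hadd _ _ (ha.smul (by fun_prop))
        (IsCc.sum s ha.continuous_base fun i _ => ha.smul (by fun_prop)) ?_ ih
      exact hsmall _ (t i) (ha.smul (by fun_prop))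
        ((closure_support_smul_subset' (χ i) a).trans (h2 i))
  convert key Finset.univ using 1
  funext z
  rw [← Finset.sum_smul]
  by_cases hz : z ∈ closure {z | a z ≠ 0}
  · rw [← Complex.ofReal_sum, h3 z hz, Complex.ofReal_one, one_smul]
  · rw [IsCc.eq_zero hz, smul_zero]

end Cc

/-! ### Summation along the fibres of an étale map -/

section Push

variable {X : Type*} [TopologicalSpace X] {A : X → Type*} [∀ x, NormedAddCommGroup (A x)]
  [∀ x, NormedSpace ℂ (A x)] [TopologicalSpace (Tot A)]
  {Z T : Type*} [TopologicalSpace Z] [TopologicalSpace T] {p : Z → T} {t : T → X}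

/-- Summation of a section along the fibres of `p`. -/
def pushSec (p : Z → T) (t : T → X) (a : ∀ z, A (t (p z))) (w : T) : A (t w) :=
  ∑ᶠ z : {z // p z = w}, tr (congrArg t z.2) (a z.1)

theorem finite_support_pushSec [T1Space T] (hp : IsEtaleMap p) {a : ∀ z, A (t (p z))}
    (ha : IsCc (fun z => t (p z)) a) (w : T) :
    (Function.support fun z : {z // p z = w} => tr (congrArg t z.2) (a z.1)).Finite := by
  refine Set.Finite.of_finite_image (f := Subtype.val) ((hp.finite_fibre ha.2 w).subset ?_)
    Subtype.val_injective.injOn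
  rintro _ ⟨z, hz, rfl⟩
  exact ⟨by_contra fun h => hz (by
    dsimp only; rw [IsCc.eq_zero h, tr_zero]), z.2⟩

variable [ApproxBundle A]

/-- By a partition of unity, `a` may be supposed to be supported in an open set on which `p` is
injective. Over the image of this set the sum is `a` read through the local inverse of `p`, which is
continuous since `p` is open; off the compact, hence closed, image of the support it is zero. -/
theorem isCc_pushSec [T2Space T] [T2Space Z] [LocallyCompactSpace Z] (hp : IsEtaleMap p)
    (ht : Continuous t) {a : ∀ z, A (t (p z))} (ha : IsCc (fun z => t (p z)) a) :
    IsCc t (pushSec p t a) := by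
  have hpt : Continuous fun z => t (p z) := ht.comp hp.continuous
  choose U hU hUi using hp.exists_injOn
  refine IsCc.induction (P := fun a => IsCc t (pushSec p t a)) (fun z => interior (U z))
    (fun z => interior_mem_nhds.2 (hU z)) ?_ ?_ ?_ ha
  · convert IsCc.zero (A := A) ht using 1
    funext w
    simp only [pushSec, tr_zero, finsum_zero]
  · intro a b ha hb h1 h2
    convert h1.add h2 using 1
    funext w
    simp only [pushSec, tr_add]
    exact finsum_add_distrib (finite_support_pushSec hp ha w) (finite_support_pushSec hp hb w)
  · intro a z₀ ha hsub
    have hinj : (interior (U z₀)).InjOn p := (hUi z₀).mono interior_subset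
    have hval : ∀ z ∈ interior (U z₀), pushSec p t a (p z) = a z := by
      intro z hz
      refine (finsum_eq_single _ ⟨z, rfl⟩ fun z' hz' => ?_).trans rfl
      have : a z'.1 = 0 := IsCc.eq_zero fun h =>
        hz' (Subtype.ext (hinj (hsub h) hz z'.2))
      rw [this, tr_zero]
    have hK := ha.2.image hp.continuous
    have hzero : ∀ w ∉ p '' closure {z | a z ≠ 0}, pushSec p t a w = 0 := by
      intro w hw
      refine (finsum_congr fun z => ?_).trans finsum_zero
      rw [IsCc.eq_zero fun h => hw ⟨z.1, h, z.2⟩, tr_zero]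
    refine IsCc.of_eq_zero (isContSec_iff.2 fun w => ?_) hK hzero
    by_cases hw : w ∈ p '' interior (U z₀)
    · obtain ⟨z, hz, rfl⟩ := hw
      have h1 := isContSec_iff.1 ha.1 z
      rw [hval z hz]
      refine Tendsto.mono_left ?_ (hp.isOpenMap.nhds_le z)
      rw [tendsto_map'_iff]
      refine h1.congr' ?_
      filter_upwards [isOpen_interior.mem_nhds hz] with y hy
      rw [Function.comp_apply, hval y hy]
    · have hw' : w ∉ p '' closure {z | a z ≠ 0} := fun h => hw (Set.image_mono hsub h)
      rw [hzero w hw']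
      refine (isContSec_iff.1 (IsContSec.zero (A := A) ht) w).congr' ?_
      filter_upwards [hK.isClosed.isOpen_compl.mem_nhds hw'] with y hy
      rw [hzero y hy]

end Push

attribute [local instance] CStarAlgebra.spectralOrder CStarAlgebra.spectralOrderedRing

/-! ### Pre-Hilbert modules -/

/-- A positive semidefinite `Q`-valued sesquilinear form on `V` that is compatible with an action on
`V` of a dense set of elements of `Q`. -/
structure PreHilbert (Q V : Type*) [NonUnitalCStarAlgebra Q] [AddCommGroup V] [Module ℂ V] where
  ip : V → V → Q
  ip_add : ∀ u v w, ip u (v + w) = ip u v + ip u w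
  ip_smul : ∀ (c : ℂ) u v, ip u (c • v) = c • ip u v
  star_ip : ∀ u v, star (ip u v) = ip v u
  ip_self_nonneg : ∀ u, 0 ≤ ip u u
  dense_ract : Dense {q : Q | ∀ v, ∃ v', ∀ u, ip u v' = ip u v * q}

namespace PreHilbert

variable {Q V : Type*} [NonUnitalCStarAlgebra Q] [AddCommGroup V] [Module ℂ V]
  (P : PreHilbert Q V)

/-- The form as a linear map in its second variable. -/
def ipₗ (u : V) : V →ₗ[ℂ] Q where
  toFun := P.ip u
  map_add' := P.ip_add u
  map_smul' c := P.ip_smul c u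

theorem ip_sub (u v w : V) : P.ip u (v - w) = P.ip u v - P.ip u w := map_sub (P.ipₗ u) v w
theorem ip_zero (u : V) : P.ip u 0 = 0 := map_zero (P.ipₗ u)

theorem add_ip (u v w : V) : P.ip (u + v) w = P.ip u w + P.ip v w := by
  rw [← P.star_ip, P.ip_add, star_add, P.star_ip, P.star_ip]
theorem sub_ip (u v w : V) : P.ip (u - v) w = P.ip u w - P.ip v w := by
  rw [← P.star_ip, P.ip_sub, star_sub, P.star_ip, P.star_ip]
theorem zero_ip (u : V) : P.ip 0 u = 0 := by rw [← P.star_ip, P.ip_zero, star_zero]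
theorem smul_ip (c : ℂ) (u v : V) : P.ip (c • u) v = (starRingEnd ℂ c) • P.ip u v := by
  rw [← P.star_ip, P.ip_smul, star_smul, P.star_ip]; rfl

theorem ip_sum {ι : Type*} (s : Finset ι) (u : V) (f : ι → V) :
    P.ip u (∑ i ∈ s, f i) = ∑ i ∈ s, P.ip u (f i) := map_sum (P.ipₗ u) f s

theorem isSelfAdjoint_ip (u : V) : IsSelfAdjoint (P.ip u u) := P.star_ip u u

/-- This is `⟨v q - w, v q - w⟩`. The expression makes sense for all `q`, while `v q` is only
available for a dense set of them; the positive cone being closed, positivity passes to the limit.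
-/
theorem conj_nonneg (v w : V) (q : Q) :
    0 ≤ star q * P.ip v v * q - star q * P.ip v w - star (P.ip v w) * q + P.ip w w := by
  have hc : IsClosed {q : Q | 0 ≤
      star q * P.ip v v * q - star q * P.ip v w - star (P.ip v w) * q + P.ip w w} :=
    isClosed_le continuous_const (by fun_prop)
  refine hc.closure_subset_iff.2 ?_ (P.dense_ract q)
  intro q hq
  obtain ⟨v', hv'⟩ := hq v
  have h1 : ∀ u, P.ip v' u = star q * P.ip v u := fun u => by
    rw [← P.star_ip, hv', star_mul, P.star_ip]
  have := P.ip_self_nonneg (v' - w)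
  rw [P.ip_sub, P.sub_ip, P.sub_ip, hv', h1, h1, hv', ← P.star_ip v w] at this
  rw [Set.mem_ofPred_eq]
  convert this using 1
  abel

/-- Cauchy–Schwarz: take `q = t⟨v, w⟩` in `conj_nonneg` and bound `⟨v, v⟩` by its norm. The best
choice is `t = ‖⟨v, v⟩‖⁻¹`; if this norm is zero, letting `t` grow forces `⟨v, w⟩ = 0`. -/
theorem star_ip_mul_ip_le (v w : V) :
    star (P.ip v w) * P.ip v w ≤ ‖P.ip v v‖ • P.ip w w := by
  have key : ∀ t : ℝ, 0 ≤ t → (2 * t - t ^ 2 * ‖P.ip v v‖) • (star (P.ip v w) * P.ip v w) ≤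
      P.ip w w := by
    intro t ht
    have h1 := P.conj_nonneg v w (t • P.ip v w)
    have h2 : star (P.ip v w) * P.ip v v * P.ip v w ≤
        ‖P.ip v v‖ • (star (P.ip v w) * P.ip v w) :=
      CStarAlgebra.star_left_conjugate_le_norm_smul (hb := P.isSelfAdjoint_ip v)
    have h3 := smul_le_smul_of_nonneg_left h2 (sq_nonneg t)
    rw [← sub_nonneg] at h3 ⊢
    convert add_nonneg h1 h3 using 1
    simp only [star_smul, star_trivial, smul_mul_assoc, mul_smul_comm, smul_smul, sub_smul]
    module
  rcases eq_or_ne ‖P.ip v v‖ 0 with h0 | h0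
  · rw [h0, zero_smul]
    have h1 : ∀ t : ℝ, 0 ≤ t → 2 * t * ‖P.ip v w‖ ^ 2 ≤ ‖P.ip w w‖ := by
      intro t ht
      have := key t ht
      rw [h0, mul_zero, sub_zero] at this
      have := CStarAlgebra.norm_le_norm_of_nonneg_of_le
        (smul_nonneg (by positivity) (star_mul_self_nonneg _)) this
      rwa [norm_smul, CStarRing.norm_star_mul_self, Real.norm_of_nonneg (by positivity),
        ← sq] at this
    have h2 : ‖P.ip v w‖ ^ 2 = 0 := by
      by_contra h
      have hp : 0 < ‖P.ip v w‖ ^ 2 := lt_of_le_of_ne (sq_nonneg _) (Ne.symm h)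
      have := h1 (‖P.ip w w‖ / ‖P.ip v w‖ ^ 2 + 1) (by positivity)
      rw [mul_assoc, add_mul, div_mul_cancel₀ _ h] at this
      nlinarith [norm_nonneg (P.ip w w)]
    have h3 : P.ip v w = 0 := by simpa using h2
    rw [h3, mul_zero]
  · have hp : 0 < ‖P.ip v v‖ := lt_of_le_of_ne (norm_nonneg _) (Ne.symm h0)
    have := smul_le_smul_of_nonneg_left (key ‖P.ip v v‖⁻¹ (by positivity)) hp.le
    rw [smul_smul] at this
    convert this using 1
    rw [show ‖P.ip v v‖ * (2 * ‖P.ip v v‖⁻¹ - ‖P.ip v v‖⁻¹ ^ 2 * ‖P.ip v v‖) = 1 by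
      field_simp; ring, one_smul]

theorem norm_ip_sq_le (v w : V) : ‖P.ip v w‖ ^ 2 ≤ ‖P.ip v v‖ * ‖P.ip w w‖ := by
  have := CStarAlgebra.norm_le_norm_of_nonneg_of_le (star_mul_self_nonneg _)
    (P.star_ip_mul_ip_le v w)
  rwa [CStarRing.norm_star_mul_self, norm_smul, norm_norm, ← sq] at this

/-- The seminorm of a pre-Hilbert module. -/
def nrm (v : V) : ℝ := Real.sqrt ‖P.ip v v‖

theorem nrm_sq (v : V) : P.nrm v ^ 2 = ‖P.ip v v‖ := Real.sq_sqrt (norm_nonneg _)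
theorem nrm_nonneg (v : V) : 0 ≤ P.nrm v := Real.sqrt_nonneg _

theorem norm_ip_le (v w : V) : ‖P.ip v w‖ ≤ P.nrm v * P.nrm w := by
  refine le_of_sq_le_sq ?_ (mul_nonneg (P.nrm_nonneg v) (P.nrm_nonneg w))
  rw [mul_pow, P.nrm_sq, P.nrm_sq]
  exact P.norm_ip_sq_le v w

theorem nrm_add_le (v w : V) : P.nrm (v + w) ≤ P.nrm v + P.nrm w := by
  refine le_of_sq_le_sq ?_ (add_nonneg (P.nrm_nonneg v) (P.nrm_nonneg w))
  rw [P.nrm_sq, P.ip_add, P.add_ip, P.add_ip, add_sq, P.nrm_sq, P.nrm_sq]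
  have h1 := norm_add_le (P.ip v v + P.ip w v) (P.ip v w + P.ip w w)
  have h2 := norm_add_le (P.ip v v) (P.ip w v)
  have h3 := norm_add_le (P.ip v w) (P.ip w w)
  have h4 := P.norm_ip_le v w
  have h5 := P.norm_ip_le w v
  linarith

theorem nrm_smul (c : ℂ) (v : V) : P.nrm (c • v) = ‖c‖ * P.nrm v := by
  rw [nrm, P.ip_smul, P.smul_ip, norm_smul, norm_smul, RCLike.norm_conj, ← mul_assoc, ← sq,
    Real.sqrt_mul (by positivity), Real.sqrt_sq (norm_nonneg _), nrm]

/-- `V` as a seminormed group. -/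
abbrev seminormed : SeminormedAddCommGroup V :=
  letI : Norm V := ⟨P.nrm⟩
  SeminormedAddCommGroup.ofCore (𝕜 := ℂ)
    { norm_nonneg := P.nrm_nonneg
      norm_smul := P.nrm_smul
      norm_triangle := P.nrm_add_le }

/-- The completion of a pre-Hilbert module, as a Banach space. -/
theorem exists_banach_completion {Q : Type*} {V : Type uE} [NonUnitalCStarAlgebra Q]
    [AddCommGroup V] [Module ℂ V] (P : PreHilbert Q V) :
    ∃ (M : Type uE) (_ : NormedAddCommGroup M) (_ : NormedSpace ℂ M) (_ : CompleteSpace M)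
      (j : V →ₗ[ℂ] M), DenseRange j ∧ ∀ v, ‖j v‖ = P.nrm v := by
  let _ := P.seminormed
  let _ : NormedSpace ℂ V := ⟨fun c v => (P.nrm_smul c v).le⟩
  refine ⟨UniformSpace.Completion V, inferInstance, inferInstance, inferInstance,
    UniformSpace.Completion.toComplₗᵢ.toLinearMap, UniformSpace.Completion.denseRange_coe, ?_⟩
  intro v
  exact UniformSpace.Completion.norm_coe v

section Complete

variable {M : Type*} [NormedAddCommGroup M] [NormedSpace ℂ M] [CompleteSpace M] {j : V →ₗ[ℂ] M}
  (hj : DenseRange j) (hn : ∀ v, ‖j v‖ = P.nrm v)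

/-- The extension of the form to the completion in its second variable. -/
def ipExt₁ (j : V →ₗ[ℂ] M) (v : V) : M →L[ℂ] Q := (P.ipₗ v).extendOfNorm j

include hj hn

theorem ipExt₁_apply (v w : V) : P.ipExt₁ j v (j w) = P.ip v w :=
  LinearMap.extendOfNorm_eq hj ⟨P.nrm v, fun w => by rw [hn]; exact P.norm_ip_le v w⟩ w

theorem norm_ipExt₁_le (v : V) : ‖P.ipExt₁ j v‖ ≤ P.nrm v :=
  LinearMap.opNorm_extendOfNorm_le hj (P.nrm_nonneg v) fun w => by
    rw [hn]; exact P.norm_ip_le v w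

theorem exists_ipExt : ∃ L : M →L⋆[ℂ] M →L[ℂ] Q, (∀ v w, L (j v) (j w) = P.ip v w) ∧
    ∀ m n, ‖L m n‖ ≤ ‖m‖ * ‖n‖ := by
  let f : V →ₛₗ[starRingEnd ℂ] (M →L[ℂ] Q) :=
    { toFun := P.ipExt₁ j
      map_add' := fun u v => ContinuousLinearMap.ext fun m => by
        refine hj.induction_on (p := fun m => P.ipExt₁ j (u + v) m =
          (P.ipExt₁ j u + P.ipExt₁ j v) m) m (isClosed_eq (by fun_prop) (by fun_prop)) fun w => ?_
        simp [P.ipExt₁_apply hj hn, P.add_ip]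
      map_smul' := fun c v => ContinuousLinearMap.ext fun m => by
        refine hj.induction_on (p := fun m => P.ipExt₁ j (c • v) m =
          (starRingEnd ℂ c • P.ipExt₁ j v) m) m (isClosed_eq (by fun_prop) (by fun_prop))
          fun w => ?_
        simp [P.ipExt₁_apply hj hn, P.smul_ip] }
  have hf : ∀ v, ‖f v‖ ≤ 1 * ‖j v‖ := fun v => by
    rw [one_mul, hn]; exact P.norm_ipExt₁_le hj hn v
  refine ⟨f.extendOfNorm j, fun v w => ?_, fun m n => ?_⟩
  · rw [LinearMap.extendOfNorm_eq hj ⟨1, hf⟩]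
    exact P.ipExt₁_apply hj hn v w
  · refine (ContinuousLinearMap.le_opNorm₂ _ _ _).trans ?_
    have := LinearMap.opNorm_extendOfNorm_le hj zero_le_one hf
    gcongr
    exact mul_le_of_le_one_left (norm_nonneg _) this

/-- The completion of a pre-Hilbert module is a Hilbert module. -/
theorem exists_hilbertModule : ∃ _ : HilbertModule Q M, ∀ v w, (HilbertModule.ip (j v) (j w) : Q) = P.ip v w := by
  obtain ⟨L, hL, hLn⟩ := P.exists_ipExt hj hn
  have hstar : ∀ m n, star (L m n) = L n m := fun m n =>
    hj.induction_on₂ (p := fun m n => star (L m n) = L n m)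
      (isClosed_eq (by fun_prop) (by fun_prop)) (fun v w => by rw [hL, hL, P.star_ip]) m n
  have hpos : ∀ m, 0 ≤ L m m := fun m =>
    hj.induction_on (p := fun m => 0 ≤ L m m) m
      (isClosed_le continuous_const (by fun_prop)) fun v => by
        rw [hL]; exact P.ip_self_nonneg v
  have hnorm : ∀ m, ‖m‖ ^ 2 = ‖L m m‖ := fun m =>
    hj.induction_on (p := fun m => ‖m‖ ^ 2 = ‖L m m‖) m
      (isClosed_eq (by fun_prop) (by fun_prop)) fun v => by rw [hL, hn, P.nrm_sq]
  -- The map `m ↦ ⟨·, m⟩` is isometric, so its range is closed. The right action is read off from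
  -- it: `n ↦ ⟨n, m⟩ q` lies in the range for dense sets of `m` and `q`, hence always.
  have hiso : ∀ m, ‖L.flip m‖ = ‖m‖ := by
    intro m
    refine le_antisymm (ContinuousLinearMap.opNorm_le_bound _ (norm_nonneg _) fun n => ?_) ?_
    · rw [L.flip_apply, mul_comm]; exact hLn n m
    · rcases eq_or_ne ‖m‖ 0 with h0 | h0
      · rw [h0]; exact norm_nonneg _
      · have := (L.flip m).le_opNorm m
        rw [L.flip_apply, ← hnorm, sq] at this
        exact le_of_mul_le_mul_right this (lt_of_le_of_ne (norm_nonneg _) (Ne.symm h0))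
  have hcl : IsClosed (Set.range L.flip) :=
    (AddMonoidHomClass.isometry_of_norm L.flip hiso).isClosedEmbedding.isClosed_range
  have hract : ∀ (m : M) (q : Q), ∃ m', ∀ n, L n m' = L n m * q := by
    intro m q
    let R : Q →L[ℂ] Q →L[ℂ] Q := (ContinuousLinearMap.mul ℂ Q).flip
    have hc : IsClosed ((fun x : M × Q => (R x.2).comp (L.flip x.1)) ⁻¹' Set.range L.flip) :=
      hcl.preimage <| (ContinuousLinearMap.compSL M Q Q (starRingEnd ℂ) (RingHom.id ℂ)).continuous₂.comp
        ((R.continuous.comp continuous_snd).prodMk (L.flip.continuous.comp continuous_fst))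
    have hd : Dense (Set.range j ×ˢ {q : Q | ∀ v, ∃ v', ∀ u, P.ip u v' = P.ip u v * q}) :=
      Dense.prod hj P.dense_ract
    have hmem : ((m, q) : M × Q) ∈
        (fun x : M × Q => (R x.2).comp (L.flip x.1)) ⁻¹' Set.range L.flip := by
      refine hc.closure_subset_iff.2 ?_ (hd (m, q))
      rintro ⟨_, q⟩ ⟨⟨v, rfl⟩, hq⟩
      obtain ⟨v', hv'⟩ := hq v
      refine ⟨j v', ContinuousLinearMap.ext fun n => ?_⟩
      refine hj.induction_on (p := fun n => L.flip (j v') n = (R q).comp (L.flip (j v)) n) n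
        (isClosed_eq (by fun_prop) (by fun_prop)) fun u => ?_
      simp [R, hL, hv']
    obtain ⟨m', hm'⟩ := hmem
    exact ⟨m', fun n => by simpa [R] using congrArg (fun T => T n) hm'⟩
  choose r hr using hract
  refine ⟨
    { ip := fun m n => L m n
      ract := r
      ip_add := fun m n k => map_add (L m) n k
      ip_smul := fun c m n => map_smul (L m) c n
      ip_ract := fun m n q => hr n q m
      star_ip := hstar
      ip_self_nonneg := fun m => CStarAlgebra.nonneg_iff_eq_star_mul_self.1 (hpos m)
      norm_sq := hnorm }, hL⟩

end Complete

/-- A C⋆-algebra acting by adjointable operators on a pre-Hilbert module acts by contractions. -/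
theorem ip_map_le {A : Type*} [NonUnitalCStarAlgebra A] (ρ : A →ₗ[ℂ] V →ₗ[ℂ] V)
    (hmul : ∀ a b v, ρ (a * b) v = ρ a (ρ b v))
    (hstar : ∀ a v w, P.ip (ρ a v) w = P.ip v (ρ (star a) w)) (a : A) (v : V) :
    P.ip (ρ a v) (ρ a v) ≤ (‖a‖ ^ 2) • P.ip v v := by
  set r := ‖a‖ with hr
  set h := star a * a with hh
  have hsa : IsSelfAdjoint h := IsSelfAdjoint.star_mul_self a
  have hspec : ∀ t ∈ quasispectrum ℝ h, t ≤ r ^ 2 := by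
    intro t ht
    have := (Real.le_norm_self t).trans (NonUnitalIsometricContinuousFunctionalCalculus.norm_quasispectrum_le h ht hsa)
    rwa [hh, CStarRing.norm_star_mul_self, ← sq] at this
  -- For `d = f(a⋆a)` one has formally `(r - d)² = r² - a⋆a`, so `r²⟨v, v⟩ - ⟨av, av⟩` is the inner
  -- product of `(r - d)v` with itself. As `f 0 = 0`, `d` lies in the algebra, and no unit of it is
  -- needed.
  set f : ℝ → ℝ := fun t => r - Real.sqrt (r ^ 2 - t) with hf
  have hf0 : f 0 = 0 := by simp [hf, Real.sqrt_sq (norm_nonneg a), hr]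
  have hfc : Continuous f := by fun_prop
  set d := cfcₙ f h with hd
  have hdsa : IsSelfAdjoint d := cfcₙ_predicate f h
  have hdd : d * d = ((2 * r : ℝ) : ℂ) • d - h := by
    have e1 : d * d = cfcₙ (fun t => f t * f t) h :=
      (cfcₙ_mul f f h hfc.continuousOn hf0 hfc.continuousOn hf0).symm
    have e2 : cfcₙ (fun t => 2 * r * f t - t) h = (2 * r) • d - h := by
      rw [cfcₙ_sub (fun t => 2 * r * f t) (fun t => t) h (by fun_prop) (by simp [hf0])
        (by fun_prop) rfl, cfcₙ_id' ℝ h hsa, cfcₙ_const_mul (2 * r) f h (by fun_prop) hf0]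
    rw [Complex.coe_smul, e1, ← e2]
    refine cfcₙ_congr fun t ht => ?_
    have := Real.mul_self_sqrt (sub_nonneg.2 (hspec t ht))
    simp only [hf]
    linear_combination this
  have hu := P.ip_self_nonneg ((r : ℂ) • v - ρ d v)
  have e1 : P.ip (ρ d v) v = P.ip v (ρ d v) := by rw [hstar, hdsa.star_eq]
  have e2 : P.ip (ρ d v) (ρ d v) = ((2 * r : ℝ) : ℂ) • P.ip v (ρ d v) - P.ip (ρ a v) (ρ a v) := by
    rw [hstar, hdsa.star_eq, ← hmul, hdd, hstar a, ← hmul, ← hh, map_sub, map_smul,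
      LinearMap.sub_apply, LinearMap.smul_apply, P.ip_sub, P.ip_smul]
  rw [P.ip_sub, P.sub_ip, P.sub_ip, P.ip_smul, P.ip_smul, P.smul_ip, P.smul_ip, e1, e2] at hu
  rw [← sub_nonneg]
  convert hu using 1
  rw [← Complex.coe_smul, Complex.conj_ofReal]
  push_cast
  module

end PreHilbert

attribute [local instance] CStarAlgebra.spectralOrder CStarAlgebra.spectralOrderedRing

/-! ### Hilbert modules -/

namespace HilbertModule

variable {Q M : Type*} [NonUnitalCStarAlgebra Q] [NormedAddCommGroup M]
  [NormedSpace ℂ M] [CompleteSpace M] [HilbertModule Q M]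

theorem ip_self_nonneg' (m : M) : (0 : Q) ≤ ip m m :=
  CStarAlgebra.nonneg_iff_eq_star_mul_self.2 (ip_self_nonneg m)

variable (Q M) in
/-- A Hilbert module as a pre-Hilbert module. -/
def pre : PreHilbert Q M where
  ip := ip
  ip_add := ip_add
  ip_smul := ip_smul
  star_ip := star_ip
  ip_self_nonneg := ip_self_nonneg'
  dense_ract := by
    convert dense_univ
    exact Set.eq_univ_of_forall fun q m => ⟨ract m q, fun u => ip_ract u m q⟩

theorem pre_nrm (m : M) : (pre Q M).nrm m = ‖m‖ := by
  rw [PreHilbert.nrm, Real.sqrt_eq_iff_mul_self_eq (norm_nonneg _) (norm_nonneg _), ← sq]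
  exact (norm_sq m).symm

theorem ip_sub (u v w : M) : (ip u (v - w) : Q) = ip u v - ip u w := (pre Q M).ip_sub u v w
theorem ip_zero (u : M) : (ip u 0 : Q) = 0 := (pre Q M).ip_zero u
theorem add_ip (u v w : M) : (ip (u + v) w : Q) = ip u w + ip v w := (pre Q M).add_ip u v w
theorem zero_ip (u : M) : (ip 0 u : Q) = 0 := (pre Q M).zero_ip u
theorem smul_ip (c : ℂ) (u v : M) : (ip (c • u) v : Q) = (starRingEnd ℂ c) • ip u v :=
  (pre Q M).smul_ip c u v
theorem ip_sum {ι : Type*} (s : Finset ι) (u : M) (f : ι → M) :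
    (ip u (∑ i ∈ s, f i) : Q) = ∑ i ∈ s, ip u (f i) := (pre Q M).ip_sum s u f

theorem norm_ip_le (u v : M) : ‖(ip u v : Q)‖ ≤ ‖u‖ * ‖v‖ := by
  have := (pre Q M).norm_ip_le u v
  rwa [pre_nrm, pre_nrm] at this

variable (Q) in
-- The norm comes from the inner product, which is therefore definite. The linearity of the right
-- action is not part of the structure; it follows by testing against inner products.
theorem ext_ip {m m' : M} (h : ∀ n, (ip n m : Q) = ip n m') : m = m' := by
  have h1 : (ip (m - m') (m - m') : Q) = 0 := by rw [ip_sub, h, sub_self]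
  have h2 := norm_sq (Q := Q) (m - m')
  rw [h1, norm_zero] at h2
  exact sub_eq_zero.1 (norm_eq_zero.1 (pow_eq_zero_iff two_ne_zero |>.1 h2))

theorem ract_add (m : M) (q q' : Q) : ract m (q + q') = ract m q + ract m q' :=
  ext_ip Q fun n => by rw [ip_add, ip_ract, ip_ract, ip_ract, mul_add]
theorem add_ract (m m' : M) (q : Q) : ract (m + m') q = ract m q + ract m' q :=
  ext_ip Q fun n => by rw [ip_add, ip_ract, ip_ract, ip_ract, ip_add, add_mul]
theorem ract_smul (c : ℂ) (m : M) (q : Q) : ract m (c • q) = c • ract m q :=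
  ext_ip Q fun n => by rw [ip_smul, ip_ract, ip_ract, mul_smul_comm]
theorem smul_ract (c : ℂ) (m : M) (q : Q) : ract (c • m) q = c • ract m q :=
  ext_ip Q fun n => by rw [ip_smul, ip_ract, ip_ract, ip_smul, smul_mul_assoc]
theorem ract_zero (m : M) : ract m (0 : Q) = 0 := by simpa using ract_smul 0 m (0 : Q)
theorem zero_ract (q : Q) : ract (0 : M) q = 0 := by simpa using smul_ract 0 (0 : M) q
theorem ract_ip (m n : M) (q : Q) : (ip (ract m q) n : Q) = star q * ip m n := by
  rw [← star_ip, ip_ract, star_mul, star_ip]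

theorem norm_ract_le (m : M) (q : Q) : ‖ract m q‖ ≤ ‖m‖ * ‖q‖ := by
  refine le_of_sq_le_sq ?_ (by positivity)
  rw [norm_sq (Q := Q), ip_ract, ract_ip, mul_pow, norm_sq (Q := Q) m]
  calc ‖star q * ip m m * q‖ ≤ ‖q‖ * ‖(ip m m : Q)‖ * ‖q‖ := by
        refine (norm_mul_le _ _).trans ?_
        gcongr
        exact (norm_mul_le _ _).trans (by rw [norm_star])
    _ = _ := by ring

end HilbertModule

open HilbertModule

/-! ### The C⋆-algebra of adjointable operators -/

section AdjOp

variable (Q M : Type*) [NonUnitalCStarAlgebra Q] [NormedAddCommGroup M]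
  [NormedSpace ℂ M] [CompleteSpace M] [HilbertModule Q M]

/-- The algebra of adjointable operators on a Hilbert module. -/
def adjSubalgebra : Subalgebra ℂ (M →L[ℂ] M) where
  carrier := {T | ∃ S : M →L[ℂ] M, ∀ m n, (ip (T m) n : Q) = ip m (S n)}
  mul_mem' := by
    rintro T T' ⟨S, hS⟩ ⟨S', hS'⟩
    exact ⟨S' * S, fun m n => by simp [hS, hS']⟩
  add_mem' := by
    rintro T T' ⟨S, hS⟩ ⟨S', hS'⟩
    exact ⟨S + S', fun m n => by simp [hS, hS', HilbertModule.ip_add, add_ip]⟩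
  algebraMap_mem' c := ⟨algebraMap ℂ _ (starRingEnd ℂ c), fun m n => by
    simp [Algebra.algebraMap_eq_smul_one, HilbertModule.ip_smul, smul_ip]⟩

/-- The type of adjointable operators on a Hilbert module. -/
def AdjOp : Type _ := adjSubalgebra Q M

instance : NormedRing (AdjOp Q M) := inferInstanceAs (NormedRing (adjSubalgebra Q M))

instance : NormedAlgebra ℂ (AdjOp Q M) := inferInstanceAs (NormedAlgebra ℂ (adjSubalgebra Q M))

namespace AdjOp

variable {Q M}

/-- The inclusion into the bounded operators. -/
def toCLM : AdjOp Q M →ₐ[ℂ] (M →L[ℂ] M) := (adjSubalgebra Q M).val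

/-- An adjointable operator, given with its adjoint. -/
def mk (T S : M →L[ℂ] M) (h : ∀ m n, (ip (T m) n : Q) = ip m (S n)) : AdjOp Q M :=
  (⟨T, S, h⟩ : adjSubalgebra Q M)

/-- The adjoint. -/
def adjoint (T : AdjOp Q M) : M →L[ℂ] M := T.2.choose

theorem ip_adjoint (T : AdjOp Q M) (m n : M) : (ip (T.1 m) n : Q) = ip m (T.adjoint n) :=
  T.2.choose_spec m n

theorem adjoint_ip (T : AdjOp Q M) (m n : M) : (ip (T.adjoint m) n : Q) = ip m (T.1 n) := by
  rw [← HilbertModule.star_ip, ← ip_adjoint, HilbertModule.star_ip]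

instance : Star (AdjOp Q M) := ⟨fun T => mk T.adjoint T.1 T.adjoint_ip⟩

theorem ip_left (T : AdjOp Q M) (m n : M) : (ip (T.1 m) n : Q) = ip m ((star T).1 n) :=
  T.ip_adjoint m n

theorem star_eq_of {T S : AdjOp Q M} (h : ∀ m n, (ip (T.1 m) n : Q) = ip m (S.1 n)) :
    star T = S := by
  refine Subtype.ext (ContinuousLinearMap.ext fun n => ext_ip Q fun m => ?_)
  rw [← ip_left, h]

theorem norm_apply_le (T : AdjOp Q M) (m : M) : ‖T.1 m‖ ≤ ‖T‖ * ‖m‖ := T.1.le_opNorm m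

/-- `‖T m‖² = ‖⟨m, T⋆T m⟩‖ ≤ ‖T⋆T‖ ‖m‖²`. -/
theorem norm_star_mul_self_ge (T : AdjOp Q M) : ‖T‖ * ‖T‖ ≤ ‖star T * T‖ := by
  suffices h : ‖T‖ ≤ Real.sqrt ‖star T * T‖ from
    (mul_self_le_mul_self (norm_nonneg _) h).trans_eq (Real.mul_self_sqrt (norm_nonneg _))
  refine T.1.opNorm_le_bound (Real.sqrt_nonneg _) fun m => ?_
  refine le_of_sq_le_sq ?_ (by positivity)
  rw [mul_pow, Real.sq_sqrt (norm_nonneg _), HilbertModule.norm_sq (Q := Q), ip_left]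
  refine (norm_ip_le _ _).trans ?_
  calc ‖m‖ * ‖(star T * T).1 m‖ ≤ ‖m‖ * (‖star T * T‖ * ‖m‖) := by
        gcongr; exact norm_apply_le _ _
    _ = _ := by ring

instance : StarRing (AdjOp Q M) where
  star_involutive T := star_eq_of fun m n => T.adjoint_ip m n
  star_mul T S := star_eq_of fun m n => by
    change (ip (T.1 (S.1 m)) n : Q) = ip m ((star S).1 ((star T).1 n))
    rw [ip_left, ip_left]
  star_add T S := star_eq_of fun m n => by
    change (ip (T.1 m + S.1 m) n : Q) = ip m ((star T).1 n + (star S).1 n)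
    rw [add_ip, ip_left, ip_left, HilbertModule.ip_add]

instance : CStarRing (AdjOp Q M) := ⟨norm_star_mul_self_ge⟩

instance : StarModule ℂ (AdjOp Q M) where
  star_smul c T := star_eq_of fun m n => by
    change (ip (c • T.1 m) n : Q) = ip m (starRingEnd ℂ c • (star T).1 n)
    rw [smul_ip, ip_left, HilbertModule.ip_smul]

/-- Taking adjoints is isometric, so the adjoints of a convergent sequence converge, and their limit
is an adjoint of the limit. -/
theorem isClosed_adjSubalgebra : IsClosed (adjSubalgebra Q M : Set (M →L[ℂ] M)) := by
  refine isClosed_of_closure_subset fun T hT => ?_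
  obtain ⟨u, hu, hT⟩ := mem_closure_iff_seq_limit.1 hT
  let U : ℕ → AdjOp Q M := fun n => (⟨u n, hu n⟩ : adjSubalgebra Q M)
  have hc : CauchySeq fun n => (star (U n)).1 := by
    have h1 := hT.cauchySeq
    rw [Metric.cauchySeq_iff] at h1 ⊢
    intro ε hε
    obtain ⟨N, hN⟩ := h1 ε hε
    refine ⟨N, fun m hm n hn => ?_⟩
    have := hN m hm n hn
    rw [dist_eq_norm] at this ⊢
    have e : ‖star (U m - U n)‖ = ‖U m - U n‖ := norm_star _
    rw [star_sub] at e
    exact e.trans_lt this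
  obtain ⟨S, hS⟩ := cauchySeq_tendsto_of_complete hc
  refine ⟨S, fun m n => ?_⟩
  have hip : ∀ m : M, Continuous fun n : M => (ip m n : Q) := fun m =>
    AddMonoidHomClass.continuous_of_bound
      (AddMonoidHom.mk' (fun n => (ip m n : Q)) (HilbertModule.ip_add m)) ‖m‖ (norm_ip_le m)
  have h1 : Tendsto (fun k => (ip (u k m) n : Q)) atTop (𝓝 (ip (T m) n)) := by
    simp_rw [← HilbertModule.star_ip (Q := Q) n]
    have : Tendsto (fun k => u k m) atTop (𝓝 (T m)) :=
      ((ContinuousLinearMap.apply ℂ M m).continuous.tendsto T).comp hT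
    exact (continuous_star.tendsto _).comp (((hip n).tendsto _).comp this)
  have h2 : Tendsto (fun k => (ip (u k m) n : Q)) atTop (𝓝 (ip m (S n))) := by
    have : Tendsto (fun k => (star (U k)).1 n) atTop (𝓝 (S n)) :=
      ((ContinuousLinearMap.apply ℂ M n).continuous.tendsto S).comp hS
    refine (((hip m).tendsto _).comp this).congr fun k => ?_
    exact (ip_left (U k) m n).symm
  exact tendsto_nhds_unique h1 h2

instance : CompleteSpace (AdjOp Q M) :=
  (isClosed_adjSubalgebra.completeSpace_coe : CompleteSpace (adjSubalgebra Q M))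

instance : CStarAlgebra (AdjOp Q M) where

/-- The rank one operator `k ↦ m ⟨n, k⟩`. -/
def rankOne (m n : M) : AdjOp Q M :=
  mk (LinearMap.mkContinuous
    { toFun := fun k => ract m (ip n k : Q)
      map_add' := fun k l => by rw [HilbertModule.ip_add, ract_add]
      map_smul' := fun c k => by rw [HilbertModule.ip_smul, ract_smul]; rfl } (‖m‖ * ‖n‖)
    fun k => (norm_ract_le _ _).trans (by
      rw [mul_assoc]; gcongr; exact norm_ip_le _ _))
   (LinearMap.mkContinuous
    { toFun := fun k => ract n (ip m k : Q)
      map_add' := fun k l => by rw [HilbertModule.ip_add, ract_add]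
      map_smul' := fun c k => by rw [HilbertModule.ip_smul, ract_smul]; rfl } (‖n‖ * ‖m‖)
    fun k => (norm_ract_le _ _).trans (by
      rw [mul_assoc]; gcongr; exact norm_ip_le _ _))
   fun k l => by
    change (ip (ract m (ip n k : Q)) l : Q) = ip k (ract n (ip m l : Q))
    rw [ract_ip, HilbertModule.ip_ract, HilbertModule.star_ip]

theorem rankOne_apply (m n k : M) : (rankOne m n : AdjOp Q M).1 k = ract m (ip n k : Q) := rfl

theorem star_rankOne (m n : M) : star (rankOne m n : AdjOp Q M) = rankOne n m :=
  star_eq_of fun k l => by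
    rw [rankOne_apply, rankOne_apply, ract_ip, HilbertModule.ip_ract, HilbertModule.star_ip]

theorem apply_ract (T : AdjOp Q M) (m : M) (q : Q) : T.1 (ract m q) = ract (T.1 m) q :=
  ext_ip Q fun n => by
    rw [HilbertModule.ip_ract, ← adjoint_ip, ← adjoint_ip, HilbertModule.ip_ract]

/-- Let `N` be the negative part of `T` and write `N = K⋆K`. Since `T N = -N²`, the hypothesis at `N
m` says `-⟨K N m, K N m⟩ ≥ 0`, whence `K N = 0`, `N² = 0` and `N = 0`. -/
theorem nonneg_of_ip {T : AdjOp Q M} (hT : IsSelfAdjoint T)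
    (h : ∀ m, (0 : Q) ≤ ip m (T.1 m)) : 0 ≤ T := by
  have hsub := CFC.posPart_sub_negPart T hT
  have hmul := CFC.posPart_mul_negPart T
  have hN := CFC.negPart_nonneg T
  set N := T⁻ with hNdef
  have hTN : T * N = - (N * N) := by
    conv_lhs => rw [← hsub]
    rw [sub_mul, hmul, zero_sub]
  obtain ⟨K, hK⟩ := CStarAlgebra.nonneg_iff_eq_star_mul_self.1 hN
  have h1 : K * N = 0 := by
    refine Subtype.ext (ContinuousLinearMap.ext fun m => ?_)
    have e1 := h (N.1 m)
    have e2 : (ip (N.1 m) (T.1 (N.1 m)) : Q) = - ip ((K * N).1 m) ((K * N).1 m) := by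
      have : T.1 (N.1 m) = (-(N * N)).1 m := by rw [← hTN]; rfl
      rw [this]
      change (ip (N.1 m) (-(N.1 (N.1 m))) : Q) = - ip (K.1 (N.1 m)) (K.1 (N.1 m))
      rw [ip_left K, ← zero_sub, HilbertModule.ip_sub, HilbertModule.ip_zero, zero_sub]
      congr 2
      change N.1 (N.1 m) = (star K * K).1 (N.1 m)
      rw [← hK]
    have e3 := ip_self_nonneg' (Q := Q) ((K * N).1 m)
    rw [e2] at e1
    have e4 : (ip ((K * N).1 m) ((K * N).1 m) : Q) = 0 := le_antisymm (neg_nonneg.1 e1) e3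
    have e5 := HilbertModule.norm_sq (Q := Q) ((K * N).1 m)
    rw [e4, norm_zero] at e5
    exact norm_eq_zero.1 (pow_eq_zero_iff two_ne_zero |>.1 e5)
  have h2 : N * N = 0 := by
    calc N * N = star K * K * N := by rw [← hK]
      _ = 0 := by rw [mul_assoc, h1, mul_zero]
  have h3 : N = 0 := by
    have := CStarRing.norm_self_mul_star (x := N)
    rw [(IsSelfAdjoint.of_nonneg hN).star_eq, h2, norm_zero] at this
    exact norm_eq_zero.1 (mul_self_eq_zero.1 this.symm)
  rw [← hsub, h3, sub_zero]
  exact CFC.posPart_nonneg T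

/-- Finitely many vectors are almost fixed by some sum of operators `k ↦ f ⟨f, k⟩`. -/
theorem exists_approx_unit {n : ℕ} (e : Fin n → M) {δ : ℝ} (hδ : 0 < δ) :
    ∃ f : Fin n → M, ∀ k, ‖∑ l, ract (f l) (ip (f l) (e k) : Q) - e k‖ < δ := by
  set ε : ℝ := δ ^ 2 / 2 with hεdef
  have hε : 0 < ε := by positivity
  set T : AdjOp Q M := ∑ l, rankOne (e l) (e l) with hT
  have hTsa : IsSelfAdjoint T := by
    rw [IsSelfAdjoint, hT, star_sum]
    simp_rw [star_rankOne]
  have hsum : ∀ g : Fin n → M, ∀ m, (∑ l, rankOne (g l) (g l) : AdjOp Q M).1 m =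
      ∑ l, ract (g l) (ip (g l) m : Q) := fun g m => by
    change toCLM (∑ l, rankOne (g l) (g l)) m = _
    rw [map_sum, sum_apply]; rfl
  have hip : ∀ g : Fin n → M, ∀ m, (ip m ((∑ l, rankOne (g l) (g l) : AdjOp Q M).1 m) : Q) =
      ∑ l, star (ip (g l) m) * ip (g l) m := fun g m => by
    rw [hsum, ip_sum]
    simp_rw [HilbertModule.ip_ract, HilbertModule.star_ip]
  have hT0 : 0 ≤ T := nonneg_of_ip hTsa fun m => by
    rw [hT, hip]; exact Finset.sum_nonneg fun l _ => star_mul_self_nonneg _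
  have hspec : ∀ t ∈ spectrum ℝ T, 0 ≤ t := fun t ht => spectrum_nonneg_of_nonneg hT0 ht
  have hpos : ∀ t : ℝ, 0 < max t 0 + ε := fun t => by positivity
  -- With `S = (T + ε)^(-1/2)` the vectors `S eₗ` satisfy `∑ S eₗ⟨S eₗ, ·⟩ = S T S = T (T + ε)⁻¹`,
  -- and the defect is `R = ε (T + ε)⁻¹`. Replacing `t` by `max t 0` makes the functions continuous
  -- on the whole line without changing them on the spectrum.
  set s : ℝ → ℝ := fun t => (Real.sqrt (max t 0 + ε))⁻¹ with hs
  set r : ℝ → ℝ := fun t => ε * (max t 0 + ε)⁻¹ with hr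
  have hsc : Continuous s := Continuous.inv₀ (by fun_prop)
    fun t => (Real.sqrt_pos.2 (hpos t)).ne'
  have hrc : Continuous r := continuous_const.mul (Continuous.inv₀ (by fun_prop)
    fun t => (hpos t).ne')
  set S := cfc s T with hSdef
  set R := cfc r T with hRdef
  have hSsa : star S = S := (cfc_predicate s T : IsSelfAdjoint S).star_eq
  have hRsa : star R = R := (cfc_predicate r T : IsSelfAdjoint R).star_eq
  have hid : cfc (fun t : ℝ => t) T = T := cfc_id' ℝ T
  have hSTS : 1 - S * T * S = R := by
    have : S * T * S = cfc (fun t => s t * t * s t) T := by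
      conv_lhs => rw [← hid, hSdef]
      rw [← cfc_mul s (fun t => t) T hsc.continuousOn continuousOn_id,
        ← cfc_mul (fun t => s t * t) s T (hsc.mul continuous_id).continuousOn hsc.continuousOn]
    rw [this, ← cfc_const_one ℝ T, ← cfc_sub (fun _ => (1 : ℝ)) (fun t => s t * t * s t) T
      continuousOn_const ((hsc.mul continuous_id).mul hsc).continuousOn]
    refine cfc_congr fun t ht => ?_
    have h1 := hpos t
    have h2 := Real.mul_self_sqrt h1.le
    have h3 := Real.sqrt_pos.2 h1
    have h4 : max t 0 = t := max_eq_left (hspec t ht)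
    simp only [hs, hr]
    rw [h4] at h1 h2 h3 ⊢
    have h5 : (Real.sqrt (t + ε))⁻¹ * t * (Real.sqrt (t + ε))⁻¹ = t * (t + ε)⁻¹ := by
      rw [mul_comm _ t, mul_assoc, ← mul_inv, h2]
    rw [h5]
    field_simp
    ring
  -- On the spectrum the function is `ε² t / (t + ε)² ≤ ε`.
  have hRTR : ‖R * T * R‖ ≤ ε := by
    have : R * T * R = cfc (fun t => r t * t * r t) T := by
      conv_lhs => rw [← hid, hRdef]
      rw [← cfc_mul r (fun t => t) T hrc.continuousOn continuousOn_id,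
        ← cfc_mul (fun t => r t * t) r T (hrc.mul continuous_id).continuousOn hrc.continuousOn]
    rw [this]
    refine norm_cfc_le hε.le fun t ht => ?_
    have h0 := hspec t ht
    simp only [hr, max_eq_left h0]
    rw [Real.norm_of_nonneg (by positivity)]
    have h1 : 0 < t + ε := by positivity
    rw [show ε * (t + ε)⁻¹ * t * (ε * (t + ε)⁻¹) = (ε ^ 2 * t) / (t + ε) ^ 2 by
      field_simp, div_le_iff₀ (by positivity)]
    nlinarith [mul_nonneg h0 h0, mul_nonneg h0 hε.le]
  have hconj : ∀ S : AdjOp Q M, star S = S →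
      S * T * S = ∑ l, rankOne (S.1 (e l)) (S.1 (e l)) := by
    intro S hS
    refine Subtype.ext (ContinuousLinearMap.ext fun m => ?_)
    rw [hsum]
    change S.1 (T.1 (S.1 m)) = _
    rw [hT, hsum, map_sum]
    refine Finset.sum_congr rfl fun l _ => ?_
    rw [apply_ract]
    congr 1
    conv_rhs => rw [ip_left, hS]
  refine ⟨fun l => S.1 (e l), fun k => ?_⟩
  have e1 : ∑ l, ract (S.1 (e l)) (ip (S.1 (e l)) (e k) : Q) - e k = - R.1 (e k) := by
    rw [← hsum (fun l => S.1 (e l)), ← hconj S hSsa, ← hSTS]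
    change (S * T * S).1 (e k) - e k = -(e k - (S * T * S).1 (e k))
    abel
  rw [e1, norm_neg]
  set f := R.1 (e k) with hf
  -- `R T R` is the sum of the operators `R eₗ⟨R eₗ, ·⟩`. Its value at `f = R eₖ`, paired with `f`,
  -- dominates the `k`-th term alone, which is `⟨f, f⟩²`.
  have h1 : ‖f‖ ^ 4 ≤ ε * ‖f‖ ^ 2 := by
    have h2 : star (ip f f : Q) * ip f f ≤ ip f ((R * T * R).1 f) := by
      rw [hconj R hRsa, hip]
      exact Finset.single_le_sum (f := fun l => star (ip (R.1 (e l)) f : Q) * ip (R.1 (e l)) f)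
        (fun l _ => star_mul_self_nonneg _) (Finset.mem_univ k)
    have h3 := CStarAlgebra.norm_le_norm_of_nonneg_of_le (star_mul_self_nonneg _) h2
    rw [CStarRing.norm_star_mul_self, ← HilbertModule.norm_sq] at h3
    calc ‖f‖ ^ 4 = ‖f‖ ^ 2 * ‖f‖ ^ 2 := by ring
      _ ≤ _ := h3
      _ ≤ ‖f‖ * (‖R * T * R‖ * ‖f‖) := (norm_ip_le _ _).trans (by
          gcongr; exact norm_apply_le _ _)
      _ ≤ ‖f‖ * (ε * ‖f‖) := by gcongr
      _ = _ := by ring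
  have h4 : ‖f‖ ^ 2 ≤ ε := by
    by_contra hlt
    push Not at hlt
    have : 0 < ‖f‖ ^ 2 := hε.trans hlt
    nlinarith
  have : ‖f‖ ^ 2 < δ ^ 2 := h4.trans_lt (by rw [hεdef]; linarith [sq_pos_of_pos hδ])
  exact lt_of_pow_lt_pow_left₀ 2 hδ.le this

end AdjOp

end AdjOp

/-! ### Extension of adjointable maps to the completion. -/

namespace PreHilbert

variable {Q V : Type*} [NonUnitalCStarAlgebra Q] [AddCommGroup V] [Module ℂ V]
  (P : PreHilbert Q V) {M : Type*} [NormedAddCommGroup M] [NormedSpace ℂ M] [CompleteSpace M]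
  [HilbertModule Q M] {j : V →ₗ[ℂ] M} (hj : DenseRange j)
  (hip : ∀ v w, (HilbertModule.ip (j v) (j w) : Q) = P.ip v w)
include hip

theorem norm_completion (v : V) : ‖j v‖ = P.nrm v := by
  refine (sq_eq_sq₀ (norm_nonneg _) (P.nrm_nonneg v)).1 ?_
  rw [P.nrm_sq, HilbertModule.norm_sq (Q := Q), hip]

include hj

/-- Bounded adjointable maps extend to the completion. -/
theorem exists_extension {T T' : V →ₗ[ℂ] V} (hT : ∀ v w, P.ip (T v) w = P.ip v (T' w)) {r : ℝ}
    (hr : 0 ≤ r) (hb : ∀ v, P.nrm (T v) ≤ r * P.nrm v) :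
    ∃ S : AdjOp Q M, ‖S‖ ≤ r ∧ ∀ v, S.1 (j v) = j (T v) := by
  have hn := P.norm_completion hip
  -- The adjoint satisfies the same bound: `‖T' v‖² = ‖⟨T T' v, v⟩‖ ≤ r ‖T' v‖ ‖v‖`.
  have hb' : ∀ v, P.nrm (T' v) ≤ r * P.nrm v := by
    intro v
    have h1 : P.nrm (T' v) * P.nrm (T' v) ≤ (r * P.nrm v) * P.nrm (T' v) := by
      rw [← sq, P.nrm_sq, ← hT]
      refine (P.norm_ip_le _ _).trans ?_
      calc P.nrm (T (T' v)) * P.nrm v ≤ (r * P.nrm (T' v)) * P.nrm v :=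
            mul_le_mul_of_nonneg_right (hb _) (P.nrm_nonneg _)
        _ = _ := by ring
    rcases (P.nrm_nonneg (T' v)).eq_or_lt with h0 | h0
    · rw [← h0]; exact mul_nonneg hr (P.nrm_nonneg _)
    · exact le_of_mul_le_mul_right h1 h0
  have key : ∀ {T : V →ₗ[ℂ] V}, (∀ v, P.nrm (T v) ≤ r * P.nrm v) →
      ∃ S : M →L[ℂ] M, ‖S‖ ≤ r ∧ ∀ v, S (j v) = j (T v) := by
    intro T hb
    have h1 : ∀ v, ‖(j.comp T) v‖ ≤ r * ‖j v‖ := fun v => by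
      rw [LinearMap.comp_apply, hn, hn]; exact hb v
    exact ⟨(j.comp T).extendOfNorm j, LinearMap.opNorm_extendOfNorm_le hj hr h1,
      fun v => LinearMap.extendOfNorm_eq hj ⟨r, h1⟩ v⟩
  obtain ⟨S, hS, hSj⟩ := key hb
  obtain ⟨S', hS', hSj'⟩ := key hb'
  have hc : ∀ m : M, Continuous fun n : M => (HilbertModule.ip m n : Q) := fun m =>
    AddMonoidHomClass.continuous_of_bound
      (AddMonoidHom.mk' (fun n => (HilbertModule.ip m n : Q)) (HilbertModule.ip_add m)) ‖m‖
      (HilbertModule.norm_ip_le m)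
  have hc' : ∀ m : M, Continuous fun n : M => (HilbertModule.ip n m : Q) := fun m => by
    simp_rw [← HilbertModule.star_ip (Q := Q) m]
    exact continuous_star.comp (hc m)
  refine ⟨AdjOp.mk S S' fun m n => ?_, hS, hSj⟩
  refine hj.induction_on (p := fun m => (HilbertModule.ip (S m) n : Q) = HilbertModule.ip m (S' n))
    m (isClosed_eq ((hc' n).comp S.continuous) (hc' _)) fun v => ?_
  refine hj.induction_on (p := fun n => (HilbertModule.ip (S (j v)) n : Q) =
    HilbertModule.ip (j v) (S' n)) n (isClosed_eq (hc _) ((hc _).comp S'.continuous)) fun w => ?_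
  rw [hSj, hSj', hip, hip, hT]

end PreHilbert

/-! ### Elementary facts on groupoids and actions -/

namespace EtaleGroupoid

variable {G X : Type*} [TopologicalSpace G] [TopologicalSpace X] (𝒢 : EtaleGroupoid G X)

theorem continuous_rng : Continuous 𝒢.rng := 𝒢.isLocalHomeomorph_rng.continuous
theorem continuous_one : Continuous 𝒢.one := 𝒢.isOpenEmbedding_one.continuous

theorem mul_inv_cancel_right {g h : G} (e : 𝒢.src g = 𝒢.rng h) :
    𝒢.mul (𝒢.mul g h) (𝒢.inv h) = g := by
  rw [𝒢.mul_assoc e (𝒢.rng_inv h).symm, 𝒢.mul_inv, ← e, 𝒢.mul_one]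

theorem inv_mul_cancel_left {g h : G} (e : 𝒢.src g = 𝒢.rng h) :
    𝒢.mul (𝒢.inv g) (𝒢.mul g h) = h := by
  rw [← 𝒢.mul_assoc (𝒢.src_inv g) e, 𝒢.inv_mul, e, 𝒢.one_mul]

theorem eq_inv_of_mul {g h : G} (e : 𝒢.src g = 𝒢.rng h) (he : 𝒢.mul g h = 𝒢.one (𝒢.rng g)) :
    h = 𝒢.inv g := by
  rw [← 𝒢.inv_mul_cancel_left e, he, ← 𝒢.src_inv g, 𝒢.mul_one]

@[simp] theorem inv_inv (g : G) : 𝒢.inv (𝒢.inv g) = g :=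
  (𝒢.eq_inv_of_mul (𝒢.src_inv g) (by rw [𝒢.inv_mul, 𝒢.rng_inv])).symm

theorem mul_inv_rev {g h : G} (e : 𝒢.src g = 𝒢.rng h) :
    𝒢.inv (𝒢.mul g h) = 𝒢.mul (𝒢.inv h) (𝒢.inv g) := by
  have e1 : 𝒢.src (𝒢.inv h) = 𝒢.rng (𝒢.inv g) := by rw [𝒢.src_inv, 𝒢.rng_inv, e]
  refine (𝒢.eq_inv_of_mul ?_ ?_).symm
  · rw [𝒢.src_mul e, 𝒢.rng_mul e1, 𝒢.rng_inv]
  · rw [𝒢.rng_mul e, ← 𝒢.mul_assoc (by rw [𝒢.src_mul e, 𝒢.rng_inv]) e1,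
      𝒢.mul_inv_cancel_right e, 𝒢.mul_inv]

theorem inv_mul_cancel_right {g h : G} (e : 𝒢.src g = 𝒢.src h) :
    𝒢.mul (𝒢.mul g (𝒢.inv h)) h = g := by
  have := 𝒢.mul_inv_cancel_right (g := g) (h := 𝒢.inv h) (by rw [e, 𝒢.rng_inv])
  rwa [𝒢.inv_inv] at this

theorem mul_inv_cancel_left {g h : G} (e : 𝒢.rng g = 𝒢.rng h) :
    𝒢.mul g (𝒢.mul (𝒢.inv g) h) = h := by
  have := 𝒢.inv_mul_cancel_left (g := 𝒢.inv g) (h := h) (by rw [𝒢.src_inv, e])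
  rwa [𝒢.inv_inv] at this

@[simp] theorem inv_one (x : X) : 𝒢.inv (𝒢.one x) = 𝒢.one x := by
  refine (𝒢.eq_inv_of_mul (by rw [𝒢.src_one, 𝒢.rng_one]) ?_).symm
  have := 𝒢.mul_one (𝒢.one x)
  rw [𝒢.src_one] at this
  rw [this, 𝒢.rng_one]

theorem isEtaleMap_rng : IsEtaleMap 𝒢.rng := 𝒢.isLocalHomeomorph_rng.isEtaleMap

/-- The inverse as a homeomorphism. -/
def invHomeomorph : G ≃ₜ G where
  toFun := 𝒢.inv
  invFun := 𝒢.inv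
  left_inv := 𝒢.inv_inv
  right_inv := 𝒢.inv_inv
  continuous_toFun := 𝒢.continuous_inv
  continuous_invFun := 𝒢.continuous_inv

theorem isEtaleMap_src : IsEtaleMap 𝒢.src := by
  have : IsLocalHomeomorph (𝒢.rng ∘ 𝒢.invHomeomorph) :=
    𝒢.isLocalHomeomorph_rng.comp 𝒢.invHomeomorph.isLocalHomeomorph
  convert this.isEtaleMap using 1
  funext g
  exact (𝒢.rng_inv g).symm

include 𝒢 in
theorem locallyCompactSpace [T2Space G] [LocallyCompactSpace X] : LocallyCompactSpace G :=
  𝒢.isLocalHomeomorph_rng.locallyCompactSpace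

/-- Right multiplication. -/
def rightMul : RightAction 𝒢 G where
  anchor := 𝒢.src
  smul := 𝒢.mul
  anchor_smul h := 𝒢.src_mul h.symm
  smul_one := 𝒢.mul_one
  smul_mul h k := (𝒢.mul_assoc h.symm k).symm
  continuous_anchor := 𝒢.continuous_src
  continuous_smul := by
    refine 𝒢.continuous_mul.mono fun p hp => Eq.symm hp

end EtaleGroupoid

/-! ### Composable pairs of a right action. -/

section RightActions

variable {H Y Z : Type*} [TopologicalSpace H] [TopologicalSpace Y] [TopologicalSpace Z]
  {ℋ : EtaleGroupoid H Y} (R : RightAction ℋ Z)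

namespace RightAction

theorem smul_smul_inv {z : Z} {h : H} (e : ℋ.rng h = R.anchor z) :
    R.smul (R.smul z h) (ℋ.inv h) = z := by
  rw [← R.smul_mul e (ℋ.rng_inv h).symm, ℋ.mul_inv, e, R.smul_one]

theorem smul_inv_smul {z : Z} {h : H} (e : ℋ.src h = R.anchor z) :
    R.smul (R.smul z (ℋ.inv h)) h = z := by
  have := R.smul_smul_inv (z := z) (h := ℋ.inv h) (by rw [ℋ.rng_inv, e])
  rwa [ℋ.inv_inv] at this

/-- The space of composable pairs. -/
abbrev FP : Type _ := {q : Z × H // ℋ.rng q.2 = R.anchor q.1}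

theorem continuous_smul_FP : Continuous fun q : R.FP => R.smul q.1.1 q.1.2 :=
  R.continuous_smul.comp_continuous continuous_subtype_val fun q => q.2

/-- The involution `(z, h) ↦ (z h, h⁻¹)` of the space of composable pairs. -/
def flip (q : R.FP) : R.FP :=
  ⟨(R.smul q.1.1 q.1.2, ℋ.inv q.1.2), by rw [ℋ.rng_inv, R.anchor_smul q.2]⟩

theorem continuous_flip : Continuous R.flip :=
  Continuous.subtype_mk (R.continuous_smul_FP.prodMk
    (ℋ.continuous_inv.comp (continuous_snd.comp continuous_subtype_val))) _

theorem flip_flip (q : R.FP) : R.flip (R.flip q) = q :=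
  Subtype.ext (Prod.ext (R.smul_smul_inv q.2) (ℋ.inv_inv _))

theorem isCompact_FP [T2Space Y] {K : Set Z} {L : Set H} (hK : IsCompact K) (hL : IsCompact L) :
    IsCompact {q : R.FP | q.1.1 ∈ K ∧ q.1.2 ∈ L} :=
  (isClosed_eq (ℋ.continuous_rng.comp continuous_snd)
    (R.continuous_anchor.comp continuous_fst)).isClosedEmbedding_subtypeVal.isCompact_preimage
      (hK.prod hL)

theorem isCompact_FP_flip [T2Space Y] {K : Set Z} {L : Set H} (hK : IsCompact K)
    (hL : IsCompact L) :
    IsCompact {q : R.FP | R.smul q.1.1 q.1.2 ∈ K ∧ ℋ.inv q.1.2 ∈ L} := by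
  convert (R.isCompact_FP hK hL).image R.continuous_flip using 1
  ext q
  constructor
  · intro h
    exact ⟨R.flip q, h, R.flip_flip q⟩
  · rintro ⟨q, h, rfl⟩
    have h2 := congrArg (fun q => q.1) (R.flip_flip q)
    change R.smul (R.flip q).1.1 (R.flip q).1.2 ∈ K ∧ ℋ.inv (R.flip q).1.2 ∈ L
    rw [show R.smul (R.flip q).1.1 (R.flip q).1.2 = q.1.1 from congrArg Prod.fst h2,
      show ℋ.inv (R.flip q).1.2 = q.1.2 from congrArg Prod.snd h2]
    exact h

variable {R} in
-- This is the form in which properness of the action is used: the pairs moving a point of `K` into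
-- `L` form a compact set.
theorem IsProper.isCompact_FP (hR : R.IsProper) {K L : Set Z} (hK : IsCompact K)
    (hL : IsCompact L) : IsCompact {q : R.FP | q.1.1 ∈ K ∧ R.smul q.1.1 q.1.2 ∈ L} := by
  convert IsProperMap.isCompact_preimage hR (hL.prod hK) using 1
  ext q
  exact and_comm

theorem isEtaleMap_fst : IsEtaleMap fun q : R.FP => q.1.1 :=
  IsEtaleMap.fst (a := R.anchor) (b := ℋ.rng) (fun _ => eq_comm) R.continuous_anchor
    ℋ.isEtaleMap_rng

theorem isEtaleMap_snd (hR : R.IsEtale) : IsEtaleMap fun q : R.FP => q.1.2 :=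
  IsEtaleMap.snd (a := R.anchor) (b := ℋ.rng) (fun _ => eq_comm)
    (IsLocalHomeomorph.isEtaleMap hR) ℋ.continuous_rng

theorem locallyCompactSpace_FP [T2Space Y] [LocallyCompactSpace Z] [LocallyCompactSpace H] :
    LocallyCompactSpace R.FP :=
  locallyCompactSpace_fibreProduct (a := R.anchor) (b := ℋ.rng) (fun _ => eq_comm)
    R.continuous_anchor ℋ.continuous_rng

/-- The arrows that can act on `z`, as a fibre. -/
def fibreFstEquiv (z : Z) : {h : H // ℋ.rng h = R.anchor z} ≃ {q : R.FP // q.1.1 = z} where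
  toFun h := ⟨⟨(z, h.1), h.2⟩, rfl⟩
  invFun q := ⟨q.1.1.2, q.1.2.trans (congrArg R.anchor q.2)⟩
  left_inv _ := rfl
  right_inv q := by obtain ⟨⟨⟨z', h⟩, e⟩, rfl⟩ := q; rfl

/-- The points on which `h` can act, as a fibre. -/
def fibreSndEquiv (h : H) : {z : Z // R.anchor z = ℋ.rng h} ≃ {q : R.FP // q.1.2 = h} where
  toFun z := ⟨⟨(z.1, h), z.2.symm⟩, rfl⟩
  invFun q := ⟨q.1.1.1, q.1.2.symm.trans (congrArg ℋ.rng q.2)⟩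
  left_inv _ := rfl
  right_inv q := by obtain ⟨⟨⟨z', h⟩, e⟩, rfl⟩ := q; rfl

end RightAction

/-! ### Sums over orbits and over fibres of the anchor map. -/

section Sums

variable [T2Space Y] [T2Space H] [T2Space Z] [LocallyCompactSpace H] [LocallyCompactSpace Z]
  {P Q S : Y → Type*}
  [∀ y, NormedAddCommGroup (P y)] [∀ y, NormedSpace ℂ (P y)] [TopologicalSpace (Tot P)]
  [∀ y, NormedAddCommGroup (Q y)] [∀ y, NormedSpace ℂ (Q y)] [TopologicalSpace (Tot Q)]
  [∀ y, NormedAddCommGroup (S y)] [∀ y, NormedSpace ℂ (S y)] [TopologicalSpace (Tot S)]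
  [ApproxBundle P] [ApproxBundle Q] [ApproxBundle S]
  {m : ∀ {y}, P y → Q y → S y}
  {act : ∀ {x y : Y} (g : H), ℋ.src g = x → ℋ.rng g = y → P x → P y}

/-- The sum is a pushforward along the étale projection `(z, h) ↦ z`. The summand vanishes off the
pairs with `z h` and `h⁻¹` in the supports of `ξ` and `c`, a set that the flip `(z, h) ↦ (z h, h⁻¹)`
identifies with a closed subset of a product of compact sets. The pairing `m` is left general so as
to cover both convolution and the right action on a module. -/
theorem isCc_convSum (hm : Continuous fun q : FibProd P Q => (⟨q.base, m q.fst q.snd⟩ : Tot S))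
    (hm₁ : ∀ {y} (b : Q y), m (0 : P y) b = 0) (hm₂ : ∀ {y} (a : P y), m a (0 : Q y) = 0)
    (ha : IsIsoAction ℋ act) {ξ : ∀ z, P (R.anchor z)} (hξ : IsCc R.anchor ξ)
    {c : ∀ h, Q (ℋ.src h)} (hc : IsCc ℋ.src c) :
    IsCc R.anchor fun z => ∑ᶠ h : {h : H // ℋ.rng h = R.anchor z},
      m (act h.1 (R.anchor_smul h.2).symm h.2 (ξ (R.smul z h.1)))
        (tr ((ℋ.src_inv h.1).trans h.2) (c (ℋ.inv h.1))) := by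
  have := R.locallyCompactSpace_FP
  let a : ∀ q : R.FP, S (R.anchor q.1.1) := fun q =>
    m (act q.1.2 (R.anchor_smul q.2).symm q.2 (ξ (R.smul q.1.1 q.1.2)))
        (tr ((ℋ.src_inv q.1.2).trans q.2) (c (ℋ.inv q.1.2)))
  have h1 : IsContSec (fun q : R.FP => R.anchor q.1.1) a := by
    refine IsContSec.map₂' (m := m) hm ?_ ?_
    · exact ha.isContSec (continuous_snd.comp continuous_subtype_val) _ _
        (hξ.1.comp R.continuous_smul_FP)
    · exact (hc.1.comp (ℋ.continuous_inv.comp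
        (continuous_snd.comp continuous_subtype_val))).congr_base _
  have h2 : IsCc (fun q : R.FP => R.anchor q.1.1) a := by
    refine IsCc.of_eq_zero h1 (R.isCompact_FP_flip hξ.2 hc.2) fun q hq => ?_
    by_cases h : R.smul q.1.1 q.1.2 ∈ closure {z | ξ z ≠ 0}
    · have : c (ℋ.inv q.1.2) = 0 := IsCc.eq_zero fun h' => hq ⟨h, h'⟩
      simp only [a, this, tr_zero, hm₂]
    · simp only [a, IsCc.eq_zero h, ha.map_zero, hm₁]
  convert isCc_pushSec (p := fun q : R.FP => q.1.1) R.isEtaleMap_fst R.continuous_anchor h2 using 1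
  funext z
  exact finsum_comp_equiv (R.fibreFstEquiv z)
    (f := fun q => tr (congrArg R.anchor q.2) (a q.1))

/-- Here the pushforward is along `(z, h) ↦ h`, étale because the anchor map is. Compactness of the
support is properness of the action. -/
theorem isCc_innerSum (hm : Continuous fun q : FibProd P Q => (⟨q.base, m q.fst q.snd⟩ : Tot S))
    (hm₁ : ∀ {y} (b : Q y), m (0 : P y) b = 0) (hm₂ : ∀ {y} (a : P y), m a (0 : Q y) = 0)
    (ha : IsIsoAction ℋ act) (hRp : R.IsProper) (hRe : R.IsEtale)
    {ξ : ∀ z, P (R.anchor z)} (hξ : IsCc R.anchor ξ)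
    {η : ∀ z, Q (R.anchor z)} (hη : IsCc R.anchor η) :
    IsCc ℋ.src fun h => ∑ᶠ z : {z : Z // R.anchor z = ℋ.rng h},
      m (act (ℋ.inv h) ((ℋ.src_inv h).trans z.2.symm) (ℋ.rng_inv h) (ξ z.1))
        (tr (R.anchor_smul z.2.symm) (η (R.smul z.1 h))) := by
  have := R.locallyCompactSpace_FP
  let a : ∀ q : R.FP, S (ℋ.src q.1.2) := fun q =>
    m (act (ℋ.inv q.1.2) ((ℋ.src_inv q.1.2).trans q.2) (ℋ.rng_inv q.1.2) (ξ q.1.1))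
        (tr (R.anchor_smul q.2) (η (R.smul q.1.1 q.1.2)))
  have h1 : IsContSec (fun q : R.FP => ℋ.src q.1.2) a := by
    refine IsContSec.map₂' (m := m) hm ?_ ?_
    · exact ha.isContSec (ℋ.continuous_inv.comp (continuous_snd.comp continuous_subtype_val)) _ _
        (hξ.1.comp (continuous_fst.comp continuous_subtype_val))
    · exact (hη.1.comp R.continuous_smul_FP).congr_base _
  have h2 : IsCc (fun q : R.FP => ℋ.src q.1.2) a := by
    refine IsCc.of_eq_zero h1 (hRp.isCompact_FP hξ.2 hη.2) fun q hq => ?_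
    by_cases h : q.1.1 ∈ closure {z | ξ z ≠ 0}
    · have : η (R.smul q.1.1 q.1.2) = 0 := IsCc.eq_zero fun h' => hq ⟨h, h'⟩
      simp only [a, this, tr_zero, hm₂]
    · simp only [a, IsCc.eq_zero h, ha.map_zero, hm₁]
  convert isCc_pushSec (p := fun q : R.FP => q.1.2) (R.isEtaleMap_snd hRe) ℋ.continuous_src h2
    using 1
  funext h
  exact finsum_comp_equiv (R.fibreSndEquiv h) (f := fun q => tr (congrArg ℋ.src q.2) (a q.1))

theorem finite_smul_mem (hRp : R.IsProper) {K : Set Z} (hK : IsCompact K) (z : Z) :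
    {h : {h : H // ℋ.rng h = R.anchor z} | R.smul z h.1 ∈ K}.Finite := by
  have h1 := R.isEtaleMap_fst.finite_fibre (hRp.isCompact_FP (isCompact_singleton (x := z)) hK) z
  refine Set.Finite.of_finite_image (f := fun h => (R.fibreFstEquiv z h).1) (h1.subset ?_)
    (Subtype.val_injective.comp (R.fibreFstEquiv z).injective).injOn
  rintro _ ⟨h, hh, rfl⟩
  exact ⟨⟨rfl, hh⟩, rfl⟩

theorem finite_anchor_eq (hRe : R.IsEtale) {K : Set Z} (hK : IsCompact K) (y : Y) :
    {z : {z : Z // R.anchor z = y} | z.1 ∈ K}.Finite := by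
  refine Set.Finite.of_finite_image (f := Subtype.val)
    (((IsLocalHomeomorph.isEtaleMap hRe).finite_fibre hK y).subset ?_)
    Subtype.val_injective.injOn
  rintro _ ⟨z, hz, rfl⟩
  exact ⟨hz, z.2⟩

theorem finite_inv_mem {L : Set H} (hL : IsCompact L) (y : Y) :
    {h : {h : H // ℋ.rng h = y} | ℋ.inv h.1 ∈ L}.Finite := by
  refine Set.Finite.of_finite_image (f := fun h => ℋ.inv h.1)
    ((ℋ.isEtaleMap_src.finite_fibre hL y).subset ?_)
    (fun a _ b _ h => Subtype.ext (ℋ.invHomeomorph.injective h))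
  rintro _ ⟨h, hh, rfl⟩
  exact ⟨hh, (ℋ.src_inv _).trans h.2⟩

end Sums

end RightActions

/-! ### Convolution algebras -/

/-- A bundle of C⋆-algebras with enough approximating sections. -/
class StarBundle {X : Type*} [TopologicalSpace X] (A : X → Type*)
    [∀ x, NonUnitalCStarAlgebra (A x)] [TopologicalSpace (Tot A)] : Prop
    extends ApproxBundle A where
  continuous_mul : Continuous fun p : FibProd A A => (⟨p.base, p.fst * p.snd⟩ : Tot A)
  continuous_star : Continuous fun a : Tot A => (⟨a.base, star a.val⟩ : Tot A)

instance CStarBundle.toStarBundle {X : Type*} [TopologicalSpace X] (A : X → Type*)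
    [∀ x, NonUnitalCStarAlgebra (A x)] [TopologicalSpace (Tot A)] [CStarBundle A] :
    StarBundle A where
  continuous_mul := CStarBundle.continuous_mul
  continuous_star := CStarBundle.continuous_star

section ConvolutionAlgebra

variable {G X : Type*} [TopologicalSpace G] [TopologicalSpace X] {A : X → Type*}
  [∀ x, NonUnitalCStarAlgebra (A x)] [TopologicalSpace (Tot A)]

/-- A continuous action of a groupoid on a bundle of C⋆-algebras. -/
structure IsStarAction (𝒢 : EtaleGroupoid G X)
    (act : ∀ {x y : X} (g : G), 𝒢.src g = x → 𝒢.rng g = y → A x → A y) : Prop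
    extends IsIsoAction 𝒢 act where
  map_mul : ∀ {x y : X} (g : G) (hx : 𝒢.src g = x) (hy : 𝒢.rng g = y) (a b : A x),
    act g hx hy (a * b) = act g hx hy a * act g hx hy b
  map_star : ∀ {x y : X} (g : G) (hx : 𝒢.src g = x) (hy : 𝒢.rng g = y) (a : A x),
    act g hx hy (star a) = star (act g hx hy a)

variable {𝒢 : EtaleGroupoid G X}

theorem CStarAction.isStarAction (γ : CStarAction 𝒢 A) :
    IsStarAction 𝒢 (A := A) fun g hx hy => γ.act g hx hy where
  toIsIsoAction := γ.isIsoAction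
  map_mul g hx hy := _root_.map_mul (γ.act g hx hy)
  map_star g hx hy a := StarHomClass.map_star (γ.act g hx hy) a

variable {act : ∀ {x y : X} (g : G), 𝒢.src g = x → 𝒢.rng g = y → A x → A y}

variable [StarBundle A] [T2Space G] [T2Space X] [LocallyCompactSpace X]
  (ha : IsStarAction 𝒢 act)
include ha

theorem IsStarAction.isCc_conv {a b : ∀ g, A (𝒢.src g)} (h₁ : IsCc 𝒢.src a)
    (h₂ : IsCc 𝒢.src b) : IsCc 𝒢.src (conv 𝒢 act a b) := by
  have := 𝒢.locallyCompactSpace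
  exact isCc_convSum 𝒢.rightMul (m := fun a b => a * b) StarBundle.continuous_mul
    (fun b => zero_mul b) (fun a => mul_zero a) ha.toIsIsoAction h₁ h₂

theorem IsStarAction.isCc_adj {a : ∀ g, A (𝒢.src g)} (h : IsCc 𝒢.src a) :
    IsCc 𝒢.src (adj 𝒢 act a) := by
  refine IsCc.of_eq_zero ?_ (h.2.image 𝒢.continuous_inv) fun g hg => ?_
  · refine ha.isContSec (g := 𝒢.inv) 𝒢.continuous_inv (fun _ => rfl) 𝒢.rng_inv ?_
    exact (StarBundle.continuous_star (A := A)).comp (h.1.comp 𝒢.continuous_inv)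
  · have : a (𝒢.inv g) = 0 := IsCc.eq_zero fun h' => hg ⟨_, h', 𝒢.inv_inv g⟩
    rw [adj, this, star_zero, ha.map_zero]

end ConvolutionAlgebra

/-! ### Finite sums -/

theorem finsum_subtype_congr {α M : Type*} [AddCommMonoid M] {p q : α → Prop}
    (h : ∀ a, p a ↔ q a) {f : {a // p a} → M} {g : {a // q a} → M}
    (hfg : ∀ a ha hb, f ⟨a, ha⟩ = g ⟨a, hb⟩) : ∑ᶠ a, f a = ∑ᶠ a, g a := by
  obtain rfl : p = q := funext fun a => propext (h a)
  exact finsum_congr fun a => hfg a.1 a.2 a.2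

theorem finsum_comm_of_finite {α β M : Type*} [AddCommMonoid M] {f : α → β → M} {s : Set α}
    {t : Set β} (hs : s.Finite) (ht : t.Finite) (h : ∀ a b, f a b ≠ 0 → a ∈ s ∧ b ∈ t) :
    ∑ᶠ a, ∑ᶠ b, f a b = ∑ᶠ b, ∑ᶠ a, f a b := by
  have h1 : (Function.support fun p : α × β => f p.1 p.2).Finite :=
    (hs.prod ht).subset fun p hp => h _ _ hp
  have h2 : (Function.support fun p : β × α => f p.2 p.1).Finite :=
    (ht.prod hs).subset fun p hp => (h _ _ hp).symm
  rw [← finsum_curry _ h1, ← finsum_curry _ h2]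
  exact (finsum_comp_equiv (Equiv.prodComm α β) (f := fun p : β × α => f p.2 p.1))

theorem finsum_sigma_of_finite {α M : Type*} [AddCommMonoid M] {β : α → Type*}
    {f : (Σ a, β a) → M} (hf : (Function.support f).Finite) :
    ∑ᶠ p, f p = ∑ᶠ a, ∑ᶠ b, f ⟨a, b⟩ := by
  classical
  set S := hf.toFinset with hS
  set T := S.image Sigma.fst with hT
  let U : ∀ a, Finset (β a) := fun a => S.preimage (Sigma.mk a) sigma_mk_injective.injOn
  have h1 : ∀ a, ∑ᶠ b, f ⟨a, b⟩ = ∑ b ∈ U a, f ⟨a, b⟩ := fun a =>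
    finsum_eq_sum_of_support_subset _ fun b hb => by
      simpa [U, hS] using hb
  simp_rw [h1]
  rw [finsum_eq_sum_of_support_subset (s := T), Finset.sum_sigma',
    finsum_eq_sum_of_support_subset]
  · intro p hp
    simp only [Finset.coe_sigma, Set.mem_sigma_iff, Finset.mem_coe]
    refine ⟨Finset.mem_image_of_mem _ (by simpa [hS] using hp), ?_⟩
    simpa [U, hS] using hp
  · intro a ha
    obtain ⟨b, hb, -⟩ := Finset.exists_ne_zero_of_sum_ne_zero ha
    exact Finset.mem_image_of_mem _ (Finset.mem_preimage.1 hb)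

/-! ### The inner product and the right action -/

section Identities

variable {H Y Z : Type*} [TopologicalSpace H] [TopologicalSpace Y] [TopologicalSpace Z]
  {ℋ : EtaleGroupoid H Y} (R : RightAction ℋ Z)
  {C : Y → Type*} [∀ y, NonUnitalCStarAlgebra (C y)] [TopologicalSpace (Tot C)]
  {E : Y → Type*} [∀ y, NormedAddCommGroup (E y)] [∀ y, NormedSpace ℂ (E y)]
  [∀ y, CompleteSpace (E y)] [TopologicalSpace (Tot E)] [∀ y, HilbertModule (C y) (E y)]
  {γ : CStarAction ℋ C} (ε : HilbertAction γ E)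

theorem tr_ip {y y' : Y} (e : y = y') (a b : E y) :
    tr e (ip a b : C y) = ip (tr e a) (tr e b) := by subst e; rfl

theorem tr_ract {y y' : Y} (e : y = y') (a : E y) (c : C y) :
    tr e (ract a c) = ract (tr e a) (tr e c) := by subst e; rfl

namespace HilbertAction

variable {ε}

theorem map_ip {x y : Y} (g : H) (hx : ℋ.src g = x) (hy : ℋ.rng g = y) (a b : E x) :
    γ.act g hx hy (ip a b) = ip (ε.act g hx hy a) (ε.act g hx hy b) := by
  subst hx hy; exact ε.act_ip g a b

theorem map_ract {x y : Y} (g : H) (hx : ℋ.src g = x) (hy : ℋ.rng g = y) (a : E x) (c : C x) :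
    ε.act g hx hy (ract a c) = ract (ε.act g hx hy a) (γ.act g hx hy c) := by
  subst hx hy; exact ε.act_ract g a c

theorem act_act {x y z : Y} (g h : H) (hx : ℋ.src h = x) (hy : ℋ.rng h = y) (hy' : ℋ.src g = y)
    (hz : ℋ.rng g = z) (a : E x) :
    ε.act g hy' hz (ε.act h hx hy a) =
      ε.act (ℋ.mul g h) ((ℋ.src_mul (hy'.trans hy.symm)).trans hx)
        ((ℋ.rng_mul (hy'.trans hy.symm)).trans hz) a :=
  ε.isIsoAction.act_act g h hx hy hy' hz a

theorem act_tr {x x' y : Y} (g : H) (e : x = x') (hx : ℋ.src g = x') (hy : ℋ.rng g = y) (a : E x) :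
    ε.act g hx hy (tr e a) = ε.act g (hx.trans e.symm) hy a := by
  subst e; rfl

theorem tr_act {x y y' : Y} (g : H) (e : y = y') (hx : ℋ.src g = x) (hy : ℋ.rng g = y) (a : E x) :
    tr e (ε.act g hx hy a) = ε.act g hx (hy.trans e) a := by
  subst e; rfl

theorem act_congr {ξ : ∀ z, E (R.anchor z)} {g g' : H} {z z' : Z} {y : Y}
    (hg : g = g') (hz : z = z') (hx : ℋ.src g = R.anchor z) (hy : ℋ.rng g = y)
    (hx' : ℋ.src g' = R.anchor z') (hy' : ℋ.rng g' = y) :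
    ε.act g hx hy (ξ z) = ε.act g' hx' hy' (ξ z') := by
  subst hg hz; rfl

theorem act_one' {x y z : Y} (hx : ℋ.src (ℋ.one z) = x) (hy : ℋ.rng (ℋ.one z) = y) (a : E x) :
    ε.act (ℋ.one z) hx hy a = tr (((ℋ.src_one z).symm.trans hx).symm.trans
      ((ℋ.rng_one z).symm.trans hy)) a :=
  ε.isIsoAction.act_one hx hy a

end HilbertAction

theorem sec_congr {A : Y → Type*} {Z : Type*} {p : Z → Y} (ξ : ∀ z, A (p z)) {z z' : Z} {y : Y}
    (h : z = z') (e : p z = y) (e' : p z' = y) : tr e (ξ z) = tr e' (ξ z') := by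
  subst h; rfl

namespace RightAction

/-- The `C`-valued inner product of sections. -/
def innerSec (ξ η : ∀ z, E (R.anchor z)) (h : H) : C (ℋ.src h) :=
  ∑ᶠ z : {z : Z // R.anchor z = ℋ.rng h},
    ip (ε.act (ℋ.inv h) ((ℋ.src_inv h).trans z.2.symm) (ℋ.rng_inv h) (ξ z.1))
      (tr (R.anchor_smul z.2.symm) (η (R.smul z.1 h)))

/-- The right action of sections over `H` on sections over `Z`. -/
def rightSec (ξ : ∀ z, E (R.anchor z)) (c : ∀ h, C (ℋ.src h)) (z : Z) : E (R.anchor z) :=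
  ∑ᶠ h : {h : H // ℋ.rng h = R.anchor z},
    ract (ε.act h.1 (R.anchor_smul h.2).symm h.2 (ξ (R.smul z h.1)))
      (tr ((ℋ.src_inv h.1).trans h.2) (c (ℋ.inv h.1)))

variable {R ε}

/-- Substitute `z ↦ z h` in the sum. -/
theorem adj_innerSec (ξ η : ∀ z, E (R.anchor z)) :
    adj ℋ (A := C) (fun h hx hy => γ.act h hx hy) (R.innerSec ε ξ η) = R.innerSec ε η ξ := by
  funext h
  unfold adj innerSec
  beta_reduce
  have : ∀ f : {z : Z // R.anchor z = ℋ.rng (ℋ.inv h)} → C (ℋ.src (ℋ.inv h)),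
      star (∑ᶠ z, f z) = ∑ᶠ z, star (f z) := fun f =>
    AddMonoidHom.map_finsum_of_injective (starAddEquiv (R := C (ℋ.src (ℋ.inv h)))).toAddMonoidHom
      star_injective f
  rw [this, γ.isIsoAction.map_finsum]
  let e : {z : Z // R.anchor z = ℋ.rng h} ≃ {z : Z // R.anchor z = ℋ.rng (ℋ.inv h)} :=
    { toFun := fun z => ⟨R.smul z.1 h, (R.anchor_smul z.2.symm).trans (ℋ.rng_inv h).symm⟩
      invFun := fun z => ⟨R.smul z.1 (ℋ.inv h),
        (R.anchor_smul z.2.symm).trans (ℋ.src_inv h)⟩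
      left_inv := fun z => Subtype.ext (R.smul_smul_inv z.2.symm)
      right_inv := fun z => Subtype.ext (R.smul_inv_smul (by rw [z.2, ℋ.rng_inv])) }
  rw [← finsum_comp_equiv e]
  refine finsum_congr fun z => ?_
  rw [HilbertModule.star_ip, HilbertAction.map_ip (ε := ε)]
  congr 1
  · rw [HilbertAction.act_tr]
    exact HilbertAction.act_congr R rfl (R.smul_smul_inv z.2.symm) _ _ _ _
  · rw [HilbertAction.act_act, ε.isIsoAction.tr_eq_act]
    refine (HilbertAction.act_congr R (by rw [ℋ.inv_inv, ℋ.inv_mul, R.anchor_smul z.2.symm]) rfl _ _ _ _)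

variable [T2Space Y] [T2Space H] [T2Space Z] [LocallyCompactSpace H] [LocallyCompactSpace Z]

/-- Both sides are the sum of `F z k`, taken in either order. Only finitely many `z` count because
`ξ` has compact support, and finitely many `k` because `c` has. -/
theorem innerSec_rightSec (hRe : R.IsEtale) {ξ η : ∀ z, E (R.anchor z)} (hξ : IsCc R.anchor ξ)
    {c : ∀ h, C (ℋ.src h)} (hc : IsCc ℋ.src c) :
    R.innerSec ε ξ (R.rightSec ε η c) =
      conv ℋ (A := C) (fun h hx hy => γ.act h hx hy) (R.innerSec ε ξ η) c := by
  funext h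
  let F : {z : Z // R.anchor z = ℋ.rng h} → {k : H // ℋ.rng k = ℋ.src h} → C (ℋ.src h) :=
    fun z k => ip (ε.act (ℋ.inv h) ((ℋ.src_inv h).trans z.2.symm) (ℋ.rng_inv h) (ξ z.1))
      (ract (ε.act k.1 (by rw [R.anchor_smul ((ℋ.rng_mul k.2.symm).trans z.2.symm),
        ℋ.src_mul k.2.symm]) k.2
        (η (R.smul z.1 (ℋ.mul h k.1)))) (tr ((ℋ.src_inv k.1).trans k.2) (c (ℋ.inv k.1))))
  have hs := finite_anchor_eq R hRe hξ.2 (ℋ.rng h)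
  have ht := finite_inv_mem hc.2 (ℋ := ℋ) (ℋ.src h)
  have hF : ∀ z k, F z k ≠ 0 → z ∈ {z : {z : Z // R.anchor z = ℋ.rng h} |
      z.1 ∈ closure {z | ξ z ≠ 0}} ∧ k ∈ {k : {k : H // ℋ.rng k = ℋ.src h} |
      ℋ.inv k.1 ∈ closure {h | c h ≠ 0}} := by
    intro z k hzk
    constructor
    · by_contra hz
      refine hzk ?_
      simp only [F, IsCc.eq_zero hz, _root_.map_zero, HilbertModule.zero_ip]
    · by_contra hk
      refine hzk ?_
      simp only [F, IsCc.eq_zero hk, tr_zero, HilbertModule.ract_zero, HilbertModule.ip_zero]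
  have h1 : R.innerSec ε ξ (R.rightSec ε η c) h = ∑ᶠ z, ∑ᶠ k, F z k := by
    refine finsum_congr fun z => ?_
    let f : E (ℋ.src h) →+ C (ℋ.src h) := AddMonoidHom.mk'
      (fun e => ip (ε.act (ℋ.inv h) ((ℋ.src_inv h).trans z.2.symm) (ℋ.rng_inv h) (ξ z.1)) e)
      (HilbertModule.ip_add _)
    have hfin : (Function.support fun k : {k : H // ℋ.rng k = ℋ.src h} =>
        (ract (ε.act k.1 (by rw [R.anchor_smul ((ℋ.rng_mul k.2.symm).trans z.2.symm),
        ℋ.src_mul k.2.symm]) k.2 (η (R.smul z.1 (ℋ.mul h k.1))))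
          (tr ((ℋ.src_inv k.1).trans k.2) (c (ℋ.inv k.1))) : E (ℋ.src h))).Finite := by
      refine ht.subset fun k hk => ?_
      by_contra hk'
      refine hk ?_
      simp only [IsCc.eq_zero hk', tr_zero, HilbertModule.ract_zero]
    refine Eq.trans (congrArg f ?_) (f.map_finsum hfin)
    rw [rightSec, tr_finsum]
    refine finsum_subtype_congr (fun k => by rw [R.anchor_smul z.2.symm]) fun k hk hk' => ?_
    refine (tr_ract _ _ _).trans ?_
    rw [HilbertAction.tr_act, tr_tr]
    congr 1
    exact HilbertAction.act_congr R rfl (R.smul_mul z.2.symm hk'.symm).symm _ _ _ _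
  have h2 : conv ℋ (A := C) (fun h hx hy => γ.act h hx hy) (R.innerSec ε ξ η) c h =
      ∑ᶠ k, ∑ᶠ z, F z k := by
    refine finsum_congr fun k => ?_
    beta_reduce
    rw [innerSec, γ.isIsoAction.map_finsum]
    have e1 : ∑ᶠ z : {z : Z // R.anchor z = ℋ.rng (ℋ.mul h k.1)},
        γ.act k.1 (ℋ.src_mul k.2.symm).symm k.2
          (ip (ε.act (ℋ.inv (ℋ.mul h k.1)) ((ℋ.src_inv _).trans z.2.symm) (ℋ.rng_inv _) (ξ z.1))
            (tr (R.anchor_smul z.2.symm) (η (R.smul z.1 (ℋ.mul h k.1)))) :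
              C (ℋ.src (ℋ.mul h k.1))) =
        ∑ᶠ z : {z : Z // R.anchor z = ℋ.rng h},
          (ip (ε.act (ℋ.inv h) ((ℋ.src_inv h).trans z.2.symm) (ℋ.rng_inv h) (ξ z.1))
            (ε.act k.1 (by rw [R.anchor_smul ((ℋ.rng_mul k.2.symm).trans z.2.symm),
              ℋ.src_mul k.2.symm]) k.2 (η (R.smul z.1 (ℋ.mul h k.1)))) : C (ℋ.src h)) := by
      refine finsum_subtype_congr (fun z => by rw [ℋ.rng_mul k.2.symm]) fun z hz hz' => ?_
      rw [HilbertAction.map_ip (ε := ε), HilbertAction.act_act, HilbertAction.act_tr]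
      congr 1
      refine HilbertAction.act_congr R ?_ rfl _ _ _ _
      rw [ℋ.mul_inv_rev k.2.symm, ℋ.mul_inv_cancel_left (by rw [ℋ.rng_inv, k.2])]
    rw [e1]
    refine Eq.trans ((AddMonoidHom.mulRight (tr ((ℋ.src_inv k.1).trans k.2)
      (c (ℋ.inv k.1)))).map_finsum ?_) ?_
    rotate_left
    · refine finsum_congr fun z => ?_
      simp only [F, HilbertModule.ip_ract]
      rfl
    · refine hs.subset fun z hz => ?_
      by_contra hz'
      refine hz ?_
      have h0 : ξ z.1 = 0 := IsCc.eq_zero hz'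
      simp only [h0, _root_.map_zero, HilbertModule.zero_ip]
  rw [h1, h2, finsum_comm_of_finite hs ht hF]

omit [T2Space Y] [T2Space H] [T2Space Z] [LocallyCompactSpace H] [LocallyCompactSpace Z] in
-- In `⟨ζ', ξ⟩(h⁻¹)` only the point `z h` contributes when `ζ (z h) ≠ 0`, since the anchor map is
-- injective on `U`. So the rank one operator given by `ζ` and `ζ'` acts at `z` as a sum over the
-- orbit of `z` of rank one operators on the fibre; this transfers fibrewise approximations to the
-- module.
theorem rightSec_innerSec {U : Set Z} (hU : U.InjOn R.anchor) {ζ ζ' ξ : ∀ z, E (R.anchor z)}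
    (hζ : ∀ z ∉ U, ζ z = 0) (hζ' : ∀ z ∉ U, ζ' z = 0) (z : Z) :
    R.rightSec ε ζ (R.innerSec ε ζ' ξ) z = ∑ᶠ h : {h : H // ℋ.rng h = R.anchor z},
      ract (ε.act h.1 (R.anchor_smul h.2).symm h.2 (ζ (R.smul z h.1)))
        (ip (ε.act h.1 (R.anchor_smul h.2).symm h.2 (ζ' (R.smul z h.1))) (ξ z) :
          C (R.anchor z)) := by
  refine finsum_congr fun h => ?_
  by_cases hz : R.smul z h.1 ∈ U
  · congr 1
    have e0 : R.anchor (R.smul z h.1) = ℋ.rng (ℋ.inv h.1) := by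
      rw [R.anchor_smul h.2, ℋ.rng_inv]
    rw [innerSec, finsum_eq_single _ ⟨R.smul z h.1, e0⟩]
    · refine (tr_ip _ _ _).trans ?_
      rw [HilbertAction.tr_act, tr_tr]
      congr 1
      · exact HilbertAction.act_congr R (ℋ.inv_inv _) rfl _ _ _ _
      · exact (sec_congr ξ (R.smul_smul_inv h.2) _ rfl)
    · rintro ⟨w, hw⟩ hne
      have : w ∉ U := fun hwU => hne (Subtype.ext (hU hwU hz (hw.trans e0.symm)))
      simp only [hζ' w this, _root_.map_zero, HilbertModule.zero_ip]
  · simp only [hζ _ hz, _root_.map_zero, HilbertModule.zero_ract]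

end RightAction

end Identities

attribute [local instance] CStarAlgebra.spectralOrder CStarAlgebra.spectralOrderedRing

/-! ### Sections supported in a compact set, and unit supported elements -/

section SectionAlgebra

variable {X : Type*} [TopologicalSpace X] {A : X → Type*} [∀ x, NonUnitalCStarAlgebra (A x)]
  [TopologicalSpace (Tot A)] [StarBundle A]

theorem isClosed_isContSec {Z : Type*} [TopologicalSpace Z] {p : Z → X} (hp : Continuous p) :
    IsClosed {ξ : lp (fun z => A (p z)) ∞ | IsContSec p fun z => ξ z} := by
  refine isClosed_of_closure_subset fun ξ hξ => IsContSec.of_approx hp fun z₀ r hr => ?_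
  obtain ⟨η, hη, h⟩ := Metric.mem_closure_iff.1 hξ r hr
  refine ⟨fun z => η z, hη, Eventually.of_forall fun z => ?_⟩
  rw [dist_eq_norm] at h
  exact (lp.norm_apply_le_norm (by simp) (ξ - η) z).trans_lt h

variable (A) in
/-- The C⋆-algebra of bounded continuous sections that vanish off `K`. -/
def secSubalgebra (K : Set X) : NonUnitalStarSubalgebra ℂ (lp A ∞) where
  carrier := {ξ | IsContSec (fun x : X => x) (fun x => ξ x)} ∩ {ξ | ∀ x ∉ K, ξ x = 0}
  add_mem' := by
    rintro ξ η ⟨h1, h2⟩ ⟨k1, k2⟩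
    exact ⟨h1.add k1, fun x hx => by simp [h2 x hx, k2 x hx]⟩
  zero_mem' := ⟨IsContSec.zero continuous_id, fun x _ => rfl⟩
  mul_mem' := by
    rintro ξ η ⟨h1, h2⟩ ⟨k1, k2⟩
    exact ⟨IsContSec.map₂' (m := fun a b => a * b) StarBundle.continuous_mul h1 k1,
      fun x hx => by simp [h2 x hx]⟩
  smul_mem' := by
    rintro c ξ ⟨h1, h2⟩
    exact ⟨h1.const_smul c, fun x hx => by simp [h2 x hx]⟩
  star_mem' := by
    rintro ξ ⟨h1, h2⟩
    exact ⟨(StarBundle.continuous_star (A := A)).comp h1, fun x hx => by simp [h2 x hx]⟩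

instance (K : Set X) : IsClosed (secSubalgebra A K : Set (lp A ∞)) := by
  refine (isClosed_isContSec continuous_id).inter ?_
  have : {ξ : lp A ∞ | ∀ x ∉ K, ξ x = 0} = ⋂ x ∈ Kᶜ, {ξ : lp A ∞ | ξ x = 0} := by
    ext ξ; simp
  rw [this]
  refine isClosed_biInter fun x _ => ?_
  have hc : Continuous fun ξ : lp A ∞ => ξ x :=
    AddMonoidHomClass.continuous_of_bound
      (AddMonoidHom.mk' (fun ξ : lp A ∞ => ξ x) fun _ _ => rfl) 1 fun ξ => by
        rw [one_mul]
        exact lp.norm_apply_le_norm (by simp) ξ x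
  exact isClosed_eq hc continuous_const

theorem mem_secSubalgebra {K : Set X} {k : ∀ x, A x} (hk : IsContSec (fun x : X => x) k)
    (hK : ∀ x ∉ K, k x = 0) {r : ℝ} (hr : ∀ x, ‖k x‖ ≤ r) :
    ∃ k' : secSubalgebra A K, (∀ x, k'.1 x = k x) ∧ (0 ≤ r → ‖k'‖ ≤ r) :=
  ⟨⟨⟨k, memℓp_infty ⟨r, by rintro _ ⟨x, rfl⟩; exact hr x⟩⟩, hk, hK⟩, fun _ => rfl,
    fun h0 => lp.norm_le_of_forall_le h0 hr⟩

variable {G : Type*} [TopologicalSpace G] (𝒢 : EtaleGroupoid G X)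

/-- The section over `G` supported on the units given by a section over the unit space. -/
def unitSec (k : ∀ x, A x) (g : G) : A (𝒢.src g) := open Classical in
  if g = 𝒢.one (𝒢.src g) then k (𝒢.src g) else 0

theorem unitSec_one (k : ∀ x, A x) (x : X) :
    unitSec 𝒢 k (𝒢.one x) = k (𝒢.src (𝒢.one x)) := by
  rw [unitSec, if_pos (by rw [𝒢.src_one])]

theorem unitSec_of_ne (k : ∀ x, A x) {g : G} (h : g ≠ 𝒢.one (𝒢.src g)) : unitSec 𝒢 k g = 0 :=
  if_neg h

theorem unitSec_add (k l : ∀ x, A x) (g : G) :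
    unitSec 𝒢 (fun x => k x + l x) g = unitSec 𝒢 k g + unitSec 𝒢 l g := by
  unfold unitSec; split_ifs <;> simp

theorem unitSec_smul (c : ℂ) (k : ∀ x, A x) (g : G) :
    unitSec 𝒢 (fun x => c • k x) g = c • unitSec 𝒢 k g := by
  unfold unitSec; split_ifs <;> simp

/-- Units form an open set because the groupoid is étale and a closed set because `G` is Hausdorff,
so extension by zero is continuous. -/
theorem isCc_unitSec [T2Space G] {K : Set X} (hK : IsCompact K) {k : ∀ x, A x}
    (hk : IsContSec (fun x : X => x) k) (h0 : ∀ x ∉ K, k x = 0) :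
    IsCc 𝒢.src (unitSec 𝒢 k) := by
  have hcl : IsClosed {g : G | g = 𝒢.one (𝒢.src g)} :=
    isClosed_eq continuous_id (𝒢.continuous_one.comp 𝒢.continuous_src)
  have hop : IsOpen {g : G | g = 𝒢.one (𝒢.src g)} := by
    convert 𝒢.isOpenEmbedding_one.isOpen_range using 1
    ext g
    constructor
    · intro h; exact ⟨_, Eq.symm h⟩
    · rintro ⟨x, rfl⟩
      change 𝒢.one x = _
      rw [𝒢.src_one]
  refine IsCc.of_eq_zero ?_ (hK.image 𝒢.continuous_one) fun g hg => ?_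
  · refine IsContSec.of_eventuallyEq fun g => ?_
    by_cases h : g = 𝒢.one (𝒢.src g)
    · refine ⟨fun g => k (𝒢.src g), IsContSec.comp hk 𝒢.continuous_src, ?_⟩
      filter_upwards [hop.mem_nhds h] with g' hg'
      exact if_pos hg'
    · refine ⟨fun g => 0, IsContSec.zero 𝒢.continuous_src, ?_⟩
      filter_upwards [hcl.isOpen_compl.mem_nhds h] with g' hg'
      exact if_neg hg'
  · by_cases h : g = 𝒢.one (𝒢.src g)
    · rw [unitSec, if_pos h, h0]
      exact fun hx => hg ⟨_, hx, h.symm⟩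
    · exact if_neg h

variable {act : ∀ {x y : X} (g : G), 𝒢.src g = x → 𝒢.rng g = y → A x → A y}

variable {𝒢}
-- Only the unit arrow contributes to the convolution. So sections on the units multiply pointwise
-- and act on the right as multipliers.
theorem IsStarAction.conv_unitSec (ha : IsStarAction 𝒢 act) (a : ∀ g, A (𝒢.src g)) (k : ∀ x, A x)
    (g : G) : conv 𝒢 act a (unitSec 𝒢 k) g = a g * k (𝒢.src g) := by
  have e : 𝒢.rng (𝒢.one (𝒢.src g)) = 𝒢.src g := 𝒢.rng_one _
  rw [conv, finsum_eq_single _ (⟨𝒢.one (𝒢.src g), e⟩ : {h : G // 𝒢.rng h = 𝒢.src g})]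
  · congr 1
    · dsimp only
      rw [ha.act_one]
      exact sec_congr a (𝒢.mul_one g) _ rfl
    · dsimp only
      rw [sec_congr (A := A) (p := 𝒢.src) (unitSec 𝒢 k) (𝒢.inv_one (𝒢.src g)) _
        (𝒢.src_one _), unitSec_one, sec_congr (A := A) (p := fun x => x) k (𝒢.src_one _) _ rfl]
      rfl
  · rintro ⟨h, hh⟩ hne
    rw [unitSec_of_ne, tr_zero, mul_zero]
    intro h1
    refine hne (Subtype.ext ?_)
    have h2 := congrArg 𝒢.inv h1
    rw [𝒢.inv_inv, 𝒢.inv_one, 𝒢.src_inv, hh] at h2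
    exact h2

theorem IsStarAction.adj_unitSec (ha : IsStarAction 𝒢 act) (k : ∀ x, A x) (g : G) :
    adj 𝒢 act (unitSec 𝒢 k) g = unitSec 𝒢 (fun x => star (k x)) g := by
  rw [adj]
  by_cases h : g = 𝒢.one (𝒢.src g)
  · obtain ⟨x, rfl⟩ : ∃ x, 𝒢.one x = g := ⟨_, h.symm⟩
    refine (raw_act_sec_congr (act := act) (p := 𝒢.src) (fun g => star (unitSec 𝒢 k g))
      (g' := 𝒢.one x) (z' := 𝒢.one x) (𝒢.inv_one x) (𝒢.inv_one x) _ _).trans ?_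
    rw [unitSec_one]
    refine (ha.act_one _ _ _).trans ?_
    rw [unitSec_one]
    rfl
  · rw [unitSec_of_ne _ _ h, unitSec_of_ne, star_zero, ha.map_zero]
    intro h1
    refine h ?_
    have h2 := congrArg 𝒢.inv h1
    rw [𝒢.inv_inv, 𝒢.inv_one, 𝒢.src_inv] at h2
    rw [h2, 𝒢.src_one]

/-- A section is supported in a bisection. -/
def IsBisecSec (b : ∀ g, A (𝒢.src g)) : Prop :=
  ∃ U : Set G, U.InjOn 𝒢.src ∧ U.InjOn 𝒢.rng ∧ ∀ g ∉ U, b g = 0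

/-- For a section supported in a bisection, `b^* b` is supported on the units. -/
theorem IsStarAction.exists_conv_adj_self [T2Space G] [T2Space X] [LocallyCompactSpace X]
    (ha : IsStarAction 𝒢 act) {b : ∀ g, A (𝒢.src g)}
    (hb : IsCc 𝒢.src b) (hbi : IsBisecSec b) : ∃ k : ∀ x, A x, IsContSec (fun x : X => x) k ∧
      (∃ K : Set X, IsCompact K ∧ ∀ x ∉ K, k x = 0) ∧
      (∀ r, (∀ g, ‖b g‖ ≤ r) → ∀ x, ‖k x‖ ≤ r ^ 2) ∧
      ∀ g, conv 𝒢 act (adj 𝒢 act b) b g = unitSec 𝒢 k g := by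
  obtain ⟨U, hs, hr, hU⟩ := hbi
  have hcc := ha.isCc_conv (ha.isCc_adj hb) hb
  set c := conv 𝒢 act (adj 𝒢 act b) b with hc
  have hterm : ∀ g, c g = ∑ᶠ h : {h : G // 𝒢.rng h = 𝒢.src g},
      act h.1 (by rw [𝒢.rng_inv, 𝒢.src_mul h.2.symm]) h.2
        (act (𝒢.inv (𝒢.mul g h.1)) rfl rfl (star (b (𝒢.inv (𝒢.mul g h.1))))) *
        tr ((𝒢.src_inv h.1).trans h.2) (b (𝒢.inv h.1)) := fun g => by
    refine finsum_congr fun h => ?_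
    congr 1
    rw [adj, ha.act_act]
    exact ha.act_act _ _ _ _ _ _ _
  -- In a nonzero term `(g h)⁻¹` and `h⁻¹` both lie in `U`. They have the same range, hence
  -- coincide, and `g h = h` makes `g` a unit.
  have hunit : ∀ g, g ≠ 𝒢.one (𝒢.src g) → c g = 0 := by
    intro g hg
    rw [hterm]
    refine (finsum_congr fun h => ?_).trans finsum_zero
    by_contra hne
    have h1 : 𝒢.inv (𝒢.mul g h.1) ∈ U := by
      by_contra h'
      exact hne (by rw [hU _ h', star_zero, ha.map_zero, ha.map_zero, zero_mul])
    have h2 : 𝒢.inv h.1 ∈ U := by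
      by_contra h'
      exact hne (by rw [hU _ h', tr_zero, mul_zero])
    have h3 := hr h1 h2 (by rw [𝒢.rng_inv, 𝒢.rng_inv, 𝒢.src_mul h.2.symm])
    have h4 := congrArg 𝒢.inv h3
    rw [𝒢.inv_inv, 𝒢.inv_inv] at h4
    have h5 := 𝒢.mul_inv_cancel_right h.2.symm
    rw [h4, 𝒢.mul_inv, h.2] at h5
    exact hg h5.symm
  -- The source is injective on `U`, which leaves at most one term in the sum at a unit.
  have hnorm : ∀ r, (∀ g, ‖b g‖ ≤ r) → ∀ x, ‖c (𝒢.one x)‖ ≤ r ^ 2 := by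
    intro r hbr x
    rw [hterm]
    by_cases hex : ∃ h : {h : G // 𝒢.rng h = 𝒢.src (𝒢.one x)}, 𝒢.inv h.1 ∈ U
    · obtain ⟨h, hh⟩ := hex
      rw [finsum_eq_single _ h]
      · refine (norm_mul_le _ _).trans ?_
        rw [ha.norm_map, ha.norm_map, norm_star, norm_tr, sq]
        exact mul_le_mul (hbr _) (hbr _) (norm_nonneg _) ((norm_nonneg _).trans (hbr (𝒢.inv h.1)))
      · intro h' hne
        have : 𝒢.inv h'.1 ∉ U := fun h'' => hne (Subtype.ext (by
          have := hs h'' hh (by rw [𝒢.src_inv, 𝒢.src_inv, h.2, h'.2])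
          simpa using congrArg 𝒢.inv this))
        rw [hU _ this, tr_zero, mul_zero]
    · push Not at hex
      rw [finsum_congr (g := fun _ => 0) fun h => by rw [hU _ (hex h), tr_zero, mul_zero],
        finsum_zero, norm_zero]
      positivity
  refine ⟨fun x => tr (𝒢.src_one x) (c (𝒢.one x)), ?_, ?_, ?_, ?_⟩
  · exact (IsContSec.comp hcc.1 𝒢.continuous_one).congr_base _
  · refine ⟨_, hcc.2.image 𝒢.continuous_src, fun x hx => ?_⟩
    rw [tr_eq_zero]
    refine IsCc.eq_zero (p := 𝒢.src) (a := c) fun h => hx ⟨_, h, 𝒢.src_one x⟩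
  · intro r hr x
    rw [norm_tr]
    exact hnorm r hr x
  · intro g
    by_cases h : g = 𝒢.one (𝒢.src g)
    · rw [unitSec, if_pos h]
      exact sec_congr (p := 𝒢.src) c h rfl _
    · rw [hunit g h, unitSec_of_ne _ _ h]

/-- Sections supported in a compact set are sums of a bounded number of sections supported in
bisections. -/
theorem exists_bisec_decomposition [T2Space G] [LocallyCompactSpace G] {L : Set G}
    (hL : IsCompact L) :
    ∃ n : ℕ, ∀ a : ∀ g, A (𝒢.src g), IsCc 𝒢.src a → (∀ g ∉ L, a g = 0) →
      ∃ b : Fin n → ∀ g, A (𝒢.src g), (∀ i, IsCc 𝒢.src (b i)) ∧ (∀ i, IsBisecSec (b i)) ∧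
        (∀ i g, ‖b i g‖ ≤ ‖a g‖) ∧ ∀ g, a g = ∑ i, b i g := by
  choose U hU hUs using 𝒢.isEtaleMap_src.exists_injOn
  choose V hV hVr using 𝒢.isEtaleMap_rng.exists_injOn
  obtain ⟨n, t, χ, -, h2, h3, h4, h5, -⟩ := exists_partition hL (fun g => U g ∩ V g)
    fun g _ => inter_mem (hU g) (hV g)
  refine ⟨n, fun a ha haL => ⟨fun i g => (χ i g : ℂ) • a g, fun i => ha.smul (by fun_prop),
    fun i => ⟨U (t i) ∩ V (t i), (hUs _).mono Set.inter_subset_left,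
      (hVr _).mono Set.inter_subset_right, fun g hg => ?_⟩, fun i g => ?_, fun g => ?_⟩⟩
  · have : χ i g = 0 := image_eq_zero_of_notMem_tsupport fun h => hg (h2 i h)
    beta_reduce
    rw [this, Complex.ofReal_zero, zero_smul]
  · rw [norm_smul, Complex.norm_real, Real.norm_of_nonneg (h4 i g)]
    exact mul_le_of_le_one_left (norm_nonneg _) (h5 i g)
  · by_cases hg : g ∈ L
    · rw [← Finset.sum_smul, ← Complex.ofReal_sum, h3 g hg, Complex.ofReal_one, one_smul]
    · simp [haL g hg]

end SectionAlgebra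

attribute [local instance] CStarAlgebra.spectralOrder CStarAlgebra.spectralOrderedRing

/-! ### Representations of convolution algebras -/

section Submodule

variable {X : Type*} [TopologicalSpace X] (A : X → Type*) [∀ x, NormedAddCommGroup (A x)]
  [∀ x, NormedSpace ℂ (A x)] [TopologicalSpace (Tot A)] [ApproxBundle A] {Z : Type*}
  [TopologicalSpace Z] {p : Z → X}

/-- The vector space of compactly supported continuous sections. -/
def ccSub (hp : Continuous p) : Submodule ℂ (∀ z, A (p z)) where
  carrier := {a | IsCc p a}
  add_mem' := IsCc.add
  zero_mem' := IsCc.zero hp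
  smul_mem' c _ h := h.const_smul c

end Submodule

section Representations

variable {G : Type uG} {X : Type uX} [TopologicalSpace G] [TopologicalSpace X]
  {𝒢 : EtaleGroupoid G X} {A : X → Type uA}
  [∀ x, NonUnitalCStarAlgebra (A x)] [TopologicalSpace (Tot A)] [StarBundle A]
  {act : ∀ {x y : X} (g : G), 𝒢.src g = x → 𝒢.rng g = y → A x → A y}

namespace IsStarRep

section

variable {D : Type uD} [NonUnitalCStarAlgebra D] {π : Cc A 𝒢.src → D} (hπ : IsStarRep 𝒢 act π)
include hπ

/-- A representation, as a linear map. -/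
def lin : ccSub A 𝒢.continuous_src →ₗ[ℂ] D where
  toFun a := π ⟨a.1, a.2⟩
  map_add' a b := hπ.map_add ⟨a.1, a.2⟩ ⟨b.1, b.2⟩ ⟨(a + b).1, (a + b).2⟩ fun _ => rfl
  map_smul' t a := hπ.map_smul t ⟨a.1, a.2⟩ ⟨(t • a).1, (t • a).2⟩ fun _ => rfl

theorem map_sum {ι : Type*} (s : Finset ι) (b : ι → Cc A 𝒢.src) (a : Cc A 𝒢.src)
    (h : ∀ g, a.1 g = ∑ i ∈ s, (b i).1 g) : π a = ∑ i ∈ s, π (b i) := by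
  have h1 := _root_.map_sum hπ.lin (fun i => (⟨(b i).1, (b i).2⟩ : ccSub A 𝒢.continuous_src)) s
  refine Eq.trans ?_ h1
  refine congrArg hπ.lin (a₁ := ⟨a.1, a.2⟩) (Subtype.ext (funext fun g => ?_))
  rw [AddSubmonoidClass.coe_finsetSum, Finset.sum_apply]
  exact h g

theorem congr {a b : Cc A 𝒢.src} (h : ∀ g, a.1 g = b.1 g) : π a = π b :=
  congrArg π (Subtype.ext (funext h))

variable [T2Space G] (ha : IsStarAction 𝒢 act)
include ha

/-- A representation, restricted to the sections on the units supported in `K`. -/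
def unitHom {K : Set X} (hK : IsCompact K) : secSubalgebra A K →⋆ₙₐ[ℂ] D where
  toFun k := π ⟨unitSec 𝒢 fun x => k.1 x, isCc_unitSec 𝒢 hK k.2.1 k.2.2⟩
  map_smul' c k := hπ.map_smul c _ _ fun g => unitSec_smul 𝒢 c _ g
  map_zero' := by
    refine (hπ.congr (b := ⟨fun _ => 0, IsCc.zero 𝒢.continuous_src⟩) fun g => ?_).trans
      hπ.lin.map_zero
    change unitSec 𝒢 (fun x => (0 : A x)) g = 0
    unfold unitSec
    split_ifs <;> rfl
  map_add' k l := hπ.map_add _ _ _ fun g => unitSec_add 𝒢 _ _ g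
  map_mul' k l := hπ.map_mul _ _ _ fun g => by
    refine Eq.trans ?_ (ha.conv_unitSec _ _ g).symm
    change unitSec 𝒢 (fun x => k.1 x * l.1 x) g = unitSec 𝒢 (fun x => k.1 x) g * l.1 (𝒢.src g)
    unfold unitSec
    split_ifs
    · rfl
    · exact (zero_mul _).symm
  map_star' k := hπ.map_star _ _ fun g => (ha.adj_unitSec _ g).symm

/-- No continuity of `π` is assumed. It is automatic here: the sections vanishing off `K` form a
C⋆-algebra under the supremum norm, and `π` is a ⋆-homomorphism on it. -/
theorem norm_unitSec_le {k : ∀ x, A x} (hk : IsContSec (fun x : X => x) k) {K : Set X}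
    (hK : IsCompact K) (h0 : ∀ x ∉ K, k x = 0) {r : ℝ} (hr : 0 ≤ r) (hkr : ∀ x, ‖k x‖ ≤ r)
    (hc : IsCc 𝒢.src (unitSec 𝒢 k)) : ‖π ⟨unitSec 𝒢 k, hc⟩‖ ≤ r := by
  obtain ⟨k', h1, h2⟩ := mem_secSubalgebra hk h0 hkr
  refine le_trans ?_ (h2 hr)
  have h3 := NonUnitalStarAlgHom.norm_apply_le (hπ.unitHom ha hK) k'
  have h4 : hπ.unitHom ha hK k' = π ⟨unitSec 𝒢 k, hc⟩ := hπ.congr fun g => by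
    change unitSec 𝒢 (fun x => k'.1 x) g = _
    rw [funext h1]
  rwa [h4] at h3

variable [T2Space X] [LocallyCompactSpace X]

/-- `‖π b‖² = ‖π (b⋆ b)‖`, and `b⋆ b` is a section on the units bounded by `r²`. -/
theorem norm_le_of_isBisecSec {b : Cc A 𝒢.src} (hb : IsBisecSec b.1) {r : ℝ} (hr : 0 ≤ r)
    (hbr : ∀ g, ‖b.1 g‖ ≤ r) : ‖π b‖ ≤ r := by
  obtain ⟨k, hk, ⟨K, hK, h0⟩, hkn, hconv⟩ := ha.exists_conv_adj_self b.2 hb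
  have h1 : π ⟨unitSec 𝒢 k, isCc_unitSec 𝒢 hK hk h0⟩ = star (π b) * π b := by
    rw [← hπ.map_star b ⟨_, ha.isCc_adj b.2⟩ fun g => rfl]
    exact hπ.map_mul _ _ _ fun g => (hconv g).symm
  have h2 := hπ.norm_unitSec_le ha hk hK h0 (sq_nonneg r) (hkn r hbr) (isCc_unitSec 𝒢 hK hk h0)
  rw [h1, CStarRing.norm_star_mul_self, ← sq] at h2
  exact le_of_sq_le_sq h2 hr

end

end IsStarRep

section

variable [T2Space G] [T2Space X] [LocallyCompactSpace X] (ha : IsStarAction 𝒢 act)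
include ha

/-- All representations are bounded by the supremum norm on sections supported in a fixed compact
set. -/
theorem IsStarAction.exists_norm_bound {L : Set G} (hL : IsCompact L) :
    ∃ c : ℝ, 0 ≤ c ∧ ∀ {D : Type uD} [NonUnitalCStarAlgebra D] {π : Cc A 𝒢.src → D},
      IsStarRep 𝒢 act π → ∀ a : Cc A 𝒢.src, (∀ g ∉ L, a.1 g = 0) → ∀ r : ℝ, 0 ≤ r →
        (∀ g, ‖a.1 g‖ ≤ r) → ‖π a‖ ≤ c * r := by
  have := 𝒢.locallyCompactSpace
  obtain ⟨n, hn⟩ := exists_bisec_decomposition (A := A) (𝒢 := 𝒢) hL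
  refine ⟨n, n.cast_nonneg, fun {D _ π} hπ a haL r hr har => ?_⟩
  obtain ⟨b, hb, hbi, hbn, hab⟩ := hn a.1 a.2 haL
  rw [hπ.map_sum Finset.univ (fun i => ⟨b i, hb i⟩) a hab]
  refine (norm_sum_le _ _).trans ((Finset.sum_le_sum fun i _ =>
    hπ.norm_le_of_isBisecSec ha (hbi i) hr fun g => (hbn i g).trans (har g)).trans ?_)
  simp

/-- The convolution algebra is well-defined and has a finite maximal C⋆-norm. -/
theorem IsStarAction.isConvAlgebra : IsConvAlgebra 𝒢 act where
  add a b := a.2.add b.2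
  smul t a := a.2.const_smul t
  conv a b := ha.isCc_conv a.2 b.2
  adj a := ha.isCc_adj a.2
  bddAbove a := by
    obtain ⟨c, -, h⟩ := ha.exists_norm_bound a.2.2
    obtain ⟨r, hr, har⟩ := a.2.exists_bound
    refine ⟨c * r, ?_⟩
    rintro _ ⟨i, rfl⟩
    exact h i.isStarRep a (fun g hg => IsCc.eq_zero hg) r hr.le har

theorem IsStarAction.universalRep_apply (a : Cc A 𝒢.src) (i : ConvRep 𝒢 act) :
    universalRep 𝒢 act a i = i.π a := by
  rw [universalRep, dif_pos (memℓp_infty (ha.isConvAlgebra.bddAbove a))]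

theorem IsStarAction.isStarRep_crossedι : IsStarRep 𝒢 act (crossedι 𝒢 act) where
  map_add a b c h := Subtype.ext (lp.ext (funext fun i => by
    change universalRep 𝒢 act c i = universalRep 𝒢 act a i + universalRep 𝒢 act b i
    simp only [ha.universalRep_apply]
    exact i.isStarRep.map_add a b c h))
  map_smul t a b h := Subtype.ext (lp.ext (funext fun i => by
    change universalRep 𝒢 act b i = t • universalRep 𝒢 act a i
    simp only [ha.universalRep_apply]
    exact i.isStarRep.map_smul t a b h))
  map_mul a b c h := Subtype.ext (lp.ext (funext fun i => by
    change universalRep 𝒢 act c i = universalRep 𝒢 act a i * universalRep 𝒢 act b i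
    simp only [ha.universalRep_apply]
    exact i.isStarRep.map_mul a b c h))
  map_star a b h := Subtype.ext (lp.ext (funext fun i => by
    change universalRep 𝒢 act b i = star (universalRep 𝒢 act a i)
    simp only [ha.universalRep_apply]
    exact i.isStarRep.map_star a b h))

/-- The range of a representation is a star subalgebra. -/
def IsStarAction.range {D : Type uD} [NonUnitalCStarAlgebra D] {π : Cc A 𝒢.src → D}
    (hπ : IsStarRep 𝒢 act π) : NonUnitalStarSubalgebra ℂ D where
  carrier := Set.range π
  add_mem' := by
    rintro _ _ ⟨a, rfl⟩ ⟨b, rfl⟩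
    exact ⟨_, hπ.map_add a b ⟨_, a.2.add b.2⟩ fun _ => rfl⟩
  zero_mem' := ⟨_, hπ.lin.map_zero⟩
  mul_mem' := by
    rintro _ _ ⟨a, rfl⟩ ⟨b, rfl⟩
    exact ⟨_, hπ.map_mul a b ⟨_, ha.isCc_conv a.2 b.2⟩ fun _ => rfl⟩
  smul_mem' := by
    rintro t _ ⟨a, rfl⟩
    exact ⟨_, hπ.map_smul t a ⟨_, a.2.const_smul t⟩ fun _ => rfl⟩
  star_mem' := by
    rintro _ ⟨a, rfl⟩
    exact ⟨_, hπ.map_star a ⟨_, ha.isCc_adj a.2⟩ fun _ => rfl⟩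

theorem IsStarAction.isStarRep_universalRep : IsStarRep 𝒢 act (universalRep 𝒢 act) where
  map_add a b c h := congrArg Subtype.val (ha.isStarRep_crossedι.map_add a b c h)
  map_smul t a b h := congrArg Subtype.val (ha.isStarRep_crossedι.map_smul t a b h)
  map_mul a b c h := congrArg Subtype.val (ha.isStarRep_crossedι.map_mul a b c h)
  map_star a b h := congrArg Subtype.val (ha.isStarRep_crossedι.map_star a b h)

/-- The image of the universal representation is already a ⋆-subalgebra, so adjoining adds nothing
to it. -/
theorem IsStarAction.denseRange_crossedι : DenseRange (crossedι 𝒢 act) := by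
  intro x
  have h1 : NonUnitalStarAlgebra.adjoin ℂ (Set.range (universalRep 𝒢 act)) ≤
      ha.range ha.isStarRep_universalRep := NonUnitalStarAlgebra.adjoin_le (le_refl _)
  have h2 : x.1 ∈ closure (Set.range (universalRep 𝒢 act)) := closure_mono h1 x.2
  refine Metric.mem_closure_iff.2 fun δ hδ => ?_
  obtain ⟨_, ⟨a, rfl⟩, h⟩ := Metric.mem_closure_iff.1 h2 δ hδ
  exact ⟨_, ⟨a, rfl⟩, h⟩

end

end Representations

attribute [local instance] CStarAlgebra.spectralOrder CStarAlgebra.spectralOrderedRing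

/-! ### Extension of representations to the crossed product -/

/-- A C⋆-algebra structure can be transported along a bijection. -/
theorem exists_cstar_of_equiv {S D : Type*} [NonUnitalCStarAlgebra D] (e : S ≃ D) :
    ∃ _ : NonUnitalCStarAlgebra S, Nonempty (S ≃⋆ₐ[ℂ] D) := by
  let _ : NonUnitalRing (S) := e.nonUnitalRing
  let _ : Module ℂ (S) := e.module ℂ
  let f : S →ₙ+* D :=
    { toFun := e
      map_mul' := fun a b => e.apply_symm_apply _
      map_zero' := e.apply_symm_apply _
      map_add' := fun a b => e.apply_symm_apply _ }
  have hsmul : ∀ (c : ℂ) a, f (c • a) = c • f a := fun c a => e.apply_symm_apply _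
  let i1 : NonUnitalNormedRing (S) := NonUnitalNormedRing.induced _ _ f e.injective
  have hnorm : ∀ a, ‖f a‖ = ‖a‖ := fun a => rfl
  let _ : NormedSpace ℂ (S) :=
    { norm_smul_le := fun c a => by
        change ‖f (c • a)‖ ≤ ‖c‖ * ‖f a‖
        rw [hsmul, norm_smul] }
  let _ : StarRing (S) :=
    { star := fun a => e.symm (star (e a))
      star_involutive := fun a => e.injective (by simp)
      star_mul := fun a b => e.injective (by
        change e (e.symm (star (f (a * b)))) = f (e.symm (star (e b)) * e.symm (star (e a)))
        rw [map_mul, map_mul, star_mul, e.apply_symm_apply]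
        congr 1 <;> exact (e.apply_symm_apply _).symm)
      star_add := fun a b => e.injective (by
        change e (e.symm (star (f (a + b)))) = f (e.symm (star (e a)) + e.symm (star (e b)))
        rw [map_add, map_add, star_add, e.apply_symm_apply]
        congr 1 <;> exact (e.apply_symm_apply _).symm) }
  have hstar : ∀ a, f (star a) = star (f a) := fun a => e.apply_symm_apply _
  have hiso : Isometry f := AddMonoidHomClass.isometry_of_norm f hnorm
  have hcomp : CompleteSpace (S) :=
    (completeSpace_congr (e := e) hiso.isUniformEmbedding).2 inferInstance
  let _ : CStarRing (S) := ⟨fun a => by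
    rw [← hnorm, ← hnorm, map_mul, hstar, CStarRing.norm_star_mul_self]⟩
  let _ : IsScalarTower ℂ (S) (S) := ⟨fun c a b => e.injective (by
    change f ((c • a) * b) = f (c • (a * b))
    rw [map_mul, hsmul, hsmul, map_mul, smul_mul_assoc])⟩
  let _ : SMulCommClass ℂ (S) (S) := ⟨fun c a b => e.injective (by
    change f (c • (a * b)) = f (a * (c • b))
    rw [map_mul, hsmul, hsmul, map_mul, mul_smul_comm])⟩
  let _ : StarModule ℂ (S) := ⟨fun c a => e.injective (by
    change f (star (c • a)) = f (star c • star a)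
    rw [hstar, hsmul, hsmul, hstar, star_smul])⟩
  let _ : NonUnitalCStarAlgebra (S) := { }
  exact ⟨inferInstance, ⟨
    { e with
      map_mul' := map_mul f
      map_add' := map_add f
      map_star' := hstar
      map_smul' := hsmul }⟩⟩

theorem CStarAlgebra.exists_norm_sub_mul_lt {S : Type*} [NonUnitalCStarAlgebra S] (k : S) {δ : ℝ}
    (hδ : 0 < δ) : ∃ u : S, ‖u‖ ≤ 1 ∧ ‖k - k * u‖ < δ := by
  have happ := CStarAlgebra.increasingApproximateUnit S
  have h3 : Tendsto (fun u => ‖k - k * u‖) (CStarAlgebra.approximateUnit S) (𝓝 ‖k - k‖) :=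
    ((happ.tendsto_mul_left k).const_sub _).norm
  rw [sub_self, norm_zero] at h3
  have := happ.neBot
  exact (happ.eventually_norm.and (h3.eventually_lt_const hδ)).exists

section Representations

variable {G : Type uG} {X : Type uX} [TopologicalSpace G] [TopologicalSpace X]
  {𝒢 : EtaleGroupoid G X} {A : X → Type uA}
  [∀ x, NonUnitalCStarAlgebra (A x)] [TopologicalSpace (Tot A)] [StarBundle A]
  {act : ∀ {x y : X} (g : G), 𝒢.src g = x → 𝒢.rng g = y → A x → A y}

/-- Evaluation of elements of the crossed product in a representation. -/
def ConvRep.eval (i : ConvRep 𝒢 act) : CrossedProduct 𝒢 act →⋆ₙₐ[ℂ] i.D where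
  toFun x := x.1 i
  map_smul' _ _ := rfl
  map_zero' := rfl
  map_add' _ _ := rfl
  map_mul' _ _ := rfl
  map_star' _ := rfl

theorem IsStarRep.comp {D : Type*} [NonUnitalCStarAlgebra D] {π : Cc A 𝒢.src → D}
    (hπ : IsStarRep 𝒢 act π) {D' : Type*} [NonUnitalCStarAlgebra D'] (Φ : D →⋆ₙₐ[ℂ] D') :
    IsStarRep 𝒢 act fun a => Φ (π a) where
  map_add a b c h := by rw [hπ.map_add a b c h, _root_.map_add]
  map_smul t a b h := by rw [hπ.map_smul t a b h, _root_.map_smul]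
  map_mul a b c h := by rw [hπ.map_mul a b c h, _root_.map_mul]
  map_star a b h := by rw [hπ.map_star a b h, StarHomClass.map_star]

variable [T2Space G] [T2Space X] [LocallyCompactSpace X] (ha : IsStarAction 𝒢 act)
include ha

/-- The universal representation only runs over C⋆-algebras in a fixed universe. A representation
elsewhere is replaced by the closure of its range, copied into that universe; it is then one of the
coordinates of the universal representation. -/
theorem IsStarAction.exists_hom {D : Type uD} [NonUnitalCStarAlgebra D] {π : Cc A 𝒢.src → D}
    (hπ : IsStarRep 𝒢 act π) :
    ∃ Φ : CrossedProduct 𝒢 act →⋆ₙₐ[ℂ] D, ∀ a, Φ (crossedι 𝒢 act a) = π a := by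
  let S := (ha.range hπ).topologicalClosure
  have hS : IsClosed (S : Set D) := NonUnitalStarSubalgebra.isClosed_topologicalClosure _
  let _ : NonUnitalCStarAlgebra S := NonUnitalStarSubalgebra.nonUnitalCStarAlgebra S (h_closed := hS)
  have hmem : ∀ a, π a ∈ S := fun a => NonUnitalStarSubalgebra.le_topologicalClosure _ ⟨a, rfl⟩
  -- Each element of the closure is the limit of a sequence of values of `π`, so the closure injects
  -- into the sequences in `Γ_c`.
  have hsmall : Small.{max uG uA} S := by
    have hA : Small.{max uG uA} (Cc A 𝒢.src) := by
      unfold Cc; infer_instance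
    have key : ∀ d : S, ∃ s : ℕ → Cc A 𝒢.src, Tendsto (fun n => π (s n)) atTop (𝓝 d.1) := by
      intro d
      obtain ⟨u, hu, hd⟩ := mem_closure_iff_seq_limit.1
        (show d.1 ∈ closure (Set.range π) from d.2)
      choose s hs using hu
      exact ⟨s, by simpa [hs] using hd⟩
    choose s hs using key
    have hinj : Function.Injective s := fun d d' h => Subtype.ext <|
      tendsto_nhds_unique (hs d) (by rw [h]; exact hs d')
    exact small_of_injective hinj
  obtain ⟨D', ⟨e₀⟩⟩ : ∃ D' : Type (max uG uA), Nonempty (D' ≃ S) :=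
    ⟨Shrink.{max uG uA} S, ⟨(equivShrink S).symm⟩⟩
  obtain ⟨_, ⟨e⟩⟩ := exists_cstar_of_equiv e₀
  have h1 : IsStarRep 𝒢 act (fun a => (⟨π a, hmem a⟩ : S)) :=
    { map_add := fun a b c h => Subtype.ext (hπ.map_add a b c h)
      map_smul := fun t a b h => Subtype.ext (hπ.map_smul t a b h)
      map_mul := fun a b c h => Subtype.ext (hπ.map_mul a b c h)
      map_star := fun a b h => Subtype.ext (hπ.map_star a b h) }
  let i : ConvRep 𝒢 act :=
    { D := D'
      π := fun a => e.symm ⟨π a, hmem a⟩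
      isStarRep := h1.comp (e.symm : S →⋆ₙₐ[ℂ] D') }
  refine ⟨(NonUnitalStarSubalgebraClass.subtype S).comp
    ((e : D' →⋆ₙₐ[ℂ] S).comp i.eval), fun a => ?_⟩
  change (e (universalRep 𝒢 act a i)).1 = π a
  rw [ha.universalRep_apply]
  change (e (e.symm ⟨π a, hmem a⟩)).1 = π a
  rw [e.apply_symm_apply]

/-- Elements of the crossed product are approximated by sums of products with elements supported on
the units. -/
theorem IsStarAction.exists_mul_unitSec (b : Cc A 𝒢.src) {δ : ℝ} (hδ : 0 < δ) :
    ∃ (n : ℕ) (c : Fin n → Cc A 𝒢.src) (u : Fin n → ∀ x, A x) (K : Set X) (_ : IsCompact K)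
      (hu : ∀ i, IsContSec (fun x : X => x) (u i)) (h0 : ∀ i, ∀ x ∉ K, u i x = 0),
      ‖crossedι 𝒢 act b - ∑ i, crossedι 𝒢 act (c i) *
        crossedι 𝒢 act ⟨unitSec 𝒢 (u i), isCc_unitSec 𝒢 ‹_› (hu i) (h0 i)⟩‖ < δ := by
  have := 𝒢.locallyCompactSpace
  have hι := ha.isStarRep_crossedι
  obtain ⟨n, hn⟩ := exists_bisec_decomposition (A := A) (𝒢 := 𝒢) b.2.2
  obtain ⟨c, hc, hci, -, hbc⟩ := hn b.1 b.2 fun g hg => IsCc.eq_zero hg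
  choose k hk hK hkn hconv using fun i => ha.exists_conv_adj_self (hc i) (hci i)
  choose K hK h1 using hK
  set L := ⋃ i, K i with hL
  have hLc : IsCompact L := isCompact_iUnion hK
  have hkL : ∀ i, ∀ x ∉ L, k i x = 0 := fun i x hx => h1 i x fun h => hx (Set.mem_iUnion.2 ⟨i, h⟩)
  have hkb : ∀ i, ∃ k' : secSubalgebra A L, ∀ x, k'.1 x = k i x := fun i => by
    obtain ⟨r, -, hr⟩ := (hc i).exists_bound
    obtain ⟨k', h, -⟩ := mem_secSubalgebra (hk i) (hkL i) (hkn i r hr)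
    exact ⟨k', h⟩
  choose k' hk' using hkb
  set Φ := hι.unitHom ha hLc with hΦ
  -- The square of the error of one term is at most `2η = (δ / (n + 1))²`, and `n` such errors add
  -- up to less than `δ`.
  set η : ℝ := (δ / (n + 1)) ^ 2 / 2 with hη
  have hηp : 0 < η := by positivity
  have hev := fun i => CStarAlgebra.exists_norm_sub_mul_lt (k' i) hηp
  choose u hu1 hu2 using hev
  refine ⟨n, fun i => ⟨c i, hc i⟩, fun i x => (u i).1 x, L, hLc, fun i => (u i).2.1,
    fun i => (u i).2.2, ?_⟩
  have hterm : ∀ i, ‖crossedι 𝒢 act ⟨c i, hc i⟩ - crossedι 𝒢 act ⟨c i, hc i⟩ * Φ (u i)‖ ≤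
      δ / (n + 1) := by
    intro i
    set β := crossedι 𝒢 act ⟨c i, hc i⟩ with hβ
    have e1 : star β * β = Φ (k' i) := by
      rw [← hι.map_star ⟨c i, hc i⟩ ⟨_, ha.isCc_adj (hc i)⟩ fun g => rfl]
      refine (hι.map_mul _ _ _ fun g => ?_).symm
      refine Eq.trans ?_ (hconv i g).symm
      change unitSec 𝒢 (fun x => (k' i).1 x) g = _
      rw [funext (hk' i)]
    -- With `β⋆β = Φ(k)`, the square of the error is a combination of `k - k u`, which is small as
    -- `u` is almost a unit for `k`.
    have e2 : star (β - β * Φ (u i)) * (β - β * Φ (u i)) =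
        Φ (k' i - k' i * u i) - star (Φ (u i)) * Φ (k' i - k' i * u i) := by
      rw [_root_.map_sub, _root_.map_mul, ← e1]
      simp only [star_sub, star_mul, sub_mul, mul_sub, mul_assoc]
      abel
    refine le_of_sq_le_sq ?_ (by positivity)
    rw [sq, ← CStarRing.norm_star_mul_self, e2]
    have h4 := NonUnitalStarAlgHom.norm_apply_le Φ (k' i - k' i * u i)
    have h5 := NonUnitalStarAlgHom.norm_apply_le Φ (u i)
    calc _ ≤ ‖Φ (k' i - k' i * u i)‖ + ‖star (Φ (u i)) * Φ (k' i - k' i * u i)‖ := norm_sub_le _ _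
      _ ≤ ‖Φ (k' i - k' i * u i)‖ + 1 * ‖Φ (k' i - k' i * u i)‖ := by
          gcongr
          refine (norm_mul_le _ _).trans ?_
          gcongr
          rw [norm_star]
          exact h5.trans (hu1 i)
      _ ≤ η + 1 * η := by gcongr <;> exact h4.trans (hu2 i).le
      _ = _ := by rw [hη]; ring
  rw [hι.map_sum Finset.univ (fun i => ⟨c i, hc i⟩) b hbc, ← Finset.sum_sub_distrib]
  refine (norm_sum_le _ _).trans_lt ((Finset.sum_le_sum fun i _ => hterm i).trans_lt ?_)
  rw [Finset.sum_const, Finset.card_univ, Fintype.card_fin, nsmul_eq_mul, ← mul_div_assoc,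
    div_lt_iff₀ (by positivity)]
  nlinarith

end Representations

attribute [local instance] CStarAlgebra.spectralOrder CStarAlgebra.spectralOrderedRing

/-! ### Representations on pre-Hilbert modules -/

namespace HilbertModule

variable {Q M : Type*} [NonUnitalCStarAlgebra Q] [NormedAddCommGroup M]
  [NormedSpace ℂ M] [CompleteSpace M] [HilbertModule Q M]

theorem continuous_ip_right (m : M) : Continuous fun n : M => (ip m n : Q) :=
  AddMonoidHomClass.continuous_of_bound
    (AddMonoidHom.mk' (fun n => (ip m n : Q)) (HilbertModule.ip_add m)) ‖m‖
    (HilbertModule.norm_ip_le m)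

theorem continuous_ip_left (m : M) : Continuous fun n : M => (ip n m : Q) := by
  simp_rw [← HilbertModule.star_ip (Q := Q) m]
  exact continuous_star.comp (continuous_ip_right m)

variable {V : Type*} {j : V → M} (hj : DenseRange j)
include hj

theorem _root_.AdjOp.ext_of_dense {S T : AdjOp Q M} (h : ∀ v, S.1 (j v) = T.1 (j v)) : S = T :=
  Subtype.ext (ContinuousLinearMap.ext fun m => congrFun
    (hj.equalizer S.1.continuous T.1.continuous (funext h)) m)

theorem _root_.AdjOp.star_eq_of_dense {S T : AdjOp Q M}
    (h : ∀ v w, (ip (T.1 (j v)) (j w) : Q) = ip (j v) (S.1 (j w))) : star T = S := by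
  refine AdjOp.star_eq_of fun m n => ?_
  refine hj.induction_on (p := fun m => (ip (T.1 m) n : Q) = ip m (S.1 n))
    m (isClosed_eq ((continuous_ip_left n).comp T.1.continuous) (continuous_ip_left _)) fun v => ?_
  exact hj.induction_on (p := fun n => (ip (T.1 (j v)) n : Q) = ip (j v) (S.1 n)) n
    (isClosed_eq (continuous_ip_right _) ((continuous_ip_right _).comp S.1.continuous)) (h v)

end HilbertModule

section Representations

variable {G : Type uG} {X : Type uX} [TopologicalSpace G] [TopologicalSpace X]
  {𝒢 : EtaleGroupoid G X} {A : X → Type uA}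
  [∀ x, NonUnitalCStarAlgebra (A x)] [TopologicalSpace (Tot A)] [StarBundle A]
  {act : ∀ {x y : X} (g : G), 𝒢.src g = x → 𝒢.rng g = y → A x → A y}

/-- Sections over the units, as elements of the convolution algebra. -/
def unitLin [T2Space G] (𝒢 : EtaleGroupoid G X) {K : Set X} (hK : IsCompact K) :
    secSubalgebra A K →ₗ[ℂ] ccSub A 𝒢.continuous_src where
  toFun k := ⟨unitSec 𝒢 fun x => k.1 x, isCc_unitSec 𝒢 hK k.2.1 k.2.2⟩
  map_add' k l := Subtype.ext (funext fun g => unitSec_add 𝒢 _ _ g)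
  map_smul' c k := Subtype.ext (funext fun g => unitSec_smul 𝒢 c _ g)

variable {Q V : Type*} [NonUnitalCStarAlgebra Q] [AddCommGroup V] [Module ℂ V]

/-- An algebraic representation of a convolution algebra on a pre-Hilbert module. -/
structure PreHilbert.IsRep (P : PreHilbert Q V) (𝒢 : EtaleGroupoid G X)
    (act : ∀ {x y : X} (g : G), 𝒢.src g = x → 𝒢.rng g = y → A x → A y)
    (ρ : ccSub A 𝒢.continuous_src →ₗ[ℂ] V →ₗ[ℂ] V) : Prop where
  mul : ∀ a b c : ccSub A 𝒢.continuous_src, (∀ g, c.1 g = conv 𝒢 act a.1 b.1 g) →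
    ∀ v, ρ c v = ρ a (ρ b v)
  adj : ∀ a b : ccSub A 𝒢.continuous_src, (∀ g, b.1 g = _root_.adj 𝒢 act a.1 g) →
    ∀ v w, P.ip (ρ a v) w = P.ip v (ρ b w)

namespace PreHilbert.IsRep

variable {P : PreHilbert Q V} {ρ : ccSub A 𝒢.continuous_src →ₗ[ℂ] V →ₗ[ℂ] V}
  (hρ : P.IsRep 𝒢 act ρ) [T2Space G] (ha : IsStarAction 𝒢 act)
include hρ ha

/-- The sections vanishing off `K` form a C⋆-algebra acting by adjointable maps, so
`PreHilbert.ip_map_le` applies before any operator is known to be bounded. -/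
theorem nrm_unitLin_le {K : Set X} (hK : IsCompact K) (k : secSubalgebra A K) (v : V) :
    P.nrm (ρ (unitLin 𝒢 hK k) v) ≤ ‖k‖ * P.nrm v := by
  have h := P.ip_map_le (ρ.comp (unitLin 𝒢 hK)) (fun k l v => hρ.mul _ _ _ (fun g => by
      refine Eq.trans ?_ (ha.conv_unitSec _ _ g).symm
      change unitSec 𝒢 (fun x => k.1 x * l.1 x) g = unitSec 𝒢 (fun x => k.1 x) g * l.1 (𝒢.src g)
      unfold unitSec
      split_ifs
      · rfl
      · exact (zero_mul _).symm) v)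
    (fun k v w => hρ.adj _ _ (fun g => (ha.adj_unitSec _ g).symm) v w) k v
  refine le_of_sq_le_sq ?_ (mul_nonneg (norm_nonneg _) (P.nrm_nonneg _))
  rw [mul_pow, P.nrm_sq, P.nrm_sq]
  refine (CStarAlgebra.norm_le_norm_of_nonneg_of_le (P.ip_self_nonneg _) h).trans ?_
  rw [norm_smul, Real.norm_of_nonneg (sq_nonneg _)]

variable [T2Space X] [LocallyCompactSpace X]

/-- `‖b v‖² = ‖⟨v, b⋆ b v⟩‖ ≤ ‖v‖ ‖b⋆ b v‖`, and `b⋆ b` is a section on the units bounded by `r²`.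
-/
theorem nrm_le_of_isBisecSec {b : ccSub A 𝒢.continuous_src} (hb : IsBisecSec b.1) {r : ℝ}
    (hr : 0 ≤ r) (hbr : ∀ g, ‖b.1 g‖ ≤ r) (v : V) : P.nrm (ρ b v) ≤ r * P.nrm v := by
  obtain ⟨k, hk, ⟨K, hK, h0⟩, hkn, hconv⟩ := ha.exists_conv_adj_self b.2 hb
  obtain ⟨k', h1, h2⟩ := mem_secSubalgebra hk h0 (hkn r hbr)
  let b' : ccSub A 𝒢.continuous_src := ⟨_, ha.isCc_adj b.2⟩
  have h3 : ρ (unitLin 𝒢 hK k') v = ρ b' (ρ b v) := hρ.mul _ _ _ (fun g => by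
    refine Eq.trans ?_ (hconv g).symm
    change unitSec 𝒢 (fun x => k'.1 x) g = _
    rw [funext h1]) v
  have h4 := hρ.adj b b' (fun _ => rfl) v (ρ b v)
  refine le_of_sq_le_sq ?_ (mul_nonneg hr (P.nrm_nonneg _))
  rw [P.nrm_sq, h4, ← h3]
  refine (P.norm_ip_le _ _).trans ?_
  calc P.nrm v * P.nrm (ρ (unitLin 𝒢 hK k') v) ≤ P.nrm v * (r ^ 2 * P.nrm v) := by
        refine mul_le_mul_of_nonneg_left ((hρ.nrm_unitLin_le ha hK k' v).trans ?_) (P.nrm_nonneg _)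
        exact mul_le_mul_of_nonneg_right (h2 (sq_nonneg r)) (P.nrm_nonneg _)
    _ = _ := by ring

theorem exists_nrm_le (b : ccSub A 𝒢.continuous_src) :
    ∃ r : ℝ, 0 ≤ r ∧ ∀ v, P.nrm (ρ b v) ≤ r * P.nrm v := by
  have := 𝒢.locallyCompactSpace
  obtain ⟨n, hn⟩ := exists_bisec_decomposition (A := A) (𝒢 := 𝒢) b.2.2
  obtain ⟨c, hc, hci, hcb, hbc⟩ := hn b.1 b.2 fun g hg => IsCc.eq_zero hg
  obtain ⟨r, hr, hbr⟩ := IsCc.exists_bound b.2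
  have key : ∀ (s : Finset (Fin n)) v,
      P.nrm (ρ (∑ i ∈ s, ⟨c i, hc i⟩) v) ≤ (s.card * r) * P.nrm v := by
    intro s v
    classical
    induction s using Finset.induction_on with
    | empty =>
      rw [Finset.sum_empty, map_zero, LinearMap.zero_apply]
      simp [PreHilbert.nrm, P.ip_zero]
    | insert i s hi ih =>
      rw [Finset.sum_insert hi, map_add, LinearMap.add_apply, Finset.card_insert_of_notMem hi]
      refine (P.nrm_add_le _ _).trans ?_
      have := hρ.nrm_le_of_isBisecSec ha (b := ⟨c i, hc i⟩) (hci i) hr.le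
        (fun g => (hcb i g).trans (hbr g)) v
      push_cast
      linarith
  refine ⟨(Finset.univ : Finset (Fin n)).card * r, by positivity, fun v => ?_⟩
  refine Eq.trans_le ?_ (key Finset.univ v)
  congr 3
  refine Subtype.ext (funext fun g => ?_)
  rw [AddSubmonoidClass.coe_finsetSum, Finset.sum_apply]
  exact hbc g

/-- An algebraic representation on a pre-Hilbert module extends to a representation on the
completion. -/
theorem exists_isStarRep {M : Type*} [NormedAddCommGroup M] [NormedSpace ℂ M] [CompleteSpace M]
    [HilbertModule Q M] {j : V →ₗ[ℂ] M} (hj : DenseRange j)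
    (hip : ∀ v w, (HilbertModule.ip (j v) (j w) : Q) = P.ip v w) :
    ∃ π : Cc A 𝒢.src → AdjOp Q M, IsStarRep 𝒢 act π ∧
      ∀ (b : Cc A 𝒢.src) v, (π b).1 (j v) = j (ρ ⟨b.1, b.2⟩ v) := by
  have key : ∀ b : Cc A 𝒢.src, ∃ S : AdjOp Q M, ∀ v, S.1 (j v) = j (ρ ⟨b.1, b.2⟩ v) := by
    intro b
    obtain ⟨r, hr, h⟩ := hρ.exists_nrm_le ha ⟨b.1, b.2⟩
    obtain ⟨S, -, hS⟩ := P.exists_extension hj hip (T' := ρ ⟨_, ha.isCc_adj b.2⟩)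
      (hρ.adj _ _ fun _ => rfl) hr h
    exact ⟨S, hS⟩
  choose π hπ using key
  refine ⟨π, ⟨fun a b c h => ?_, fun t a b h => ?_, fun a b c h => ?_, fun a b h => ?_⟩, hπ⟩
  · refine AdjOp.ext_of_dense hj fun v => ?_
    change (π c).1 (j v) = (π a).1 (j v) + (π b).1 (j v)
    rw [hπ, hπ, hπ, ← map_add, ← LinearMap.add_apply, ← map_add]
    congr 3
    exact Subtype.ext (funext h)
  · refine AdjOp.ext_of_dense hj fun v => ?_
    change (π b).1 (j v) = t • (π a).1 (j v)
    rw [hπ, hπ, ← map_smul, ← LinearMap.smul_apply, ← map_smul]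
    congr 3
    exact Subtype.ext (funext h)
  · refine AdjOp.ext_of_dense hj fun v => ?_
    change (π c).1 (j v) = (π a).1 ((π b).1 (j v))
    rw [hπ, hπ, hπ]
    exact congrArg j (hρ.mul ⟨a.1, a.2⟩ ⟨b.1, b.2⟩ ⟨c.1, c.2⟩ h v)
  · refine (AdjOp.star_eq_of_dense hj fun v w => ?_).symm
    rw [hπ, hπ, hip, hip]
    exact hρ.adj ⟨a.1, a.2⟩ ⟨b.1, b.2⟩ h v w

end PreHilbert.IsRep

end Representations

/-! ### Linearity of the operations -/

section Linearity

variable {H Y Z : Type*} [TopologicalSpace H] [TopologicalSpace Y] [TopologicalSpace Z]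
  {ℋ : EtaleGroupoid H Y} {R : RightAction ℋ Z}
  {C : Y → Type*} [∀ y, NonUnitalCStarAlgebra (C y)] [TopologicalSpace (Tot C)]
  {E : Y → Type*} [∀ y, NormedAddCommGroup (E y)] [∀ y, NormedSpace ℂ (E y)]
  [∀ y, CompleteSpace (E y)] [TopologicalSpace (Tot E)] [∀ y, HilbertModule (C y) (E y)]
  {γ : CStarAction ℋ C} {ε : HilbertAction γ E}
  [T2Space Y] [T2Space H] [T2Space Z] [LocallyCompactSpace H] [LocallyCompactSpace Z]

namespace RightAction

theorem innerSec_add (hRe : R.IsEtale) {ξ : ∀ z, E (R.anchor z)} (hξ : IsCc R.anchor ξ)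
    (η η' : ∀ z, E (R.anchor z)) (h : H) : R.innerSec ε ξ (fun z => η z + η' z) h =
      R.innerSec ε ξ η h + R.innerSec ε ξ η' h := by
  have hs := finite_anchor_eq R hRe hξ.2 (ℋ.rng h)
  have key : ∀ η : ∀ z, E (R.anchor z), (Function.support fun z : {z // R.anchor z = ℋ.rng h} =>
      (ip (ε.act (ℋ.inv h) ((ℋ.src_inv h).trans z.2.symm) (ℋ.rng_inv h) (ξ z.1))
      (tr (R.anchor_smul z.2.symm) (η (R.smul z.1 h))) : C (ℋ.src h))).Finite := by
    refine fun η => hs.subset fun z hz => by_contra fun hz' => hz ?_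
    have h0 : ξ z.1 = 0 := IsCc.eq_zero hz'
    simp only [h0, _root_.map_zero, HilbertModule.zero_ip]
  rw [innerSec, innerSec, innerSec, ← finsum_add_distrib (key η) (key η')]
  exact finsum_congr fun z => by rw [tr_add, HilbertModule.ip_add]

theorem innerSec_smul (c : ℂ) (ξ η : ∀ z, E (R.anchor z)) (h : H) :
    R.innerSec ε ξ (fun z => c • η z) h = c • R.innerSec ε ξ η h := by
  rw [innerSec, innerSec, smul_finsum]
  exact finsum_congr fun z => by rw [tr_smul, HilbertModule.ip_smul]

theorem finite_support_rightSec (ξ : ∀ z, E (R.anchor z)) {c : ∀ h, C (ℋ.src h)}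
    (hc : IsCc ℋ.src c) (z : Z) : (Function.support fun h : {h : H // ℋ.rng h = R.anchor z} =>
      ract (ε.act h.1 (R.anchor_smul h.2).symm h.2 (ξ (R.smul z h.1)))
      (tr ((ℋ.src_inv h.1).trans h.2) (c (ℋ.inv h.1)))).Finite := by
  refine (finite_inv_mem hc.2 (ℋ := ℋ) (R.anchor z)).subset fun h hh => by_contra fun hk => hh ?_
  have h0 : c (ℋ.inv h.1) = 0 := IsCc.eq_zero hk
  simp only [h0, tr_zero, HilbertModule.ract_zero]

theorem rightSec_add_left (ξ ξ' : ∀ z, E (R.anchor z)) {c : ∀ h, C (ℋ.src h)}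
    (hc : IsCc ℋ.src c) (z : Z) : R.rightSec ε (fun z => ξ z + ξ' z) c z =
      R.rightSec ε ξ c z + R.rightSec ε ξ' c z := by
  rw [rightSec, rightSec, rightSec, ← finsum_add_distrib (finite_support_rightSec ξ hc z)
    (finite_support_rightSec ξ' hc z)]
  exact finsum_congr fun z => by rw [_root_.map_add, HilbertModule.add_ract]

theorem rightSec_add_right (ξ : ∀ z, E (R.anchor z)) {c c' : ∀ h, C (ℋ.src h)}
    (hc : IsCc ℋ.src c) (hc' : IsCc ℋ.src c') (z : Z) : R.rightSec ε ξ (fun h => c h + c' h) z =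
      R.rightSec ε ξ c z + R.rightSec ε ξ c' z := by
  rw [rightSec, rightSec, rightSec, ← finsum_add_distrib (finite_support_rightSec ξ hc z)
    (finite_support_rightSec ξ hc' z)]
  exact finsum_congr fun z => by rw [tr_add, HilbertModule.ract_add]

theorem rightSec_smul_left (t : ℂ) (ξ : ∀ z, E (R.anchor z)) (c : ∀ h, C (ℋ.src h)) (z : Z) :
    R.rightSec ε (fun z => t • ξ z) c z = t • R.rightSec ε ξ c z := by
  rw [rightSec, rightSec, smul_finsum]
  exact finsum_congr fun z => by rw [_root_.map_smul, HilbertModule.smul_ract]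

theorem rightSec_smul_right (t : ℂ) (ξ : ∀ z, E (R.anchor z)) (c : ∀ h, C (ℋ.src h)) (z : Z) :
    R.rightSec ε ξ (fun h => t • c h) z = t • R.rightSec ε ξ c z := by
  rw [rightSec, rightSec, smul_finsum]
  exact finsum_congr fun z => by rw [tr_smul, HilbertModule.ract_smul]

end RightAction

end Linearity

attribute [local instance] CStarAlgebra.spectralOrder CStarAlgebra.spectralOrderedRing

/-! ### The regular representations -/

/-- A C⋆-algebra as a Hilbert module over itself. -/
abbrev HilbertModule.self (Q : Type*) [NonUnitalCStarAlgebra Q] : HilbertModule Q Q where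
  ip a b := star a * b
  ract a b := a * b
  ip_add _ _ _ := mul_add _ _ _
  ip_smul _ _ _ := mul_smul_comm _ _ _
  ip_ract _ _ _ := (mul_assoc _ _ _).symm
  star_ip a b := by rw [star_mul, star_star]
  ip_self_nonneg a := ⟨a, rfl⟩
  norm_sq a := by rw [CStarRing.norm_star_mul_self, sq]

theorem EtaleGroupoid.isLocalHomeomorph_src {G X : Type*} [TopologicalSpace G]
    [TopologicalSpace X] (𝒢 : EtaleGroupoid G X) : IsLocalHomeomorph 𝒢.src := by
  have := 𝒢.isLocalHomeomorph_rng.comp 𝒢.invHomeomorph.isLocalHomeomorph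
  convert this using 1
  funext g
  exact (𝒢.rng_inv g).symm

theorem BanachBundle.exists_isCc {X : Type*} [TopologicalSpace X] [T2Space X]
    [LocallyCompactSpace X] {A : X → Type*} [∀ x, NormedAddCommGroup (A x)]
    [∀ x, NormedSpace ℂ (A x)] [∀ x, CompleteSpace (A x)] [TopologicalSpace (Tot A)]
    [BanachBundle A] (x : X) (a : A x) : ∃ ξ : ∀ x, A x, IsCc (fun x : X => x) ξ ∧ ξ x = a := by
  obtain ⟨ξ, hξ, h⟩ := BanachBundle.exists_section x a
  obtain ⟨χ, h1, -, h2, -⟩ := exists_continuous_one_zero_of_isCompact (isCompact_singleton (x := x))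
    isClosed_empty (Set.disjoint_empty _)
  refine ⟨fun x => (χ x : ℂ) • ξ x, hξ.1.isCc_smul χ.continuous h2, ?_⟩
  have : χ x = 1 := h1 rfl
  simp only [this, h, Complex.ofReal_one, one_smul]

section

variable {H : Type uH} {Y : Type uY} [TopologicalSpace H] [TopologicalSpace Y]
  {ℋ : EtaleGroupoid H Y}
  {C : Y → Type uC} [∀ y, NonUnitalCStarAlgebra (C y)] [TopologicalSpace (Tot C)]
  (γ : CStarAction ℋ C)

attribute [local instance] HilbertModule.self

/-- The action on a C⋆-bundle as an action on a bundle of Hilbert modules. -/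
def CStarAction.selfAction : HilbertAction γ C where
  act g hx hy :=
    { toFun := γ.act g hx hy
      invFun := (γ.act g hx hy).symm
      left_inv := (γ.act g hx hy).left_inv
      right_inv := (γ.act g hx hy).right_inv
      map_add' := map_add (γ.act g hx hy)
      map_smul' := map_smul (γ.act g hx hy)
      norm_map' := fun a => γ.isIsoAction.norm_map g hx hy a }
  act_one := γ.act_one
  act_mul := γ.act_mul
  continuous_act := γ.continuous_act
  act_ip g e f := by
    change γ.act g rfl rfl (star e * f) = star (γ.act g rfl rfl e) * γ.act g rfl rfl f
    rw [map_mul, StarHomClass.map_star]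
  act_ract g e c := map_mul (γ.act g rfl rfl) e c

variable {γ}

local notation "cnv" => conv ℋ (A := C) (fun h hx hy => γ.act h hx hy)
local notation "ajt" => adj ℋ (A := C) (fun h hx hy => γ.act h hx hy)

theorem adj_adj (a : ∀ h, C (ℋ.src h)) : ajt (ajt a) = a := by
  funext h
  unfold adj
  beta_reduce
  rw [← StarHomClass.map_star, star_star]
  refine (γ.isIsoAction.act_act _ _ _ _ _ _ _).trans ?_
  refine (raw_act_sec_congr (act := fun h hx hy => γ.act h hx hy) a
    (𝒢 := ℋ) (g' := ℋ.one (ℋ.src h)) (by rw [ℋ.inv_inv, ℋ.inv_mul]) (ℋ.inv_inv h) _ _).trans ?_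
  exact γ.isIsoAction.act_one _ _ _

/-- Substitute `k = (z h)⁻¹`. Thus `a⋆ b` is the inner product for right multiplication of the
groupoid on itself, and convolution is its right action. The laws of the convolution algebra become
instances of the identities for modules. -/
theorem conv_adj_eq_innerSec (a b : ∀ h, C (ℋ.src h)) :
    cnv (ajt a) b = ℋ.rightMul.innerSec γ.selfAction a b := by
  funext h
  let e : {z : H // ℋ.rightMul.anchor z = ℋ.rng h} ≃ {k : H // ℋ.rng k = ℋ.src h} :=
    { toFun := fun z => ⟨ℋ.inv (ℋ.mul z.1 h), by rw [ℋ.rng_inv, ℋ.src_mul z.2]⟩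
      invFun := fun k => ⟨ℋ.inv (ℋ.mul h k.1), by
        change ℋ.src _ = _
        rw [ℋ.src_inv, ℋ.rng_mul k.2.symm]⟩
      left_inv := fun z => Subtype.ext (by
        dsimp only
        rw [ℋ.mul_inv_rev z.2, ℋ.mul_inv_cancel_left (by rw [ℋ.rng_inv]; exact z.2.symm),
          ℋ.inv_inv])
      right_inv := fun k => Subtype.ext (by
        dsimp only
        rw [ℋ.mul_inv_rev k.2.symm, ℋ.inv_mul_cancel_right (by rw [ℋ.src_inv, k.2]),
          ℋ.inv_inv]) }
  rw [conv, ← finsum_comp_equiv e]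
  refine finsum_congr fun z => ?_
  have hz : ℋ.src z.1 = ℋ.rng h := z.2
  change _ = star _ * _
  congr 1
  · rw [adj]
    refine (γ.isIsoAction.act_act _ _ _ _ _ _ _).trans ?_
    refine Eq.trans ?_ (StarHomClass.map_star (γ.act (ℋ.inv h) ((ℋ.src_inv h).trans z.2.symm)
      (ℋ.rng_inv h)) (a z.1))
    have e1 : ℋ.mul h (e z).1 = ℋ.inv z.1 := by
      change ℋ.mul h (ℋ.inv (ℋ.mul z.1 h)) = _
      rw [ℋ.mul_inv_rev hz, ℋ.mul_inv_cancel_left (by rw [ℋ.rng_inv, hz])]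
    refine raw_act_sec_congr (act := fun h hx hy => γ.act h hx hy) (𝒢 := ℋ)
      (fun z => star (a z)) ?_ ?_ _ _
    · rw [e1, ℋ.inv_inv]
      change ℋ.mul (ℋ.inv (ℋ.mul z.1 h)) z.1 = _
      rw [ℋ.mul_inv_rev hz, ℋ.inv_mul_cancel_right (by rw [ℋ.src_inv, hz])]
    · rw [e1, ℋ.inv_inv]
  · exact sec_congr b (ℋ.inv_inv _) _ _

variable [CStarBundle C] [T2Space H] [T2Space Y] [LocallyCompactSpace Y]

/-- With `a = (a⋆)⋆`, this is `⟨a⋆, b⟩ c = ⟨a⋆, b c⟩`. -/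
theorem conv_assoc {a b c : ∀ h, C (ℋ.src h)} (ha : IsCc ℋ.src a)
    (hc : IsCc ℋ.src c) : cnv (cnv a b) c = cnv a (cnv b c) := by
  have := ℋ.locallyCompactSpace
  have h1 := RightAction.innerSec_rightSec (R := ℋ.rightMul) (ε := γ.selfAction) (ξ := ajt a)
    (η := b) ℋ.isLocalHomeomorph_src (γ.isStarAction.isCc_adj ha) hc
  have e2 := conv_adj_eq_innerSec (γ := γ) (ajt a) (cnv b c)
  have e3 := conv_adj_eq_innerSec (γ := γ) (ajt a) b
  rw [adj_adj] at e2 e3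
  exact (congrArg (fun x => cnv x c) e3).trans (h1.symm.trans e2.symm)

theorem adj_conv (a b : ∀ h, C (ℋ.src h)) : ajt (cnv a b) = cnv (ajt b) (ajt a) := by
  have h1 := RightAction.adj_innerSec (R := ℋ.rightMul) (ε := γ.selfAction) (ajt a) b
  have e2 := conv_adj_eq_innerSec (γ := γ) (ajt a) b
  rw [adj_adj] at e2
  exact (congrArg (fun x => ajt x) e2).trans (h1.trans (conv_adj_eq_innerSec b (ajt a)).symm)

theorem conv_add_left (a a' : ∀ h, C (ℋ.src h)) {b : ∀ h, C (ℋ.src h)} (hb : IsCc ℋ.src b) :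
    cnv (fun h => a h + a' h) b = fun h => cnv a b h + cnv a' b h := by
  have := ℋ.locallyCompactSpace
  exact funext fun h => RightAction.rightSec_add_left (R := ℋ.rightMul) (ε := γ.selfAction) a a' hb h

theorem conv_add_right (a : ∀ h, C (ℋ.src h)) {b b' : ∀ h, C (ℋ.src h)} (hb : IsCc ℋ.src b)
    (hb' : IsCc ℋ.src b') : cnv a (fun h => b h + b' h) = fun h => cnv a b h + cnv a b' h := by
  have := ℋ.locallyCompactSpace
  exact funext fun h => RightAction.rightSec_add_right (R := ℋ.rightMul) (ε := γ.selfAction)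
    a hb hb' h

theorem conv_smul_left (t : ℂ) (a b : ∀ h, C (ℋ.src h)) :
    cnv (fun h => t • a h) b = fun h => t • cnv a b h := by
  have := ℋ.locallyCompactSpace
  exact funext fun h => RightAction.rightSec_smul_left (R := ℋ.rightMul) (ε := γ.selfAction) t a b h

theorem conv_smul_right (t : ℂ) (a b : ∀ h, C (ℋ.src h)) :
    cnv a (fun h => t • b h) = fun h => t • cnv a b h := by
  have := ℋ.locallyCompactSpace
  exact funext fun h => RightAction.rightSec_smul_right (R := ℋ.rightMul) (ε := γ.selfAction) t a b h

variable (γ) in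
/-- Left convolution. -/
def convLin : ccSub C ℋ.continuous_src →ₗ[ℂ] ccSub C ℋ.continuous_src →ₗ[ℂ]
    ccSub C ℋ.continuous_src :=
  LinearMap.mk₂ ℂ (fun a b => ⟨cnv a.1 b.1, γ.isStarAction.isCc_conv a.2 b.2⟩)
    (fun a a' b => Subtype.ext (conv_add_left a.1 a'.1 b.2))
    (fun t a b => Subtype.ext (conv_smul_left t a.1 b.1))
    (fun a b b' => Subtype.ext (conv_add_right a.1 b.2 b'.2))
    (fun t a b => Subtype.ext (conv_smul_right t a.1 b.1))

/-- The value of `f⋆ g` at a unit is an `ℓ²` inner product over the arrows starting there, so for `g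
= f` it is a sum of positive elements. -/
theorem conv_adj_self_one (f g : ∀ h, C (ℋ.src h)) (y : Y) :
    tr (ℋ.src_one y) (cnv (ajt f) g (ℋ.one y)) =
      ∑ᶠ h : {h : H // ℋ.src h = y}, tr h.2 (star (f h.1) * g h.1) := by
  refine (congrArg (tr _) (congrFun (conv_adj_eq_innerSec f g) _)).trans
    ((tr_finsum (A := C) _ _).trans ?_)
  refine finsum_subtype_congr (fun h => by rw [ℋ.rng_one]; rfl) fun h hh hh' => ?_
  rw [tr_mul]
  refine (tr_mul _ _ _).trans ?_
  congr 1
  · rw [tr_star]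
    refine Eq.trans (congrArg (star : C y → C y) ?_) (tr_star _ _).symm
    refine (tr_raw_act (act := fun h hx hy => γ.act h hx hy) _ _ _ _ _).trans ?_
    refine (raw_act_sec_congr (act := fun h hx hy => γ.act h hx hy) (𝒢 := ℋ)
      f (g' := ℋ.one y) (ℋ.inv_one y) rfl _ _).trans ?_
    exact γ.isIsoAction.act_one _ _ _
  · refine (tr_tr _ _ _).trans ?_
    refine sec_congr g ?_ _ _
    subst hh'
    exact ℋ.mul_one h

theorem tr_star_mul_self_nonneg {Y : Type*} {C : Y → Type*} [∀ y, NonUnitalCStarAlgebra (C y)]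
    {y y' : Y} (e : y = y') (a : C y) : 0 ≤ tr (A := C) e (star a * a) := by
  subst e
  exact star_mul_self_nonneg _

variable (γ) in
/-- The inner product of the regular representation at `y`. -/
def regPre (y : Y) : PreHilbert (C y) (ccSub C ℋ.continuous_src) where
  ip f g := tr (ℋ.src_one y) (cnv (ajt f.1) g.1 (ℋ.one y))
  ip_add f g g' := by
    change tr _ (cnv (ajt f.1) (fun h => g.1 h + g'.1 h) _) = _
    rw [conv_add_right _ g.2 g'.2, tr_add]
  ip_smul c f g := by
    change tr _ (cnv (ajt f.1) (fun h => c • g.1 h) _) = _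
    rw [conv_smul_right, tr_smul]
  star_ip f g := by
    have h1 : ajt (cnv (ajt f.1) g.1) = cnv (ajt g.1) f.1 := by rw [adj_conv, adj_adj]
    rw [← h1, adj, ← tr_star]
    refine Eq.symm ((tr_raw_act (act := fun h hx hy => γ.act h hx hy) _ _ _ _ _).trans ?_)
    refine (raw_act_sec_congr (act := fun h hx hy => γ.act h hx hy) (𝒢 := ℋ)
      (fun h => star (cnv (ajt f.1) g.1 h)) (g' := ℋ.one y) (ℋ.inv_one y) (ℋ.inv_one y) _ _).trans ?_
    exact γ.isIsoAction.act_one _ _ _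
  ip_self_nonneg f := by
    rw [conv_adj_self_one]
    refine finsum_induction (fun c => 0 ≤ c) le_rfl (fun _ _ => add_nonneg) fun h => ?_
    exact tr_star_mul_self_nonneg h.2 _
  dense_ract := by
    convert dense_univ
    refine Set.eq_univ_of_forall fun q f => ?_
    -- Every `q` acts: extend it to a section `k` and multiply pointwise by `k ∘ src`, which is `q`
    -- on the arrows starting at `y`.
    obtain ⟨k, hk, rfl⟩ := BanachBundle.exists_section (A := C) y q
    refine ⟨⟨fun h => f.1 h * k (ℋ.src h), IsContSec.map₂' (m := fun a b => a * b)
      StarBundle.continuous_mul f.2.1 (IsContSec.comp hk.1 ℋ.continuous_src),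
      f.2.2.of_isClosed_subset isClosed_closure (closure_mono fun h hh h0 => hh ?_)⟩, fun g => ?_⟩
    · simp only [h0, zero_mul]
    · rw [conv_adj_self_one, conv_adj_self_one]
      have := ℋ.locallyCompactSpace
      have hfin : (Function.support fun h : {h : H // ℋ.src h = y} =>
          tr h.2 (star (g.1 h.1) * f.1 h.1)).Finite := by
        refine (finite_anchor_eq ℋ.rightMul ℋ.isLocalHomeomorph_src f.2.2 y).subset
          fun h hh => by_contra fun hk => hh ?_
        have h0 : f.1 h.1 = 0 := IsCc.eq_zero hk
        simp only [h0, mul_zero, tr_zero]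
      refine Eq.trans ?_ ((AddMonoidHom.mulRight (k y)).map_finsum hfin).symm
      refine finsum_congr fun h => ?_
      obtain ⟨h, rfl⟩ := h
      exact (mul_assoc _ _ _).symm

theorem isRep_convLin (y : Y) :
    (regPre γ y).IsRep ℋ (fun h hx hy => γ.act h hx hy) (convLin γ) where
  mul a b c h v := by
    refine Subtype.ext ?_
    change cnv c.1 v.1 = cnv a.1 (cnv b.1 v.1)
    rw [funext h, conv_assoc a.2 v.2]
  adj a b h v w := by
    change tr _ (cnv (ajt (cnv a.1 v.1)) w.1 _) = tr _ (cnv (ajt v.1) (cnv b.1 w.1) _)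
    rw [adj_conv, funext h, conv_assoc (γ.isStarAction.isCc_adj v.2) w.2]

/-- The canonical map to the crossed product is injective. -/
theorem CStarAction.ι_injective {a : Cc C ℋ.src} (h : γ.ι a = 0) (g : H) : a.1 g = 0 := by
  have hact := γ.isStarAction
  have := ℋ.locallyCompactSpace
  set y := ℋ.src g with hy
  obtain ⟨M, _, _, _, j, hj, hjn⟩ := (regPre γ y).exists_banach_completion
  obtain ⟨_, hip⟩ := (regPre γ y).exists_hilbertModule hj hjn
  obtain ⟨π, hπ, hπj⟩ := (isRep_convLin (γ := γ) y).exists_isStarRep hact hj hip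
  obtain ⟨Φ, hΦ⟩ := hact.exists_hom hπ
  have h0 : π a = 0 := by rw [← hΦ]; exact (congrArg Φ h).trans (map_zero Φ)
  -- The test vector is a section on the units with value `a(g)⋆` at the source of `g`. Its image
  -- under `a` has value `a(g) a(g)⋆` at `g`; this image has norm zero, so all the positive terms of
  -- its inner product with itself vanish.
  obtain ⟨k, hk, hky⟩ := BanachBundle.exists_isCc (A := C) y (star (a.1 g))
  let v : ccSub C ℋ.continuous_src := ⟨unitSec ℋ k, isCc_unitSec ℋ hk.2 hk.1
    fun x hx => IsCc.eq_zero hx⟩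
  have h1 : j (convLin γ ⟨a.1, a.2⟩ v) = 0 := by rw [← hπj, h0]; rfl
  have h2 := hip (convLin γ ⟨a.1, a.2⟩ v) (convLin γ ⟨a.1, a.2⟩ v)
  rw [h1, HilbertModule.ip_zero] at h2
  have h3 : (∑ᶠ h : {h : H // ℋ.src h = y},
      tr h.2 (star ((convLin γ ⟨a.1, a.2⟩ v).1 h.1) * (convLin γ ⟨a.1, a.2⟩ v).1 h.1)) = 0 := by
    rw [← conv_adj_self_one (γ := γ)]; exact h2.symm
  have hnn : ∀ h : {h : H // ℋ.src h = y}, 0 ≤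
      tr h.2 (star ((convLin γ ⟨a.1, a.2⟩ v).1 h.1) * (convLin γ ⟨a.1, a.2⟩ v).1 h.1) := by
    exact fun h => tr_star_mul_self_nonneg h.2 _
  have hfin : (Function.support fun h : {h : H // ℋ.src h = y} =>
      tr h.2 (star ((convLin γ ⟨a.1, a.2⟩ v).1 h.1) * (convLin γ ⟨a.1, a.2⟩ v).1 h.1)).Finite := by
    refine (finite_anchor_eq ℋ.rightMul ℋ.isLocalHomeomorph_src
      (convLin γ ⟨a.1, a.2⟩ v).2.2 y).subset fun h hh => by_contra fun hk => hh ?_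
    have h0 : (convLin γ ⟨a.1, a.2⟩ v).1 h.1 = 0 := IsCc.eq_zero hk
    simp only [h0, mul_zero, tr_zero]
  rw [finsum_eq_sum _ hfin] at h3
  have h4 : star ((convLin γ ⟨a.1, a.2⟩ v).1 g) * (convLin γ ⟨a.1, a.2⟩ v).1 g = 0 := by
    by_contra hne
    have := (Finset.sum_eq_zero_iff_of_nonneg fun h _ => hnn h).1 h3 ⟨g, rfl⟩
      (hfin.mem_toFinset.2 hne)
    exact hne this
  have h5 : (convLin γ ⟨a.1, a.2⟩ v).1 g = a.1 g * star (a.1 g) := by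
    refine (hact.conv_unitSec a.1 k g).trans ?_
    rw [← hky]
  have h6 := CStarRing.norm_star_mul_self (x := (convLin γ ⟨a.1, a.2⟩ v).1 g)
  rw [h4, norm_zero, h5, CStarRing.norm_self_mul_star] at h6
  have h7 := mul_self_eq_zero.1 (mul_self_eq_zero.1 h6.symm)
  exact norm_eq_zero.1 h7

end

/-! ### Sums over orbits -/

namespace RightAction

section Average

variable {H Y Z : Type*} [TopologicalSpace H] [TopologicalSpace Y] [TopologicalSpace Z]
  {ℋ : EtaleGroupoid H Y} (R : RightAction ℋ Z)
  {P : Y → Type*} [∀ y, NormedAddCommGroup (P y)] [∀ y, NormedSpace ℂ (P y)]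
  [TopologicalSpace (Tot P)]
  (act : ∀ {x y : Y} (g : H), ℋ.src g = x → ℋ.rng g = y → P x → P y)

/-- The sum over the orbits of a section: `z ↦ ∑ₕ h · η(z · h)`. -/
def avg (η : ∀ z, P (R.anchor z)) (z : Z) : P (R.anchor z) :=
  ∑ᶠ h : {h : H // ℋ.rng h = R.anchor z},
    act h.1 (R.anchor_smul h.2).symm h.2 (η (R.smul z h.1))

/-- The arrows starting at `z · h` correspond to those starting at `z`. -/
def orbitEquiv {z : Z} {h : H} (hz : ℋ.rng h = R.anchor z) :
    {k : H // ℋ.rng k = R.anchor (R.smul z h)} ≃ {k : H // ℋ.rng k = R.anchor z} where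
  toFun k := ⟨ℋ.mul h k.1, by rw [ℋ.rng_mul (k.2.trans (R.anchor_smul hz)).symm, hz]⟩
  invFun k := ⟨ℋ.mul (ℋ.inv h) k.1, by
    rw [ℋ.rng_mul (by rw [ℋ.src_inv, hz, k.2]), ℋ.rng_inv, R.anchor_smul hz]⟩
  left_inv k := Subtype.ext (ℋ.inv_mul_cancel_left (k.2.trans (R.anchor_smul hz)).symm)
  right_inv k := Subtype.ext (ℋ.mul_inv_cancel_left (hz.trans k.2.symm))

theorem smul_orbitEquiv {z : Z} {h : H} (hz : ℋ.rng h = R.anchor z)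
    (k : {k : H // ℋ.rng k = R.anchor (R.smul z h)}) :
    R.smul z (R.orbitEquiv hz k).1 = R.smul (R.smul z h) k.1 :=
  R.smul_mul hz (k.2.trans (R.anchor_smul hz)).symm

variable {R} {act}

/-- The orbits of `z h` and of `z` are matched by `k ↦ h k`. -/
theorem avg_equivariant (ha : IsIsoAction ℋ act) (η : ∀ z, P (R.anchor z)) {z : Z} {h : H}
    (hz : ℋ.rng h = R.anchor z) : R.avg act η (R.smul z h) =
      act (ℋ.inv h) ((ℋ.src_inv h).trans hz) ((ℋ.rng_inv h).trans (R.anchor_smul hz).symm)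
        (R.avg act η z) := by
  rw [avg, avg, ha.map_finsum, ← finsum_comp_equiv (R.orbitEquiv hz)]
  refine finsum_congr fun k => ?_
  have hk : ℋ.src h = ℋ.rng k.1 := (k.2.trans (R.anchor_smul hz)).symm
  rw [ha.act_act]
  exact raw_act_sec_congr (act := fun h hx hy => act h hx hy) (𝒢 := ℋ) η
    (ℋ.inv_mul_cancel_left hk).symm (R.smul_orbitEquiv hz k).symm _ _

variable [T2Space Y] [T2Space H] [T2Space Z] [LocallyCompactSpace H] [LocallyCompactSpace Z]

theorem finite_support_avg (ha : IsIsoAction ℋ act) (hRp : R.IsProper) {η : ∀ z, P (R.anchor z)}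
    (hη : IsCc R.anchor η) (z : Z) :
    (Function.support fun h : {h : H // ℋ.rng h = R.anchor z} =>
      act h.1 (R.anchor_smul h.2).symm h.2 (η (R.smul z h.1))).Finite := by
  refine (finite_smul_mem R hRp hη.2 z).subset fun h hh => by_contra fun hk => hh ?_
  have : η (R.smul z h.1) = 0 := IsCc.eq_zero hk
  simp only [this, ha.map_zero]

/-- Near a given point, multiply by a cutoff function equal to `1` there. By properness the terms
then have compact support on the composable pairs and can be summed along the étale projection `(z,
h) ↦ z`. -/
theorem isContSec_avg [ApproxBundle P] (ha : IsIsoAction ℋ act) (hRp : R.IsProper)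
    {η : ∀ z, P (R.anchor z)} (hη : IsCc R.anchor η) : IsContSec R.anchor (R.avg act η) := by
  have := R.locallyCompactSpace_FP
  refine IsContSec.of_eventuallyEq fun z₀ => ?_
  obtain ⟨N, hN, hz₀⟩ := exists_compact_mem_nhds z₀
  obtain ⟨χ, h1, -, h2, -⟩ := exists_continuous_one_zero_of_isCompact hN
    isClosed_empty (Set.disjoint_empty _)
  let a : ∀ q : R.FP, P (R.anchor q.1.1) := fun q =>
    (χ q.1.1 : ℂ) • act q.1.2 (R.anchor_smul q.2).symm q.2 (η (R.smul q.1.1 q.1.2))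
  have h3 : IsContSec (fun q : R.FP => R.anchor q.1.1) a := by
    refine IsContSec.smul (Complex.continuous_ofReal.comp (χ.continuous.comp
      (continuous_fst.comp continuous_subtype_val))) ?_
    exact ha.isContSec (continuous_snd.comp continuous_subtype_val) _ _
      (hη.1.comp R.continuous_smul_FP)
  have h4 : IsCc (fun q : R.FP => R.anchor q.1.1) a := by
    refine IsCc.of_eq_zero h3 (hRp.isCompact_FP h2.isCompact hη.2) fun q hq => ?_
    by_cases h : R.smul q.1.1 q.1.2 ∈ closure {z | η z ≠ 0}
    · have : χ q.1.1 = 0 := image_eq_zero_of_notMem_tsupport fun h' => hq ⟨h', h⟩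
      simp only [a, this, Complex.ofReal_zero, zero_smul]
    · simp only [a, IsCc.eq_zero h, ha.map_zero, smul_zero]
  have h5 := isCc_pushSec (p := fun q : R.FP => q.1.1) R.isEtaleMap_fst R.continuous_anchor h4
  refine ⟨_, h5.1, ?_⟩
  filter_upwards [hz₀] with z hz
  refine Eq.trans ?_ (finsum_comp_equiv (R.fibreFstEquiv z)
    (f := fun q => tr (congrArg R.anchor q.2) (a q.1)))
  refine finsum_congr fun h => ?_
  have : χ z = 1 := h1 hz
  change _ = a ⟨(z, h.1), h.2⟩
  simp only [a, this, Complex.ofReal_one, one_smul]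

end Average

/-! ### Scalar orbit sums and partitions of unity over orbits. -/

section Orbits

variable {H Y Z : Type*} [TopologicalSpace H] [TopologicalSpace Y] [TopologicalSpace Z]
  {ℋ : EtaleGroupoid H Y} (R : RightAction ℋ Z)

/-- The sum of a function over the orbits, `z ↦ ∑ₕ f(z · h)`. -/
def orbSum (f : Z → ℝ) (z : Z) : ℝ :=
  ∑ᶠ h : {h : H // ℋ.rng h = R.anchor z}, f (R.smul z h.1)

theorem orbSum_smul (f : Z → ℝ) {z : Z} {h : H} (hz : ℋ.rng h = R.anchor z) :
    R.orbSum f (R.smul z h) = R.orbSum f z := by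
  rw [orbSum, orbSum, ← finsum_comp_equiv (R.orbitEquiv hz)]
  exact finsum_congr fun k => by rw [R.smul_orbitEquiv hz]

theorem orbSum_nonneg {f : Z → ℝ} (hf : ∀ z, 0 ≤ f z) (z : Z) : 0 ≤ R.orbSum f z :=
  finsum_nonneg fun _ => hf _

section Trivial

/-- The topology of the trivial line bundle. -/
abbrev trivialTopology (Y : Type*) [TopologicalSpace Y] : TopologicalSpace (Tot fun _ : Y => ℂ) :=
  TopologicalSpace.induced (fun a => (a.base, a.val)) inferInstance

attribute [local instance] trivialTopology

theorem continuous_trivial_iff {T : Type*} [TopologicalSpace T] {f : T → Tot fun _ : Y => ℂ} :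
    Continuous f ↔ Continuous (fun t => (f t).base) ∧ Continuous fun t => (f t).val := by
  rw [continuous_induced_rng]
  exact continuous_prodMk

theorem continuous_trivial_base : Continuous (Tot.base : (Tot fun _ : Y => ℂ) → Y) :=
  (continuous_trivial_iff.1 continuous_id).1

theorem continuous_trivial_val : Continuous (fun a : Tot fun _ : Y => ℂ => a.val) :=
  (continuous_trivial_iff.1 continuous_id).2

theorem approxBundle_trivial : ApproxBundle fun _ : Y => ℂ where
  continuous_base := continuous_trivial_base
  upperSemicontinuous_norm := (continuous_norm.comp continuous_trivial_val).upperSemicontinuous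
  continuous_add := by
    have h : Continuous fun p : FibProd (fun _ : Y => ℂ) (fun _ : Y => ℂ) =>
      ((⟨p.base, p.fst⟩ : Tot fun _ : Y => ℂ), (⟨p.base, p.snd⟩ : Tot fun _ : Y => ℂ)) :=
      continuous_induced_dom
    have h1 : Continuous fun p : FibProd (fun _ : Y => ℂ) (fun _ : Y => ℂ) => p.base :=
      continuous_trivial_base.comp h.fst
    have h2 : Continuous fun p : FibProd (fun _ : Y => ℂ) (fun _ : Y => ℂ) => p.fst :=
      continuous_trivial_val.comp h.fst
    have h3 : Continuous fun p : FibProd (fun _ : Y => ℂ) (fun _ : Y => ℂ) => p.snd :=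
      continuous_trivial_val.comp h.snd
    exact continuous_trivial_iff.2 ⟨h1, h2.add h3⟩
  continuous_smul c := continuous_trivial_iff.2
    ⟨continuous_trivial_base, continuous_trivial_val.const_smul c⟩
  tendsto_zero x := by
    rw [nhds_induced, nhds_prod_eq, ← tendsto_iff_comap]
    refine Tendsto.prodMk (tendsto_comap.mono_left inf_le_left) ?_
    exact tendsto_zero_iff_norm_tendsto_zero.2 (tendsto_comap.mono_left inf_le_right)
  exists_approx x a r hr := ⟨fun _ => a, continuous_trivial_iff.2
    ⟨continuous_id, continuous_const⟩, by simpa using hr⟩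

variable {R} [T2Space Y] [T2Space H] [T2Space Z] [LocallyCompactSpace H] [LocallyCompactSpace Z]

/-- Apply `isContSec_avg` to the trivial line bundle with the trivial action. -/
theorem continuous_orbSum (hRp : R.IsProper) {f : Z → ℝ} (hf : Continuous f)
    (hfc : HasCompactSupport f) : Continuous (R.orbSum f) := by
  have := approxBundle_trivial (Y := Y)
  have ha : IsIsoAction ℋ (A := fun _ : Y => ℂ) fun _ _ _ a => a :=
    { map_add := fun _ _ _ _ _ => rfl
      map_smul := fun _ _ _ _ _ => rfl
      norm_map := fun _ _ _ _ => rfl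
      one := fun _ _ => rfl
      mul := fun _ _ _ _ => rfl
      continuous := by
        have h : Continuous fun p : {p : H × Tot (fun _ : Y => ℂ) // ℋ.src p.1 = p.2.base} =>
            p.1.2.val :=
          continuous_trivial_val.comp (continuous_snd.comp continuous_subtype_val)
        exact continuous_trivial_iff.2
          ⟨ℋ.continuous_rng.comp (continuous_fst.comp continuous_subtype_val), h⟩ }
  have hcc : IsCc (A := fun _ : Y => ℂ) R.anchor fun z => (f z : ℂ) := by
    refine IsCc.of_eq_zero (continuous_trivial_iff.2
      ⟨R.continuous_anchor, Complex.continuous_ofReal.comp hf⟩) hfc.isCompact fun z hz => ?_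
    rw [image_eq_zero_of_notMem_tsupport hz, Complex.ofReal_zero]
  have h1 := Complex.continuous_re.comp (continuous_trivial_val.comp (isContSec_avg ha hRp hcc))
  refine h1.congr fun z => ?_
  have h2 := finite_support_avg ha hRp hcc z
  exact (Complex.reAddGroupHom.map_finsum h2)

end Trivial

variable {R} [T2Space Y] [T2Space H] [T2Space Z] [LocallyCompactSpace H] [LocallyCompactSpace Z]

theorem finite_support_orbSum (hRp : R.IsProper) {f : Z → ℝ} (hfc : HasCompactSupport f) (z : Z) :
    (Function.support fun h : {h : H // ℋ.rng h = R.anchor z} => f (R.smul z h.1)).Finite :=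
  (finite_smul_mem R hRp hfc.isCompact z).subset fun _ hh => subset_tsupport _ hh

/-- The unit contributes the term `f z` to the sum. -/
theorem le_orbSum (hRp : R.IsProper) {f : Z → ℝ} (hf : ∀ z, 0 ≤ f z) (hfc : HasCompactSupport f)
    (z : Z) : f z ≤ R.orbSum f z := by
  have h := single_le_finsum ⟨ℋ.one (R.anchor z), ℋ.rng_one _⟩
    (finite_support_orbSum hRp hfc z) fun h => hf _
  simp only [R.smul_one] at h
  exact h

/-- Compactly supported functions with small supports whose sums over the orbits add up to `1` on
the orbits meeting a given compact set. -/
theorem exists_orbit_partition (hRp : R.IsProper) {K : Set Z} (hK : IsCompact K) (U : Z → Set Z)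
    (hU : ∀ z ∈ K, U z ∈ 𝓝 z) :
    ∃ (n : ℕ) (t : Fin n → Z) (f : Fin n → Z → ℝ), (∀ i, t i ∈ K) ∧ (∀ i, Continuous (f i)) ∧
      (∀ i, HasCompactSupport (f i)) ∧ (∀ i, tsupport (f i) ⊆ U (t i)) ∧ (∀ i z, 0 ≤ f i z) ∧
      (∀ z, ∑ i, R.orbSum (f i) z ≤ 1) ∧ ∀ z ∈ K, ∑ i, R.orbSum (f i) z = 1 := by
  obtain ⟨n, t, χ, ht, hχU, hχ1, hχ0, -, hχc⟩ := exists_partition hK U hU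
  let F : Z → ℝ := fun z => ∑ i, R.orbSum (χ i) z
  have hFc : Continuous F := continuous_finsetSum _ fun i _ =>
    continuous_orbSum hRp (χ i).continuous (hχc i)
  have hF0 : ∀ z, 0 ≤ F z := fun z => Finset.sum_nonneg fun i _ => R.orbSum_nonneg (hχ0 i) z
  have hF1 : ∀ z ∈ K, 1 ≤ F z := fun z hz => by
    rw [← hχ1 z hz]
    exact Finset.sum_le_sum fun i _ => le_orbSum hRp (hχ0 i) (hχc i) z
  -- The total orbit sum `F` is constant on orbits and at least `1` on `K`. Dividing the functions
  -- by `max F 1` divides their orbit sums by the same quantity, which is `F` itself on `K`.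
  have hm : ∀ z, 0 < max (F z) 1 := fun z => lt_max_of_lt_right one_pos
  have horb : ∀ i z, R.orbSum (fun z => χ i z * (max (F z) 1)⁻¹) z =
      R.orbSum (χ i) z * (max (F z) 1)⁻¹ := fun i z => by
    refine Eq.trans (finsum_congr fun h => ?_)
      ((AddMonoidHom.mulRight ((max (F z) 1)⁻¹)).map_finsum
        (finite_support_orbSum hRp (hχc i) z)).symm
    have : F (R.smul z h.1) = F z := Finset.sum_congr rfl fun j _ => R.orbSum_smul _ h.2
    change χ i _ * (max (F (R.smul z h.1)) 1)⁻¹ = _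
    rw [this]
    rfl
  have hsub : ∀ i, Function.support (fun z => χ i z * (max (F z) 1)⁻¹) ⊆ Function.support (χ i) :=
    fun i => Function.support_mul_subset_left _ _
  refine ⟨n, t, fun i z => χ i z * (max (F z) 1)⁻¹, ht, fun i => ?_, fun i => (hχc i).mul_right,
    fun i => (closure_mono (hsub i)).trans (hχU i), fun i z => ?_, fun z => ?_, fun z hz => ?_⟩
  · exact (χ i).continuous.mul ((hFc.max continuous_const).inv₀ fun z => (hm z).ne')
  · exact mul_nonneg (hχ0 i z) (inv_nonneg.2 (hm z).le)
  · simp only [horb]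
    rw [← Finset.sum_mul, ← div_eq_mul_inv, div_le_one (hm z)]
    exact le_max_left _ _
  · simp only [horb]
    rw [← Finset.sum_mul, max_eq_left (hF1 z hz)]
    exact mul_inv_cancel₀ (by have := hF1 z hz; positivity)

/-- Cover `K` by finitely many sets on which the anchor map is injective; each contains at most one
point of a given fibre. -/
theorem exists_card_le (hRe : R.IsEtale) {K : Set Z} (hK : IsCompact K) :
    ∃ N : ℕ, ∀ (y : Y) (s : Finset {z : Z // R.anchor z = y}), (∀ z ∈ s, z.1 ∈ K) →
      s.card ≤ N := by
  have h1 := (IsLocalHomeomorph.isEtaleMap hRe).exists_injOn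
  choose U hU hUi using h1
  obtain ⟨t, -, ht⟩ := hK.elim_nhds_subcover U fun z _ => hU z
  refine ⟨t.card, fun y s hs => ?_⟩
  have h2 : ∀ z : {z : Z // R.anchor z = y}, ∃ x, z ∈ s → x ∈ t ∧ z.1 ∈ U x := fun z => by
    by_cases hz : z ∈ s
    · obtain ⟨x, hx, hzx⟩ := Set.mem_iUnion₂.1 (ht (hs z hz))
      exact ⟨x, fun _ => ⟨hx, hzx⟩⟩
    · exact ⟨z.1, fun h => absurd h hz⟩
  choose x hx using h2
  refine Finset.card_le_card_of_injOn x (fun z hz => (hx z hz).1) fun z hz z' hz' h => ?_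
  refine Subtype.ext (hUi (x z) (hx z hz).2 ?_ (z.2.trans z'.2.symm))
  rw [h]
  exact (hx z' hz').2

/-- Small neighbourhoods meet each orbit of a free and proper action at most once. -/
theorem IsFree.exists_nhds (hRf : R.IsFree) (hRp : R.IsProper) (z₀ : Z) :
    ∃ V ∈ 𝓝 z₀, ∀ z ∈ V, ∀ h, ℋ.rng h = R.anchor z → R.smul z h ∈ V →
      h = ℋ.one (R.anchor z) := by
  obtain ⟨N, hN, hz₀⟩ := exists_compact_mem_nhds z₀
  -- Units being open, the non-units that move points of `N` into `N` form a compact set of pairs.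
  -- Its image under `(z, h) ↦ (z, z h)` is closed and, by freeness, does not contain `(z₀, z₀)`.
  have h1 : IsCompact {q : R.FP | (q.1.1 ∈ N ∧ R.smul q.1.1 q.1.2 ∈ N) ∧
      q.1.2 ∉ Set.range ℋ.one} := by
    refine (hRp.isCompact_FP hN hN).inter_right (IsOpen.isClosed_compl
      (ℋ.isOpenEmbedding_one.isOpen_range.preimage (continuous_snd.comp continuous_subtype_val)))
  have h2 := (h1.image (f := fun q : R.FP => (q.1.1, R.smul q.1.1 q.1.2))
    ((continuous_fst.comp continuous_subtype_val).prodMk R.continuous_smul_FP)).isClosed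
  have h3 : ((z₀, z₀) : Z × Z) ∉ (fun q : R.FP => (q.1.1, R.smul q.1.1 q.1.2)) ''
      {q : R.FP | (q.1.1 ∈ N ∧ R.smul q.1.1 q.1.2 ∈ N) ∧ q.1.2 ∉ Set.range ℋ.one} := by
    rintro ⟨q, ⟨-, hq⟩, he⟩
    rw [Prod.mk.injEq] at he
    refine hq (hRf _ _ q.2 ?_)
    rw [he.2, he.1]
  obtain ⟨V, hV, V', hV', hVV⟩ := mem_nhds_prod_iff.1 (h2.isOpen_compl.mem_nhds h3)
  refine ⟨V ∩ V' ∩ N, inter_mem (inter_mem hV hV') hz₀, fun z hz h hh hzh => ?_⟩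
  have h4 : h ∈ Set.range ℋ.one := by
    by_contra hne
    exact hVV (Set.mk_mem_prod hz.1.1 hzh.1.2) ⟨⟨(z, h), hh⟩, ⟨⟨hz.2, hzh.2⟩, hne⟩, rfl⟩
  obtain ⟨y, rfl⟩ := h4
  rw [← hh, ℋ.rng_one]

end Orbits

end RightAction

attribute [local instance] CStarAlgebra.spectralOrder CStarAlgebra.spectralOrderedRing

/-! ### Positivity of the inner product -/

namespace RightAction

variable {H : Type uH} {Y : Type uY} {Z : Type uΩ} [TopologicalSpace H] [TopologicalSpace Y]
  [TopologicalSpace Z] {ℋ : EtaleGroupoid H Y} {R : RightAction ℋ Z}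
  {C : Y → Type uC} [∀ y, NonUnitalCStarAlgebra (C y)] [TopologicalSpace (Tot C)]
  {E : Y → Type uE} [∀ y, NormedAddCommGroup (E y)] [∀ y, NormedSpace ℂ (E y)]
  [∀ y, CompleteSpace (E y)] [TopologicalSpace (Tot E)] [∀ y, HilbertModule (C y) (E y)]
  {γ : CStarAction ℋ C} {ε : HilbertAction γ E}
  [CStarBundle C] [HilbertBundle C E]
  [T2Space Y] [T2Space H] [T2Space Z] [LocallyCompactSpace Y]

theorem isCc_innerSec (hRp : R.IsProper) (hRe : R.IsEtale) {ξ η : ∀ z, E (R.anchor z)}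
    (hξ : IsCc R.anchor ξ) (hη : IsCc R.anchor η) : IsCc ℋ.src (R.innerSec ε ξ η) := by
  have := ℋ.locallyCompactSpace
  have := IsLocalHomeomorph.locallyCompactSpace hRe
  exact isCc_innerSum R (m := fun a b => (ip a b : C _)) HilbertBundle.continuous_ip
    (fun b => HilbertModule.zero_ip b) (fun a => HilbertModule.ip_zero a) ε.isIsoAction hRp hRe hξ hη

theorem isCc_rightSec (hRe : R.IsEtale) {ξ : ∀ z, E (R.anchor z)} (hξ : IsCc R.anchor ξ)
    {c : ∀ h, C (ℋ.src h)} (hc : IsCc ℋ.src c) : IsCc R.anchor (R.rightSec ε ξ c) := by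
  have := ℋ.locallyCompactSpace
  have := IsLocalHomeomorph.locallyCompactSpace hRe
  exact isCc_convSum R (m := fun a b => ract a b) HilbertBundle.continuous_ract
    (fun b => HilbertModule.zero_ract b) (fun a => HilbertModule.ract_zero a) ε.isIsoAction hξ hc

/-- The inner product is continuous in the inductive limit topology. -/
theorem exists_norm_ι_innerSec_le (hRp : R.IsProper) (hRe : R.IsEtale) {K : Set Z}
    (hK : IsCompact K) : ∃ c : ℝ, 0 ≤ c ∧ ∀ (ξ η : ∀ z, E (R.anchor z))
      (h : IsCc ℋ.src (R.innerSec ε ξ η)) (r s : ℝ), 0 ≤ r → 0 ≤ s → (∀ z ∉ K, ξ z = 0) →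
      (∀ z ∉ K, η z = 0) → (∀ z, ‖ξ z‖ ≤ r) → (∀ z, ‖η z‖ ≤ s) →
      ‖γ.ι ⟨_, h⟩‖ ≤ c * (r * s) := by
  have := ℋ.locallyCompactSpace
  have := IsLocalHomeomorph.locallyCompactSpace hRe
  -- The arrows that move some point of `K` into `K` form a compact set, which contains the supports
  -- of all inner products in question. Each value is a sum of at most `N` terms of norm at most `r
  -- s`.
  have hL := (hRp.isCompact_FP hK hK).image (f := fun q : R.FP => q.1.2)
    (continuous_snd.comp continuous_subtype_val)
  obtain ⟨c, hc, hcb⟩ := γ.isStarAction.exists_norm_bound (𝒢 := ℋ) hL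
  obtain ⟨N, hN⟩ := exists_card_le hRe hK
  refine ⟨c * N, by positivity, fun ξ η h r s hr hs hξ hη hξr hηs => ?_⟩
  rw [mul_assoc]
  refine hcb γ.isStarAction.isStarRep_crossedι ⟨_, h⟩ (fun k hk => ?_) _ (by positivity)
    fun k => ?_
  · refine finsum_eq_zero_of_forall_eq_zero fun z => ?_
    by_cases h1 : z.1 ∈ K
    · by_cases h2 : R.smul z.1 k ∈ K
      · exact absurd ⟨⟨(z.1, k), z.2.symm⟩, ⟨h1, h2⟩, rfl⟩ hk
      · rw [hη _ h2, tr_zero, HilbertModule.ip_zero]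
    · rw [hξ _ h1, map_zero, HilbertModule.zero_ip]
  · change ‖R.innerSec ε ξ η k‖ ≤ _
    rw [innerSec]
    have hfin : (Function.support fun z : {z : Z // R.anchor z = ℋ.rng k} =>
        (ip (ε.act (ℋ.inv k) ((ℋ.src_inv k).trans z.2.symm) (ℋ.rng_inv k) (ξ z.1))
          (tr (R.anchor_smul z.2.symm) (η (R.smul z.1 k))) : C (ℋ.src k))).Finite := by
      refine (finite_anchor_eq R hRe hK (ℋ.rng k)).subset fun z hz => by_contra fun hk => hz ?_
      simp only [hξ _ hk, map_zero, HilbertModule.zero_ip]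
    rw [finsum_eq_sum _ hfin]
    refine (norm_sum_le_of_le (f := _) _ (n := fun _ => r * s) fun z _ => ?_).trans ?_
    · refine (HilbertModule.norm_ip_le _ _).trans ?_
      rw [norm_tr, LinearIsometryEquiv.norm_map]
      exact mul_le_mul (hξr _) (hηs _) (norm_nonneg _) hr
    · rw [Finset.sum_const, nsmul_eq_mul]
      refine mul_le_mul_of_nonneg_right (Nat.cast_le.2 (hN _ _ fun z hz => ?_)) (by positivity)
      by_contra hk
      exact (hfin.mem_toFinset.1 hz) (by simp only [hξ _ hk, map_zero, HilbertModule.zero_ip])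

/-- A condition on the points `(z, h)` with `z · h` in a compact set that is open and holds over
`z₀` holds over a neighbourhood of `z₀`. -/
theorem IsProper.eventually_forall [LocallyCompactSpace Z] (hRp : R.IsProper) {K : Set Z}
    (hK : IsCompact K) {p : R.FP → Prop} (hp : IsOpen {q | p q}) {z₀ : Z}
    (h : ∀ q : R.FP, q.1.1 = z₀ → R.smul q.1.1 q.1.2 ∈ K → p q) :
    ∀ᶠ z in 𝓝 z₀, ∀ q : R.FP, q.1.1 = z → R.smul q.1.1 q.1.2 ∈ K → p q := by
  obtain ⟨N, hN, hz₀⟩ := exists_compact_mem_nhds z₀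
  have h1 := (((hRp.isCompact_FP hN hK).inter_right hp.isClosed_compl).image
    (f := fun q : R.FP => q.1.1) (continuous_fst.comp continuous_subtype_val)).isClosed
  have h2 : z₀ ∉ (fun q : R.FP => q.1.1) ''
      ({q : R.FP | q.1.1 ∈ N ∧ R.smul q.1.1 q.1.2 ∈ K} ∩ {q | p q}ᶜ) := by
    rintro ⟨q, ⟨hq, hq'⟩, he⟩
    exact hq' (h q he hq.2)
  filter_upwards [hz₀, h1.isOpen_compl.mem_nhds h2] with z hz hz' q hq hqK
  by_contra hne
  exact hz' ⟨q, ⟨⟨hq ▸ hz, hqK⟩, hne⟩, hq⟩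

/-- Locally, a section is approximated by finitely many rank one operators. -/
theorem exists_local_approx_unit (hRp : R.IsProper) (hRe : R.IsEtale) {ξ : ∀ z, E (R.anchor z)}
    (hξ : IsCc R.anchor ξ) {K : Set Z} (hK : IsCompact K) {δ : ℝ} (hδ : 0 < δ) (z₀ : Z) :
    ∃ (m : ℕ) (e : Fin m → ∀ y, E y), (∀ j, IsContSec (fun y : Y => y) (e j)) ∧
      ∀ᶠ z in 𝓝 z₀, ∀ h, (hz : ℋ.rng h = R.anchor z) → R.smul z h ∈ K →
        ‖∑ j, ract (e j (R.anchor z)) (ip (e j (R.anchor z))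
          (ε.act h (R.anchor_smul hz).symm hz (ξ (R.smul z h))) : C (R.anchor z)) -
            ε.act h (R.anchor_smul hz).symm hz (ξ (R.smul z h))‖ < δ := by
  have := ℋ.locallyCompactSpace
  have := IsLocalHomeomorph.locallyCompactSpace hRe
  -- Over `z₀` only finitely many translates of values of `ξ` matter, and these are almost fixed by
  -- a sum of rank one operators on one fibre. Sections through the vectors involved keep the
  -- estimate open, and `IsProper.eventually_forall` spreads it to nearby points.
  have hfin := finite_smul_mem R hRp hK z₀
  let s := hfin.toFinset
  let w : {h : H // ℋ.rng h = R.anchor z₀} → E (R.anchor z₀) := fun h =>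
    ε.act h.1 (R.anchor_smul h.2).symm h.2 (ξ (R.smul z₀ h.1))
  let v : Fin s.card → E (R.anchor z₀) := fun k => w (s.equivFin.symm k).1
  obtain ⟨f, hf⟩ := AdjOp.exists_approx_unit (Q := C (R.anchor z₀)) v hδ
  choose e he hef using fun j => BanachBundle.exists_section (A := E) (R.anchor z₀) (f j)
  refine ⟨s.card, e, fun j => (he j).1, ?_⟩
  have hs : IsContSec (fun q : R.FP => R.anchor q.1.1) fun q : R.FP =>
      ε.act q.1.2 (R.anchor_smul q.2).symm q.2 (ξ (R.smul q.1.1 q.1.2)) :=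
    ε.isIsoAction.isContSec (continuous_snd.comp continuous_subtype_val) _ _
      (hξ.1.comp R.continuous_smul_FP)
  have hb : Continuous fun q : R.FP => R.anchor q.1.1 :=
    R.continuous_anchor.comp (continuous_fst.comp continuous_subtype_val)
  have hD : IsContSec (fun q : R.FP => R.anchor q.1.1) fun q : R.FP =>
      ∑ j, ract (e j (R.anchor q.1.1)) (ip (e j (R.anchor q.1.1))
          (ε.act q.1.2 (R.anchor_smul q.2).symm q.2 (ξ (R.smul q.1.1 q.1.2))) : C (R.anchor q.1.1)) -
        ε.act q.1.2 (R.anchor_smul q.2).symm q.2 (ξ (R.smul q.1.1 q.1.2)) := by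
    refine (IsContSec.sum _ hb fun j _ => ?_).sub hs
    refine IsContSec.map₂' (Q := C) (m := fun a b => ract a b)
      HilbertBundle.continuous_ract (IsContSec.comp (he j).1 hb) ?_
    exact IsContSec.map₂' (m := fun a b => (ip a b : C _)) HilbertBundle.continuous_ip
      (IsContSec.comp (he j).1 hb) hs
  have h1 := hRp.eventually_forall hK (hD.isOpen_norm_lt δ) (z₀ := z₀) (by
    rintro ⟨⟨z, h⟩, hz⟩ rfl hhK
    obtain ⟨i, hi⟩ := s.equivFin.symm.surjective ⟨⟨h, hz⟩, hfin.mem_toFinset.2 hhK⟩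
    have h1 := hf i
    have h2 : v i = w ⟨h, hz⟩ := congrArg (fun k : s => w k.1) hi
    rw [h2] at h1
    simp only [hef]
    exact h1)
  filter_upwards [h1] with z hz h hh hhK
  exact hz ⟨(z, h), hh⟩ rfl hhK

/-- The error of an average over an orbit. -/
theorem norm_orbit_sum_sub_le [LocallyCompactSpace Z] (hRp : R.IsProper) {n : ℕ} {f : Fin n → Z → ℝ}
    (hfc : ∀ i, HasCompactSupport (f i)) (hf0 : ∀ i z, 0 ≤ f i z) {z : Z}
    (hf1 : ∑ i, R.orbSum (f i) z ≤ 1) {V : Type*} [NormedAddCommGroup V] [NormedSpace ℂ V]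
    (T : Fin n → {h : H // ℋ.rng h = R.anchor z} → V) {v : V} {δ : ℝ}
    (hv : ∑ i, R.orbSum (f i) z = 1 ∨ ‖v‖ ≤ δ)
    (hT : ∀ i h, f i (R.smul z h.1) ≠ 0 → ‖T i h - v‖ ≤ δ) :
    ‖∑ i, ∑ᶠ h : {h : H // ℋ.rng h = R.anchor z}, (f i (R.smul z h.1) : ℂ) • T i h - v‖ ≤ δ := by
  have := ℋ.locallyCompactSpace
  have hfin := fun i => finite_support_orbSum hRp (hfc i) z
  have h1 : ∀ i, ∑ᶠ h : {h : H // ℋ.rng h = R.anchor z}, (f i (R.smul z h.1) : ℂ) • T i h =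
      ∑ h ∈ (hfin i).toFinset, (f i (R.smul z h.1) : ℂ) • T i h := fun i => by
    refine finsum_eq_sum_of_support_subset _ fun h hh => (hfin i).mem_toFinset.2 fun h0 => hh ?_
    simp only [h0, Complex.ofReal_zero, zero_smul]
  have h2 : ∀ i, R.orbSum (f i) z = ∑ h ∈ (hfin i).toFinset, f i (R.smul z h.1) := fun i =>
    finsum_eq_sum _ _
  set F := ∑ i, R.orbSum (f i) z with hF
  -- The weights have total `F ≤ 1`. The error splits into the weighted errors, of total at most `F
  -- δ`, and the missing part `(1 - F) v`, which is zero if `F = 1` and at most `(1 - F) δ` if `‖v‖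
  -- ≤ δ`.
  have h3 : ∑ i, ∑ᶠ h : {h : H // ℋ.rng h = R.anchor z}, (f i (R.smul z h.1) : ℂ) • T i h - v =
      ∑ i, ∑ h ∈ (hfin i).toFinset, (f i (R.smul z h.1) : ℂ) • (T i h - v) -
        ((1 - F : ℝ) : ℂ) • v := by
    simp only [h1, smul_sub, Finset.sum_sub_distrib, ← Finset.sum_smul]
    have : ((1 - F : ℝ) : ℂ) = 1 - ∑ i, ∑ h ∈ (hfin i).toFinset, (f i (R.smul z h.1) : ℂ) := by
      simp only [hF, h2, Complex.ofReal_sub, Complex.ofReal_sum, Complex.ofReal_one]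
    rw [this, sub_smul, one_smul]
    abel
  have h4 : ‖∑ i, ∑ h ∈ (hfin i).toFinset, (f i (R.smul z h.1) : ℂ) • (T i h - v)‖ ≤ F * δ := by
    rw [hF, Finset.sum_mul]
    refine norm_sum_le_of_le _ fun i _ => ?_
    rw [h2, Finset.sum_mul]
    refine norm_sum_le_of_le _ fun h hh => ?_
    rw [norm_smul, Complex.norm_real, Real.norm_of_nonneg (hf0 _ _)]
    exact mul_le_mul_of_nonneg_left (hT i h ((hfin i).mem_toFinset.1 hh)) (hf0 _ _)
  have h5 : ‖((1 - F : ℝ) : ℂ) • v‖ ≤ (1 - F) * δ := by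
    rw [norm_smul, Complex.norm_real, Real.norm_of_nonneg (sub_nonneg.2 hf1)]
    rcases hv with hv | hv
    · simp [hv]
    · exact mul_le_mul_of_nonneg_left hv (sub_nonneg.2 hf1)
  rw [h3]
  refine (norm_sub_le _ _).trans ((add_le_add h4 h5).trans_eq ?_)
  ring

/-- Each element of `Γ_c(Z, E)` is approximated by sums of sections `ζ⟨ζ, ξ⟩`. -/
theorem exists_sum_rightSec_innerSec (hRp : R.IsProper) (hRe : R.IsEtale)
    {ξ : ∀ z, E (R.anchor z)} (hξ : IsCc R.anchor ξ) {δ : ℝ} (hδ : 0 < δ) :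
    ∃ (n : ℕ) (m : Fin n → ℕ) (ζ : ∀ i : Fin n, Fin (m i) → ∀ z, E (R.anchor z)),
      (∀ i j, IsCc R.anchor (ζ i j)) ∧
      ∀ z, ‖∑ i, ∑ j, R.rightSec ε (ζ i j) (R.innerSec ε (ζ i j) ξ) z - ξ z‖ ≤ δ ∧
        (ξ z = 0 → ∑ i, ∑ j, R.rightSec ε (ζ i j) (R.innerSec ε (ζ i j) ξ) z = 0) := by
  have := ℋ.locallyCompactSpace
  have := IsLocalHomeomorph.locallyCompactSpace hRe
  choose m e he hev using fun z₀ => exists_local_approx_unit hRp hRe (ε := ε) hξ hξ.2 hδ z₀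
  choose V hV hVi using (IsLocalHomeomorph.isEtaleMap hRe).exists_injOn
  obtain ⟨n, t, f, -, hfc, hfs, hfU, hf0, hf1, hfK⟩ := exists_orbit_partition hRp hξ.2
    (fun z₀ => V z₀ ∩ _) (fun z₀ _ => inter_mem (hV z₀) (hev z₀))
  -- Each rank one operator uses `ζ` twice, so square roots of the cutoff functions give the weight
  -- `f i`.
  let ζ : ∀ i : Fin n, Fin (m (t i)) → ∀ z, E (R.anchor z) := fun i j z =>
    ((Real.sqrt (f i z) : ℝ) : ℂ) • e (t i) j (R.anchor z)
  have hsq : ∀ i, HasCompactSupport fun z => Real.sqrt (f i z) := fun i =>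
    (hfs i).comp_left Real.sqrt_zero
  have hζc : ∀ i j, IsCc R.anchor (ζ i j) := fun i j =>
    (IsContSec.comp (he (t i) j) R.continuous_anchor).isCc_smul
      (Real.continuous_sqrt.comp (hfc i)) (hsq i)
  have hζ0 : ∀ i j, ∀ z ∉ V (t i), ζ i j z = 0 := fun i j z hz => by
    have : f i z = 0 := image_eq_zero_of_notMem_tsupport fun h => hz (hfU i h).1
    simp only [ζ, this, Real.sqrt_zero, Complex.ofReal_zero, zero_smul]
  let T : ∀ z, Fin n → {h : H // ℋ.rng h = R.anchor z} → E (R.anchor z) := fun z i h =>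
    ∑ j, ract (ε.act h.1 (R.anchor_smul h.2).symm h.2 (e (t i) j (R.anchor (R.smul z h.1))))
      (ip (ε.act h.1 (R.anchor_smul h.2).symm h.2 (e (t i) j (R.anchor (R.smul z h.1)))) (ξ z) :
        C (R.anchor z))
  have hsum : ∀ z, ∑ i, ∑ j, R.rightSec ε (ζ i j) (R.innerSec ε (ζ i j) ξ) z =
      ∑ i, ∑ᶠ h : {h : H // ℋ.rng h = R.anchor z}, (f i (R.smul z h.1) : ℂ) • T z i h := by
    intro z
    refine Finset.sum_congr rfl fun i _ => ?_
    have h1 : ∀ j (h : {h : H // ℋ.rng h = R.anchor z}),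
        ract (ε.act h.1 (R.anchor_smul h.2).symm h.2 (ζ i j (R.smul z h.1)))
          (ip (ε.act h.1 (R.anchor_smul h.2).symm h.2 (ζ i j (R.smul z h.1))) (ξ z) :
            C (R.anchor z)) = (f i (R.smul z h.1) : ℂ) •
        ract (ε.act h.1 (R.anchor_smul h.2).symm h.2 (e (t i) j (R.anchor (R.smul z h.1))))
          (ip (ε.act h.1 (R.anchor_smul h.2).symm h.2 (e (t i) j (R.anchor (R.smul z h.1))))
            (ξ z) : C (R.anchor z)) := fun j h => by
      simp only [ζ, map_smul]
      rw [HilbertModule.smul_ip, HilbertModule.ract_smul, HilbertModule.smul_ract, smul_smul,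
        Complex.conj_ofReal, ← Complex.ofReal_mul, Real.mul_self_sqrt (hf0 _ _)]
    simp only [T, Finset.smul_sum]
    rw [finsum_sum_comm]
    · refine Finset.sum_congr rfl fun j _ => ?_
      rw [rightSec_innerSec (hVi (t i)) (hζ0 i j) (hζ0 i j)]
      exact finsum_congr (h1 j)
    · refine fun j _ => (finite_support_orbSum hRp (hfs i) z).subset fun h hh h0 => hh ?_
      simp only [h0, Complex.ofReal_zero, zero_smul]
  refine ⟨n, fun i => m (t i), ζ, hζc, fun z => ⟨?_, fun h0 => ?_⟩⟩
  · rw [hsum]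
    by_cases hz : ξ z = 0
    · refine norm_orbit_sum_sub_le hRp hfs hf0 (hf1 z) _ (Or.inr (by simp [hz, hδ.le]))
        fun i h _ => ?_
      simp only [T, hz, HilbertModule.ip_zero, HilbertModule.ract_zero, Finset.sum_const_zero,
        sub_zero, norm_zero, hδ.le]
    · have hzK : z ∈ closure {z | ξ z ≠ 0} := subset_closure hz
      refine norm_orbit_sum_sub_le hRp hfs hf0 (hf1 z) _ (Or.inl (hfK z hzK))
        fun i h hne => ?_
      have h1 := (hfU i (subset_tsupport _ hne)).2
      have h2 : ℋ.rng (ℋ.inv h.1) = R.anchor (R.smul z h.1) := by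
        rw [ℋ.rng_inv, R.anchor_smul h.2]
      have h3 := (h1 (ℋ.inv h.1) h2 (by rw [R.smul_smul_inv h.2]; exact hzK)).le
      -- The local estimate holds at `z h`, for the translate by `h⁻¹` of the value of `ξ` at `z`.
      -- The isometric action of `h` carries it back to `z`.
      have h4 : ε.act h.1 (R.anchor_smul h.2).symm h.2 (ε.act (ℋ.inv h.1) (R.anchor_smul h2).symm h2
          (ξ (R.smul (R.smul z h.1) (ℋ.inv h.1)))) = ξ z := by
        rw [HilbertAction.act_act]
        refine (HilbertAction.act_congr R (g' := ℋ.one (R.anchor z)) (z' := z) ?_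
          (R.smul_smul_inv h.2) _ _ (ℋ.src_one _) (ℋ.rng_one _)).trans (ε.act_one _ _)
        rw [ℋ.mul_inv, h.2]
      rw [← LinearIsometryEquiv.norm_map (ε.act h.1 (R.anchor_smul h.2).symm h.2), map_sub,
        map_sum, h4] at h3
      refine (le_of_eq ?_).trans h3
      congr 2
      refine Finset.sum_congr rfl fun j _ => ?_
      rw [HilbertAction.map_ract, HilbertAction.map_ip, h4]
  · rw [hsum]
    refine Finset.sum_eq_zero fun i _ => finsum_eq_zero_of_forall_eq_zero fun h => ?_
    simp only [T, h0, HilbertModule.ip_zero, HilbertModule.ract_zero, Finset.sum_const_zero,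
      smul_zero]

variable (ε) in
-- Approximate `ξ` by `ξ' = ∑ ζ⟨ζ, ξ⟩`. Then `⟨ξ, ξ'⟩ = ∑ ⟨ζ, ξ⟩⋆⟨ζ, ξ⟩` is positive. As `ξ'`
-- vanishes wherever `ξ` does, the estimate for sections supported in a fixed compact set shows that
-- `⟨ξ, ξ'⟩` is close to `⟨ξ, ξ⟩`.
theorem ι_innerSec_self_nonneg (hRp : R.IsProper) (hRe : R.IsEtale) {ξ : ∀ z, E (R.anchor z)}
    (hξ : IsCc R.anchor ξ) (hc : IsCc ℋ.src (R.innerSec ε ξ ξ)) : 0 ≤ γ.ι ⟨_, hc⟩ := by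
  have := ℋ.locallyCompactSpace
  have := IsLocalHomeomorph.locallyCompactSpace hRe
  have hιr := γ.isStarAction.isStarRep_crossedι
  obtain ⟨c, hc0, hcb⟩ := exists_norm_ι_innerSec_le hRp hRe (ε := ε) hξ.2
  obtain ⟨r, hr, hξr⟩ := hξ.exists_bound
  have hcl : IsClosed {q : γ.Crossed | 0 ≤ q} := CStarAlgebra.isClosed_nonneg
  refine hcl.closure_subset (Metric.mem_closure_iff.2 fun κ hκ => ?_)
  obtain ⟨δ, hδ, hδκ⟩ : ∃ δ > 0, c * (r * δ) < κ := by
    refine ⟨κ / (c * r + 1), by positivity, ?_⟩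
    rw [← mul_assoc, mul_div_assoc', div_lt_iff₀ (by positivity)]
    nlinarith
  obtain ⟨n, m, ζ, hζ, hζb⟩ := exists_sum_rightSec_innerSec hRp hRe (ε := ε) hξ hδ
  have hi : ∀ i j, IsCc ℋ.src (R.innerSec ε (ζ i j) ξ) := fun i j =>
    isCc_innerSec hRp hRe (hζ i j) hξ
  have hi' : ∀ i j, IsCc ℋ.src (R.innerSec ε ξ (ζ i j)) := fun i j =>
    isCc_innerSec hRp hRe hξ (hζ i j)
  have hrs : ∀ i j, IsCc R.anchor (R.rightSec ε (ζ i j) (R.innerSec ε (ζ i j) ξ)) := fun i j =>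
    isCc_rightSec hRe (hζ i j) (hi i j)
  let ξ' : ∀ z, E (R.anchor z) := fun z =>
    ∑ i, ∑ j, R.rightSec ε (ζ i j) (R.innerSec ε (ζ i j) ξ) z
  have hξ'j : ∀ i, IsCc R.anchor fun z =>
      ∑ j, R.rightSec ε (ζ i j) (R.innerSec ε (ζ i j) ξ) z := fun i =>
    IsCc.sum _ R.continuous_anchor fun j _ => hrs i j
  have hξ' : IsCc R.anchor ξ' := IsCc.sum _ R.continuous_anchor fun i _ => hξ'j i
  have hc' := isCc_innerSec hRp hRe (ε := ε) hξ hξ'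
  have hsum : ∀ h, R.innerSec ε ξ ξ' h =
      ∑ i, ∑ j, conv ℋ (A := C) (fun h hx hy => γ.act h hx hy)
        (R.innerSec ε ξ (ζ i j)) (R.innerSec ε (ζ i j) ξ) h := by
    let L : ccSub E R.continuous_anchor →ₗ[ℂ] ∀ h, C (ℋ.src h) :=
      { toFun := fun η => R.innerSec ε ξ η.1
        map_add' := fun η η' => funext fun h => innerSec_add hRe hξ η.1 η'.1 h
        map_smul' := fun t η => funext fun h => innerSec_smul t ξ η.1 h }
    have h1 : (⟨ξ', hξ'⟩ : ccSub E R.continuous_anchor) =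
        ∑ i, ∑ j, ⟨R.rightSec ε (ζ i j) (R.innerSec ε (ζ i j) ξ), hrs i j⟩ := by
      refine Subtype.ext (funext fun z => ?_)
      simp only [Submodule.coe_sum, Finset.sum_apply]
      rfl
    have h2 := congrArg L h1
    simp only [map_sum] at h2
    intro h
    refine (congrFun h2 h).trans ?_
    simp only [Finset.sum_apply]
    refine Finset.sum_congr rfl fun i _ => Finset.sum_congr rfl fun j _ => ?_
    exact congrFun (innerSec_rightSec hRe hξ (hi i j)) h
  refine ⟨γ.ι ⟨_, hc'⟩, ?_, ?_⟩
  · have hcv : ∀ i j, IsCc ℋ.src (conv ℋ (A := C) (fun h hx hy => γ.act h hx hy)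
        (R.innerSec ε ξ (ζ i j)) (R.innerSec ε (ζ i j) ξ)) := fun i j =>
      γ.isStarAction.isCc_conv (hi' i j) (hi i j)
    have hcvj : ∀ i, IsCc ℋ.src fun h => ∑ j, conv ℋ (A := C) (fun h hx hy => γ.act h hx hy)
        (R.innerSec ε ξ (ζ i j)) (R.innerSec ε (ζ i j) ξ) h := fun i =>
      IsCc.sum _ ℋ.continuous_src fun j _ => hcv i j
    have h1 : γ.ι ⟨_, hc'⟩ = ∑ i, ∑ j, star (γ.ι ⟨_, hi i j⟩) * γ.ι ⟨_, hi i j⟩ := by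
      refine (hιr.map_sum Finset.univ (fun i => ⟨_, hcvj i⟩) _ hsum).trans ?_
      refine Finset.sum_congr rfl fun i _ => ?_
      refine (hιr.map_sum Finset.univ (fun j => ⟨_, hcv i j⟩) _ fun h => rfl).trans ?_
      refine Finset.sum_congr rfl fun j _ => ?_
      refine (hιr.map_mul ⟨_, hi' i j⟩ ⟨_, hi i j⟩ _ fun h => rfl).trans ?_
      refine congrArg (fun q => q * γ.ι ⟨_, hi i j⟩) ?_
      exact hιr.map_star ⟨_, hi i j⟩ ⟨_, hi' i j⟩ fun h => (congrFun (adj_innerSec _ _) h).symm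
    change 0 ≤ γ.ι ⟨_, hc'⟩
    rw [h1]
    exact Finset.sum_nonneg fun i _ => Finset.sum_nonneg fun j _ => star_mul_self_nonneg _
  · have hd : IsCc R.anchor fun z => ξ z - ξ' z := hξ.sub hξ'
    have hdc := isCc_innerSec hRp hRe (ε := ε) hξ hd
    have h1 : γ.ι ⟨_, hc⟩ - γ.ι ⟨_, hc'⟩ = γ.ι ⟨_, hdc⟩ := by
      refine sub_eq_of_eq_add (hιr.map_add ⟨_, hdc⟩ ⟨_, hc'⟩ ⟨_, hc⟩ fun h => ?_)
      refine Eq.trans ?_ (innerSec_add hRe hξ (fun z => ξ z - ξ' z) ξ' h)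
      simp only [sub_add_cancel]
    rw [dist_eq_norm, h1]
    refine (hcb _ _ hdc r δ hr.le hδ.le (fun z hz => IsCc.eq_zero hz) (fun z hz => ?_) hξr
      fun z => ?_).trans_lt hδκ
    · have h0 : ξ z = 0 := IsCc.eq_zero hz
      change ξ z - ξ' z = 0
      have h0' : ξ' z = 0 := (hζb z).2 h0
      rw [h0', h0, sub_zero]
    · rw [norm_sub_rev]
      exact (hζb z).1

end RightAction

attribute [local instance] CStarAlgebra.spectralOrder CStarAlgebra.spectralOrderedRing

/-! ### The module `Ω ⋉ E` -/

theorem tr_ip_self_nonneg {Y : Type*} {C : Y → Type*} [∀ y, NonUnitalCStarAlgebra (C y)]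
    {E : Y → Type*} [∀ y, NormedAddCommGroup (E y)] [∀ y, NormedSpace ℂ (E y)]
    [∀ y, CompleteSpace (E y)] [∀ y, HilbertModule (C y) (E y)] {y y' : Y} (e : y = y') (a : E y) :
    0 ≤ tr (A := C) e (ip a a) := by
  subst e
  exact HilbertModule.ip_self_nonneg' _

namespace RightAction

variable {H : Type uH} {Y : Type uY} {Z : Type uΩ} [TopologicalSpace H] [TopologicalSpace Y]
  [TopologicalSpace Z] {ℋ : EtaleGroupoid H Y} {R : RightAction ℋ Z}
  {C : Y → Type uC} [∀ y, NonUnitalCStarAlgebra (C y)] [TopologicalSpace (Tot C)]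
  {E : Y → Type uE} [∀ y, NormedAddCommGroup (E y)] [∀ y, NormedSpace ℂ (E y)]
  [∀ y, CompleteSpace (E y)] [TopologicalSpace (Tot E)] [∀ y, HilbertModule (C y) (E y)]
  {γ : CStarAction ℋ C} {ε : HilbertAction γ E}

theorem innerSec_one (ξ η : ∀ z, E (R.anchor z)) (y : Y) :
    tr (ℋ.src_one y) (R.innerSec ε ξ η (ℋ.one y)) =
      ∑ᶠ z : {z : Z // R.anchor z = y}, tr z.2 (ip (ξ z.1) (η z.1) : C (R.anchor z.1)) := by
  refine (tr_finsum (A := C) _ _).trans ?_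
  refine finsum_subtype_congr (fun z => by rw [ℋ.rng_one]) fun z hz hz' => ?_
  refine (tr_ip _ _ _).trans (Eq.trans ?_ (tr_ip _ _ _).symm)
  congr 1
  · refine (HilbertAction.tr_act _ _ _ _ _).trans ?_
    refine (HilbertAction.act_congr R (g' := ℋ.one y) (z' := z) (ℋ.inv_one y) rfl _ _
      ((ℋ.src_one y).trans hz'.symm) (ℋ.rng_one y)).trans ?_
    exact HilbertAction.act_one' _ _ _
  · refine (tr_tr _ _ _).trans (sec_congr η ?_ _ _)
    subst hz'
    exact R.smul_one z

variable [CStarBundle C] [HilbertBundle C E] [T2Space Y] [T2Space H] [T2Space Z]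
  [LocallyCompactSpace Y]

variable (ε) in
/-- The pre-Hilbert module `Γ_c(Z, E)`. -/
def modPre (hRp : R.IsProper) (hRe : R.IsEtale) :
    PreHilbert γ.Crossed (ccSub E R.continuous_anchor) where
  ip ξ η := γ.ι ⟨R.innerSec ε ξ.1 η.1, isCc_innerSec hRp hRe ξ.2 η.2⟩
  ip_add ξ η η' := by
    have := ℋ.locallyCompactSpace
    have := IsLocalHomeomorph.locallyCompactSpace hRe
    exact γ.isStarAction.isStarRep_crossedι.map_add _ _ _ fun h =>
      innerSec_add hRe ξ.2 η.1 η'.1 h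
  ip_smul c ξ η := by
    have := ℋ.locallyCompactSpace
    have := IsLocalHomeomorph.locallyCompactSpace hRe
    exact γ.isStarAction.isStarRep_crossedι.map_smul _ _ _ fun h => innerSec_smul c ξ.1 η.1 h
  star_ip ξ η := (γ.isStarAction.isStarRep_crossedι.map_star _ _ fun h =>
    (congrFun (adj_innerSec ξ.1 η.1) h).symm).symm
  ip_self_nonneg ξ := ι_innerSec_self_nonneg ε hRp hRe ξ.2 _
  dense_ract := by
    have := ℋ.locallyCompactSpace
    have := IsLocalHomeomorph.locallyCompactSpace hRe
    refine γ.isStarAction.denseRange_crossedι.mono ?_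
    rintro _ ⟨c, rfl⟩ η
    refine ⟨⟨_, isCc_rightSec (ε := ε) hRe η.2 c.2⟩, fun ξ => ?_⟩
    exact γ.isStarAction.isStarRep_crossedι.map_mul _ _ _ fun h =>
      congrFun (innerSec_rightSec hRe ξ.2 c.2) h

variable {hRp : R.IsProper} {hRe : R.IsEtale}
  {M : Type*} [NormedAddCommGroup M] [NormedSpace ℂ M] [CompleteSpace M]
  [HilbertModule γ.Crossed M] {j : ccSub E R.continuous_anchor →ₗ[ℂ] M}

/-- Inner products with the dense range of `j` determine an element, and those of both sides are
`⟨η, ξ⟩ c`. -/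
theorem ract_ι (hj : DenseRange j)
    (hip : ∀ ξ η, (ip (j ξ) (j η) : γ.Crossed) = (modPre ε hRp hRe).ip ξ η)
    (ξ : ccSub E R.continuous_anchor) (c : Cc C ℋ.src) :
    ract (j ξ) (γ.ι c) = j ⟨_, isCc_rightSec (ε := ε) hRe ξ.2 c.2⟩ := by
  have := ℋ.locallyCompactSpace
  have := IsLocalHomeomorph.locallyCompactSpace hRe
  refine HilbertModule.ext_ip γ.Crossed fun n => ?_
  refine congrFun (hj.equalizer (HilbertModule.continuous_ip_left _)
    (HilbertModule.continuous_ip_left _) (funext fun η => ?_)) n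
  refine (HilbertModule.ip_ract _ _ _).trans ?_
  refine Eq.trans ?_ (hip _ _).symm
  rw [hip]
  exact (γ.isStarAction.isStarRep_crossedι.map_mul _ _ _ fun h =>
      congrFun (innerSec_rightSec hRe η.2 c.2) h).symm

/-- If `⟨ξ, ξ⟩` vanishes in the crossed product, it vanishes as a section over `H` by injectivity of
the canonical map. At units it is a sum of the positive elements `⟨ξ(z), ξ(z)⟩`, each of which must
be zero. -/
theorem eq_zero_of_completion
    (hip : ∀ ξ η, (ip (j ξ) (j η) : γ.Crossed) = (modPre ε hRp hRe).ip ξ η)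
    {ξ : ccSub E R.continuous_anchor} (h : j ξ = 0) : ξ = 0 := by
  have := ℋ.locallyCompactSpace
  have := IsLocalHomeomorph.locallyCompactSpace hRe
  refine Subtype.ext (funext fun z => ?_)
  have h1 := hip ξ ξ
  rw [h, HilbertModule.ip_zero] at h1
  have h2 : R.innerSec ε ξ.1 ξ.1 (ℋ.one (R.anchor z)) = 0 := CStarAction.ι_injective h1.symm _
  have h3 := innerSec_one (ε := ε) ξ.1 ξ.1 (R.anchor z)
  rw [h2, tr_zero] at h3
  have hnn : ∀ z' : {z' : Z // R.anchor z' = R.anchor z},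
      0 ≤ tr z'.2 (ip (ξ.1 z'.1) (ξ.1 z'.1) : C (R.anchor z'.1)) := fun z' =>
    tr_ip_self_nonneg z'.2 _
  have hfin : (Function.support fun z' : {z' : Z // R.anchor z' = R.anchor z} =>
      tr z'.2 (ip (ξ.1 z'.1) (ξ.1 z'.1) : C (R.anchor z'.1))).Finite := by
    refine (finite_anchor_eq R hRe ξ.2.2 (R.anchor z)).subset
      fun z' hz' => by_contra fun hk => hz' ?_
    have h0 : ξ.1 z'.1 = 0 := IsCc.eq_zero hk
    simp only [h0, HilbertModule.ip_zero, tr_zero]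
  rw [finsum_eq_sum _ hfin] at h3
  have h4 : (ip (ξ.1 z) (ξ.1 z) : C (R.anchor z)) = 0 := by
    by_contra hne
    have := (Finset.sum_eq_zero_iff_of_nonneg fun z' _ => hnn z').1 h3.symm ⟨z, rfl⟩
      (hfin.mem_toFinset.2 hne)
    exact hne this
  have h5 := HilbertModule.norm_sq (Q := C (R.anchor z)) (ξ.1 z)
  rw [h4, norm_zero] at h5
  exact norm_eq_zero.1 (pow_eq_zero_iff two_ne_zero |>.1 h5)

/-- For sections supported in a fixed compact set, uniform convergence implies convergence in the
module. -/
theorem norm_completion_le (hRp : R.IsProper) (hRe : R.IsEtale)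
    (hip : ∀ ξ η, (ip (j ξ) (j η) : γ.Crossed) = (modPre ε hRp hRe).ip ξ η) {K : Set Z}
    (hK : IsCompact K) : ∃ c : ℝ, 0 ≤ c ∧ ∀ (ξ : ccSub E R.continuous_anchor) (r : ℝ), 0 ≤ r →
      (∀ z ∉ K, ξ.1 z = 0) → (∀ z, ‖ξ.1 z‖ ≤ r) → ‖j ξ‖ ≤ c * r := by
  obtain ⟨c, hc, h⟩ := exists_norm_ι_innerSec_le hRp hRe (ε := ε) hK
  refine ⟨Real.sqrt c, Real.sqrt_nonneg _, fun ξ r hr hξ hξr => ?_⟩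
  refine abs_le_of_sq_le_sq' (a := ‖j ξ‖) ?_ (by positivity) |>.2
  rw [HilbertModule.norm_sq (Q := γ.Crossed), hip, mul_pow, Real.sq_sqrt hc, sq r]
  exact h _ _ _ r r hr hr hξ hξ hξr hξr

end RightAction

theorem isCrossedProductModule_of_completion
    {G : Type uG} {X : Type uX} {H : Type uH} {Y : Type uY} {Ω : Type uΩ}
    [TopologicalSpace G] [TopologicalSpace X] [TopologicalSpace H] [TopologicalSpace Y]
    [TopologicalSpace Ω] [T2Space H] [T2Space Y] [T2Space Ω] [LocallyCompactSpace Y]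
    {𝒢 : EtaleGroupoid G X} {ℋ : EtaleGroupoid H Y} (W : EtaleCorrespondence 𝒢 ℋ Ω)
    {C : Y → Type uC} [∀ y, NonUnitalCStarAlgebra (C y)] [TopologicalSpace (Tot C)]
    [CStarBundle C]
    {E : Y → Type uE} [∀ y, NormedAddCommGroup (E y)] [∀ y, NormedSpace ℂ (E y)]
    [∀ y, CompleteSpace (E y)] [TopologicalSpace (Tot E)] [∀ y, HilbertModule (C y) (E y)]
    [HilbertBundle C E] {γ : CStarAction ℋ C} {ε : HilbertAction γ E}
    {M : Type*} [NormedAddCommGroup M] [NormedSpace ℂ M] [CompleteSpace M]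
    [HilbertModule γ.Crossed M] {j : ccSub E W.right.continuous_anchor →ₗ[ℂ] M}
    (hj : DenseRange j)
    (hip : ∀ ξ η, (ip (j ξ) (j η) : γ.Crossed) =
      (RightAction.modPre ε W.proper W.etale).ip ξ η) :
    IsCrossedProductModule W ε fun ξ : Cc E W.right.anchor => j ⟨ξ.1, ξ.2⟩ where
  map_add ξ η ζ h := by
    rw [← map_add]
    exact congrArg j (Subtype.ext (funext h))
  map_smul t ξ η h := by
    rw [← map_smul]
    exact congrArg j (Subtype.ext (funext h))
  injective ξ η h := by
    have h1 : j (⟨ξ.1, ξ.2⟩ - ⟨η.1, η.2⟩) = 0 := by rw [map_sub, sub_eq_zero]; exact h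
    have h2 := sub_eq_zero.1 (RightAction.eq_zero_of_completion hip h1)
    exact Subtype.ext (congrArg Subtype.val h2)
  denseRange := Dense.mono (by rintro _ ⟨ξ, rfl⟩; exact ⟨⟨ξ.1, ξ.2⟩, rfl⟩) hj
  ip_eq ξ η := ⟨RightAction.isCc_innerSec W.proper W.etale ξ.2 η.2, hip _ _⟩
  ract_eq ξ c := ⟨RightAction.isCc_rightSec W.etale ξ.2 c.2, RightAction.ract_ι hj hip _ c⟩

/-! ### Orbit spaces -/

namespace RightAction

variable {H Y Z : Type*} [TopologicalSpace H] [TopologicalSpace Y] [TopologicalSpace Z]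
  {ℋ : EtaleGroupoid H Y} (R : RightAction ℋ Z)

/-- The projection to the orbit space. -/
abbrev orb (z : Z) : R.Orbits := Quot.mk _ z

variable {R}

theorem orb_smul {z : Z} {h : H} (hz : ℋ.rng h = R.anchor z) : R.orb (R.smul z h) = R.orb z :=
  (Quot.sound ⟨h, hz, rfl⟩).symm

/-- Lying in one orbit is already an equivalence relation, so equality in the quotient is witnessed
by a single arrow. -/
theorem orb_eq_orb {z z' : Z} (h : R.orb z = R.orb z') :
    ∃ h, ℋ.rng h = R.anchor z ∧ R.smul z h = z' := by
  have he : Equivalence fun z z' : Z => ∃ g, ℋ.rng g = R.anchor z ∧ R.smul z g = z' := by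
    refine ⟨fun z => ⟨ℋ.one (R.anchor z), ℋ.rng_one _, R.smul_one z⟩, ?_, ?_⟩
    · rintro z _ ⟨g, hg, rfl⟩
      exact ⟨ℋ.inv g, by rw [ℋ.rng_inv, R.anchor_smul hg], R.smul_smul_inv hg⟩
    · rintro z _ _ ⟨g, hg, rfl⟩ ⟨k, hk, rfl⟩
      have h1 : ℋ.src g = ℋ.rng k := by rw [hk, R.anchor_smul hg]
      exact ⟨ℋ.mul g k, (ℋ.rng_mul h1).trans hg, R.smul_mul hg h1⟩
  exact he.eqvGen_iff.1 (Quot.eqvGen_exact h)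

/-- The saturation of an open set is the image of an open set of composable pairs under an étale
projection. -/
theorem isOpenMap_orb : IsOpenMap R.orb := by
  intro U hU
  refine isOpen_coinduced.2 ?_
  have : R.orb ⁻¹' (R.orb '' U) = (fun q : R.FP => q.1.1) '' {q | R.smul q.1.1 q.1.2 ∈ U} := by
    ext z
    constructor
    · rintro ⟨z', hz', h⟩
      obtain ⟨k, hk, rfl⟩ := orb_eq_orb h.symm
      exact ⟨⟨(z, k), hk⟩, hz', rfl⟩
    · rintro ⟨q, hq, rfl⟩
      exact ⟨_, hq, orb_smul q.2⟩
  change IsOpen (R.orb ⁻¹' (R.orb '' U))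
  rw [this]
  exact R.isEtaleMap_fst.isOpenMap _ (hU.preimage R.continuous_smul_FP)

/-- Compact subsets of the orbit space lift to compact subsets. -/
theorem exists_compact_lift [LocallyCompactSpace Z] {K : Set R.Orbits} (hK : IsCompact K) :
    ∃ L : Set Z, IsCompact L ∧ ∀ z, R.orb z ∈ K → ∃ h, ℋ.rng h = R.anchor z ∧ R.smul z h ∈ L := by
  choose N hN hz using fun z : Z => exists_compact_mem_nhds z
  obtain ⟨t, ht⟩ := hK.elim_finite_subcover (fun z => R.orb '' interior (N z))
    (fun z => isOpenMap_orb _ isOpen_interior) (by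
      intro k _
      obtain ⟨z, rfl⟩ := Quot.exists_rep k
      exact Set.mem_iUnion.2 ⟨z, z, mem_interior_iff_mem_nhds.2 (hz z), rfl⟩)
  refine ⟨⋃ z ∈ t, N z, t.isCompact_biUnion fun z _ => hN z, fun z hzK => ?_⟩
  obtain ⟨z', hz', w, hw, he⟩ := Set.mem_iUnion₂.1 (ht hzK)
  obtain ⟨h, hh, rfl⟩ := orb_eq_orb he.symm
  exact ⟨h, hh, Set.mem_biUnion hz' (interior_subset hw)⟩

end RightAction

/-! ### Induced algebras -/

section Ind

variable {H : Type uH} {Y : Type uY} [TopologicalSpace H] [TopologicalSpace Y]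
  {ℋ : EtaleGroupoid H Y} {B : Y → Type uB} [∀ y, NonUnitalCStarAlgebra (B y)]
  [TopologicalSpace (Tot B)] [CStarBundle B] {β : CStarAction ℋ B}
  {Z : Type*} [TopologicalSpace Z] {R : RightAction ℋ Z}

theorem Ind.norm_apply_le (ξ : Ind R β) (z : Z) : ‖ξ.1 z‖ ≤ ‖ξ‖ :=
  lp.norm_apply_le_norm (by simp) ξ.1 z

theorem Ind.norm_le {ξ : Ind R β} {r : ℝ} (hr : 0 ≤ r) (h : ∀ z, ‖ξ.1 z‖ ≤ r) : ‖ξ‖ ≤ r :=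
  lp.norm_le_of_forall_le hr h

theorem Ind.norm_smul_point (ξ : Ind R β) {z : Z} {h : H} (hz : ℋ.rng h = R.anchor z) :
    ‖ξ.1 (R.smul z h)‖ = ‖ξ.1 z‖ := by
  rw [ξ.2.2.1 z h hz]
  exact β.isIsoAction.norm_map _ _ _ _

/-- All three conditions survive uniform limits. Closedness is what makes the induced algebra and
its fibres complete, hence C⋆-algebras. -/
instance Ind.isClosed (R : RightAction ℋ Z) (β : CStarAction ℋ B) :
    IsClosed (Ind R β : Set (lp (fun z => B (R.anchor z)) ∞)) := by
  refine isClosed_of_closure_subset fun ξ hξ => ?_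
  have happ : ∀ δ > 0, ∃ η ∈ Ind R β, ∀ z, ‖ξ z - η z‖ < δ := fun δ hδ => by
    obtain ⟨η, hη, h⟩ := Metric.mem_closure_iff.1 hξ δ hδ
    rw [dist_eq_norm] at h
    exact ⟨η, hη, fun z => (lp.norm_apply_le_norm (by simp) (ξ - η) z).trans_lt h⟩
  refine ⟨?_, fun z h hz => ?_, fun δ hδ => ?_⟩
  · exact (isClosed_isContSec (A := B) R.continuous_anchor).closure_subset_iff.2
      (fun η hη => hη.1) hξ
  · rw [← sub_eq_zero, ← norm_le_zero_iff]
    refine le_of_forall_pos_lt_add fun δ hδ => ?_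
    obtain ⟨η, hη, hd⟩ := happ (δ / 2) (half_pos hδ)
    have h1 := hd (R.smul z h)
    have h2 := hd z
    rw [hη.2.1 z h hz] at h1
    have h3 := β.isIsoAction.norm_map (ℋ.inv h) ((ℋ.src_inv h).trans hz)
      ((ℋ.rng_inv h).trans (R.anchor_smul hz).symm) (ξ z - η z)
    rw [map_sub] at h3
    rw [← h3, norm_sub_rev] at h2
    calc _ ≤ _ := norm_sub_le_norm_sub_add_norm_sub _ _ _
      _ < δ / 2 + δ / 2 := add_lt_add h1 h2
      _ = 0 + δ := by ring
  · obtain ⟨η, hη, hd⟩ := happ (δ / 2) (half_pos hδ)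
    obtain ⟨K, hK, hKη⟩ := hη.2.2 (δ / 2) (half_pos hδ)
    refine ⟨K, hK, fun z hz => ?_⟩
    have := norm_le_norm_add_norm_sub (η z) (ξ z)
    rw [norm_sub_rev] at this
    linarith [hd z, hKη z hz]

variable [T2Space Y] [T2Space H] [T2Space Z] [LocallyCompactSpace H] [LocallyCompactSpace Z]

/-- The sums over the orbits of compactly supported sections belong to the induced algebra. -/
theorem Ind.exists_avg (hRp : R.IsProper) {η : ∀ z, B (R.anchor z)} (hη : IsCc R.anchor η) :
    ∃ ξ : Ind R β, ∀ z, ξ.1 z = R.avg (fun h hx hy => β.act h hx hy) η z := by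
  have ha := β.isIsoAction
  have hc := RightAction.isContSec_avg ha hRp hη
  obtain ⟨r, hr, hrb⟩ := hc.exists_bound hη.2
  -- An orbit on which the average is not zero meets the support of `η`. As the norm of the average
  -- is constant on orbits, its bound on that compact set is a global one.
  have h0 : ∀ z, R.avg (fun h hx hy => β.act h hx hy) η z ≠ 0 →
      ∃ h, ∃ hz : ℋ.rng h = R.anchor z, R.smul z h ∈ closure {z | η z ≠ 0} := fun z hz => by
    by_contra hne
    refine hz (finsum_eq_zero_of_forall_eq_zero fun h => ?_)
    have : η (R.smul z h.1) = 0 := IsCc.eq_zero fun h' => hne ⟨h.1, h.2, h'⟩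
    simp only [this, map_zero]
  have hnorm : ∀ z h, ℋ.rng h = R.anchor z →
      ‖R.avg (fun h hx hy => β.act h hx hy) η (R.smul z h)‖ =
        ‖R.avg (fun h hx hy => β.act h hx hy) η z‖ := fun z h hz => by
    rw [RightAction.avg_equivariant ha η hz]
    exact ha.norm_map _ _ _ _
  refine ⟨⟨⟨R.avg (fun h hx hy => β.act h hx hy) η, memℓp_infty ⟨r, ?_⟩⟩, hc, fun z h hz => ?_,
    fun δ hδ => ⟨R.orb '' closure {z | η z ≠ 0}, hη.2.image continuous_quot_mk, fun z hz => ?_⟩⟩,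
    fun z => rfl⟩
  · rintro _ ⟨z, rfl⟩
    by_cases hz : R.avg (fun h hx hy => β.act h hx hy) η z = 0
    · dsimp only
      rw [hz, norm_zero]
      exact hr.le
    · obtain ⟨h, hh, hhz⟩ := h0 z hz
      exact (hnorm z h hh).symm.trans_le (hrb _ hhz).le
  · exact RightAction.avg_equivariant ha η hz
  · by_cases h1 : R.avg (fun h hx hy => β.act h hx hy) η z = 0
    · change ‖R.avg (fun h hx hy => β.act h hx hy) η z‖ < δ
      rw [h1, norm_zero]
      exact hδ
    · obtain ⟨h, hh, hhz⟩ := h0 z h1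
      exact absurd ⟨_, hhz, RightAction.orb_smul hh⟩ hz

end Ind

/-! ### The bundle of an induced algebra -/

section IndBundle

/-- Vanishing at infinity is stated on the orbit space. Lifting compact sets restates it on `Z`:
where `ξ` is not small, the orbit meets a compact set. -/
theorem Ind.exists_compact {H : Type uH} {Y : Type uY} [TopologicalSpace H] [TopologicalSpace Y]
    {ℋ : EtaleGroupoid H Y} {B : Y → Type uB} [∀ y, NonUnitalCStarAlgebra (B y)]
    [TopologicalSpace (Tot B)] [CStarBundle B] {β : CStarAction ℋ B} {Z : Type*}
    [TopologicalSpace Z] {R : RightAction ℋ Z} [LocallyCompactSpace Z] (ξ : Ind R β) {δ : ℝ}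
    (hδ : 0 < δ) : ∃ L : Set Z, IsCompact L ∧
      ∀ z, δ ≤ ‖ξ.1 z‖ → ∃ h, ℋ.rng h = R.anchor z ∧ R.smul z h ∈ L := by
  obtain ⟨K, hK, h⟩ := ξ.2.2.2 δ hδ
  obtain ⟨L, hL, hKL⟩ := R.exists_compact_lift hK
  exact ⟨L, hL, fun z hz => hKL z (by_contra fun hn => (h z hn).not_ge hz)⟩

variable {G : Type uG} {X : Type uX} {H : Type uH} {Y : Type uY} {Ω : Type uΩ}
  [TopologicalSpace G] [TopologicalSpace X] [TopologicalSpace H] [TopologicalSpace Y]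
  [TopologicalSpace Ω]
  {𝒢 : EtaleGroupoid G X} {ℋ : EtaleGroupoid H Y} (W : EtaleCorrespondence 𝒢 ℋ Ω)
  {B : Y → Type uB} [∀ y, NonUnitalCStarAlgebra (B y)] [TopologicalSpace (Tot B)]
  [CStarBundle B] (β : CStarAction ℋ B)

theorem EtaleCorrespondence.fibre_smul_coe {x : X} (ω : {ω // W.left.anchor ω = x}) {h : H}
    (hh : ℋ.rng h = W.right.anchor ω.1) :
    (((W.fibre x).smul ω h).1 : Ω) = W.right.smul ω.1 h :=
  W.right.restrictSMul_coe _ (W.fibre_invariant x) ω h hh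

theorem EtaleCorrespondence.locallyCompactSpace {G X H Y Ω : Type*}
    [TopologicalSpace G] [TopologicalSpace X] [TopologicalSpace H] [TopologicalSpace Y]
    [TopologicalSpace Ω] [T2Space Ω] [LocallyCompactSpace Y]
    {𝒢 : EtaleGroupoid G X} {ℋ : EtaleGroupoid H Y} (W : EtaleCorrespondence 𝒢 ℋ Ω) :
    LocallyCompactSpace Ω :=
  IsLocalHomeomorph.locallyCompactSpace W.etale

variable [T2Space X] [T2Space Y] [T2Space Ω] [LocallyCompactSpace Y]

theorem EtaleCorrespondence.isClosed_fibre (x : X) : IsClosed {ω | W.left.anchor ω = x} :=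
  isClosed_eq W.left.continuous_anchor continuous_const

theorem EtaleCorrespondence.locallyCompactSpace_fibre (x : X) :
    LocallyCompactSpace {ω // W.left.anchor ω = x} :=
  have := W.locallyCompactSpace
  (W.isClosed_fibre x).isClosedEmbedding_subtypeVal.locallyCompactSpace

/-- The restriction to `Ω^x` of an element of the induced algebra. -/
def indRes (η : Ind W.right β) (x : X) : IndFib W β x :=
  ⟨indRestrict W β η x, (η.2.1.comp continuous_subtype_val :), fun ω h hh => by
    change η.1 ((W.fibre x).smul ω h).1 = _
    have h1 := η.2.2.1 ω.1 h hh
    rw [apply_eq_tr (p := W.right.anchor) (fun z => η.1 z) (W.fibre_smul_coe ω hh), h1]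
    exact tr_raw_act (act := fun h hx hy => β.act h hx hy) _ _ _ _ _, fun δ hδ => by
    have := W.locallyCompactSpace
    obtain ⟨L, hL, h⟩ := Ind.exists_compact η hδ
    refine ⟨(W.fibre x).orb '' (Subtype.val ⁻¹' L), IsCompact.image
      ((W.isClosed_fibre x).isClosedEmbedding_subtypeVal.isCompact_preimage hL)
      continuous_quot_mk, fun ω hω => lt_of_not_ge fun hn => hω ?_⟩
    obtain ⟨k, hk, hkL⟩ := h ω.1 hn
    refine ⟨(W.fibre x).smul ω k, ?_, RightAction.orb_smul hk⟩
    change ((W.fibre x).smul ω k).1 ∈ L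
    rw [W.fibre_smul_coe ω hk]
    exact hkL⟩

theorem indRes_add (η η' : Ind W.right β) (x : X) :
    indRes W β (η + η') x = indRes W β η x + indRes W β η' x := rfl

theorem indRes_sub (η η' : Ind W.right β) (x : X) :
    indRes W β (η - η') x = indRes W β η x - indRes W β η' x := rfl

theorem indRes_smul (c : ℂ) (η : Ind W.right β) (x : X) :
    indRes W β (c • η) x = c • indRes W β η x := rfl

variable {W β}

/-- Every orbit on which `‖η‖ ≥ s` meets the compact set `L`. The image in `X` of the part of `L`
where `‖η‖ ≥ s` is compact, hence closed, and misses `x`; so nearby fibres have norm at most `s`. -/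
theorem eventually_norm_indRes_lt (η : Ind W.right β) {x : X} {r : ℝ} (h : ‖indRes W β η x‖ < r) :
    ∀ᶠ x' in 𝓝 x, ‖indRes W β η x'‖ < r := by
  have := W.locallyCompactSpace
  obtain ⟨s, hs, hsr⟩ := exists_between h
  have hs0 : 0 < s := (norm_nonneg _).trans_lt hs
  obtain ⟨L, hL, hLη⟩ := Ind.exists_compact η hs0
  have hcl : IsClosed {ω | ‖η.1 ω‖ < s}ᶜ := (η.2.1.isOpen_norm_lt s).isClosed_compl
  have h1 := ((hL.inter_right hcl).image W.left.continuous_anchor).isClosed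
  have h2 : x ∉ W.left.anchor '' (L ∩ {ω | ‖η.1 ω‖ < s}ᶜ) := by
    rintro ⟨ω, ⟨-, hω⟩, rfl⟩
    exact hω ((Ind.norm_apply_le (indRes W β η _) ⟨ω, rfl⟩).trans_lt hs)
  filter_upwards [h1.isOpen_compl.mem_nhds h2] with x' hx'
  refine (Ind.norm_le hs0.le fun ω => ?_).trans_lt hsr
  by_contra hne
  obtain ⟨k, hk, hkL⟩ := hLη ω.1 (not_le.1 hne).le
  refine hx' ⟨W.right.smul ω.1 k, ⟨hkL, fun hlt => hne ?_⟩, ?_⟩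
  · rw [Set.mem_ofPred_eq, Ind.norm_smul_point η hk] at hlt
    exact hlt.le
  · rw [W.left_anchor_smul hk, ω.2]

/-- A basic neighbourhood. -/
theorem isOpen_ind_basic (η : Ind W.right β) {U : Set X} (hU : IsOpen U) (r : ℝ) :
    IsOpen {p : Tot (IndFib W β) | p.base ∈ U ∧ ‖p.val - indRes W β η p.base‖ < r} :=
  TopologicalSpace.isOpen_generateFrom_of_mem ⟨η, U, r, hU, rfl⟩

variable [T2Space H]

/-- The restrictions of the elements of the induced algebra are dense in the fibres. -/
theorem exists_norm_indRes_sub_lt {x : X} (ξ : IndFib W β x) {r : ℝ} (hr : 0 < r) :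
    ∃ η : Ind W.right β, ‖indRes W β η x - ξ‖ < r := by
  have := W.locallyCompactSpace
  have := W.locallyCompactSpace_fibre x
  have := ℋ.locallyCompactSpace
  have hr2 := half_pos hr
  obtain ⟨L, hL, hLξ⟩ := Ind.exists_compact ξ hr2
  have hLK := hL.image continuous_subtype_val
  -- Near each point of the fibre, `ξ` is almost a section `b` of the bundle over `Y`, which also
  -- makes sense off the fibre. These sections are cut off by an orbit partition, added and averaged
  -- over orbits. Points off the fibre get a dummy choice, never used since the points of the
  -- partition come from the fibre.
  have h1 : ∀ t : Ω, ∃ b : ∀ y, B y, IsContSec (fun y : Y => y) b ∧ ∃ U ∈ 𝓝 t,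
      ∀ ω : {ω // W.left.anchor ω = x}, ω.1 ∈ U → W.left.anchor t = x →
        ‖b (W.right.anchor ω.1) - ξ.1 ω‖ < r / 2 := fun t => by
    by_cases ht : W.left.anchor t = x
    · obtain ⟨b, hb, hbt⟩ := BanachBundle.exists_section (W.right.anchor t) (ξ.1 ⟨t, ht⟩)
      have h2 : IsContSec (W.fibre x).anchor fun ω => b (W.right.anchor ω.1) - ξ.1 ω :=
        (IsContSec.comp hb.1 (W.right.continuous_anchor.comp continuous_subtype_val)).sub ξ.2.1
      have h3 := (h2.isOpen_norm_lt (r / 2)).mem_nhds (x := ⟨t, ht⟩) (by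
        rw [Set.mem_ofPred_eq, hbt, sub_self, norm_zero]
        exact hr2)
      obtain ⟨U, hU, hUs⟩ := mem_nhds_subtype _ _ _ |>.1 h3
      exact ⟨b, hb.1, U, hU, fun ω hω _ => hUs hω⟩
    · exact ⟨fun y => 0, IsContSec.zero continuous_id, Set.univ, univ_mem,
        fun _ _ h => absurd h ht⟩
  choose b hb U hU hbU using h1
  obtain ⟨n, t, f, ht, hfc, hfs, hfU, hf0, hf1, hfK⟩ := RightAction.exists_orbit_partition W.proper
    hLK U fun ω _ => hU ω
  let η₀ : ∀ ω, B (W.right.anchor ω) := fun ω => ∑ i, (f i ω : ℂ) • b (t i) (W.right.anchor ω)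
  have hη₀ : IsCc W.right.anchor η₀ := IsCc.sum _ W.right.continuous_anchor fun i _ =>
    (IsContSec.comp (hb (t i)) W.right.continuous_anchor).isCc_smul (hfc i) (hfs i)
  obtain ⟨η, hη⟩ := Ind.exists_avg (β := β) W.proper hη₀
  refine ⟨η, (Ind.norm_le hr2.le fun ω => ?_).trans_lt (half_lt_self hr)⟩
  change ‖η.1 ω.1 - ξ.1 ω‖ ≤ r / 2
  have h2 : η.1 ω.1 = ∑ i, ∑ᶠ h : {h : H // ℋ.rng h = W.right.anchor ω.1},
      (f i (W.right.smul ω.1 h.1) : ℂ) • β.act h.1 (W.right.anchor_smul h.2).symm h.2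
        (b (t i) (W.right.anchor (W.right.smul ω.1 h.1))) := by
    rw [hη, RightAction.avg, ← finsum_sum_comm]
    · refine finsum_congr fun h => ?_
      simp only [η₀, map_sum, map_smul]
    · refine fun i _ => (RightAction.finite_support_orbSum W.proper (hfs i) ω.1).subset
        fun h hh h0 => hh ?_
      simp only [h0, Complex.ofReal_zero, zero_smul]
  rw [h2]
  refine RightAction.norm_orbit_sum_sub_le W.proper hfs hf0 (hf1 _) _ ?_ fun i h hne => ?_
  · by_cases hω : r / 2 ≤ ‖ξ.1 ω‖
    · obtain ⟨k, hk, hkL⟩ := hLξ ω hω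
      refine Or.inl ?_
      rw [← hfK (W.right.smul ω.1 k) ⟨_, hkL, W.fibre_smul_coe ω hk⟩]
      exact Finset.sum_congr rfl fun i _ => (W.right.orbSum_smul _ hk).symm
    · exact Or.inr (not_le.1 hω).le
  · have h3 : W.left.anchor (t i) = x := by
      obtain ⟨ω', -, h'⟩ := ht i
      rw [← h', ω'.2]
    have h4 := hbU (t i) ⟨W.right.smul ω.1 h.1, W.fibre_invariant x _ _ ω.2 h.2⟩
      (hfU i (subset_tsupport _ hne)) h3
    -- By equivariance `ξ(ω)` is the translate by `h` of `ξ(ω h)`, so the local estimate at `ω h`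
    -- bounds the error at `ω`.
    have h5 : ξ.1 ω = β.act h.1 (W.right.anchor_smul h.2).symm h.2
        (ξ.1 ⟨W.right.smul ω.1 h.1, W.fibre_invariant x _ _ ω.2 h.2⟩) := by
      have h6 := ξ.2.2.1 ω h.1 h.2
      have h7 : (W.fibre x).smul ω h.1 =
          ⟨W.right.smul ω.1 h.1, W.fibre_invariant x _ _ ω.2 h.2⟩ :=
        Subtype.ext (W.fibre_smul_coe ω h.2)
      rw [apply_eq_tr (p := (W.fibre x).anchor) (fun z => ξ.1 z) h7.symm, h6]
      refine Eq.symm ((raw_act_tr (act := fun h hx hy => β.act h hx hy) _ _ _ _ _).trans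
        ((β.isIsoAction.act_act _ _ _ _ _ _ _).trans ((raw_act_sec_congr
          (act := fun h hx hy => β.act h hx hy) (𝒢 := ℋ) (p := (W.fibre x).anchor)
          (fun z => ξ.1 z) (g' := ℋ.one (W.right.anchor ω.1)) (z' := ω) ?_ rfl _ _).trans ?_)))
      · rw [ℋ.mul_inv, h.2]
      · exact β.act_one _ _
    rw [h5, ← map_sub]
    exact (β.isIsoAction.norm_map _ _ _ _).trans_le h4.le

end IndBundle

/-! ### The induced algebra as a bundle of C⋆-algebras. -/

section IndStar

variable {G : Type uG} {X : Type uX} {H : Type uH} {Y : Type uY} {Ω : Type uΩ}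
  [TopologicalSpace G] [TopologicalSpace X] [TopologicalSpace H] [TopologicalSpace Y]
  [TopologicalSpace Ω]
  {𝒢 : EtaleGroupoid G X} {ℋ : EtaleGroupoid H Y} {W : EtaleCorrespondence 𝒢 ℋ Ω}
  {B : Y → Type uB} [∀ y, NonUnitalCStarAlgebra (B y)] [TopologicalSpace (Tot B)]
  [CStarBundle B] {β : CStarAction ℋ B}
  [T2Space X] [T2Space Y] [T2Space Ω] [LocallyCompactSpace Y]
  {T : Type*} {l : Filter T} {p : T → X}

/-- A basic neighbourhood of `a₀` is tested against some `η'`. If `η` is close to `a₀`, then `‖η -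
η'‖` is less than the radius on the fibre at `x`, and it stays so nearby by upper semicontinuity;
`η` is in turn close to `a`. -/
theorem tendsto_ind_of_approx {a : ∀ t, IndFib W β (p t)} {x : X} {a₀ : IndFib W β x}
    (hp : Tendsto p l (𝓝 x)) (h : ∀ r > 0, ∃ η : Ind W.right β, ‖a₀ - indRes W β η x‖ < r ∧
      ∀ᶠ t in l, ‖a t - indRes W β η (p t)‖ < r) :
    Tendsto (fun t => (⟨p t, a t⟩ : Tot (IndFib W β))) l (𝓝 ⟨x, a₀⟩) := by
  refine TopologicalSpace.tendsto_nhds_generateFrom_iff.2 ?_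
  rintro _ ⟨η', U, r, hU, rfl⟩ ⟨hx, hr⟩
  replace hr : ‖a₀ - indRes W β η' x‖ < r := hr
  obtain ⟨η, h1, h2⟩ := h ((r - ‖a₀ - indRes W β η' x‖) / 2) (half_pos (sub_pos.2 hr))
  have h3 : ‖indRes W β (η - η') x‖ < r - (r - ‖a₀ - indRes W β η' x‖) / 2 := by
    rw [indRes_sub]
    have := norm_sub_le_norm_sub_add_norm_sub (indRes W β η x) a₀ (indRes W β η' x)
    rw [norm_sub_rev] at h1
    linarith
  filter_upwards [h2, hp.eventually (eventually_norm_indRes_lt _ h3), hp (hU.mem_nhds hx)]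
    with t ht ht' htU
  refine ⟨htU, ?_⟩
  change ‖a t - indRes W β η' (p t)‖ < r
  rw [indRes_sub] at ht'
  have := norm_sub_le_norm_sub_add_norm_sub (a t) (indRes W β η (p t)) (indRes W β η' (p t))
  linarith

theorem eventually_ind_sub_lt {a : ∀ t, IndFib W β (p t)} {x : X} {a₀ : IndFib W β x}
    (h : Tendsto (fun t => (⟨p t, a t⟩ : Tot (IndFib W β))) l (𝓝 ⟨x, a₀⟩)) (η : Ind W.right β)
    {r : ℝ} (hr : ‖a₀ - indRes W β η x‖ < r) : ∀ᶠ t in l, ‖a t - indRes W β η (p t)‖ < r :=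
  (h.eventually ((isOpen_ind_basic η isOpen_univ r).mem_nhds ⟨trivial, hr⟩)).mono fun _ ht => ht.2

theorem eventually_ind_norm_lt {a : ∀ t, IndFib W β (p t)} {x : X} {a₀ : IndFib W β x}
    (h : Tendsto (fun t => (⟨p t, a t⟩ : Tot (IndFib W β))) l (𝓝 ⟨x, a₀⟩))
    {r : ℝ} (hr : ‖a₀‖ < r) : ∀ᶠ t in l, ‖a t‖ < r := by
  have h0 : ∀ x, indRes W β (0 : Ind W.right β) x = 0 := fun _ => rfl
  simpa only [h0, sub_zero] using eventually_ind_sub_lt h 0 (by simpa only [h0, sub_zero] using hr)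

theorem continuous_ind_base : Continuous (Tot.base : Tot (IndFib W β) → X) := by
  refine continuous_def.2 fun U hU => ?_
  have : (Tot.base ⁻¹' U : Set (Tot (IndFib W β))) = ⋃ r : ℝ,
      {p | p.base ∈ U ∧ ‖p.val - indRes W β 0 p.base‖ < r} := by
    ext p
    simp only [Set.mem_preimage, Set.mem_iUnion, Set.mem_ofPred_eq]
    exact ⟨fun h => ⟨_, h, lt_add_one _⟩, fun ⟨_, h, _⟩ => h⟩
  rw [this]
  exact isOpen_iUnion fun r => isOpen_ind_basic 0 hU r

variable [T2Space H]

theorem exists_norm_sub_indRes_lt {x : X} (ξ : IndFib W β x) {r : ℝ} (hr : 0 < r) :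
    ∃ η : Ind W.right β, ‖ξ - indRes W β η x‖ < r := by
  obtain ⟨η, h⟩ := exists_norm_indRes_sub_lt ξ hr
  exact ⟨η, by rwa [norm_sub_rev]⟩

theorem tendsto_ind_fst_snd {x : X} {a b : IndFib W β x} :
    Tendsto (fun q : FibProd (IndFib W β) (IndFib W β) => (⟨q.base, q.fst⟩ : Tot (IndFib W β)))
      (𝓝 ⟨x, a, b⟩) (𝓝 ⟨x, a⟩) ∧
    Tendsto (fun q : FibProd (IndFib W β) (IndFib W β) => (⟨q.base, q.snd⟩ : Tot (IndFib W β)))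
      (𝓝 ⟨x, a, b⟩) (𝓝 ⟨x, b⟩) := by
  have h : Continuous fun p : FibProd (IndFib W β) (IndFib W β) =>
      ((⟨p.base, p.fst⟩ : Tot (IndFib W β)), (⟨p.base, p.snd⟩ : Tot (IndFib W β))) :=
    continuous_induced_dom
  exact ⟨h.fst.tendsto _, h.snd.tendsto _⟩

theorem norm_mul_sub_mul_lt {A : Type*} [NonUnitalNormedRing A] {a a' b b' : A} {δ s : ℝ}
    (hδ : 0 < δ) (hs : 0 < s) (h1 : ‖a - a'‖ < δ) (h2 : ‖b - b'‖ < δ) (h3 : ‖a‖ < s)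
    (h4 : ‖b‖ < s) : ‖a * b - a' * b'‖ < δ * (2 * s + δ) := by
  have h5 : a * b - a' * b' = (a - a') * b + a' * (b - b') := by
    rw [sub_mul, mul_sub]
    abel
  have h6 : ‖a'‖ ≤ s + δ := by
    have := norm_le_norm_add_norm_sub a a'
    rw [norm_sub_rev] at h1
    linarith [norm_sub_rev a a']
  have h7 : ‖(a - a') * b‖ < δ * s :=
    (norm_mul_le _ _).trans_lt (mul_lt_mul'' h1 h4 (norm_nonneg _) (norm_nonneg _))
  have h8 : ‖a' * (b - b')‖ ≤ (s + δ) * δ :=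
    (norm_mul_le _ _).trans (mul_le_mul h6 h2.le (norm_nonneg _) (by positivity))
  rw [h5]
  refine (norm_add_le _ _).trans_lt ((add_lt_add_of_lt_of_le h7 h8).trans_eq ?_)
  ring

theorem tendsto_ind_mul {a b : ∀ t, IndFib W β (p t)} {x : X} {a₀ b₀ : IndFib W β x}
    (ha : Tendsto (fun t => (⟨p t, a t⟩ : Tot (IndFib W β))) l (𝓝 ⟨x, a₀⟩))
    (hb : Tendsto (fun t => (⟨p t, b t⟩ : Tot (IndFib W β))) l (𝓝 ⟨x, b₀⟩)) :
    Tendsto (fun t => (⟨p t, a t * b t⟩ : Tot (IndFib W β))) l (𝓝 ⟨x, a₀ * b₀⟩) := by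
  refine tendsto_ind_of_approx (continuous_ind_base.continuousAt.tendsto.comp ha) fun r hr => ?_
  obtain ⟨s, hs⟩ : ∃ s, s = ‖a₀‖ + ‖b₀‖ + 1 := ⟨_, rfl⟩
  have hs0 : 0 < s := by rw [hs]; positivity
  -- The product has error at most `δ (2 s + δ)`, and `δ ≤ 1` bounds this by `δ (2 s + 2) ≤ r`.
  obtain ⟨δ, hδ⟩ : ∃ δ, δ = min 1 (r / (2 * s + 2)) := ⟨_, rfl⟩
  have hδ0 : 0 < δ := by rw [hδ]; positivity
  have hδ1 : δ ≤ 1 := hδ ▸ min_le_left _ _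
  have hδr : δ * (2 * s + 2) ≤ r := by
    rw [← le_div_iff₀ (by positivity), hδ]; exact min_le_right _ _
  obtain ⟨η, hη⟩ := exists_norm_sub_indRes_lt a₀ hδ0
  obtain ⟨η', hη'⟩ := exists_norm_sub_indRes_lt b₀ hδ0
  have key : ∀ {x : X} {a b : IndFib W β x}, ‖a - indRes W β η x‖ < δ →
      ‖b - indRes W β η' x‖ < δ → ‖a‖ < s → ‖b‖ < s →
      ‖a * b - indRes W β (η * η') x‖ < r := fun h1 h2 h3 h4 =>
    (norm_mul_sub_mul_lt hδ0 hs0 h1 h2 h3 h4).trans_le (le_trans (by nlinarith) hδr)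
  have has : ‖a₀‖ < s := by have := norm_nonneg b₀; linarith
  have hbs : ‖b₀‖ < s := by have := norm_nonneg a₀; linarith
  refine ⟨η * η', key hη hη' has hbs, ?_⟩
  filter_upwards [eventually_ind_sub_lt ha η hη, eventually_ind_sub_lt hb η' hη',
    eventually_ind_norm_lt ha has, eventually_ind_norm_lt hb hbs] with q h1 h2 h3 h4
  exact key h1 h2 h3 h4

theorem norm_star_sub_star {A : Type*} [NonUnitalCStarAlgebra A] (a b : A) :
    ‖star a - star b‖ = ‖a - b‖ := by
  rw [← star_sub, norm_star]

theorem tendsto_ind_star {a : ∀ t, IndFib W β (p t)} {x : X} {a₀ : IndFib W β x}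
    (ha : Tendsto (fun t => (⟨p t, a t⟩ : Tot (IndFib W β))) l (𝓝 ⟨x, a₀⟩)) :
    Tendsto (fun t => (⟨p t, star (a t)⟩ : Tot (IndFib W β))) l (𝓝 ⟨x, star a₀⟩) := by
  refine tendsto_ind_of_approx (continuous_ind_base.continuousAt.tendsto.comp ha) fun r hr => ?_
  obtain ⟨η, hη⟩ := exists_norm_sub_indRes_lt a₀ hr
  have key : ∀ {x : X} {a : IndFib W β x}, ‖a - indRes W β η x‖ < r →
      ‖star a - indRes W β (star η) x‖ < r := by
    intro x a h
    exact (norm_star_sub_star (A := IndFib W β x) a (indRes W β η x)).trans_lt h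
  exact ⟨star η, key hη, (eventually_ind_sub_lt ha η hη).mono fun q hq => key hq⟩

/-- Restriction to fibres commutes with the algebraic operations. So approximations by restricted
elements of the induced algebra are carried along by them, and `tendsto_ind_of_approx` yields
continuity. -/
instance IndFib.starBundle : StarBundle (IndFib W β) where
  continuous_base := continuous_ind_base
  upperSemicontinuous_norm p r hr := eventually_ind_norm_lt (tendsto_id (x := 𝓝 p)) hr
  continuous_add := by
    refine continuous_iff_continuousAt.2 fun ⟨x, a, b⟩ => ?_
    obtain ⟨ha, hb⟩ := tendsto_ind_fst_snd (W := W) (β := β) (a := a) (b := b)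
    refine tendsto_ind_of_approx (continuous_ind_base.continuousAt.tendsto.comp ha)
      fun r hr => ?_
    obtain ⟨η, hη⟩ := exists_norm_sub_indRes_lt a (half_pos hr)
    obtain ⟨η', hη'⟩ := exists_norm_sub_indRes_lt b (half_pos hr)
    have key : ∀ {x : X} {a b : IndFib W β x}, ‖a - indRes W β η x‖ < r / 2 →
        ‖b - indRes W β η' x‖ < r / 2 → ‖a + b - indRes W β (η + η') x‖ < r := by
      intro x a b h1 h2
      rw [indRes_add, add_sub_add_comm]
      exact (norm_add_le _ _).trans_lt (by linarith)
    refine ⟨η + η', key hη hη', ?_⟩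
    filter_upwards [eventually_ind_sub_lt ha η hη, eventually_ind_sub_lt hb η' hη'] with q h1 h2
    exact key h1 h2
  continuous_smul c := by
    refine continuous_iff_continuousAt.2 fun ⟨x, a⟩ => ?_
    refine tendsto_ind_of_approx continuous_ind_base.continuousAt.tendsto fun r hr => ?_
    obtain ⟨η, hη⟩ := exists_norm_sub_indRes_lt a (r := r / (‖c‖ + 1)) (by positivity)
    have key : ∀ {x : X} {a : IndFib W β x}, ‖a - indRes W β η x‖ < r / (‖c‖ + 1) →
        ‖c • a - indRes W β (c • η) x‖ < r := by
      intro x a h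
      rw [indRes_smul, ← smul_sub, norm_smul]
      rw [lt_div_iff₀ (by positivity)] at h
      nlinarith [norm_nonneg (a - indRes W β η x)]
    exact ⟨c • η, key hη, (eventually_ind_sub_lt (tendsto_id (x := 𝓝 (⟨x, a⟩ : Tot _))) η hη).mono
      fun q hq => key hq⟩
  tendsto_zero x := by
    refine tendsto_id'.1 (tendsto_ind_of_approx (tendsto_comap.mono_left inf_le_left)
      fun r hr => ⟨0, ?_, ?_⟩)
    · change ‖(0 : IndFib W β x) - 0‖ < r
      rw [sub_zero, norm_zero]
      exact hr
    · have h1 : Tendsto (fun a : Tot (IndFib W β) => ‖a.val‖)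
          ((𝓝 x).comap Tot.base ⊓ (𝓝 (0 : ℝ)).comap (fun a : Tot (IndFib W β) => ‖a.val‖))
          (𝓝 0) := tendsto_comap.mono_left inf_le_right
      filter_upwards [h1.eventually_lt_const hr] with q hq
      change ‖q.val - 0‖ < r
      rwa [sub_zero]
  exists_approx x a r hr := by
    obtain ⟨η, hη⟩ := exists_norm_indRes_sub_lt a hr
    refine ⟨indRes W β η, continuous_iff_continuousAt.2 fun x' => ?_, hη⟩
    have h : ∀ x, ∀ r > 0, ‖indRes W β η x - indRes W β η x‖ < r := fun x r hr => by
      rw [sub_self, norm_zero]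
      exact hr
    exact tendsto_ind_of_approx tendsto_id fun r hr => ⟨η, h _ r hr,
      Eventually.of_forall fun t => h _ r hr⟩
  continuous_mul := continuous_iff_continuousAt.2 fun _ =>
    tendsto_ind_mul tendsto_ind_fst_snd.1 tendsto_ind_fst_snd.2
  continuous_star := continuous_iff_continuousAt.2 fun p => tendsto_ind_star (tendsto_id (x := 𝓝 p))

/-- Evaluation of sections of the induced bundle. -/
theorem isContSec_ind_apply [TopologicalSpace T] {a : ∀ t, IndFib W β (p t)} (ha : IsContSec p a)
    {ω : T → Ω} (hω : Continuous ω) (hp : ∀ t, W.left.anchor (ω t) = p t) :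
    IsContSec (fun t => W.right.anchor (ω t)) fun t => (a t).1 ⟨ω t, hp t⟩ := by
  refine IsContSec.of_approx (W.right.continuous_anchor.comp hω) fun t₀ r hr => ?_
  obtain ⟨η, hη⟩ := exists_norm_sub_indRes_lt (a t₀) hr
  refine ⟨fun t => η.1 (ω t), IsContSec.comp η.2.1 hω, ?_⟩
  filter_upwards [eventually_ind_sub_lt (ha.tendsto t₀) η hη] with t ht
  exact (Ind.norm_apply_le (a t - indRes W β η (p t)) ⟨ω t, hp t⟩).trans_lt ht

end IndStar

/-! ### The action on the induced bundle -/

namespace LeftAction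

variable {G X Z : Type*} [TopologicalSpace G] [TopologicalSpace X] [TopologicalSpace Z]
  {𝒢 : EtaleGroupoid G X} (L : LeftAction 𝒢 Z)

theorem inv_smul_smul {g : G} {z : Z} (h : 𝒢.src g = L.anchor z) :
    L.smul (𝒢.inv g) (L.smul g z) = z := by
  rw [← L.mul_smul (𝒢.src_inv g) h, 𝒢.inv_mul, h, L.one_smul]

/-- The composable pairs. -/
abbrev FP : Type _ := {q : G × Z // 𝒢.src q.1 = L.anchor q.2}

theorem continuous_smul_FP : Continuous fun q : L.FP => L.smul q.1.1 q.1.2 :=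
  L.continuous_smul.comp_continuous continuous_subtype_val fun q => q.2

theorem isEtaleMap_snd : IsEtaleMap fun q : L.FP => q.1.2 :=
  IsEtaleMap.snd (fun _ => Iff.rfl) 𝒢.isEtaleMap_src L.continuous_anchor

theorem locallyCompactSpace_FP [T2Space X] [LocallyCompactSpace Z] [LocallyCompactSpace G] :
    LocallyCompactSpace L.FP :=
  locallyCompactSpace_fibreProduct (fun _ => Iff.rfl) 𝒢.continuous_src L.continuous_anchor

theorem isCompact_FP [T2Space X] {K : Set G} {S : Set Z} (hK : IsCompact K) (hS : IsCompact S) :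
    IsCompact {q : L.FP | q.1.1 ∈ K ∧ q.1.2 ∈ S} :=
  (isClosed_fibreProduct (fun _ => Iff.rfl) 𝒢.continuous_src
    L.continuous_anchor).isClosedEmbedding_subtypeVal.isCompact_preimage (hK.prod hS)

/-- The pair `(g, z)` gives the pair `(g⁻¹, g · z)`. -/
def flip (q : L.FP) : L.FP :=
  ⟨(𝒢.inv q.1.1, L.smul q.1.1 q.1.2), by rw [𝒢.src_inv, L.anchor_smul q.2]⟩

theorem continuous_flip : Continuous L.flip :=
  Continuous.subtype_mk ((𝒢.continuous_inv.comp
    (continuous_fst.comp continuous_subtype_val)).prodMk L.continuous_smul_FP) _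

theorem flip_flip (q : L.FP) : L.flip (L.flip q) = q :=
  Subtype.ext (Prod.ext (𝒢.inv_inv _) (L.inv_smul_smul q.2))

theorem isCompact_FP_flip [T2Space X] {K : Set G} {S : Set Z} (hK : IsCompact K)
    (hS : IsCompact S) : IsCompact {q : L.FP | 𝒢.inv q.1.1 ∈ K ∧ L.smul q.1.1 q.1.2 ∈ S} := by
  convert (L.isCompact_FP hK hS).image L.continuous_flip using 1
  ext q
  exact ⟨fun h => ⟨L.flip q, h, L.flip_flip q⟩, by
    rintro ⟨q, hq, rfl⟩
    refine ⟨?_, ?_⟩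
    · change 𝒢.inv (𝒢.inv _) ∈ K
      rw [𝒢.inv_inv]
      exact hq.1
    · change L.smul (𝒢.inv _) (L.smul _ _) ∈ S
      rw [L.inv_smul_smul q.2]
      exact hq.2⟩

end LeftAction

section IndAct

variable {G : Type uG} {X : Type uX} {H : Type uH} {Y : Type uY} {Ω : Type uΩ}
  [TopologicalSpace G] [TopologicalSpace X] [TopologicalSpace H] [TopologicalSpace Y]
  [TopologicalSpace Ω]
  {𝒢 : EtaleGroupoid G X} {ℋ : EtaleGroupoid H Y} {W : EtaleCorrespondence 𝒢 ℋ Ω}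
  {B : Y → Type uB} [∀ y, NonUnitalCStarAlgebra (B y)] [TopologicalSpace (Tot B)]
  [CStarBundle B] {β : CStarAction ℋ B}

theorem IndFib.ext {x : X} {ξ η : IndFib W β x} (h : ∀ ω, ξ.1 ω = η.1 ω) : ξ = η :=
  Subtype.ext (Subtype.ext (funext h))

theorem indAct_apply {x y : X} (g : G) (hx : 𝒢.src g = x) (hy : 𝒢.rng g = y) (ξ : IndFib W β x)
    (ω : {ω // W.left.anchor ω = y}) : (indAct W β g hx hy ξ).1 ω =
      tr (W.anchor_move (𝒢.inv g) ((𝒢.src_inv g).trans hy) ((𝒢.rng_inv g).trans hx) ω)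
        (ξ.1 (W.move (𝒢.inv g) ((𝒢.src_inv g).trans hy) ((𝒢.rng_inv g).trans hx) ω)) := rfl

theorem norm_indAct_le {x y : X} (g : G) (hx : 𝒢.src g = x) (hy : 𝒢.rng g = y)
    (ξ : IndFib W β x) : ‖indAct W β g hx hy ξ‖ ≤ ‖ξ‖ :=
  Ind.norm_le (norm_nonneg _) fun ω => by
    rw [indAct_apply, norm_tr]
    exact Ind.norm_apply_le ξ _

theorem indAct_one {x z : X} (hx : 𝒢.src (𝒢.one z) = x) (hy : 𝒢.rng (𝒢.one z) = x)
    (ξ : IndFib W β x) : indAct W β (𝒢.one z) hx hy ξ = ξ := by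
  refine IndFib.ext fun ω => ?_
  refine sec_congr (p := (W.fibre x).anchor) (fun ω => ξ.1 ω) (Subtype.ext ?_) _ rfl
  change W.left.smul (𝒢.inv (𝒢.one z)) ω.1 = ω.1
  have hz : z = W.left.anchor ω.1 := by rw [ω.2, ← hx, 𝒢.src_one]
  rw [𝒢.inv_one, hz, W.left.one_smul]

theorem indAct_indAct {x y z : X} (g h : G) (hx : 𝒢.src h = x) (hy : 𝒢.rng h = y)
    (hy' : 𝒢.src g = y) (hz : 𝒢.rng g = z) (ξ : IndFib W β x) :
    indAct W β g hy' hz (indAct W β h hx hy ξ) =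
      indAct W β (𝒢.mul g h) ((𝒢.src_mul (hy'.trans hy.symm)).trans hx)
        ((𝒢.rng_mul (hy'.trans hy.symm)).trans hz) ξ := by
  refine IndFib.ext fun ω => ?_
  refine (tr_tr _ _ _).trans ?_
  refine sec_congr (p := (W.fibre x).anchor) (fun ω => ξ.1 ω) (Subtype.ext ?_) _ _
  change W.left.smul (𝒢.inv h) (W.left.smul (𝒢.inv g) ω.1) = W.left.smul (𝒢.inv (𝒢.mul g h)) ω.1
  rw [𝒢.mul_inv_rev (hy'.trans hy.symm), W.left.mul_smul]
  · rw [𝒢.src_inv, 𝒢.rng_inv, hy, hy']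
  · rw [𝒢.src_inv, hz, ω.2]

theorem indAct_sub {x y : X} (g : G) (hx : 𝒢.src g = x) (hy : 𝒢.rng g = y)
    (ξ η : IndFib W β x) :
    indAct W β g hx hy (ξ - η) = indAct W β g hx hy ξ - indAct W β g hx hy η := by
  subst hx hy
  refine IndFib.ext fun ω => ?_
  have h : ∀ {y y' : Y} (e : y = y') (a b : B y), tr e (a - b) = tr e a - tr e b := by
    intro y y' e a b; subst e; rfl
  exact h _ _ _

theorem indAct_inv {x y : X} (g : G) (hx : 𝒢.src g = x) (hy : 𝒢.rng g = y) (ξ : IndFib W β y) :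
    indAct W β g hx hy (indAct W β (𝒢.inv g) ((𝒢.src_inv g).trans hy) ((𝒢.rng_inv g).trans hx) ξ) =
      ξ := by
  rw [indAct_indAct]
  have h : ∀ k (hx : 𝒢.src k = y) (hy : 𝒢.rng k = y), k = 𝒢.one y → indAct W β k hx hy ξ = ξ := by
    rintro _ hx hy rfl
    exact indAct_one _ _ _
  exact h _ _ _ (by rw [𝒢.mul_inv, hy])

/-- The action is contractive, and so is that of the inverse arrow. -/
theorem norm_indAct {x y : X} (g : G) (hx : 𝒢.src g = x) (hy : 𝒢.rng g = y)
    (ξ : IndFib W β x) : ‖indAct W β g hx hy ξ‖ = ‖ξ‖ := by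
  refine le_antisymm (norm_indAct_le g hx hy ξ) ?_
  have h := indAct_inv (𝒢.inv g) ((𝒢.src_inv g).trans hy) ((𝒢.rng_inv g).trans hx) ξ
  conv_lhs => rw [← h]
  refine (norm_indAct_le _ _ _ _).trans_eq ?_
  have : ∀ k (hk : 𝒢.src k = x) (hk' : 𝒢.rng k = y), k = g →
      ‖indAct W β k hk hk' ξ‖ = ‖indAct W β g hx hy ξ‖ := by
    rintro _ _ _ rfl; rfl
  exact this _ _ _ (𝒢.inv_inv g)

variable [T2Space X] [T2Space Y] [T2Space Ω] [T2Space G] [LocallyCompactSpace Y]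
  [LocallyCompactSpace X]

/-- The argument is that of `eventually_norm_indRes_lt` for a family indexed by arrows: the pairs
`(g, ω)` with `g` near `g₀` at which the difference is large meet, up to the action of `ℋ`, a
compact set of composable pairs. -/
theorem eventually_norm_indAct_sub_lt (η η' : Ind W.right β) {g₀ : G} {r : ℝ}
    (h : ‖indAct W β g₀ rfl rfl (indRes W β η (𝒢.src g₀)) - indRes W β η' (𝒢.rng g₀)‖ < r) :
    ∀ᶠ g in 𝓝 g₀,
      ‖indAct W β g rfl rfl (indRes W β η (𝒢.src g)) - indRes W β η' (𝒢.rng g)‖ < r := by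
  have := W.locallyCompactSpace
  have := 𝒢.locallyCompactSpace
  -- The difference is moved isometrically to the fibre at the source, where it can be evaluated
  -- continuously at `(g, ω)`.
  let D : ∀ g, IndFib W β (𝒢.src g) := fun g => indRes W β η (𝒢.src g) -
    indAct W β (𝒢.inv g) (𝒢.src_inv g) (𝒢.rng_inv g) (indRes W β η' (𝒢.rng g))
  have hD : ∀ g, ‖indAct W β g rfl rfl (indRes W β η (𝒢.src g)) - indRes W β η' (𝒢.rng g)‖ =
      ‖D g‖ := fun g => by
    rw [← norm_indAct g rfl rfl (D g), indAct_sub, indAct_inv]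
  simp only [hD] at h ⊢
  obtain ⟨s, hs, hsr⟩ := exists_between h
  have hs0 : 0 < s := (norm_nonneg _).trans_lt hs
  obtain ⟨N, hN, hg₀⟩ := exists_compact_mem_nhds g₀
  obtain ⟨L₁, hL₁, h₁⟩ := Ind.exists_compact η (half_pos hs0)
  obtain ⟨L₂, hL₂, h₂⟩ := Ind.exists_compact η' (half_pos hs0)
  have hDc : IsContSec (fun q : W.left.FP => W.right.anchor q.1.2)
      fun q : W.left.FP => (D q.1.1).1 ⟨q.1.2, q.2.symm⟩ := by
    refine IsContSec.sub (IsContSec.comp η.2.1 (continuous_snd.comp continuous_subtype_val)) ?_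
    have h3 : ∀ q : W.left.FP, W.right.anchor (W.left.smul (𝒢.inv (𝒢.inv q.1.1)) q.1.2) =
        W.right.anchor q.1.2 := fun q => by
      rw [𝒢.inv_inv]
      exact W.right_anchor_smul q.2
    have h4 : Continuous fun q : W.left.FP => W.left.smul (𝒢.inv (𝒢.inv q.1.1)) q.1.2 := by
      simp only [𝒢.inv_inv]
      exact W.left.continuous_smul_FP
    exact (IsContSec.comp η'.2.1 h4).congr_base h3
  have hNi : IsCompact (𝒢.inv '' N) := hN.image 𝒢.continuous_inv
  -- If the difference exceeds `s` at `ω`, then `η(ω)` or `η'(g ω)` has norm at least `s / 2`, so a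
  -- translate of `ω` lies in `L₁` or a translate of `g ω` lies in `L₂`. The two compact sets of
  -- pairs correspond to these cases.
  have hcpt := (((W.left.isCompact_FP hN hL₁).union (W.left.isCompact_FP_flip hNi hL₂)).inter_right
    (hDc.isOpen_norm_lt s).isClosed_compl).image
      (f := fun q : W.left.FP => q.1.1) (continuous_fst.comp continuous_subtype_val)
  have hg₀' : g₀ ∉ (fun q : W.left.FP => q.1.1) '' (({q : W.left.FP | q.1.1 ∈ N ∧ q.1.2 ∈ L₁} ∪
      {q : W.left.FP | 𝒢.inv q.1.1 ∈ 𝒢.inv '' N ∧ W.left.smul q.1.1 q.1.2 ∈ L₂}) ∩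
      {q : W.left.FP | ‖(D q.1.1).1 ⟨q.1.2, q.2.symm⟩‖ < s}ᶜ) := by
    rintro ⟨q, ⟨-, hq⟩, rfl⟩
    exact hq ((Ind.norm_apply_le _ _).trans_lt hs)
  filter_upwards [hg₀, hcpt.isClosed.isOpen_compl.mem_nhds hg₀'] with g hgN hg
  refine (Ind.norm_le hs0.le fun ω => ?_).trans_lt hsr
  by_contra hne
  have hsrc : 𝒢.src g = W.left.anchor ω.1 := ω.2.symm
  have key : ∀ k, ℋ.rng k = W.right.anchor ω.1 →
      (W.right.smul ω.1 k ∈ L₁ ∨ W.right.smul (W.left.smul g ω.1) k ∈ L₂) → False := by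
    intro k hk hkL
    have hk' : 𝒢.src g = W.left.anchor (W.right.smul ω.1 k) :=
      hsrc.trans (W.left_anchor_smul hk).symm
    refine hg ⟨⟨(g, W.right.smul ω.1 k), hk'⟩, ⟨hkL.imp (fun h => ⟨hgN, h⟩) fun h => ⟨⟨g, hgN, rfl⟩,
      ?_⟩, fun hlt => hne ?_⟩, rfl⟩
    · rw [W.smul_comm hsrc hk] at h
      exact h
    · have h3 := Ind.norm_smul_point (D g) (z := ω) hk
      rw [← h3]
      have h4 : (W.fibre (𝒢.src g)).smul ω k = ⟨W.right.smul ω.1 k, hk'.symm⟩ :=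
        Subtype.ext (W.fibre_smul_coe ω hk)
      rw [h4]
      exact le_of_lt hlt
  rcases le_or_gt (s / 2) ‖η.1 ω.1‖ with h3 | h3
  · obtain ⟨k, hk, hkL⟩ := h₁ _ h3
    exact key k hk (Or.inl hkL)
  · rcases le_or_gt (s / 2) ‖η'.1 (W.left.smul g ω.1)‖ with h4 | h4
    · obtain ⟨k, hk, hkL⟩ := h₂ _ h4
      exact key k (hk.trans (W.right_anchor_smul hsrc)) (Or.inr hkL)
    · refine hne ?_
      have h5 : (D g).1 ω = η.1 ω.1 - (indAct W β (𝒢.inv g) (𝒢.src_inv g) (𝒢.rng_inv g)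
        (indRes W β η' (𝒢.rng g))).1 ω := rfl
      rw [h5]
      refine (norm_sub_le _ _).trans ?_
      rw [indAct_apply, norm_tr]
      have h6 : ‖(indRes W β η' (𝒢.rng g)).1 (W.move (𝒢.inv (𝒢.inv g)) ((𝒢.src_inv _).trans
          (𝒢.rng_inv g)) ((𝒢.rng_inv _).trans (𝒢.src_inv g)) ω)‖ =
          ‖η'.1 (W.left.smul g ω.1)‖ := by
        change ‖η'.1 (W.left.smul (𝒢.inv (𝒢.inv g)) ω.1)‖ = _
        rw [𝒢.inv_inv]
      rw [h6]
      linarith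

variable [T2Space H]

/-- The induced bundle carries an action by ⋆-automorphisms. -/
theorem isStarAction_indAct :
    IsStarAction 𝒢 (A := IndFib W β) fun g hx hy => indAct W β g hx hy where
  map_add g hx hy a b := IndFib.ext fun ω => tr_add (A := B) (W.anchor_move (𝒢.inv g)
    ((𝒢.src_inv g).trans hy) ((𝒢.rng_inv g).trans hx) ω) (a.1 (W.move _ _ _ ω)) (b.1 (W.move _ _ _ ω))
  map_smul g hx hy c a := IndFib.ext fun ω => tr_smul (A := B) (W.anchor_move (𝒢.inv g)
    ((𝒢.src_inv g).trans hy) ((𝒢.rng_inv g).trans hx) ω) c (a.1 (W.move _ _ _ ω))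
  map_mul g hx hy a b := IndFib.ext fun ω => tr_mul (A := B) (W.anchor_move (𝒢.inv g)
    ((𝒢.src_inv g).trans hy) ((𝒢.rng_inv g).trans hx) ω) (a.1 (W.move _ _ _ ω)) (b.1 (W.move _ _ _ ω))
  map_star g hx hy a := IndFib.ext fun ω => tr_star (A := B) (W.anchor_move (𝒢.inv g)
    ((𝒢.src_inv g).trans hy) ((𝒢.rng_inv g).trans hx) ω) (a.1 (W.move _ _ _ ω))
  norm_map g hx hy a := norm_indAct g hx hy a
  one x a := indAct_one _ _ a
  mul g h hgh a := (indAct_indAct g h rfl rfl hgh rfl a).symm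
  continuous := by
    refine continuous_iff_continuousAt.2 fun p₀ => ?_
    obtain ⟨⟨g₀, x₀, ξ₀⟩, h₀⟩ := p₀
    change 𝒢.src g₀ = x₀ at h₀
    subst h₀
    refine tendsto_ind_of_approx (𝒢.continuous_rng.comp
      (continuous_fst.comp continuous_subtype_val)).continuousAt.tendsto fun r hr => ?_
    have hr3 : 0 < r / 3 := by positivity
    obtain ⟨η, hη⟩ := exists_norm_sub_indRes_lt ξ₀ hr3
    obtain ⟨η', hη'⟩ := exists_norm_sub_indRes_lt
      (indAct W β g₀ rfl rfl (indRes W β η (𝒢.src g₀))) hr3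
    have key : ∀ {x : X} (g : G) (hx : 𝒢.src g = x) (ξ : IndFib W β x),
        ‖ξ - indRes W β η x‖ < r / 3 →
        ‖indAct W β g rfl rfl (indRes W β η (𝒢.src g)) - indRes W β η' (𝒢.rng g)‖ < r / 3 →
        ‖indAct W β g hx rfl ξ - indRes W β η' (𝒢.rng g)‖ < r := by
      rintro _ g rfl ξ h1 h2
      rw [← norm_indAct g rfl rfl, indAct_sub] at h1
      have := norm_sub_le_norm_sub_add_norm_sub (indAct W β g rfl rfl ξ)
        (indAct W β g rfl rfl (indRes W β η (𝒢.src g))) (indRes W β η' (𝒢.rng g))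
      linarith
    refine ⟨η', key g₀ rfl ξ₀ hη hη', ?_⟩
    have h1 : Tendsto (fun p : {p : G × Tot (IndFib W β) // 𝒢.src p.1 = p.2.base} =>
        (⟨p.1.2.base, p.1.2.val⟩ : Tot (IndFib W β))) (𝓝 ⟨(g₀, ⟨_, ξ₀⟩), rfl⟩) (𝓝 ⟨_, ξ₀⟩) :=
      (continuous_snd.comp continuous_subtype_val).continuousAt.tendsto
    have h2 : Tendsto (fun p : {p : G × Tot (IndFib W β) // 𝒢.src p.1 = p.2.base} => p.1.1)
        (𝓝 ⟨(g₀, ⟨_, ξ₀⟩), rfl⟩) (𝓝 g₀) :=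
      (continuous_fst.comp continuous_subtype_val).continuousAt.tendsto
    filter_upwards [eventually_ind_sub_lt h1 η hη,
      h2.eventually (eventually_norm_indAct_sub_lt η η' hη')] with p hp hp'
    exact key p.1.1 p.2 p.1.2.val hp hp'

end IndAct

/-! ### The left action on sections -/

section LeftActionSections

variable {G : Type uG} {X : Type uX} {H : Type uH} {Y : Type uY} {Ω : Type uΩ}
  [TopologicalSpace G] [TopologicalSpace X] [TopologicalSpace H] [TopologicalSpace Y]
  [TopologicalSpace Ω]
  {𝒢 : EtaleGroupoid G X} {ℋ : EtaleGroupoid H Y} {W : EtaleCorrespondence 𝒢 ℋ Ω}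
  {B : Y → Type uB} [∀ y, NonUnitalCStarAlgebra (B y)] [TopologicalSpace (Tot B)]
  [CStarBundle B]
  {C : Y → Type uC} [∀ y, NonUnitalCStarAlgebra (C y)] [TopologicalSpace (Tot C)]
  {E : Y → Type uE} [∀ y, NormedAddCommGroup (E y)] [∀ y, NormedSpace ℂ (E y)]
  [∀ y, CompleteSpace (E y)] [TopologicalSpace (Tot E)] [∀ y, HilbertModule (C y) (E y)]
  {β : CStarAction ℋ B} {γ : CStarAction ℋ C} {ε : HilbertAction γ E}
  (φ : EquivariantCorrespondence β ε)

theorem IndFib.apply_smul {x : X} (a : IndFib W β x) (ω z : {ω // W.left.anchor ω = x}) {h : H}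
    (hh : ℋ.rng h = W.right.anchor ω.1) (hz : z.1 = W.right.smul ω.1 h)
    (hy : ℋ.rng (ℋ.inv h) = W.right.anchor z.1) :
    a.1 z = β.act (ℋ.inv h) ((ℋ.src_inv h).trans hh) hy (a.1 ω) := by
  obtain rfl : z = (W.fibre x).smul ω h := Subtype.ext (hz.trans (W.fibre_smul_coe ω hh).symm)
  exact a.2.2.1 ω h hh

/-- Values of sections of the induced bundle at equal points. -/
theorem ind_congr {P : Type*} {p : P → X} (b : ∀ t, IndFib W β (p t)) {t t' : P} {ω ω' : Ω} {y : Y}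
    (ht : t = t') (hω : ω = ω') (h : W.left.anchor ω = p t) (h' : W.left.anchor ω' = p t')
    (e : W.right.anchor ω = y) (e' : W.right.anchor ω' = y) :
    tr e ((b t).1 ⟨ω, h⟩) = tr e' ((b t').1 ⟨ω', h'⟩) := by
  subst ht hω; rfl

namespace EquivariantCorrespondence

theorem map_toHom {x y : Y} (g : H) (hx : ℋ.src g = x) (hy : ℋ.rng g = y) (b : B x) (e : E x) :
    ε.act g hx hy ((φ.fibre x).toHom b e) =
      (φ.fibre y).toHom (β.act g hx hy b) (ε.act g hx hy e) := by
  subst hx hy; exact φ.equivariant g b e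

theorem tr_toHom {x y : Y} (h : x = y) (b : B x) (e : E x) :
    tr h ((φ.fibre x).toHom b e) = (φ.fibre y).toHom (tr h b) (tr h e) := by
  subst h; rfl

/-- The fibre maps as additive maps in both variables. -/
theorem zero_toHom {y : Y} (e : E y) : (φ.fibre y).toHom 0 e = 0 := by
  rw [_root_.map_zero, zero_apply]

end EquivariantCorrespondence

variable [T2Space X] [T2Space Y] [T2Space Ω] [T2Space G] [T2Space H] [LocallyCompactSpace Y]
  [LocallyCompactSpace X]

theorem finite_inv_mem_src {K : Set G} (hK : IsCompact K) (x : X) :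
    {g : {g : G // 𝒢.src g = x} | 𝒢.inv g.1 ∈ K}.Finite := by
  refine Set.Finite.of_finite_image (f := fun g => 𝒢.inv g.1)
    ((𝒢.isEtaleMap_rng.finite_fibre hK x).subset ?_) fun g _ k _ h => Subtype.ext ?_
  · rintro _ ⟨g, hg, rfl⟩
    exact ⟨hg, (𝒢.rng_inv _).trans g.2⟩
  · rw [← 𝒢.inv_inv g.1, ← 𝒢.inv_inv k.1]
    exact congrArg 𝒢.inv h

variable (W) in
/-- The term of an arrow in the left action. -/
def leftTerm (b : ∀ g, IndFib W β (𝒢.src g)) (ξ : ∀ ω, E (W.right.anchor ω)) (ω : Ω)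
    (g : {g : G // 𝒢.src g = W.left.anchor ω}) : E (W.right.anchor ω) :=
  tr (W.right_anchor_smul g.2) ((φ.fibre _).toHom
    ((b (𝒢.inv g.1)).1 ⟨W.left.smul g.1 ω, (W.left.anchor_smul g.2).trans (𝒢.src_inv g.1).symm⟩)
    (ξ (W.left.smul g.1 ω)))

theorem leftTerm_eq_zero {b : ∀ g, IndFib W β (𝒢.src g)} (ξ : ∀ ω, E (W.right.anchor ω)) {ω : Ω}
    {g : {g : G // 𝒢.src g = W.left.anchor ω}} (h : b (𝒢.inv g.1) = 0) :
    leftTerm W φ b ξ ω g = 0 := by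
  unfold leftTerm
  rw [h]
  refine (congrArg (tr _) (φ.zero_toHom _)).trans (tr_zero _)

theorem finite_support_leftTerm {b : ∀ g, IndFib W β (𝒢.src g)} (hb : IsCc 𝒢.src b)
    (ξ : ∀ ω, E (W.right.anchor ω)) (ω : Ω) : (Function.support (leftTerm W φ b ξ ω)).Finite :=
  (finite_inv_mem_src (𝒢 := 𝒢) hb.2 (W.left.anchor ω)).subset fun _ hg => by_contra fun hk =>
    hg (leftTerm_eq_zero φ ξ (IsCc.eq_zero hk))

theorem leftSec_add_right {b : ∀ g, IndFib W β (𝒢.src g)} (hb : IsCc 𝒢.src b)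
    (ξ η : ∀ ω, E (W.right.anchor ω)) (ω : Ω) :
    leftSec W φ b (fun ω => ξ ω + η ω) ω = leftSec W φ b ξ ω + leftSec W φ b η ω := by
  refine Eq.trans ?_ (finsum_add_distrib (finite_support_leftTerm φ hb ξ ω)
    (finite_support_leftTerm φ hb η ω))
  refine finsum_congr fun g => ?_
  beta_reduce
  rw [_root_.map_add, tr_add]

theorem leftSec_smul_right (c : ℂ) (b : ∀ g, IndFib W β (𝒢.src g))
    (ξ : ∀ ω, E (W.right.anchor ω)) (ω : Ω) :
    leftSec W φ b (fun ω => c • ξ ω) ω = c • leftSec W φ b ξ ω := by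
  rw [leftSec, leftSec, smul_finsum]
  refine finsum_congr fun g => ?_
  rw [_root_.map_smul, tr_smul]

theorem leftSec_add_left {b b' : ∀ g, IndFib W β (𝒢.src g)} (hb : IsCc 𝒢.src b)
    (hb' : IsCc 𝒢.src b') (ξ : ∀ ω, E (W.right.anchor ω)) (ω : Ω) :
    leftSec W φ (fun g => b g + b' g) ξ ω = leftSec W φ b ξ ω + leftSec W φ b' ξ ω := by
  refine Eq.trans ?_ (finsum_add_distrib (finite_support_leftTerm φ hb ξ ω)
    (finite_support_leftTerm φ hb' ξ ω))
  refine finsum_congr fun g => ?_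
  beta_reduce
  rw [← tr_add, ← add_apply, ← _root_.map_add]
  rfl

theorem leftSec_smul_left (c : ℂ) (b : ∀ g, IndFib W β (𝒢.src g))
    (ξ : ∀ ω, E (W.right.anchor ω)) (ω : Ω) :
    leftSec W φ (fun g => c • b g) ξ ω = c • leftSec W φ b ξ ω := by
  rw [leftSec, leftSec, smul_finsum]
  refine finsum_congr fun g => ?_
  rw [← tr_smul, ← smul_apply, ← _root_.map_smul]
  rfl

/-- A pushforward along `(g, ω) ↦ ω`, étale as a base change of the source map. The flip `(g, ω) ↦
(g⁻¹, g ω)` shows that the support is compact. -/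
theorem isCc_leftSec [CStarBundle C] [HilbertBundle C E] {b : ∀ g, IndFib W β (𝒢.src g)}
    (hb : IsCc 𝒢.src b) {ξ : ∀ ω, E (W.right.anchor ω)} (hξ : IsCc W.right.anchor ξ) :
    IsCc W.right.anchor (leftSec W φ b ξ) := by
  have := W.locallyCompactSpace
  have := 𝒢.locallyCompactSpace
  have := W.left.locallyCompactSpace_FP
  let a : ∀ q : W.left.FP, E (W.right.anchor q.1.2) := fun q =>
    leftTerm W φ b ξ q.1.2 ⟨q.1.1, q.2⟩
  have h1 : IsContSec (fun q : W.left.FP => W.right.anchor q.1.2) a := by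
    have h3 : IsContSec (fun q : W.left.FP => W.right.anchor (W.left.smul q.1.1 q.1.2)) fun q =>
        (φ.fibre _).toHom ((b (𝒢.inv q.1.1)).1 ⟨W.left.smul q.1.1 q.1.2,
          (W.left.anchor_smul q.2).trans (𝒢.src_inv q.1.1).symm⟩)
          (ξ (W.left.smul q.1.1 q.1.2)) := by
      refine IsContSec.map₂' (m := fun {y} (b : B y) (e : E y) => (φ.fibre y).toHom b e)
        φ.continuous_fibre ?_ (hξ.1.comp W.left.continuous_smul_FP)
      exact isContSec_ind_apply (p := fun q : W.left.FP => 𝒢.src (𝒢.inv q.1.1))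
        (hb.1.comp (𝒢.continuous_inv.comp (continuous_fst.comp continuous_subtype_val)))
        W.left.continuous_smul_FP _
    exact h3.congr_base fun q => W.right_anchor_smul q.2
  have h2 : IsCc (fun q : W.left.FP => W.right.anchor q.1.2) a := by
    refine IsCc.of_eq_zero h1 (W.left.isCompact_FP_flip hb.2 hξ.2) fun q hq => ?_
    by_cases h : 𝒢.inv q.1.1 ∈ closure {g | b g ≠ 0}
    · have : ξ (W.left.smul q.1.1 q.1.2) = 0 := IsCc.eq_zero fun h' => hq ⟨h, h'⟩
      simp only [a, leftTerm, this, _root_.map_zero, tr_zero]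
    · exact leftTerm_eq_zero φ ξ (IsCc.eq_zero h)
  convert isCc_pushSec (p := fun q : W.left.FP => q.1.2) W.left.isEtaleMap_snd
    W.right.continuous_anchor h2 using 1
  funext ω
  let e : {g : G // 𝒢.src g = W.left.anchor ω} ≃ {q : W.left.FP // q.1.2 = ω} :=
    { toFun := fun g => ⟨⟨(g.1, ω), g.2⟩, rfl⟩
      invFun := fun q => ⟨q.1.1.1, q.1.2.trans (congrArg W.left.anchor q.2)⟩
      left_inv := fun _ => rfl
      right_inv := fun q => by obtain ⟨⟨⟨g, z⟩, h⟩, rfl⟩ := q; rfl }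
  exact finsum_comp_equiv e
    (f := fun q => tr (congrArg W.right.anchor q.2) (a q.1))

/-- Sections over the unit space act pointwise. -/
theorem leftSec_unitSec (k : ∀ x, IndFib W β x) (ξ : ∀ ω, E (W.right.anchor ω)) (ω : Ω) :
    leftSec W φ (unitSec 𝒢 k) ξ ω =
      (φ.fibre _).toHom ((k (W.left.anchor ω)).1 ⟨ω, rfl⟩) (ξ ω) := by
  refine (finsum_eq_single (leftTerm W φ (unitSec 𝒢 k) ξ ω)
    ⟨𝒢.one (W.left.anchor ω), 𝒢.src_one _⟩ fun g hg => ?_).trans ?_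
  · refine leftTerm_eq_zero φ ξ (unitSec_of_ne 𝒢 _ fun h => hg (Subtype.ext ?_))
    have h1 : g.1 = 𝒢.one (𝒢.src (𝒢.inv g.1)) := by
      conv_lhs => rw [← 𝒢.inv_inv g.1, h, 𝒢.inv_one]
    have h2 : 𝒢.src g.1 = 𝒢.src (𝒢.inv g.1) := by
      conv_lhs => rw [h1, 𝒢.src_one]
    exact h1.trans (congrArg 𝒢.one (h2.symm.trans g.2))
  · unfold leftTerm
    refine (φ.tr_toHom _ _ _).trans ?_
    have h1 := W.left.one_smul ω
    have h2 : unitSec 𝒢 k (𝒢.one (W.left.anchor ω)) = k _ := unitSec_one 𝒢 k _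
    congr 2
    · refine (ind_congr (unitSec 𝒢 k) (𝒢.inv_one _) h1 _ (𝒢.src_one _).symm _ rfl).trans ?_
      rw [h2]
      exact ind_congr (p := fun x => x) k (𝒢.src_one _) rfl _ _ _ rfl
    · exact (sec_congr ξ h1 _ rfl)

theorem tr_ind_apply {x x' : X} (e : x = x') (a : IndFib W β x) {ω : Ω} (h : W.left.anchor ω = x') :
    (tr e a).1 ⟨ω, h⟩ = a.1 ⟨ω, h.trans e.symm⟩ := by
  subst e; rfl

/-- Both sides are the sum of `F g m` over pairs of arrows starting at `ρ(ω)`, where `b` is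
evaluated at `g⁻¹` and `b'` at `g m⁻¹`. -/
theorem leftSec_conv {b b' : ∀ g, IndFib W β (𝒢.src g)} (hb : IsCc 𝒢.src b) (hb' : IsCc 𝒢.src b')
    (ξ : ∀ ω, E (W.right.anchor ω)) (ω : Ω) :
    leftSec W φ (conv 𝒢 (A := IndFib W β) (fun g hx hy => indAct W β g hx hy) b b') ξ ω =
      leftSec W φ b (leftSec W φ b' ξ) ω := by
  have := 𝒢.locallyCompactSpace
  let S := {g : G // 𝒢.src g = W.left.anchor ω}
  have hsm : ∀ g m : S, 𝒢.src g.1 = 𝒢.rng (𝒢.inv m.1) := fun g m => by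
    rw [𝒢.rng_inv, g.2, m.2]
  have hgm : ∀ g m : S, W.left.anchor (W.left.smul m.1 ω) = 𝒢.src (𝒢.mul g.1 (𝒢.inv m.1)) :=
    fun g m => by rw [𝒢.src_mul (hsm g m), W.left.anchor_smul m.2, 𝒢.src_inv]
  let F : S → S → E (W.right.anchor ω) := fun g m => (φ.fibre _).toHom
    (tr (W.right_anchor_smul g.2) ((b (𝒢.inv g.1)).1 ⟨W.left.smul g.1 ω,
      (W.left.anchor_smul g.2).trans (𝒢.src_inv g.1).symm⟩))
    ((φ.fibre _).toHom (tr (W.right_anchor_smul m.2) ((b' (𝒢.mul g.1 (𝒢.inv m.1))).1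
      ⟨W.left.smul m.1 ω, hgm g m⟩)) (tr (W.right_anchor_smul m.2) (ξ (W.left.smul m.1 ω))))
  have hR : leftSec W φ b (leftSec W φ b' ξ) ω = ∑ᶠ g, ∑ᶠ m, F g m := by
    refine finsum_congr fun g => ?_
    refine (φ.tr_toHom _ _ _).trans ?_
    rw [leftSec, tr_finsum]
    have hfin := (finite_support_leftTerm φ hb' ξ (W.left.smul g.1 ω)).subset
      (t := Function.support fun k => tr (W.right_anchor_smul g.2)
        (leftTerm W φ b' ξ (W.left.smul g.1 ω) k)) fun k hk h0 => hk (by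
          beta_reduce; rw [h0, tr_zero])
    refine (AddMonoidHom.map_finsum (AddMonoidHomClass.toAddMonoidHom ((φ.fibre _).toHom _))
      hfin).trans ?_
    let e : S ≃ {k : G // 𝒢.src k = W.left.anchor (W.left.smul g.1 ω)} :=
      { toFun := fun m => ⟨𝒢.mul m.1 (𝒢.inv g.1), by
          rw [𝒢.src_mul (hsm m g), 𝒢.src_inv, W.left.anchor_smul g.2]⟩
        invFun := fun k => ⟨𝒢.mul k.1 g.1, by
          rw [𝒢.src_mul (k.2.trans (W.left.anchor_smul g.2)), g.2]⟩
        left_inv := fun m => Subtype.ext (𝒢.inv_mul_cancel_right (m.2.trans g.2.symm))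
        right_inv := fun k => Subtype.ext (𝒢.mul_inv_cancel_right
          (k.2.trans (W.left.anchor_smul g.2))) }
    refine (finsum_comp_equiv e).symm.trans (finsum_congr fun m => ?_)
    refine congrArg ((φ.fibre _).toHom _) ?_
    unfold leftTerm
    rw [tr_tr]
    refine (φ.tr_toHom _ _ _).trans ?_
    have h1 : W.left.smul (e m).1 (W.left.smul g.1 ω) = W.left.smul m.1 ω := by
      rw [← W.left.mul_smul (by rw [(e m).2, W.left.anchor_smul g.2]) g.2]
      exact congrArg (fun k => W.left.smul k ω) (𝒢.inv_mul_cancel_right (m.2.trans g.2.symm))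
    refine congrArg₂ (fun x y => (φ.fibre (W.right.anchor ω)).toHom x y) ?_ ?_
    · refine ind_congr b' ?_ h1 _ _ _ _
      change 𝒢.inv (𝒢.mul m.1 (𝒢.inv g.1)) = _
      rw [𝒢.mul_inv_rev (hsm m g), 𝒢.inv_inv]
    · exact sec_congr ξ h1 _ _
  have hL : leftSec W φ (conv 𝒢 (A := IndFib W β) (fun g hx hy => indAct W β g hx hy) b b') ξ ω =
      ∑ᶠ m, ∑ᶠ g, F g m := by
    refine finsum_congr fun m => ?_
    refine (φ.tr_toHom _ _ _).trans ?_
    let v := tr (W.right_anchor_smul m.2) (ξ (W.left.smul m.1 ω))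
    let Λ : IndFib W β (𝒢.src (𝒢.inv m.1)) →+ E (W.right.anchor ω) := AddMonoidHom.mk'
      (fun a => (φ.fibre _).toHom (tr (W.right_anchor_smul m.2) (a.1 ⟨W.left.smul m.1 ω,
        (W.left.anchor_smul m.2).trans (𝒢.src_inv m.1).symm⟩)) v) fun a a' => by
          rw [← add_apply, ← _root_.map_add, ← tr_add]
          rfl
    have hfin := (finite_inv_mem hb'.2 (ℋ := 𝒢) (𝒢.src (𝒢.inv m.1))).subset
      (t := Function.support fun h : {h : G // 𝒢.rng h = 𝒢.src (𝒢.inv m.1)} =>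
        indAct W β h.1 (𝒢.src_mul h.2.symm).symm h.2 (b (𝒢.mul (𝒢.inv m.1) h.1)) *
          tr ((𝒢.src_inv h.1).trans h.2) (b' (𝒢.inv h.1))) fun h hh => by_contra fun hk => hh (by
            beta_reduce; rw [IsCc.eq_zero hk, tr_zero, mul_zero])
    refine (Λ.map_finsum hfin).trans ?_
    let e : S ≃ {h : G // 𝒢.rng h = 𝒢.src (𝒢.inv m.1)} :=
      { toFun := fun g => ⟨𝒢.mul m.1 (𝒢.inv g.1), by rw [𝒢.rng_mul (hsm m g), 𝒢.src_inv]⟩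
        invFun := fun h => ⟨𝒢.mul (𝒢.inv h.1) m.1, by
          rw [𝒢.src_mul (by rw [𝒢.src_inv, h.2, 𝒢.src_inv]), m.2]⟩
        left_inv := fun g => Subtype.ext (by
          change 𝒢.mul (𝒢.inv (𝒢.mul m.1 (𝒢.inv g.1))) m.1 = g.1
          rw [𝒢.mul_inv_rev (hsm m g), 𝒢.inv_inv, 𝒢.inv_mul_cancel_right (g.2.trans m.2.symm)])
        right_inv := fun h => Subtype.ext (by
          have h1 : 𝒢.src (𝒢.inv h.1) = 𝒢.rng m.1 := by rw [𝒢.src_inv, h.2, 𝒢.src_inv]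
          change 𝒢.mul m.1 (𝒢.inv (𝒢.mul (𝒢.inv h.1) m.1)) = h.1
          rw [𝒢.mul_inv_rev h1, 𝒢.inv_inv, 𝒢.mul_inv_cancel_left (by rw [h.2, 𝒢.src_inv])]) }
    refine (finsum_comp_equiv e).symm.trans (finsum_congr fun g => ?_)
    have he : 𝒢.inv (e g).1 = 𝒢.mul g.1 (𝒢.inv m.1) := by
      change 𝒢.inv (𝒢.mul m.1 (𝒢.inv g.1)) = _
      rw [𝒢.mul_inv_rev (hsm m g), 𝒢.inv_inv]
    have h1 : W.left.smul (𝒢.inv (e g).1) (W.left.smul m.1 ω) = W.left.smul g.1 ω := by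
      rw [he, ← W.left.mul_smul (by rw [𝒢.src_mul (hsm g m), 𝒢.src_inv]) m.2,
        𝒢.inv_mul_cancel_right (g.2.trans m.2.symm)]
    refine (congrArg (fun x => (φ.fibre _).toHom x v) (tr_mul (A := B) _ _ _)).trans ?_
    refine (congrArg (fun T => T v) (_root_.map_mul (φ.fibre (W.right.anchor ω)).toHom _ _)).trans ?_
    refine congrArg₂ (fun x y => (φ.fibre (W.right.anchor ω)).toHom x
      ((φ.fibre (W.right.anchor ω)).toHom y v)) ?_ ?_
    · rw [indAct_apply, tr_tr]
      refine ind_congr b ?_ h1 _ _ _ _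
      exact 𝒢.inv_mul_cancel_left (hsm m g)
    · rw [tr_ind_apply]
      exact ind_congr b' he rfl _ _ _ _
  rw [hR, hL]
  have hs := finite_inv_mem_src (𝒢 := 𝒢) hb.2 (W.left.anchor ω)
  -- The condition `g m⁻¹ ∈ supp b'` involves `g`, but only finitely many `g` matter, and each
  -- allows finitely many `m`.
  have ht : {m : S | ∃ g : S, 𝒢.inv g.1 ∈ closure {g | b g ≠ 0} ∧
      𝒢.mul g.1 (𝒢.inv m.1) ∈ closure {g | b' g ≠ 0}}.Finite := by
    refine (hs.biUnion (t := fun g : S => {m : S | 𝒢.mul g.1 (𝒢.inv m.1) ∈ closure {g | b' g ≠ 0}})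
      fun g _ => ?_).subset fun m ⟨g, hg, hm⟩ => Set.mem_biUnion hg hm
    refine Set.Finite.of_finite_image (f := fun m : S => 𝒢.mul g.1 (𝒢.inv m.1))
      ((𝒢.isEtaleMap_rng.finite_fibre hb'.2 (𝒢.rng g.1)).subset ?_) fun m _ m' _ h =>
        Subtype.ext ?_
    · rintro _ ⟨m, hm, rfl⟩
      exact ⟨hm, 𝒢.rng_mul (hsm g m)⟩
    · refine 𝒢.invHomeomorph.injective ?_
      have h2 := congrArg (𝒢.mul (𝒢.inv g.1)) h
      beta_reduce at h2
      rwa [𝒢.inv_mul_cancel_left (hsm g m), 𝒢.inv_mul_cancel_left (hsm g m')] at h2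
  refine (finsum_comm_of_finite hs ht fun g m h => ?_).symm
  have h1 : 𝒢.inv g.1 ∈ closure {g | b g ≠ 0} := by
    by_contra h0
    refine h ?_
    simp only [F]
    rw [IsCc.eq_zero h0]
    exact (congrArg (fun x => (φ.fibre _).toHom x _) (tr_zero _)).trans (φ.zero_toHom _)
  refine ⟨h1, g, h1, ?_⟩
  by_contra h0
  refine h ?_
  simp only [F]
  rw [IsCc.eq_zero h0]
  refine (congrArg _ ((congrArg (fun x => (φ.fibre _).toHom x _) (tr_zero _)).trans
    (φ.zero_toHom _))).trans (_root_.map_zero _)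

end LeftActionSections

/-- The sections over an étale groupoid with values in a bundle of C⋆-algebras. -/
abbrev convSub {G : Type uG} {X : Type uX} [TopologicalSpace G] [TopologicalSpace X]
    (A : X → Type uA) [∀ x, NonUnitalCStarAlgebra (A x)] [TopologicalSpace (Tot A)] [StarBundle A]
    (𝒢 : EtaleGroupoid G X) : Submodule ℂ (∀ g, A (𝒢.src g)) :=
  ccSub A 𝒢.continuous_src

/-! ### Adjointability of the left action. -/

section LeftActionSections

variable {G : Type uG} {X : Type uX} {H : Type uH} {Y : Type uY} {Ω : Type uΩ}
  [TopologicalSpace G] [TopologicalSpace X] [TopologicalSpace H] [TopologicalSpace Y]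
  [TopologicalSpace Ω]
  {𝒢 : EtaleGroupoid G X} {ℋ : EtaleGroupoid H Y} {W : EtaleCorrespondence 𝒢 ℋ Ω}
  {B : Y → Type uB} [∀ y, NonUnitalCStarAlgebra (B y)] [TopologicalSpace (Tot B)]
  [CStarBundle B]
  {C : Y → Type uC} [∀ y, NonUnitalCStarAlgebra (C y)] [TopologicalSpace (Tot C)]
  {E : Y → Type uE} [∀ y, NormedAddCommGroup (E y)] [∀ y, NormedSpace ℂ (E y)]
  [∀ y, CompleteSpace (E y)] [TopologicalSpace (Tot E)] [∀ y, HilbertModule (C y) (E y)]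
  {β : CStarAction ℋ B} {γ : CStarAction ℋ C} {ε : HilbertAction γ E}
  (φ : EquivariantCorrespondence β ε)

theorem IndFib.tr_apply_smul {x : X} (a : IndFib W β x) {ω : Ω} {h : H} {y : Y}
    (hh : ℋ.rng h = W.right.anchor ω) (h1 : W.left.anchor ω = x)
    (h2 : W.left.anchor (W.right.smul ω h) = x) (e : W.right.anchor (W.right.smul ω h) = y)
    (hy : ℋ.rng (ℋ.inv h) = y) :
    tr e (a.1 ⟨W.right.smul ω h, h2⟩) =
      β.act (ℋ.inv h) ((ℋ.src_inv h).trans hh) hy (a.1 ⟨ω, h1⟩) := by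
  subst e
  exact IndFib.apply_smul a ⟨ω, h1⟩ ⟨_, h2⟩ hh rfl hy

variable [T2Space X] [T2Space Y] [T2Space Ω] [T2Space G] [T2Space H] [LocallyCompactSpace Y]
  [LocallyCompactSpace X]

/-- Write both sides as sums over pairs of a point `ω` and an arrow `g` starting at `ρ(ω)`. The
involution `(ω, g) ↦ (g ω, g⁻¹)` exchanges the terms `D` and `D'`, because on each fibre `B` acts by
adjointable operators and the values of `b` are equivariant. -/
theorem innerSec_leftSec {b : ∀ g, IndFib W β (𝒢.src g)} (hb : IsCc 𝒢.src b)
    {ξ : ∀ ω, E (W.right.anchor ω)} (hξ : IsCc W.right.anchor ξ)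
    (η : ∀ ω, E (W.right.anchor ω))
    (hb' : IsCc 𝒢.src (adj 𝒢 (A := IndFib W β) (fun g hx hy => indAct W β g hx hy) b)) (h : H) :
    W.right.innerSec ε (leftSec W φ b ξ) η h = W.right.innerSec ε ξ
      (leftSec W φ (adj 𝒢 (A := IndFib W β) (fun g hx hy => indAct W β g hx hy) b) η) h := by
  have := W.locallyCompactSpace
  have := 𝒢.locallyCompactSpace
  have := ℋ.locallyCompactSpace
  let b' := adj 𝒢 (A := IndFib W β) (fun g hx hy => indAct W β g hx hy) b
  let T := {ω : Ω // W.right.anchor ω = ℋ.rng h}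
  let P := Σ ω : T, {g : G // 𝒢.src g = W.left.anchor ω.1}
  let D : P → C (ℋ.src h) := fun p =>
    ip (ε.act (ℋ.inv h) ((ℋ.src_inv h).trans p.1.2.symm) (ℋ.rng_inv h)
      (leftTerm W φ b ξ p.1.1 p.2)) (tr (W.right.anchor_smul p.1.2.symm) (η (W.right.smul p.1.1 h)))
  have hsrc : ∀ p : P, 𝒢.src p.2.1 = W.left.anchor (W.right.smul p.1.1 h) := fun p =>
    p.2.2.trans (W.left_anchor_smul p.1.2.symm).symm
  let D' : P → C (ℋ.src h) := fun p =>
    ip (ε.act (ℋ.inv h) ((ℋ.src_inv h).trans p.1.2.symm) (ℋ.rng_inv h) (ξ p.1.1))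
      (tr (W.right.anchor_smul p.1.2.symm)
        (leftTerm W φ b' η (W.right.smul p.1.1 h) ⟨p.2.1, hsrc p⟩))
  let e : P → P := fun p => ⟨⟨W.left.smul p.2.1 p.1.1, (W.right_anchor_smul p.2.2).trans p.1.2⟩,
    ⟨𝒢.inv p.2.1, (𝒢.src_inv _).trans (W.left.anchor_smul p.2.2).symm⟩⟩
  have he : Function.Involutive e := by
    rintro ⟨⟨ω, hω⟩, ⟨g, hg⟩⟩
    have key : ∀ (ω' : Ω) (g' : G) (h1 : W.right.anchor ω' = ℋ.rng h)
        (h2 : 𝒢.src g' = W.left.anchor ω'), ω' = ω → g' = g →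
        (⟨⟨ω', h1⟩, ⟨g', h2⟩⟩ : P) = ⟨⟨ω, hω⟩, ⟨g, hg⟩⟩ := by
      rintro _ _ _ _ rfl rfl; rfl
    exact key _ _ _ _ (W.left.inv_smul_smul hg) (𝒢.inv_inv g)
  have hDe : ∀ p, D (e p) = D' p := by
    intro p
    have hσ : W.right.anchor (W.left.smul p.2.1 p.1.1) = ℋ.rng h :=
      (W.right_anchor_smul p.2.2).trans p.1.2
    let x : B (ℋ.src h) := β.act (ℋ.inv h) ((ℋ.src_inv h).trans p.1.2.symm) (ℋ.rng_inv h)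
      ((b p.2.1).1 ⟨p.1.1, p.2.2.symm⟩)
    let u : E (ℋ.src h) := ε.act (ℋ.inv h) ((ℋ.src_inv h).trans p.1.2.symm) (ℋ.rng_inv h) (ξ p.1.1)
    let v : E (ℋ.src h) := tr (W.right.anchor_smul hσ.symm)
      (η (W.right.smul (W.left.smul p.2.1 p.1.1) h))
    have h1 : D (e p) = ip ((φ.fibre _).toHom x u) v := by
      refine congrArg (fun w => (ip w v : C (ℋ.src h))) ?_
      have h2 : leftTerm W φ b ξ (e p).1.1 (e p).2 = tr (W.right_anchor_smul p.2.2).symm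
          ((φ.fibre _).toHom ((b p.2.1).1 ⟨p.1.1, p.2.2.symm⟩) (ξ p.1.1)) := by
        unfold leftTerm
        refine (φ.tr_toHom _ _ _).trans (Eq.trans ?_ (φ.tr_toHom _ _ _).symm)
        refine congrArg₂ (fun x y => (φ.fibre _).toHom x y) ?_ ?_
        · exact ind_congr b (𝒢.inv_inv _) (W.left.inv_smul_smul p.2.2) _ _ _ _
        · exact sec_congr ξ (W.left.inv_smul_smul p.2.2) _ _
      rw [h2, HilbertAction.act_tr]
      exact φ.map_toHom _ _ _ _ _
    have h2 : D' p = ip u ((φ.fibre _).toHom (star x) v) := by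
      refine congrArg (fun w => (ip u w : C (ℋ.src h))) ?_
      unfold leftTerm
      rw [tr_tr]
      refine (φ.tr_toHom _ _ _).trans ?_
      refine congrArg₂ (fun x y => (φ.fibre (ℋ.src h)).toHom x y) ?_ ?_
      · simp only [b', adj]
        rw [indAct_apply, tr_tr]
        refine (ind_congr (fun g => star (b g)) (t' := p.2.1) (ω' := W.right.smul p.1.1 h)
          (𝒢.inv_inv _) ?_ _ (hsrc p).symm _ (W.right.anchor_smul p.1.2.symm)).trans ?_
        · change W.left.smul (𝒢.inv (𝒢.inv (𝒢.inv p.2.1))) _ = _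
          rw [𝒢.inv_inv]
          exact W.left.inv_smul_smul (hsrc p)
        · refine (IndFib.tr_apply_smul _ p.1.2.symm p.2.2.symm _ _ (ℋ.rng_inv h)).trans ?_
          exact StarHomClass.map_star (β.act (ℋ.inv h) _ _) _
      · exact sec_congr η (W.smul_comm p.2.2 p.1.2.symm).symm _ _
    rw [h1, h2, (φ.fibre _).adjoint]
  -- Finiteness is visible for `D'`, where `ξ` restricts the points and `b` the arrows; the
  -- involution transfers it to `D`.
  have hfin' : (Function.support D').Finite := by
    have ht : ∀ ω : T, {g : {g : G // 𝒢.src g = W.left.anchor ω.1} |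
        𝒢.inv (𝒢.inv g.1) ∈ closure {g | b g ≠ 0}}.Finite := fun ω => by
      simp only [𝒢.inv_inv]
      refine Set.Finite.of_finite_image (f := Subtype.val)
        ((𝒢.isEtaleMap_src.finite_fibre hb.2 (W.left.anchor ω.1)).subset ?_)
        Subtype.val_injective.injOn
      rintro _ ⟨g, hg, rfl⟩
      exact ⟨hg, g.2⟩
    refine ((finite_anchor_eq W.right W.etale hξ.2 (ℋ.rng h)).biUnion fun ω _ =>
      (ht ω).image (Sigma.mk ω)).subset fun p hp => Set.mem_biUnion (x := p.1) ?_ ⟨p.2, ?_, rfl⟩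
    · by_contra h0
      have h1 : ξ p.1.1 = 0 := IsCc.eq_zero h0
      exact hp (by simp only [D', h1, _root_.map_zero, HilbertModule.zero_ip])
    · by_contra h0
      have h1 : b (𝒢.inv (𝒢.inv p.2.1)) = 0 := IsCc.eq_zero h0
      have h2 : b' (𝒢.inv p.2.1) = 0 := by
        simp only [b', adj]
        rw [h1, star_zero]
        exact isStarAction_indAct.map_zero _ _ _
      refine hp ?_
      simp only [D']
      rw [leftTerm_eq_zero φ η (g := ⟨p.2.1, hsrc p⟩) h2, tr_zero, HilbertModule.ip_zero]
  have hfin : (Function.support D).Finite := by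
    refine (hfin'.image e).subset fun p hp => ⟨e p, ?_, he p⟩
    rw [Function.mem_support, ← hDe, he p]
    exact hp
  have hL : W.right.innerSec ε (leftSec W φ b ξ) η h = ∑ᶠ p, D p := by
    rw [finsum_sigma_of_finite hfin]
    refine finsum_congr fun ω => ?_
    let f : E (W.right.anchor ω.1) →+ C (ℋ.src h) := AddMonoidHom.mk'
      (fun w => ip (ε.act (ℋ.inv h) ((ℋ.src_inv h).trans ω.2.symm) (ℋ.rng_inv h) w)
        (tr (W.right.anchor_smul ω.2.symm) (η (W.right.smul ω.1 h)))) fun w w' => by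
          rw [_root_.map_add, HilbertModule.add_ip]
    exact f.map_finsum (finite_support_leftTerm φ hb ξ ω.1)
  have hR : W.right.innerSec ε ξ (leftSec W φ b' η) h = ∑ᶠ p, D' p := by
    rw [finsum_sigma_of_finite hfin']
    refine finsum_congr fun ω => ?_
    let f : E (W.right.anchor (W.right.smul ω.1 h)) →+ C (ℋ.src h) := AddMonoidHom.mk'
      (fun w => ip (ε.act (ℋ.inv h) ((ℋ.src_inv h).trans ω.2.symm) (ℋ.rng_inv h) (ξ ω.1))
        (tr (W.right.anchor_smul ω.2.symm) w)) fun w w' => by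
          rw [tr_add, HilbertModule.ip_add]
    refine (f.map_finsum (finite_support_leftTerm φ hb' η _)).trans ?_
    exact finsum_subtype_congr (fun g => by rw [W.left_anchor_smul ω.2.symm]) fun g _ _ => rfl
  rw [hL, hR]
  exact (finsum_comp_equiv he.toPerm).symm.trans (finsum_congr hDe)

variable [CStarBundle C] [HilbertBundle C E]

variable (W) in
/-- The left action of sections on sections, as a bilinear map. -/
def leftRep : convSub (IndFib W β) 𝒢 →ₗ[ℂ] ccSub E W.right.continuous_anchor →ₗ[ℂ]
    ccSub E W.right.continuous_anchor :=
  LinearMap.mk₂ ℂ (fun b ξ => ⟨leftSec W φ b.1 ξ.1, isCc_leftSec φ b.2 ξ.2⟩)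
    (fun b b' ξ => Subtype.ext (funext fun ω => leftSec_add_left φ b.2 b'.2 ξ.1 ω))
    (fun c b ξ => Subtype.ext (funext fun ω => leftSec_smul_left φ c b.1 ξ.1 ω))
    (fun b ξ η => Subtype.ext (funext fun ω => leftSec_add_right φ b.2 ξ.1 η.1 ω))
    fun c b ξ => Subtype.ext (funext fun ω => leftSec_smul_right φ c b.1 ξ.1 ω)

theorem leftRep_apply (b : convSub (IndFib W β) 𝒢)
    (ξ : ccSub E W.right.continuous_anchor) :
    leftRep W φ b ξ = ⟨leftSec W φ b.1 ξ.1, isCc_leftSec φ b.2 ξ.2⟩ := rfl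

theorem isRep_leftRep : (RightAction.modPre ε W.proper W.etale).IsRep 𝒢
    (A := IndFib W β) (fun g hx hy => indAct W β g hx hy) (leftRep W φ) where
  mul a b c h ξ := Subtype.ext (funext fun ω =>
    (congrArg (fun d => leftSec W φ d ξ.1 ω) (funext h)).trans (leftSec_conv φ a.2 b.2 ξ.1 ω))
  adj a b h ξ η := by
    have h1 : b.1 = adj 𝒢 (A := IndFib W β) (fun g hx hy => indAct W β g hx hy) a.1 :=
      funext h
    refine congrArg γ.ι (Subtype.ext (funext fun k => ?_))
    exact (innerSec_leftSec φ a.2 ξ.2 η.1 (h1 ▸ b.2) k).trans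
      (congrArg (fun d => W.right.innerSec ε ξ.1 (leftSec W φ d η.1) k) h1.symm)

end LeftActionSections

/-! ### Nondegeneracy -/

theorem PreHilbert.IsRep.exists_hom {G : Type uG} {X : Type uX} [TopologicalSpace G]
    [TopologicalSpace X] {𝒢 : EtaleGroupoid G X} {A : X → Type uA} [∀ x, NonUnitalCStarAlgebra (A x)]
    [TopologicalSpace (Tot A)] [StarBundle A]
    {act : ∀ {x y : X} (g : G), 𝒢.src g = x → 𝒢.rng g = y → A x → A y}
    {Q V : Type*} [NonUnitalCStarAlgebra Q] [AddCommGroup V] [Module ℂ V]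
    {P : PreHilbert Q V} {ρ : convSub A 𝒢 →ₗ[ℂ] V →ₗ[ℂ] V}
    (hρ : P.IsRep 𝒢 act ρ) [T2Space G] (ha : IsStarAction 𝒢 act) [T2Space X] [LocallyCompactSpace X]
    {M : Type*} [NormedAddCommGroup M] [NormedSpace ℂ M] [CompleteSpace M]
    [HilbertModule Q M] {j : V →ₗ[ℂ] M} (hj : DenseRange j)
    (hip : ∀ v w, (HilbertModule.ip (j v) (j w) : Q) = P.ip v w) :
    ∃ Φ : CrossedProduct 𝒢 act →⋆ₙₐ[ℂ] AdjOp Q M, ∀ b v,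
      (Φ (crossedι 𝒢 act b)).1 (j v) = j (ρ ⟨b.1, b.2⟩ v) := by
  obtain ⟨π, hπ, h⟩ := hρ.exists_isStarRep ha hj hip
  obtain ⟨Φ, hΦ⟩ := ha.exists_hom hπ
  exact ⟨Φ, fun b ξ => by rw [hΦ, h]⟩

section LeftHom

variable {G : Type uG} {X : Type uX} {H : Type uH} {Y : Type uY} {Ω : Type uΩ}
  [TopologicalSpace G] [TopologicalSpace X] [TopologicalSpace H] [TopologicalSpace Y]
  [TopologicalSpace Ω]
  {𝒢 : EtaleGroupoid G X} {ℋ : EtaleGroupoid H Y} {W : EtaleCorrespondence 𝒢 ℋ Ω}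
  {B : Y → Type uB} [∀ y, NonUnitalCStarAlgebra (B y)] [TopologicalSpace (Tot B)]
  [CStarBundle B]
  {C : Y → Type uC} [∀ y, NonUnitalCStarAlgebra (C y)] [TopologicalSpace (Tot C)]
  {E : Y → Type uE} [∀ y, NormedAddCommGroup (E y)] [∀ y, NormedSpace ℂ (E y)]
  [∀ y, CompleteSpace (E y)] [TopologicalSpace (Tot E)] [∀ y, HilbertModule (C y) (E y)]
  {β : CStarAction ℋ B} {γ : CStarAction ℋ C} {ε : HilbertAction γ E}
  (φ : EquivariantCorrespondence β ε)
  [T2Space X] [T2Space Y] [T2Space Ω] [T2Space G] [T2Space H] [LocallyCompactSpace Y]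
  [LocallyCompactSpace X]

/-- Local sections of the bundle extend to the induced algebra. -/
theorem exists_ind_eventually_eq {b : ∀ y, B y} (hb : IsContSec (fun y : Y => y) b) (ω₀ : Ω) :
    ∃ a : Ind W.right β, ∀ᶠ ω in 𝓝 ω₀, a.1 ω = b (W.right.anchor ω) := by
  have := W.locallyCompactSpace
  have := ℋ.locallyCompactSpace
  -- By freeness, `V` meets each orbit at most once. So in the average of a section cut off inside
  -- `V`, only the unit contributes at points of `N`.
  obtain ⟨V, hV, hV1⟩ := W.free.exists_nhds W.proper ω₀
  obtain ⟨N, hN, hω₀, hNV⟩ := exists_compact_subset isOpen_interior (mem_interior_iff_mem_nhds.2 hV)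
  obtain ⟨χ, h1, h2, h3, -⟩ := exists_continuous_one_zero_of_isCompact hN
    (isOpen_interior (s := V)).isClosed_compl (Set.disjoint_compl_right_iff_subset.2 hNV)
  have hη := (IsContSec.comp hb W.right.continuous_anchor).isCc_smul χ.continuous h3
  obtain ⟨a, ha⟩ := Ind.exists_avg (β := β) W.proper hη
  refine ⟨a, ?_⟩
  filter_upwards [mem_interior_iff_mem_nhds.1 hω₀] with ω hω
  rw [ha, RightAction.avg]
  rw [finsum_eq_single _ ⟨ℋ.one (W.right.anchor ω), ℋ.rng_one _⟩]
  · have h4 : ∀ (z : Ω) (hz : z = ω) (hx : ℋ.src (ℋ.one (W.right.anchor ω)) = W.right.anchor z)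
        (hy : ℋ.rng (ℋ.one (W.right.anchor ω)) = W.right.anchor ω),
        β.act (ℋ.one (W.right.anchor ω)) hx hy ((χ z : ℂ) • b (W.right.anchor z)) =
          b (W.right.anchor ω) := by
      rintro z rfl hx hy
      rw [β.act_one, show χ z = 1 from h1 hω, Complex.ofReal_one, one_smul]
    exact h4 _ (W.right.smul_one ω) _ _
  · rintro ⟨h, hh⟩ hne
    by_cases hm : W.right.smul ω h ∈ interior V
    · exact absurd (Subtype.ext (hV1 ω (interior_subset (hNV hω)) h hh (interior_subset hm))) hne
    · have h5 : χ (W.right.smul ω h) = 0 := h2 hm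
      simp only [h5, Complex.ofReal_zero, zero_smul, _root_.map_zero]

theorem isContSec_indRes (a : Ind W.right β) :
    IsContSec (fun x : X => x) fun x => indRes W β a x :=
  continuous_iff_continuousAt.2 fun x => tendsto_ind_of_approx tendsto_id fun r hr => by
    refine ⟨a, by simpa using hr, Eventually.of_forall fun x => by simpa using hr⟩

variable [CStarBundle C] [HilbertBundle C E]

/-- Sections on the units act pointwise. Cutting off `a` by a function on `X` equal to `1` on the
image of the support of `χ` puts it in `Γ_c(G)` without changing the product. -/
theorem exists_leftSec_eq_smul (a : Ind W.right β) {η : ∀ ω, E (W.right.anchor ω)}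
    (hη : IsContSec W.right.anchor η) {χ : Ω → ℝ} (hχ : Continuous χ) (hχc : HasCompactSupport χ) :
    ∃ b ζ, ∀ ω, (leftRep W φ b ζ).1 ω =
      (χ ω : ℂ) • (φ.fibre (W.right.anchor ω)).toHom (a.1 ω) (η ω) := by
  obtain ⟨g, h1, -, h2, -⟩ := exists_continuous_one_zero_of_isCompact
    (hχc.isCompact.image W.left.continuous_anchor) isClosed_empty (Set.disjoint_empty _)
  have hk := (isContSec_indRes a).smul (f := fun x => (g x : ℂ)) (by fun_prop)
  have hk0 : ∀ x ∉ tsupport g, (g x : ℂ) • indRes W β a x = 0 := fun x hx => by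
    rw [image_eq_zero_of_notMem_tsupport hx, Complex.ofReal_zero, zero_smul]
  refine ⟨⟨_, isCc_unitSec 𝒢 h2.isCompact hk hk0⟩, ⟨_, hη.isCc_smul hχ hχc⟩, fun ω => ?_⟩
  rw [leftRep_apply]
  refine (leftSec_unitSec φ _ _ ω).trans ?_
  rw [_root_.map_smul]
  by_cases h : χ ω = 0
  · rw [h, Complex.ofReal_zero, zero_smul, zero_smul]
  · have h3 : g (W.left.anchor ω) = 1 := h1 ⟨ω, subset_tsupport _ h, rfl⟩
    simp only [h3, Complex.ofReal_one, one_smul]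
    rfl

variable (W) in
/-- The span of the products of sections. -/
def leftSpan : Submodule ℂ (ccSub E W.right.continuous_anchor) :=
  Submodule.span ℂ {ζ | ∃ b η, leftRep W φ b η = ζ}

/-- A continuous section whose product with cutoff functions near a point is in the span of the
products of sections. -/
def IsLocallyInLeftSpan (ω₀ : Ω) (T : ∀ ω, E (W.right.anchor ω)) : Prop :=
  IsContSec W.right.anchor T ∧ ∃ U ∈ 𝓝 ω₀, ∀ χ : Ω → ℝ, Continuous χ → HasCompactSupport χ →
    tsupport χ ⊆ U → ∃ ζ ∈ leftSpan W φ, ∀ ω, ζ.1 ω = (χ ω : ℂ) • T ω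

/-- A product `p m` in the fibre is the value of a product of sections, with `p` extended through an
element of the induced algebra. Sums and scalar multiples are handled by linearity on a smaller
neighbourhood. -/
theorem exists_isLocallyInLeftSpan (ω₀ : Ω) {v : E (W.right.anchor ω₀)}
    (hv : v ∈ Submodule.span ℂ {k | ∃ p m, (φ.fibre (W.right.anchor ω₀)).toHom p m = k}) :
    ∃ T, IsLocallyInLeftSpan φ ω₀ T ∧ T ω₀ = v := by
  refine Submodule.span_induction (p := fun v _ => ∃ T, IsLocallyInLeftSpan φ ω₀ T ∧ T ω₀ = v)
    ?_ ?_ ?_ ?_ hv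
  · rintro _ ⟨p, m, rfl⟩
    obtain ⟨b, hb, hbp⟩ := BanachBundle.exists_section (W.right.anchor ω₀) p
    obtain ⟨e, he, hem⟩ := BanachBundle.exists_section (W.right.anchor ω₀) m
    obtain ⟨a, ha⟩ := exists_ind_eventually_eq (W := W) (β := β) hb.1 ω₀
    have hη := IsContSec.comp he.1 W.right.continuous_anchor
    refine ⟨fun ω => (φ.fibre _).toHom (a.1 ω) (e (W.right.anchor ω)),
      ⟨IsContSec.map₂' (m := fun {y} (b : B y) (e : E y) => (φ.fibre y).toHom b e)
        φ.continuous_fibre a.2.1 hη, Set.univ, univ_mem, fun χ hχ hχc _ => ?_⟩, ?_⟩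
    · obtain ⟨k, ζ, h⟩ := exists_leftSec_eq_smul φ a hη hχ hχc
      exact ⟨_, Submodule.subset_span ⟨k, ζ, rfl⟩, h⟩
    · beta_reduce
      rw [ha.self_of_nhds, hbp, hem]
  · refine ⟨fun _ => 0, ⟨IsContSec.zero W.right.continuous_anchor, Set.univ, univ_mem,
      fun χ _ _ _ => ⟨0, zero_mem _, fun ω => (smul_zero _).symm⟩⟩, rfl⟩
  · rintro _ _ - - ⟨T, ⟨hT, U, hU, h⟩, rfl⟩ ⟨T', ⟨hT', U', hU', h'⟩, rfl⟩
    refine ⟨fun ω => T ω + T' ω, ⟨hT.add hT', U ∩ U', inter_mem hU hU', fun χ h1 h2 h3 => ?_⟩, rfl⟩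
    obtain ⟨ζ, hζ, e⟩ := h χ h1 h2 (h3.trans Set.inter_subset_left)
    obtain ⟨ζ', hζ', e'⟩ := h' χ h1 h2 (h3.trans Set.inter_subset_right)
    exact ⟨ζ + ζ', add_mem hζ hζ', fun ω => by
      rw [smul_add, ← e, ← e']; rfl⟩
  · rintro c _ - ⟨T, ⟨hT, U, hU, h⟩, rfl⟩
    refine ⟨fun ω => c • T ω, ⟨hT.const_smul c, U, hU, fun χ h1 h2 h3 => ?_⟩, rfl⟩
    obtain ⟨ζ, hζ, e⟩ := h χ h1 h2 h3
    exact ⟨c • ζ, Submodule.smul_mem _ c hζ, fun ω => by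
      rw [smul_comm, ← e]; rfl⟩

/-- Uniform approximation by products of sections. -/
theorem exists_mem_leftSpan {ξ : ∀ ω, E (W.right.anchor ω)} (hξ : IsCc W.right.anchor ξ)
    {K : Set Ω} (hK : closure {ω | ξ ω ≠ 0} ⊆ interior K) {δ : ℝ} (hδ : 0 < δ) :
    ∃ ζ ∈ leftSpan W φ, (∀ ω ∉ K, ζ.1 ω = 0) ∧ ∀ ω, ‖ζ.1 ω - ξ ω‖ ≤ δ := by
  have := W.locallyCompactSpace
  have h1 : ∀ t : Ω, ∃ T, IsLocallyInLeftSpan φ t T ∧ ‖T t - ξ t‖ < δ := fun t => by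
    obtain ⟨v, hv, hvt⟩ := Metric.mem_closure_iff.1
      ((φ.fibre (W.right.anchor t)).nondegenerate (ξ t)) δ hδ
    obtain ⟨T, hT, rfl⟩ := exists_isLocallyInLeftSpan φ t hv
    exact ⟨T, hT, by rwa [← dist_eq_norm, dist_comm]⟩
  choose T hT hTt using h1
  choose U hU hUT using fun t => (hT t).2
  obtain ⟨n, t, χ, -, hχU, hχ1, hχ0, -, hχc⟩ := exists_partition hξ.2
    (fun t => (U t ∩ {ω | ‖T t ω - ξ ω‖ < δ}) ∩ interior K) fun t ht =>
      inter_mem (inter_mem (hU t) ((((hT t).1.sub hξ.1).isOpen_norm_lt δ).mem_nhds (hTt t)))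
        (isOpen_interior.mem_nhds (hK ht))
  -- The functions `χ i` add up to `1` only on the support of `ξ`. Division by `s` keeps their sum
  -- at most `1` elsewhere and changes nothing on the support.
  let s : Ω → ℝ := fun ω => max 1 (∑ i, χ i ω)
  have hs : Continuous s := by fun_prop
  have hs1 : ∀ ω, 1 ≤ s ω := fun ω => le_max_left _ _
  have hs0 : ∀ ω, 0 < s ω := fun ω => zero_lt_one.trans_le (hs1 ω)
  have hsub : ∀ i, tsupport (fun ω => χ i ω * (s ω)⁻¹) ⊆ tsupport (χ i) := fun i =>
    closure_mono fun ω hω h => hω (by beta_reduce; rw [h, zero_mul])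
  choose ζ hζ hζe using fun i => hUT (t i) (fun ω => χ i ω * (s ω)⁻¹)
    ((χ i).continuous.mul (hs.inv₀ fun ω => (hs0 ω).ne')) ((hχc i).mul_right)
    ((hsub i).trans ((hχU i).trans (Set.inter_subset_left.trans Set.inter_subset_left)))
  have hζs : ∀ ω, (∑ i, ζ i).1 ω = ∑ i, ((χ i ω * (s ω)⁻¹ : ℝ) : ℂ) • T (t i) ω := fun ω => by
    rw [Submodule.coe_sum, Finset.sum_apply]
    exact Finset.sum_congr rfl fun i _ => hζe i ω
  refine ⟨∑ i, ζ i, sum_mem fun i _ => hζ i, fun ω hω => ?_, fun ω => ?_⟩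
  · rw [hζs]
    refine Finset.sum_eq_zero fun i _ => ?_
    have h2 : χ i ω = 0 := image_eq_zero_of_notMem_tsupport fun h =>
      hω (interior_subset (hχU i h).2)
    rw [h2, zero_mul, Complex.ofReal_zero, zero_smul]
  · have h3 : ∑ i, ((χ i ω * (s ω)⁻¹ : ℝ) : ℂ) • ξ ω = ξ ω := by
      by_cases h : ξ ω = 0
      · simp [h]
      · have h4 := hχ1 ω (subset_closure h)
        have h5 : s ω = 1 := by simp only [s, h4, max_self]
        simp only [h5, inv_one, mul_one]
        rw [← Finset.sum_smul, ← Complex.ofReal_sum, h4, Complex.ofReal_one, one_smul]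
    have h6 : ∑ i, χ i ω * (s ω)⁻¹ ≤ 1 := by
      rw [← Finset.sum_mul, ← div_eq_mul_inv, div_le_one (hs0 ω)]
      exact le_max_right _ _
    rw [hζs]
    conv_lhs => rw [← h3]
    rw [← Finset.sum_sub_distrib]
    calc _ ≤ ∑ i, χ i ω * (s ω)⁻¹ * δ := norm_sum_le_of_le _ fun i _ => by
          have h7 : 0 ≤ χ i ω * (s ω)⁻¹ := mul_nonneg (hχ0 i ω) (inv_nonneg.2 (hs0 ω).le)
          rw [← smul_sub, norm_smul, Complex.norm_real, Real.norm_of_nonneg h7]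
          by_cases h : χ i ω = 0
          · simp [h]
          · exact mul_le_mul_of_nonneg_left (hχU i (subset_tsupport _ h)).1.2.le h7
      _ ≤ δ := by
        rw [← Finset.sum_mul]
        exact mul_le_of_le_one_left hδ.le h6

/-- The left action extends to the full crossed product. -/
theorem exists_leftHom {M : Type*} [NormedAddCommGroup M] [NormedSpace ℂ M] [CompleteSpace M]
    [HilbertModule γ.Crossed M] {j : ccSub E W.right.continuous_anchor →ₗ[ℂ] M}
    (hj : DenseRange j) (hip : ∀ ξ η, (ip (j ξ) (j η) : γ.Crossed) =
      (RightAction.modPre ε W.proper W.etale).ip ξ η) :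
    ∃ Φ : IndCrossed W β →⋆ₙₐ[ℂ] AdjOp γ.Crossed M, ∀ b ξ,
      (Φ (indι W β b)).1 (j ξ) = j (leftRep W φ ⟨b.1, b.2⟩ ξ) := by
  exact PreHilbert.IsRep.exists_hom (isRep_leftRep φ) isStarAction_indAct hj hip

/-- The correspondence defined by an action by adjointable operators. -/
def AdjOp.correspondence {P Q M : Type*} [NonUnitalCStarAlgebra P] [NonUnitalCStarAlgebra Q]
    [NormedAddCommGroup M] [NormedSpace ℂ M] [CompleteSpace M] [HilbertModule Q M]
    (Φ : P →⋆ₙₐ[ℂ] AdjOp Q M) (h : Dense (Submodule.span ℂ {k : M | ∃ p m, (Φ p).1 m = k} : Set M)) :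
    CStarCorrespondence P Q M where
  toHom := (AdjOp.toCLM (Q := Q) (M := M) : AdjOp Q M →ₙₐ[ℂ] M →L[ℂ] M).comp
    (Φ : P →ₙₐ[ℂ] AdjOp Q M)
  adjoint p m n := by
    refine ((Φ p).ip_left m n).trans ?_
    rw [← StarHomClass.map_star]
    rfl
  nondegenerate := h

/-- Elements of `Γ_c` are uniform limits of sums of products supported in one compact set, and by
`norm_completion_le` such limits are limits in `M`. -/
theorem dense_leftHom {M : Type*} [NormedAddCommGroup M] [NormedSpace ℂ M] [CompleteSpace M]
    [HilbertModule γ.Crossed M] {j : ccSub E W.right.continuous_anchor →ₗ[ℂ] M}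
    (hj : DenseRange j) (hip : ∀ ξ η, (ip (j ξ) (j η) : γ.Crossed) =
      (RightAction.modPre ε W.proper W.etale).ip ξ η)
    {Φ : IndCrossed W β →⋆ₙₐ[ℂ] AdjOp γ.Crossed M} (hΦ : ∀ b ξ,
      (Φ (indι W β b)).1 (j ξ) = j (leftRep W φ ⟨b.1, b.2⟩ ξ)) :
    Dense (Submodule.span ℂ {k : M | ∃ p m, (Φ p).1 m = k} : Set M) := by
  have := W.locallyCompactSpace
  have h1 : leftSpan W φ ≤ (Submodule.span ℂ {k : M | ∃ p m, (Φ p).1 m = k}).comap j := by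
    refine Submodule.span_le.2 ?_
    rintro _ ⟨b, η, rfl⟩
    exact Submodule.subset_span ⟨_, _, hΦ ⟨b.1, b.2⟩ η⟩
  have h2 : Set.range j ⊆ closure (Submodule.span ℂ {k : M | ∃ p m, (Φ p).1 m = k} : Set M) := by
    rintro _ ⟨ξ, rfl⟩
    obtain ⟨K, hK, hξK⟩ := exists_compact_superset ξ.2.2
    obtain ⟨c, hc, hcb⟩ := RightAction.norm_completion_le W.proper W.etale hip hK
    refine Metric.mem_closure_iff.2 fun r hr => ?_
    have hδ : 0 < r / (c + 1) := by positivity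
    obtain ⟨ζ, hζ, h0, hζξ⟩ := exists_mem_leftSpan φ ξ.2 hξK hδ
    refine ⟨j ζ, h1 hζ, ?_⟩
    rw [dist_comm, dist_eq_norm, ← _root_.map_sub]
    refine (hcb (ζ - ξ) _ hδ.le (fun z hz => ?_) hζξ).trans_lt ?_
    · have h3 : ξ.1 z = 0 := IsCc.eq_zero fun h => hz (interior_subset (hξK h))
      change ζ.1 z - ξ.1 z = 0
      rw [h0 z hz, h3, sub_zero]
    · rw [← mul_div_assoc, div_lt_iff₀ (by positivity)]
      nlinarith
  exact dense_iff_closure_eq.2 (Set.eq_univ_of_univ_subset (hj.closure_eq.ge.trans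
    (closure_minimal h2 isClosed_closure)))

end LeftHom

/-! ### Norms of adjointable operators -/

section Operators

variable {P Q M : Type*} [NonUnitalCStarAlgebra P] [NonUnitalCStarAlgebra Q]
  [NormedAddCommGroup M] [NormedSpace ℂ M] [CompleteSpace M] [HilbertModule Q M]

theorem AdjOp.sum_apply {ι : Type*} (s : Finset ι) (T : ι → AdjOp Q M) (m : M) :
    (∑ i ∈ s, T i).1 m = ∑ i ∈ s, (T i).1 m := by
  have h := map_sum (AdjOp.toCLM (Q := Q) (M := M)) T s
  exact (congrArg (fun S : M →L[ℂ] M => S m) h).trans (_root_.sum_apply _ _ _)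

/-- The structure map of a correspondence. -/
def CStarCorrespondence.adjHom (F : CStarCorrespondence P Q M) : P →⋆ₙₐ[ℂ] AdjOp Q M where
  toFun p := AdjOp.mk (F.toHom p) (F.toHom (star p)) (F.adjoint p)
  map_smul' c p := Subtype.ext (map_smul F.toHom c p)
  map_zero' := Subtype.ext (map_zero F.toHom)
  map_add' p q := Subtype.ext (map_add F.toHom p q)
  map_mul' p q := Subtype.ext (map_mul F.toHom p q)
  map_star' p := (AdjOp.star_eq_of fun m n => F.adjoint p m n).symm

theorem CStarCorrespondence.norm_toHom_le (F : CStarCorrespondence P Q M) (p : P) (m : M) :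
    ‖F.toHom p m‖ ≤ ‖p‖ * ‖m‖ := by
  refine ((F.adjHom p).norm_apply_le m).trans ?_
  gcongr
  exact NonUnitalStarAlgHom.norm_apply_le F.adjHom p

theorem le_one_of_forall_pow_le {x c : ℝ} (h : ∀ k : ℕ, x ^ 2 ^ k ≤ c) : x ≤ 1 := by
  by_contra! hx
  obtain ⟨n, hn⟩ := ((tendsto_pow_atTop_atTop_of_one_lt hx).eventually_gt_atTop c).exists
  exact absurd ((pow_le_pow_right₀ hx.le Nat.lt_two_pow_self.le).trans (h n)) hn.not_ge

/-- A bound for an operator from the growth of the powers of its absolute value on a vector. -/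
theorem AdjOp.norm_apply_sq_le {T : AdjOp Q M} {m : M} {r c : ℝ} (hr : 0 < r)
    (h : ∀ n, ‖((star T * T) ^ n).1 m‖ ≤ c * r ^ n) : ‖T.1 m‖ ^ 2 ≤ r * ‖m‖ ^ 2 := by
  rcases eq_or_ne m 0 with rfl | hm
  · simp
  have hm0 : 0 < ‖m‖ := norm_pos_iff.2 hm
  set R := star T * T with hR
  have hsa : IsSelfAdjoint R := IsSelfAdjoint.star_mul_self T
  let x : ℕ → ℝ := fun n => ‖(R ^ n).1 m‖ / ‖m‖
  -- Cauchy–Schwarz, for the self-adjoint `Rⁿ`. Iterated, it gives `x 1 ^ 2ᵏ ≤ x (2ᵏ)`, which is at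
  -- most a constant times `r ^ 2ᵏ`; the constant disappears on taking roots, so `x 1 ≤ r`.
  have hx : ∀ n, x n ^ 2 ≤ x (2 * n) := fun n => by
    have h1 : ‖(R ^ n).1 m‖ ^ 2 ≤ ‖m‖ * ‖(R ^ (2 * n)).1 m‖ := by
      rw [HilbertModule.norm_sq (Q := Q), AdjOp.ip_left, (hsa.pow n).star_eq]
      refine (HilbertModule.norm_ip_le _ _).trans_eq ?_
      rw [two_mul, pow_add]
      rfl
    simp only [x]
    rw [div_pow, div_le_div_iff₀ (by positivity) hm0]
    nlinarith
  have hxk : ∀ k : ℕ, x 1 ^ 2 ^ k ≤ x (2 ^ k) := fun k => by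
    induction k with
    | zero => simp
    | succ k ih =>
      rw [pow_succ 2 k, pow_mul, mul_comm (2 ^ k) 2]
      exact (pow_le_pow_left₀ (by positivity) ih 2).trans (hx _)
  have h1 : x 1 / r ≤ 1 := le_one_of_forall_pow_le (c := c / ‖m‖) fun k => by
    rw [div_pow, div_le_iff₀ (by positivity), div_mul_eq_mul_div]
    refine (hxk k).trans ?_
    simp only [x]
    gcongr
    exact h _
  rw [div_le_one hr] at h1
  have h2 : ‖R.1 m‖ ≤ r * ‖m‖ := by
    have h3 := (div_le_iff₀ hm0).1 h1
    rwa [pow_one] at h3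
  rw [HilbertModule.norm_sq (Q := Q), AdjOp.ip_left]
  refine (HilbertModule.norm_ip_le m (R.1 m)).trans ?_
  nlinarith

variable (Q M) in
/-- The compact operators on a Hilbert module. -/
def compactOp : Submodule ℂ (M →L[ℂ] M) :=
  (Submodule.span ℂ {T : M →L[ℂ] M | ∃ m n, ∀ k, T k = ract m (ip n k : Q)}).topologicalClosure

theorem rankOne_mem_compactOp (m n : M) : (AdjOp.rankOne m n : AdjOp Q M).1 ∈ compactOp Q M :=
  Submodule.le_topologicalClosure _ (Submodule.subset_span ⟨m, n, fun _ => rfl⟩)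

/-- The product of `S` with the rank one operator of `m` and `n` is that of `S m` and `n`. -/
theorem mul_mem_compactOp (S : AdjOp Q M) {T : M →L[ℂ] M} (hT : T ∈ compactOp Q M) :
    S.1 * T ∈ compactOp Q M := by
  let f : (M →L[ℂ] M) →L[ℂ] (M →L[ℂ] M) := ContinuousLinearMap.mul ℂ (M →L[ℂ] M) S.1
  refine map_mem_closure f.continuous hT fun T hT => ?_
  refine Submodule.span_induction (p := fun T _ => f T ∈ Submodule.span ℂ
    {T : M →L[ℂ] M | ∃ m n, ∀ k, T k = ract m (ip n k : Q)}) ?_ ?_ ?_ ?_ hT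
  · rintro T ⟨m, n, h⟩
    refine Submodule.subset_span ⟨S.1 m, n, fun k => ?_⟩
    change S.1 (T k) = _
    rw [h, AdjOp.apply_ract]
  · rw [map_zero]
    exact zero_mem _
  · rintro T T' - - h h'
    rw [map_add]
    exact add_mem h h'
  · rintro c T - h
    rw [map_smul]
    exact Submodule.smul_mem _ c h

end Operators

/-! ### Properness of an equivariant correspondence on the fibres. -/

section Sections

variable {Y : Type*} [TopologicalSpace Y] [T2Space Y] [LocallyCompactSpace Y]

/-- By upper semicontinuity a section through `w` has norm less than `‖w‖ + δ` near `y`; cut it off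
there. -/
theorem BanachBundle.exists_isC0_norm_le {E : Y → Type*} [∀ y, NormedAddCommGroup (E y)]
    [∀ y, NormedSpace ℂ (E y)] [∀ y, CompleteSpace (E y)] [TopologicalSpace (Tot E)]
    [BanachBundle E] (y : Y) (w : E y) {δ : ℝ} (hδ : 0 < δ) :
    ∃ v : ∀ y, E y, IsC0 v ∧ v y = w ∧ ∀ x, ‖v x‖ ≤ ‖w‖ + δ := by
  obtain ⟨ξ, hξ, rfl⟩ := BanachBundle.exists_isCc y w
  have hU := hξ.1.isOpen_norm_lt (‖ξ y‖ + δ)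
  obtain ⟨χ, h1, h2, h3, h4⟩ := exists_continuous_one_zero_of_isCompact
    (isCompact_singleton (x := y)) hU.isClosed_compl (Set.disjoint_compl_right_iff_subset.2
      (Set.singleton_subset_iff.2 (lt_add_of_pos_right _ hδ)))
  have hv := hξ.1.isCc_smul χ.continuous h3
  refine ⟨fun x => (χ x : ℂ) • ξ x, ⟨hv.1, fun r hr => ⟨_, hv.2, fun x hx => ?_⟩⟩, ?_, fun x => ?_⟩
  · exact (congrArg norm (IsCc.eq_zero hx)).trans_lt (norm_zero.trans_lt hr)
  · beta_reduce
    rw [show χ y = 1 from h1 rfl, Complex.ofReal_one, one_smul]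
  · rw [norm_smul, Complex.norm_real, Real.norm_of_nonneg (h4 x).1]
    by_cases h : ‖ξ x‖ < ‖ξ y‖ + δ
    · exact (mul_le_of_le_one_left (norm_nonneg _) (h4 x).2).trans h.le
    · rw [show χ x = 0 from h2 h, zero_mul]
      positivity

/-- Properness of an equivariant correspondence, on the fibres. -/
theorem EquivariantCorrespondence.IsProper.exists_norm_le {H : Type*} [TopologicalSpace H]
    {ℋ : EtaleGroupoid H Y} {B C E : Y → Type*} [∀ y, NonUnitalCStarAlgebra (B y)]
    [TopologicalSpace (Tot B)] [∀ y, NonUnitalCStarAlgebra (C y)] [TopologicalSpace (Tot C)]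
    [∀ y, NormedAddCommGroup (E y)] [∀ y, NormedSpace ℂ (E y)] [∀ y, CompleteSpace (E y)]
    [TopologicalSpace (Tot E)] [∀ y, HilbertModule (C y) (E y)] [CStarBundle C] [HilbertBundle C E]
    {β : CStarAction ℋ B} {γ : CStarAction ℋ C} {ε : HilbertAction γ E}
    {φ : EquivariantCorrespondence β ε} (hφ : φ.IsProper) {b : ∀ y, B y} (hb : IsC0 b) {δ : ℝ}
    (hδ : 0 < δ) : ∃ (n : ℕ) (e f : Fin n → ∀ y, E y), (∀ i, IsC0 (e i)) ∧ (∀ i, IsC0 (f i)) ∧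
      ∀ y, ‖(φ.fibre y).adjHom (b y) - ∑ i, (AdjOp.rankOne (e i y) (f i y) : AdjOp (C y) (E y))‖
        ≤ δ := by
  obtain ⟨n, e, f, he, hf, h⟩ := hφ b hb δ hδ
  refine ⟨n, e, f, he, hf, fun y => ContinuousLinearMap.opNorm_le_bound _ hδ.le fun w => ?_⟩
  -- Properness is stated for sections with a global bound. A section through `w` bounded by `‖w‖ +
  -- r / δ` costs an error of `r` in the estimate.
  refine le_of_forall_pos_le_add fun r hr => ?_
  obtain ⟨v, hv, rfl, hvb⟩ := BanachBundle.exists_isC0_norm_le y w (div_pos hr hδ)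
  have h1 := h v hv _ hvb y
  rw [mul_add, mul_div_cancel₀ _ hδ.ne'] at h1
  refine le_trans (le_of_eq ?_) h1
  change ‖(φ.fibre y).toHom (b y) (v y) - (∑ i, (AdjOp.rankOne (e i y) (f i y) :
    AdjOp (C y) (E y))).1 (v y)‖ = _
  rw [AdjOp.sum_apply]
  rfl

end Sections

/-! ### Properness -/

namespace RightAction

variable {H Y Z : Type*} [TopologicalSpace H] [TopologicalSpace Y] [TopologicalSpace Z]
  {ℋ : EtaleGroupoid H Y} {R : RightAction ℋ Z}
  {B : Y → Type*} [∀ y, NonUnitalCStarAlgebra (B y)] [TopologicalSpace (Tot B)] [CStarBundle B]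
  {C : Y → Type*} [∀ y, NonUnitalCStarAlgebra (C y)] [TopologicalSpace (Tot C)]
  {E : Y → Type*} [∀ y, NormedAddCommGroup (E y)] [∀ y, NormedSpace ℂ (E y)]
  [∀ y, CompleteSpace (E y)] [TopologicalSpace (Tot E)] [∀ y, HilbertModule (C y) (E y)]
  {β : CStarAction ℋ B} {γ : CStarAction ℋ C} {ε : HilbertAction γ E}
  [T2Space Y] [T2Space H] [T2Space Z] [LocallyCompactSpace Y]
  [CStarBundle C] [HilbertBundle C E]

/-- The product of a section with the square root of a cutoff function. -/
def sqrtSec (R : RightAction ℋ Z) (f : Z → ℝ) (e : ∀ y, E y) (z : Z) : E (R.anchor z) :=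
  ((Real.sqrt (f z) : ℝ) : ℂ) • e (R.anchor z)

theorem isCc_sqrtSec [BanachBundle E] {f : Z → ℝ} (hf : Continuous f) (hfc : HasCompactSupport f) {e : ∀ y, E y}
    (he : IsContSec (fun y : Y => y) e) : IsCc R.anchor (R.sqrtSec f e) :=
  (IsContSec.comp he R.continuous_anchor).isCc_smul (Real.continuous_sqrt.comp hf)
    (hfc.comp_left Real.sqrt_zero)

/-- A sum of operators of rank one that is close to an equivariant family of operators on the
fibres. -/
theorem norm_sum_rightSec_innerSec_sub_le [LocallyCompactSpace Z] (φ : EquivariantCorrespondence β ε) (hRp : R.IsProper)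
    {n : ℕ} {f : Fin n → Z → ℝ} (hfc : ∀ i, HasCompactSupport (f i)) (hf0 : ∀ i z, 0 ≤ f i z)
    (hf1 : ∀ z, ∑ i, R.orbSum (f i) z ≤ 1) {V : Fin n → Set Z} (hfV : ∀ i, tsupport (f i) ⊆ V i)
    (hV : ∀ i, (V i).InjOn R.anchor) {m : Fin n → ℕ} (e e' : ∀ i, Fin (m i) → ∀ y, E y)
    {a : ∀ z, B (R.anchor z)} (ha : ∀ z h (hz : ℋ.rng h = R.anchor z),
      β.act h (R.anchor_smul hz).symm hz (a (R.smul z h)) = a z) {r : ℝ}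
    (hae : ∀ i, ∀ z ∈ tsupport (f i), ‖(φ.fibre _).adjHom (a z) - ∑ j, (AdjOp.rankOne
      (e i j (R.anchor z)) (e' i j (R.anchor z)) : AdjOp (C (R.anchor z)) (E (R.anchor z)))‖ ≤ r)
    (har : ∀ z, ∑ i, R.orbSum (f i) z = 1 ∨ ‖a z‖ ≤ r) (ξ : ∀ z, E (R.anchor z)) (z : Z) :
    ‖∑ i, ∑ j, R.rightSec ε (R.sqrtSec (f i) (e i j))
      (R.innerSec ε (R.sqrtSec (f i) (e' i j)) ξ) z - (φ.fibre _).toHom (a z) (ξ z)‖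
        ≤ r * ‖ξ z‖ := by
  have := ℋ.locallyCompactSpace
  let T : Fin n → {h : H // ℋ.rng h = R.anchor z} → E (R.anchor z) := fun i h =>
    ∑ j, ract (ε.act h.1 (R.anchor_smul h.2).symm h.2 (e i j (R.anchor (R.smul z h.1))))
      (ip (ε.act h.1 (R.anchor_smul h.2).symm h.2 (e' i j (R.anchor (R.smul z h.1)))) (ξ z) :
        C (R.anchor z))
  have hsec : ∀ i, ∀ e : ∀ y, E y, ∀ z ∉ V i, R.sqrtSec (f i) e z = 0 := fun i e z hz => by
    have : f i z = 0 := image_eq_zero_of_notMem_tsupport fun h => hz (hfV i h)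
    simp only [sqrtSec, this, Real.sqrt_zero, Complex.ofReal_zero, zero_smul]
  have hsum : ∑ i, ∑ j, R.rightSec ε (R.sqrtSec (f i) (e i j))
      (R.innerSec ε (R.sqrtSec (f i) (e' i j)) ξ) z =
      ∑ i, ∑ᶠ h : {h : H // ℋ.rng h = R.anchor z}, (f i (R.smul z h.1) : ℂ) • T i h := by
    refine Finset.sum_congr rfl fun i _ => ?_
    have h1 : ∀ j (h : {h : H // ℋ.rng h = R.anchor z}),
        ract (ε.act h.1 (R.anchor_smul h.2).symm h.2 (R.sqrtSec (f i) (e i j) (R.smul z h.1)))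
          (ip (ε.act h.1 (R.anchor_smul h.2).symm h.2 (R.sqrtSec (f i) (e' i j) (R.smul z h.1)))
            (ξ z) : C (R.anchor z)) = (f i (R.smul z h.1) : ℂ) •
        ract (ε.act h.1 (R.anchor_smul h.2).symm h.2 (e i j (R.anchor (R.smul z h.1))))
          (ip (ε.act h.1 (R.anchor_smul h.2).symm h.2 (e' i j (R.anchor (R.smul z h.1))))
            (ξ z) : C (R.anchor z)) := fun j h => by
      simp only [sqrtSec, map_smul]
      rw [HilbertModule.smul_ip, HilbertModule.ract_smul, HilbertModule.smul_ract, smul_smul,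
        Complex.conj_ofReal, ← Complex.ofReal_mul, Real.mul_self_sqrt (hf0 _ _)]
    simp only [T, Finset.smul_sum]
    rw [finsum_sum_comm]
    · refine Finset.sum_congr rfl fun j _ => ?_
      rw [rightSec_innerSec (hV i) (hsec i _) (hsec i _)]
      exact finsum_congr (h1 j)
    · refine fun j _ => (finite_support_orbSum hRp (hfc i) z).subset fun h hh h0 => hh ?_
      simp only [h0, Complex.ofReal_zero, zero_smul]
  rw [hsum]
  refine norm_orbit_sum_sub_le hRp hfc hf0 (hf1 z) T ((har z).imp_right fun h =>
    ((φ.fibre _).norm_toHom_le _ _).trans (by gcongr)) fun i h hne => ?_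
  -- Moving `ξ(z)` to the fibre at `z h` makes the estimate there for `a` applicable; equivariance
  -- of `a` brings the result back to `z`.
  obtain ⟨w, hw⟩ : ∃ w, ε.act h.1 (R.anchor_smul h.2).symm h.2 w = ξ z :=
    (ε.act h.1 (R.anchor_smul h.2).symm h.2).surjective _
  have h3 := (((φ.fibre _).adjHom (a (R.smul z h.1)) - ∑ j, (AdjOp.rankOne
      (e i j (R.anchor (R.smul z h.1))) (e' i j (R.anchor (R.smul z h.1))) :
        AdjOp (C (R.anchor (R.smul z h.1))) (E (R.anchor (R.smul z h.1))))).norm_apply_le w).trans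
    (mul_le_mul_of_nonneg_right (hae i _ (subset_tsupport _ hne)) (norm_nonneg w))
  rw [norm_sub_rev, ← ha z h.1 h.2, ← hw, LinearIsometryEquiv.norm_map]
  refine le_trans (le_of_eq ?_) h3
  rw [← LinearIsometryEquiv.norm_map (ε.act h.1 (R.anchor_smul h.2).symm h.2)]
  refine congrArg norm ?_
  change _ = ε.act h.1 (R.anchor_smul h.2).symm h.2 ((φ.fibre _).toHom (a (R.smul z h.1)) w -
    (∑ j, (AdjOp.rankOne (e i j (R.anchor (R.smul z h.1))) (e' i j (R.anchor (R.smul z h.1))) :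
        AdjOp (C (R.anchor (R.smul z h.1))) (E (R.anchor (R.smul z h.1))))).1 w)
  rw [AdjOp.sum_apply, map_sub, map_sum, φ.map_toHom]
  refine congrArg₂ _ rfl (Finset.sum_congr rfl fun j _ => ?_)
  rw [AdjOp.rankOne_apply, HilbertAction.map_ract, HilbertAction.map_ip (ε := ε), hw]

variable {M : Type*} [NormedAddCommGroup M] [NormedSpace ℂ M] [CompleteSpace M]
  [HilbertModule γ.Crossed M] {j : ccSub E R.continuous_anchor →ₗ[ℂ] M}

/-- An operator on the completion is bounded by a bound on the fibres. -/
theorem norm_le_of_pointwise {hRp : R.IsProper} {hRe : R.IsEtale} (hj : DenseRange j)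
    (hip : ∀ ξ η, (ip (j ξ) (j η) : γ.Crossed) = (modPre ε hRp hRe).ip ξ η)
    {T : AdjOp γ.Crossed M} {r : ℝ} (hr : 0 < r)
    (hT : ∀ ξ, ∃ ζ, T.1 (j ξ) = j ζ ∧ ∀ z, ‖ζ.1 z‖ ≤ r * ‖ξ.1 z‖)
    (hT' : ∀ ξ, ∃ ζ, (star T).1 (j ξ) = j ζ ∧ ∀ z, ‖ζ.1 z‖ ≤ r * ‖ξ.1 z‖) : ‖T‖ ≤ r := by
  refine T.1.opNorm_le_bound hr.le fun m => ?_
  refine hj.induction_on (p := fun m => ‖T.1 m‖ ≤ r * ‖m‖) m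
    (isClosed_le (by fun_prop) (by fun_prop)) fun ξ => ?_
  -- The norm of the module is not a pointwise one, so the bound cannot be applied directly. But
  -- `(T⋆T)ⁿ ξ` vanishes wherever `ξ` does and is bounded by `r²ⁿ` times a bound of `ξ`. On that
  -- fixed support the module norm is controlled with a constant that does not depend on `n`, and
  -- `AdjOp.norm_apply_sq_le` removes it.
  have h1 : ∀ n : ℕ, ∃ ζ : ccSub E R.continuous_anchor, ((star T * T) ^ n).1 (j ξ) = j ζ ∧
      ∀ z, ‖ζ.1 z‖ ≤ (r ^ 2) ^ n * ‖ξ.1 z‖ := fun n => by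
    induction n with
    | zero => exact ⟨ξ, rfl, fun z => by simp⟩
    | succ n ih =>
      obtain ⟨ζ, h, hζ⟩ := ih
      obtain ⟨ζ', h', hζ'⟩ := hT ζ
      obtain ⟨ζ'', h'', hζ''⟩ := hT' ζ'
      refine ⟨ζ'', ?_, fun z => ?_⟩
      · rw [pow_succ']
        change (star T).1 (T.1 (((star T * T) ^ n).1 (j ξ))) = _
        rw [h, h', h'']
      · calc _ ≤ r * (r * ((r ^ 2) ^ n * ‖ξ.1 z‖)) := by
              refine (hζ'' z).trans ?_
              gcongr
              refine (hζ' z).trans ?_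
              gcongr
              exact hζ z
          _ = _ := by ring
  obtain ⟨c, hc, hcb⟩ := norm_completion_le hRp hRe hip ξ.2.2
  obtain ⟨b, hb, hbξ⟩ := ξ.2.exists_bound
  have h2 := AdjOp.norm_apply_sq_le (T := T) (m := j ξ) (pow_pos hr 2) (c := c * b) fun n => by
    obtain ⟨ζ, h, hζ⟩ := h1 n
    rw [h]
    refine (hcb ζ ((r ^ 2) ^ n * b) (by positivity) (fun z hz => ?_) fun z => ?_).trans_eq (by ring)
    · have h3 := hζ z
      rw [IsCc.eq_zero hz, norm_zero, mul_zero] at h3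
      exact norm_le_zero_iff.1 h3
    · refine (hζ z).trans ?_
      gcongr
      exact hbξ z
  rw [← mul_pow] at h2
  exact le_of_sq_le_sq h2 (by positivity)

end RightAction

/-! ### Compactness of equivariant families of operators. -/

namespace RightAction

variable {H Y Z : Type*} [TopologicalSpace H] [TopologicalSpace Y] [TopologicalSpace Z]
  {ℋ : EtaleGroupoid H Y} {R : RightAction ℋ Z}
  {B : Y → Type*} [∀ y, NonUnitalCStarAlgebra (B y)] [TopologicalSpace (Tot B)] [CStarBundle B]
  {C : Y → Type*} [∀ y, NonUnitalCStarAlgebra (C y)] [TopologicalSpace (Tot C)]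
  {E : Y → Type*} [∀ y, NormedAddCommGroup (E y)] [∀ y, NormedSpace ℂ (E y)]
  [∀ y, CompleteSpace (E y)] [TopologicalSpace (Tot E)] [∀ y, HilbertModule (C y) (E y)]
  {β : CStarAction ℋ B} {γ : CStarAction ℋ C} {ε : HilbertAction γ E}
  [T2Space Y] [T2Space H] [T2Space Z] [LocallyCompactSpace Y]
  [CStarBundle C] [HilbertBundle C E]
  {M : Type*} [NormedAddCommGroup M] [NormedSpace ℂ M] [CompleteSpace M]
  [HilbertModule γ.Crossed M] {j : ccSub E R.continuous_anchor →ₗ[ℂ] M}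

/-- A sum of operators of rank one on the completion. -/
theorem exists_sum_rankOne_apply {hRp : R.IsProper} {hRe : R.IsEtale} (hj : DenseRange j)
    (hip : ∀ ξ η, (ip (j ξ) (j η) : γ.Crossed) = (modPre ε hRp hRe).ip ξ η)
    {n : ℕ} {m : Fin n → ℕ} (ζ ζ' : ∀ i, Fin (m i) → ccSub E R.continuous_anchor)
    (ξ : ccSub E R.continuous_anchor) :
    ∃ η, (∑ i, ∑ k, (AdjOp.rankOne (j (ζ i k)) (j (ζ' i k)) : AdjOp γ.Crossed M)).1 (j ξ) = j η ∧
      ∀ z, η.1 z = ∑ i, ∑ k, R.rightSec ε (ζ i k).1 (R.innerSec ε (ζ' i k).1 ξ.1) z := by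
  have h1 : ∀ i k, (AdjOp.rankOne (j (ζ i k)) (j (ζ' i k)) : AdjOp γ.Crossed M).1 (j ξ) =
      j ⟨_, isCc_rightSec (ε := ε) hRe (ζ i k).2 (isCc_innerSec (ε := ε) hRp hRe (ζ' i k).2 ξ.2)⟩ := fun i k => by
    rw [AdjOp.rankOne_apply, hip]
    exact ract_ι hj hip (ζ i k) ⟨_, isCc_innerSec (ε := ε) hRp hRe (ζ' i k).2 ξ.2⟩
  refine ⟨∑ i, ∑ k, ⟨_, isCc_rightSec (ε := ε) hRe (ζ i k).2 (isCc_innerSec (ε := ε) hRp hRe (ζ' i k).2 ξ.2)⟩,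
    ?_, fun z => ?_⟩
  · simp only [AdjOp.sum_apply, h1, _root_.map_sum]
  · simp only [Submodule.coe_sum, Finset.sum_apply]

/-- The operator defined by an equivariant family of operators on the fibres, if these come from an
equivariant section that vanishes at infinity on the space of orbits, is compact. -/
theorem mem_compactOp [LocallyCompactSpace Z] {φ : EquivariantCorrespondence β ε} (hφ : φ.IsProper)
    {hRp : R.IsProper} {hRe : R.IsEtale} (hj : DenseRange j)
    (hip : ∀ ξ η, (ip (j ξ) (j η) : γ.Crossed) = (modPre ε hRp hRe).ip ξ η)
    {a : ∀ z, B (R.anchor z)} (hac : IsContSec R.anchor a)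
    (ha : ∀ z h (hz : ℋ.rng h = R.anchor z),
      β.act h (R.anchor_smul hz).symm hz (a (R.smul z h)) = a z)
    (haL : ∀ r > 0, ∃ L : Set Z, IsCompact L ∧
      ∀ z, r ≤ ‖a z‖ → ∃ h, ℋ.rng h = R.anchor z ∧ R.smul z h ∈ L)
    {T : AdjOp γ.Crossed M}
    (hT : ∀ ξ, ∃ ζ, T.1 (j ξ) = j ζ ∧ ∀ z, ζ.1 z = (φ.fibre _).toHom (a z) (ξ.1 z))
    (hT' : ∀ ξ, ∃ ζ, (star T).1 (j ξ) = j ζ ∧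
      ∀ z, ζ.1 z = (φ.fibre _).toHom (star (a z)) (ξ.1 z)) : T.1 ∈ compactOp γ.Crossed M := by
  have := ℋ.locallyCompactSpace
  have hE : BanachBundle E := HilbertBundle.toBanachBundle C
  suffices h : ∀ r > 0, ∃ S : AdjOp γ.Crossed M, S.1 ∈ compactOp γ.Crossed M ∧ ‖T - S‖ ≤ r by
    refine (Submodule.isClosed_topologicalClosure _).closure_subset
      (Metric.mem_closure_iff.2 fun r hr => ?_)
    obtain ⟨S, hS, hTS⟩ := h (r / 2) (half_pos hr)
    exact ⟨S.1, hS, (dist_eq_norm _ _).trans_lt (lt_of_le_of_lt hTS (half_lt_self hr))⟩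
  intro r hr
  -- Near `z`, the section `a` is within `r / 2` of a section `b z` of the bundle over `Y`, which by
  -- properness acts on every fibre within `r / 2` of a sum of rank one operators.
  choose b hb hbt using fun z => BanachBundle.exists_section (R.anchor z) (a z)
  choose m e e' he he' hee using fun z => hφ.exists_norm_le (hb z) (half_pos hr)
  choose U hU hUi using (IsLocalHomeomorph.isEtaleMap hRe).exists_injOn
  obtain ⟨L, hL, hLa⟩ := haL r hr
  obtain ⟨n, t, f, -, hf, hfc, hft, hf0, hf1, hfL⟩ := exists_orbit_partition hRp hL
    (fun z => U z ∩ {w | ‖a w - b z (R.anchor w)‖ < r / 2}) fun z _ => by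
      refine inter_mem (hU z) (IsOpen.mem_nhds
        ((hac.sub (IsContSec.comp (hb z).1 R.continuous_anchor)).isOpen_norm_lt _) ?_)
      change ‖a z - b z (R.anchor z)‖ < r / 2
      rw [hbt, sub_self, norm_zero]
      exact half_pos hr
  have hae : ∀ i, ∀ z ∈ tsupport (f i), ‖(φ.fibre _).adjHom (a z) - ∑ k, (AdjOp.rankOne
      (e (t i) k (R.anchor z)) (e' (t i) k (R.anchor z)) :
        AdjOp (C (R.anchor z)) (E (R.anchor z)))‖ ≤ r := fun i z hz => by
    have h1 := hee (t i) (R.anchor z)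
    have h2 := (NonUnitalStarAlgHom.norm_apply_le (φ.fibre _).adjHom
      (a z - b (t i) (R.anchor z))).trans (le_of_lt (hft i hz).2)
    rw [_root_.map_sub] at h2
    have h3 := norm_add_le_of_le h2 h1
    rwa [sub_add_sub_cancel, add_halves] at h3
  -- The norm estimate `norm_le_of_pointwise` needs pointwise bounds for the adjoint as well. These
  -- come from taking adjoints on the fibres, which exchanges `e` and `e'`.
  have hae' : ∀ i, ∀ z ∈ tsupport (f i), ‖(φ.fibre _).adjHom (star (a z)) - ∑ k, (AdjOp.rankOne
      (e' (t i) k (R.anchor z)) (e (t i) k (R.anchor z)) :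
        AdjOp (C (R.anchor z)) (E (R.anchor z)))‖ ≤ r := fun i z hz => by
    have h1 := hae i z hz
    rw [← norm_star, star_sub, star_sum, ← StarHomClass.map_star] at h1
    simpa only [AdjOp.star_rankOne] using h1
  have har : ∀ z, ∑ i, R.orbSum (f i) z = 1 ∨ ‖a z‖ ≤ r := fun z => by
    rcases le_or_gt ‖a z‖ r with h | h
    · exact Or.inr h
    · obtain ⟨k, hk, hkL⟩ := hLa z h.le
      have h1 := hfL _ hkL
      simp only [orbSum_smul (hz := hk)] at h1
      exact Or.inl h1
  let ζ : ∀ i, Fin (m (t i)) → ccSub E R.continuous_anchor := fun i k =>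
    ⟨R.sqrtSec (f i) (e (t i) k), isCc_sqrtSec (hf i) (hfc i) (he (t i) k).1⟩
  let ζ' : ∀ i, Fin (m (t i)) → ccSub E R.continuous_anchor := fun i k =>
    ⟨R.sqrtSec (f i) (e' (t i) k), isCc_sqrtSec (hf i) (hfc i) (he' (t i) k).1⟩
  refine ⟨∑ i, ∑ k, AdjOp.rankOne (j (ζ i k)) (j (ζ' i k)), ?_, ?_⟩
  · have h1 : (∑ i, ∑ k, (AdjOp.rankOne (j (ζ i k)) (j (ζ' i k)) : AdjOp γ.Crossed M)).1 =
        ∑ i, ∑ k, (AdjOp.rankOne (j (ζ i k)) (j (ζ' i k)) : AdjOp γ.Crossed M).1 :=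
      ContinuousLinearMap.ext fun x => by
        simp only [AdjOp.sum_apply, _root_.sum_apply]
    rw [h1]
    exact Submodule.sum_mem _ fun i _ => Submodule.sum_mem _ fun k _ => rankOne_mem_compactOp _ _
  · refine norm_le_of_pointwise hj hip hr (fun ξ => ?_) fun ξ => ?_
    · obtain ⟨η, h, hη⟩ := hT ξ
      obtain ⟨θ, h', hθ⟩ := exists_sum_rankOne_apply hj hip ζ ζ' ξ
      refine ⟨η - θ, ?_, fun z => ?_⟩
      · rw [_root_.map_sub, ← h, ← h']
        rfl
      · change ‖η.1 z - θ.1 z‖ ≤ _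
        rw [norm_sub_rev, hη, hθ]
        exact norm_sum_rightSec_innerSec_sub_le φ hRp hfc hf0 hf1 (fun i => (hft i).trans
          Set.inter_subset_left) (fun i => hUi (t i)) _ _ ha hae har ξ.1 z
    · obtain ⟨η, h, hη⟩ := hT' ξ
      obtain ⟨θ, h', hθ⟩ := exists_sum_rankOne_apply hj hip ζ' ζ ξ
      refine ⟨η - θ, ?_, fun z => ?_⟩
      · rw [_root_.map_sub, ← h, ← h', star_sub, star_sum]
        simp only [star_sum, AdjOp.star_rankOne]
        rfl
      · change ‖η.1 z - θ.1 z‖ ≤ _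
        rw [norm_sub_rev, hη, hθ]
        exact norm_sum_rightSec_innerSec_sub_le φ hRp hfc hf0 hf1 (fun i => (hft i).trans
          Set.inter_subset_left) (fun i => hUi (t i)) _ _
          (fun z h hz => (StarHomClass.map_star _ _).trans (congrArg star (ha z h hz))) hae'
          (fun z => by rw [norm_star]; exact har z) ξ.1 z

end RightAction

/-! ### Reduction of compactness to sections on the units. -/

section Generic

variable {G : Type uG} {X : Type uX} [TopologicalSpace G]
  [TopologicalSpace X] {𝒢 : EtaleGroupoid G X} {A : X → Type uA} [∀ x, NonUnitalCStarAlgebra (A x)]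
  [TopologicalSpace (Tot A)] [StarBundle A]
  {act : ∀ {x y : X} (g : G), 𝒢.src g = x → 𝒢.rng g = y → A x → A y}
  [T2Space G] [T2Space X] [LocallyCompactSpace X] (ha : IsStarAction 𝒢 act)

include ha in
theorem IsStarAction.star_crossedι_unitSec {u : ∀ x, A x} (hc : IsCc 𝒢.src (unitSec 𝒢 u)) :
    ∃ hc' : IsCc 𝒢.src (unitSec 𝒢 fun x => star (u x)),
      star (crossedι 𝒢 act ⟨_, hc⟩) = crossedι 𝒢 act ⟨_, hc'⟩ := by
  have hs : adj 𝒢 act (unitSec 𝒢 u) = unitSec 𝒢 fun x => star (u x) :=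
    funext fun g => ha.adj_unitSec u g
  have hc' : IsCc 𝒢.src (unitSec 𝒢 fun x => star (u x)) := hs ▸ ha.isConvAlgebra.adj ⟨_, hc⟩
  exact ⟨hc', (ha.isStarRep_crossedι.map_star ⟨_, hc⟩ ⟨_, hc'⟩ fun g => (congrFun hs g).symm).symm⟩

include ha in
/-- A representation of the crossed product is by compact operators if this holds for the sections
supported on the unit space. -/
theorem IsStarAction.mem_compactOp {Q M : Type*} [NonUnitalCStarAlgebra Q]
    [NormedAddCommGroup M] [NormedSpace ℂ M] [CompleteSpace M] [HilbertModule Q M]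
    (Φ : CrossedProduct 𝒢 act →⋆ₙₐ[ℂ] AdjOp Q M)
    (h : ∀ (u : ∀ x, A x) (K : Set X) (hK : IsCompact K) (hu : IsContSec (fun x : X => x) u)
      (h0 : ∀ x ∉ K, u x = 0),
      (Φ (crossedι 𝒢 act ⟨unitSec 𝒢 u, isCc_unitSec 𝒢 hK hu h0⟩)).1 ∈ compactOp Q M)
    (p : CrossedProduct 𝒢 act) : (Φ p).1 ∈ compactOp Q M := by
  have hcl : IsClosed (compactOp Q M : Set (M →L[ℂ] M)) :=
    Submodule.isClosed_topologicalClosure _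
  let Ψ : CrossedProduct 𝒢 act →ₗ[ℂ] M →L[ℂ] M :=
    { toFun := fun p => (Φ p).1
      map_add' := fun p q => congrArg Subtype.val (map_add Φ p q)
      map_smul' := fun c p => congrArg Subtype.val (map_smul Φ c p) }
  have hle : ∀ q, ‖Ψ q‖ ≤ ‖q‖ := fun q => NonUnitalStarAlgHom.norm_apply_le Φ q
  refine hcl.closure_subset (Metric.mem_closure_iff.2 fun r hr => ?_)
  obtain ⟨b, hb⟩ := ha.denseRange_crossedι.exists_dist_lt p (half_pos hr)
  -- An element is close to a sum of products `c u` with `u` on the units, and compact operators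
  -- absorb adjointable ones on the left.
  obtain ⟨n, c, u, K, hK, hu, h0, hbc⟩ := ha.exists_mul_unitSec b (half_pos hr)
  refine ⟨Ψ (∑ i, crossedι 𝒢 act (c i) *
    crossedι 𝒢 act ⟨unitSec 𝒢 (u i), isCc_unitSec 𝒢 hK (hu i) (h0 i)⟩), ?_, ?_⟩
  · rw [map_sum]
    refine Submodule.sum_mem _ fun i _ => ?_
    have h2 : Ψ (crossedι 𝒢 act (c i) *
        crossedι 𝒢 act ⟨unitSec 𝒢 (u i), isCc_unitSec 𝒢 hK (hu i) (h0 i)⟩) =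
        (Φ (crossedι 𝒢 act (c i))).1 *
          (Φ (crossedι 𝒢 act ⟨unitSec 𝒢 (u i), isCc_unitSec 𝒢 hK (hu i) (h0 i)⟩)).1 :=
      congrArg Subtype.val (_root_.map_mul Φ _ _)
    rw [h2]
    exact mul_mem_compactOp _ (h _ _ hK (hu i) (h0 i))
  · change dist (Ψ p) _ < r
    rw [dist_eq_norm, ← map_sub]
    refine (hle _).trans_lt ?_
    rw [dist_eq_norm] at hb
    refine (norm_sub_le_norm_sub_add_norm_sub _ (crossedι 𝒢 act b) _).trans_lt ?_
    exact (add_lt_add hb hbc).trans_eq (add_halves r)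

end Generic

/-! ### Compactness of the left action for a proper correspondence. -/

section Proper

variable {G : Type uG} {X : Type uX} {H : Type uH} {Y : Type uY} {Ω : Type uΩ}
  [TopologicalSpace G] [TopologicalSpace X] [TopologicalSpace H] [TopologicalSpace Y]
  [TopologicalSpace Ω]
  {𝒢 : EtaleGroupoid G X} {ℋ : EtaleGroupoid H Y} {W : EtaleCorrespondence 𝒢 ℋ Ω}
  {B : Y → Type uB} [∀ y, NonUnitalCStarAlgebra (B y)] [TopologicalSpace (Tot B)]
  [CStarBundle B]
  {C : Y → Type uC} [∀ y, NonUnitalCStarAlgebra (C y)] [TopologicalSpace (Tot C)]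
  {E : Y → Type uE} [∀ y, NormedAddCommGroup (E y)] [∀ y, NormedSpace ℂ (E y)]
  [∀ y, CompleteSpace (E y)] [TopologicalSpace (Tot E)] [∀ y, HilbertModule (C y) (E y)]
  {β : CStarAction ℋ B} {γ : CStarAction ℋ C} {ε : HilbertAction γ E}
  [T2Space X] [T2Space Y] [T2Space Ω] [T2Space G] [T2Space H] [LocallyCompactSpace Y]
  [LocallyCompactSpace X]

/-- The section of `σ^* B` defined by a section of the induced bundle. -/
def indSec (u : ∀ x, IndFib W β x) (ω : Ω) : B (W.right.anchor ω) :=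
  (u (W.left.anchor ω)).1 ⟨ω, rfl⟩

theorem isContSec_indSec {u : ∀ x, IndFib W β x} (hu : IsContSec (fun x : X => x) u) :
    IsContSec W.right.anchor (indSec u) :=
  isContSec_ind_apply (IsContSec.comp hu W.left.continuous_anchor) continuous_id fun _ => rfl

theorem act_indSec (u : ∀ x, IndFib W β x) (ω : Ω) (h : H) (hh : ℋ.rng h = W.right.anchor ω) :
    β.act h (W.right.anchor_smul hh).symm hh (indSec u (W.right.smul ω h)) = indSec u ω := by
  have h1 := IndFib.tr_apply_smul (u (W.left.anchor ω)) hh rfl (W.left_anchor_smul hh) rfl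
    ((ℋ.rng_inv h).trans (W.right.anchor_smul hh).symm)
  have h2 : indSec u (W.right.smul ω h) =
      (u (W.left.anchor ω)).1 ⟨W.right.smul ω h, W.left_anchor_smul hh⟩ :=
    ind_congr u (W.left_anchor_smul hh) rfl rfl (W.left_anchor_smul hh) rfl rfl
  rw [h2]
  refine (congrArg (β.act h (W.right.anchor_smul hh).symm hh) h1).trans ?_
  refine (β.isIsoAction.act_act _ _ _ _ _ _ _).trans ?_
  have e : ℋ.mul h (ℋ.inv h) = ℋ.one (W.right.anchor ω) := by rw [ℋ.mul_inv, hh]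
  simp only [e]
  exact β.isIsoAction.act_one _ _ _

/-- Over the compact set `K`, `u` is uniformly within `r / 2` of finitely many restricted elements
of the induced algebra, each of which is small off the orbits of a compact set. -/
theorem exists_compact_indSec {u : ∀ x, IndFib W β x} (hu : IsContSec (fun x : X => x) u)
    {K : Set X} (hK : IsCompact K) (h0 : ∀ x ∉ K, u x = 0) {r : ℝ} (hr : 0 < r) :
    ∃ L : Set Ω, IsCompact L ∧ ∀ ω, r ≤ ‖indSec u ω‖ →
      ∃ h, ℋ.rng h = W.right.anchor ω ∧ W.right.smul ω h ∈ L := by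
  have := W.locallyCompactSpace
  choose η hη using fun x => exists_norm_sub_indRes_lt (u x) (half_pos hr)
  choose L hL hηL using fun x => Ind.exists_compact (η x) (half_pos hr)
  obtain ⟨s, hs, hKs⟩ := hK.elim_nhds_subcover
    (fun x => {y | ‖u y - indRes W β (η x) y‖ < r / 2}) fun x _ =>
      eventually_ind_sub_lt (hu.tendsto x) (η x) (hη x)
  refine ⟨⋃ x ∈ s, L x, s.isCompact_biUnion fun x _ => hL x, fun ω hω => ?_⟩
  by_cases hωK : W.left.anchor ω ∈ K
  · obtain ⟨x, hx, hxω⟩ := Set.mem_iUnion₂.1 (hKs hωK)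
    have h1 : ‖indSec u ω - (η x).1 ω‖ < r / 2 :=
      (Ind.norm_apply_le (u (W.left.anchor ω) - indRes W β (η x) (W.left.anchor ω))
        ⟨ω, rfl⟩).trans_lt hxω
    have h2 := norm_sub_norm_le (indSec u ω) ((η x).1 ω)
    obtain ⟨h, hh, hhL⟩ := hηL x ω (by linarith)
    exact ⟨h, hh, Set.mem_biUnion hx hhL⟩
  · have h1 : indSec u ω = 0 := by
      rw [indSec, h0 _ hωK]
      rfl
    rw [h1, norm_zero] at hω
    exact absurd hω hr.not_ge

variable [CStarBundle C] [HilbertBundle C E] {φ : EquivariantCorrespondence β ε}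
  {M : Type*} [NormedAddCommGroup M] [NormedSpace ℂ M] [CompleteSpace M]
  [HilbertModule γ.Crossed M] {j : ccSub E W.right.continuous_anchor →ₗ[ℂ] M}

/-- A section on the units acts pointwise through the equivariant section `indSec u`, and its
adjoint through the pointwise adjoint. So it falls under `RightAction.mem_compactOp`. -/
theorem leftHom_unitSec_mem_compactOp (hφ : φ.IsProper) (hj : DenseRange j)
    (hip : ∀ ξ η, (ip (j ξ) (j η) : γ.Crossed) =
      (RightAction.modPre ε W.proper W.etale).ip ξ η)
    {Φ : IndCrossed W β →⋆ₙₐ[ℂ] AdjOp γ.Crossed M} (hΦ : ∀ b ξ,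
      (Φ (indι W β b)).1 (j ξ) = j (leftRep W φ ⟨b.1, b.2⟩ ξ))
    {u : ∀ x, IndFib W β x} (hu : IsContSec (fun x : X => x) u)
    {K : Set X} (hK : IsCompact K) (h0 : ∀ x ∉ K, u x = 0) :
    (Φ (indι W β ⟨unitSec 𝒢 u, isCc_unitSec 𝒢 hK hu h0⟩)).1 ∈ compactOp γ.Crossed M := by
  have := W.locallyCompactSpace
  have hc := isCc_unitSec 𝒢 hK hu h0
  obtain ⟨hc', hs⟩ := isStarAction_indAct.star_crossedι_unitSec hc
  refine RightAction.mem_compactOp hφ hj hip (isContSec_indSec hu) (act_indSec u)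
    (fun r hr => exists_compact_indSec hu hK h0 hr) (fun ξ => ⟨_, hΦ _ ξ, fun ω => ?_⟩)
    fun ξ => ⟨leftRep W φ ⟨_, hc'⟩ ξ, ?_, fun ω => ?_⟩
  · exact leftSec_unitSec φ u ξ.1 ω
  · have h1 := (StarHomClass.map_star Φ (indι W β ⟨_, hc⟩)).symm.trans (congrArg Φ hs)
    exact (congrArg (fun S : AdjOp γ.Crossed M => S.1 (j ξ)) h1).trans (hΦ ⟨_, hc'⟩ ξ)
  · exact leftSec_unitSec φ (fun x => star (u x)) ξ.1 ω

/-- The left action on the crossed product module of a proper correspondence is by compact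
operators. -/
theorem leftHom_mem_compactOp (hφ : φ.IsProper) (hj : DenseRange j)
    (hip : ∀ ξ η, (ip (j ξ) (j η) : γ.Crossed) =
      (RightAction.modPre ε W.proper W.etale).ip ξ η)
    {Φ : IndCrossed W β →⋆ₙₐ[ℂ] AdjOp γ.Crossed M} (hΦ : ∀ b ξ,
      (Φ (indι W β b)).1 (j ξ) = j (leftRep W φ ⟨b.1, b.2⟩ ξ)) (p : IndCrossed W β) :
    (Φ p).1 ∈ compactOp γ.Crossed M := by
  exact isStarAction_indAct.mem_compactOp Φ (fun u K hK hu h0 =>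
    leftHom_unitSec_mem_compactOp hφ hj hip hΦ hu hK h0) p

end Proper

/-! ### The correspondence between the crossed products. -/

theorem mainTheorem3
    {G : Type uG} {X : Type uX} {H : Type uH} {Y : Type uY} {Ω : Type uΩ}
    [TopologicalSpace G] [TopologicalSpace X] [TopologicalSpace H] [TopologicalSpace Y]
    [TopologicalSpace Ω] [T2Space G] [T2Space X] [T2Space H] [T2Space Y] [T2Space Ω]
    [LocallyCompactSpace X] [LocallyCompactSpace Y]
    (𝒢 : EtaleGroupoid G X) (ℋ : EtaleGroupoid H Y) (W : EtaleCorrespondence 𝒢 ℋ Ω)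
    {B : Y → Type uB} [∀ y, NonUnitalCStarAlgebra (B y)] [TopologicalSpace (Tot B)]
    [CStarBundle B]
    {C : Y → Type uC} [∀ y, NonUnitalCStarAlgebra (C y)] [TopologicalSpace (Tot C)]
    [CStarBundle C]
    {E : Y → Type uE} [∀ y, NormedAddCommGroup (E y)] [∀ y, NormedSpace ℂ (E y)]
    [∀ y, CompleteSpace (E y)] [TopologicalSpace (Tot E)] [∀ y, HilbertModule (C y) (E y)]
    [HilbertBundle C E]
    (β : CStarAction ℋ B) (γ : CStarAction ℋ C) (ε : HilbertAction γ E)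
    (φ : EquivariantCorrespondence β ε) :
    IsConvAlgebra 𝒢 (A := IndFib W β) (fun g hx hy => indAct W β g hx hy) ∧
    IsConvAlgebra ℋ (A := C) (fun h hx hy => γ.act h hx hy) ∧
    ∃ (M : Type (max uΩ uE)) (_ : NormedAddCommGroup M) (_ : NormedSpace ℂ M)
      (_ : CompleteSpace M) (_ : HilbertModule γ.Crossed M)
      (j : Cc E W.right.anchor → M) (F : CStarCorrespondence (IndCrossed W β) γ.Crossed M),
      IsCrossedProductModule W ε j ∧
      (∀ (b : Cc (IndFib W β) 𝒢.src) (ξ : Cc E W.right.anchor),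
        ∃ hc : IsCc W.right.anchor (leftSec W φ b.1 ξ.1),
          F.toHom (indι W β b) (j ξ) = j ⟨_, hc⟩) ∧
      (φ.IsProper → F.IsProper) := by
  refine ⟨isStarAction_indAct.isConvAlgebra, γ.isStarAction.isConvAlgebra, ?_⟩
  obtain ⟨M, _, _, _, j, hj, hn⟩ := (RightAction.modPre ε W.proper W.etale).exists_banach_completion
  obtain ⟨_, hip⟩ := PreHilbert.exists_hilbertModule (P := RightAction.modPre ε W.proper W.etale)
    hj hn
  obtain ⟨Φ, hΦ⟩ := exists_leftHom φ hj hip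
  refine ⟨M, _, _, _, _, fun ξ => j ⟨ξ.1, ξ.2⟩, AdjOp.correspondence Φ (dense_leftHom φ hj hip hΦ),
    isCrossedProductModule_of_completion W hj hip,
    fun b ξ => ⟨isCc_leftSec φ b.2 ξ.2, hΦ b ⟨ξ.1, ξ.2⟩⟩, fun hφ p => ?_⟩
  exact leftHom_mem_compactOp hφ hj hip hΦ p

end
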